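/- **Setting.** Let $\mathbb T^2=(\mathbb R/2\pi\mathbb Z)^2$. Let $\varphi_0:\mathbb R^2\to\mathbb R$ be smooth with $\varphi_0=1$ for $|\xi|\le\frac58$ and $\varphi_0=0$ for $|\xi|\ge\frac85$, put $\varphi_j(\xi)=\varphi_0(2^{-j}\xi)-\varphi_0(2^{-(j-1)}\xi)$ for $j\ge1$, and $\delta_jf=\sum_n\varphi_j(n)\widehat f(n)e^{in\cdot x}$. For $s\in\mathbb R$, $C^s=C^s(\mathbb T^2)$ is the completion of the smooth functions on $\mathbb T^2$ for the norm $\|f\|_{C^s}=\sup_{j\ge0}2^{js}\|\delta_jf\|_{L^\infty}$. Let $a_1,\gamma>0$, $a_2,c_1,c_2\in\mathbb R$, let $m\ge2$ be an integer, and let $S(t)=e^{t(a_1+ia_2)(\Delta-1)}$. Let $(\beta_n)_{n\in\mathbb Z^2}$ be independent two-sided complex Brownian motions with $\mathbb E|\beta_n(t)|^2=|t|$ (real and imaginary parts independent, of equal variance). Let $\chi:\mathbb R^2\to\mathbb R$ be smooth with $\chi=1$ for $|\xi|\le\frac12$ and $\chi=0$ for $|\xi|\ge1$, and let $$\Psi_N(t,x)=\sqrt{2\gamma}\sum_{n\in\mathbb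 Z^2}\chi(\tfrac nN)e^{in\cdot x}\int_{-\infty}^te^{-(t-t')(a_1+ia_2)(|n|^2+1)}\,d\beta_n(t'),\qquad \sigma_N=\mathbb E|\Psi_N(t,x)|^2 .$$ With the generalized Laguerre polynomials $L^{(\ell)}_k$ and $L_k^{(\ell)}(x;\sigma)=\sigma^kL^{(\ell)}_k(x/\sigma)$, put $$:\!\Psi_N^k\overline{\Psi_N}^\ell\!:\;=\begin{cases}(-1)^\ell\,\ell!\,L_\ell^{(k-\ell)}(|\Psi_N|^2;\sigma_N)\,\Psi_N^{k-\ell},&\ell\le k,\\ (-1)^kk!\,L_k^{(\ell-k)}(|\Psi_N|^2;\sigma_N)\,\overline{\Psi_N}^{\,\ell-k},&k<\ell.\end{cases}$$ Let $:\!\Psi^k\overline\Psi^\ell\!:$ be the limit of $:\!\Psi_N^k\overline{\Psi_N}^\ell\!:$ in $L^p(\Omega;C([0,T];C^{-\varepsilon}))$ for all $\varepsilon,T>0$, $1\le p<\infty$, taken with paths almost surely in $C([0,\infty);C^{-\varepsilon})$ for each $\varepsilon>0$, and let $\Psi=\;:\!\Psi^1\overline\Psi^0\!:$. That these limits exist is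 part of the claim. Put $$F(v)=-(c_1+ic_2)\sum_{i=0}^{m}\sum_{j=0}^{m-1}\binom mi\binom{m-1}j v^i\overline v^j:\!\Psi^{m-i}\overline\Psi^{m-1-j}\!: .$$ For $\varepsilon>0$ and a distribution $u_0$ on $\mathbb T^2$, a *mild solution* on $[0,T]$ with datum $u_0$ is a function $v\in C((0,T];C^{2\varepsilon})\cap C([0,T];C^{s_0})$ with $$v(t)=S(t)(u_0-\Psi(0))+\int_0^tS(t-t')F(v)(t')\,dt'\qquad(0\le t\le T),$$ the integral being an absolutely convergent one in the sense of distributions (Fourier coefficient by Fourier coefficient); then $u=v+\Psi$ is by definition a solution of the Wick ordered stochastic complex Ginzburg-Landau equation $$\partial_tu=(a_1+ia_2)(\Delta-1)u-(c_1+ic_2):\!|u|^{2m-2}u\!:+\sqrt{2\gamma}\,\xi,\qquad u|_{t=0}=u_0 .$$ **Theorem.** Let $m\ge2$ be an integer and $-\frac2{2m-1}<s_0<0$. For every sufficiently small $\varepsilon>0$ (depending on $m,s_0$) there is $\theta>0$ (depending on $m,s_0,\varepsilon$) such that the Wick ordered equation is pathwise locally well-posed in $C^{s_0}(\mathbb T^2)$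 in the following sense. There is an almost surely positive random variable $K$, independent of the initial datum, such that almost surely, for every $u_0\in C^{s_0}$, with $$T=T(u_0,\omega)=K(\omega)\,\max(1,\|u_0\|_{C^{s_0}})^{-\theta},$$ there is a unique mild solution $v\in C((0,T];C^{2\varepsilon})\cap C([0,T];C^{s_0})$ on $[0,T]$ with datum $u_0$. Moreover, it depends continuously on $u_0$: almost surely there is $L<\infty$ such that for all $u_0,u_0'\in C^{s_0}$, with corresponding solutions $v,v'$, and all $0<t\le\min(T(u_0,\omega),T(u_0',\omega))$, $$\|v(t)-v'(t)\|_{C^{s_0}}\le L\|u_0-u_0'\|_{C^{s_0}},\qquad t^{\frac{2\varepsilon-s_0}2}\|v(t)-v'(t)\|_{C^{2\varepsilon}}\le L\|u_0-u_0'\|_{C^{s_0}} .$$ -/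

import Mathlib

open MeasureTheory ProbabilityTheory Filter Topology
open scoped ENNReal NNReal

noncomputable section

namespace SCGL

/-! ### Distributions on the torus and Besov-Hölder spaces -/

/-- A periodic distribution on `𝕋² = (ℝ/2πℤ)²`, given by its Fourier coefficients. Coefficient
families in the spaces `C^s` below grow at most polynomially, so they are distributions. -/
abbrev Dist : Type := ℤ × ℤ → ℂ

/-- A frequency `n ∈ ℤ²` as a point of the Euclidean plane. -/
def freq (n : ℤ × ℤ) : EuclideanSpace ℝ (Fin 2) := !₂[(n.1 : ℝ), (n.2 : ℝ)]

/-- The character `e^{i n·x}`. -/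
def char2 (n : ℤ × ℤ) (x : ℝ × ℝ) : ℂ :=
  Complex.exp (Complex.I * (((n.1 : ℝ) * x.1 + (n.2 : ℝ) * x.2 : ℝ) : ℂ))

/-- A smooth function `φ₀` on the plane equal to `1` for `|ξ| ≤ 5/8` and to `0` for
`|ξ| ≥ 8/5`; it generates the dyadic partition of unity `dyadic φ₀`. -/
structure IsDyadicCutoff (φ₀ : EuclideanSpace ℝ (Fin 2) → ℝ) : Prop where
  smooth : ContDiff ℝ (⊤ : ℕ∞) φ₀
  eq_one : ∀ ξ, ‖ξ‖ ≤ 5 / 8 → φ₀ ξ = 1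
  eq_zero : ∀ ξ, 8 / 5 ≤ ‖ξ‖ → φ₀ ξ = 0

/-- `φ_j(ξ) = φ₀(ξ/2^j) - φ₀(ξ/2^(j-1))` for `j ≥ 1`. -/
def dyadic (φ₀ : EuclideanSpace ℝ (Fin 2) → ℝ) : ℕ → EuclideanSpace ℝ (Fin 2) → ℝ
  | 0 => φ₀
  | j + 1 => fun ξ => φ₀ (((2 : ℝ) ^ (j + 1))⁻¹ • ξ) - φ₀ (((2 : ℝ) ^ j)⁻¹ • ξ)

/-- The Littlewood-Paley block `δ_j f`, a trigonometric polynomial (the sum is finite). -/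
def block (φ₀ : EuclideanSpace ℝ (Fin 2) → ℝ) (j : ℕ) (f : Dist) (x : ℝ × ℝ) : ℂ :=
  ∑' n : ℤ × ℤ, (dyadic φ₀ j (freq n) : ℂ) * f n * char2 n x

/-- The norm of `B^s_{∞,∞}`: `sup_j 2^{js} ‖δ_j f‖_{L^∞}`, with value `∞` allowed. -/
def besovNorm (φ₀ : EuclideanSpace ℝ (Fin 2) → ℝ) (s : ℝ) (f : Dist) : ℝ≥0∞ :=
  ⨆ j : ℕ, ENNReal.ofReal ((2 : ℝ) ^ ((j : ℝ) * s)) * ⨆ x : ℝ × ℝ, ‖block φ₀ j f x‖ₑ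

/-- Membership in `C^s(𝕋²)`, the completion of the smooth functions for the norm of
`B^s_{∞,∞}`; equivalently, `f` is a limit of trigonometric polynomials in this norm. -/
def MemC (φ₀ : EuclideanSpace ℝ (Fin 2) → ℝ) (s : ℝ) (f : Dist) : Prop :=
  ∀ δ : ℝ≥0∞, 0 < δ → ∃ g : Dist, (Function.support g).Finite ∧ besovNorm φ₀ s (f - g) < δ

/-- `v ∈ C(I; C^s(𝕋²))`. -/
def ContC (φ₀ : EuclideanSpace ℝ (Fin 2) → ℝ) (s : ℝ) (I : Set ℝ) (v : ℝ → Dist) : Prop :=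
  ∀ t ∈ I, MemC φ₀ s (v t) ∧
    Tendsto (fun τ => besovNorm φ₀ s (v τ - v t)) (𝓝[I] t) (𝓝 0)

/-- The product of two distributions, when it is defined: the convolution of their Fourier
coefficients. The series converges absolutely for `f ∈ C^{s}`, `g ∈ C^{r}` with `s + r > 0`. -/
def prod (f g : Dist) : Dist := fun n => ∑' k : ℤ × ℤ, f (n - k) * g k

/-- The complex conjugate of a distribution. -/
def conjD (f : Dist) : Dist := fun n => (starRingEnd ℂ) (f (-n))

/-- Powers for the product `prod`; the zeroth power is the constant function `1`. -/
def powD (f : Dist) : ℕ → Dist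
  | 0 => Pi.single 0 1
  | k + 1 => prod f (powD f k)

/-- The symbol `a (|n|² + 1)` of `-a (Δ - 1)`. -/
def symb (a : ℂ) (n : ℤ × ℤ) : ℂ := a * (((n.1 : ℝ) ^ 2 + (n.2 : ℝ) ^ 2 + 1 : ℝ) : ℂ)

/-! ### Laguerre polynomials -/

/-- The generalized Laguerre polynomial `L_k^{(ℓ)}(x)`, through its three-term recursion. -/
def laguerre (l : ℕ) : ℕ → ℝ → ℝ
  | 0, _ => 1
  | 1, x => 1 + l - x
  | k + 2, x =>
      ((2 * (k + 1) + 1 + l - x) * laguerre l (k + 1) x - (k + 1 + l) * laguerre l k x) / (k + 2)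

/-- `L_k^{(ℓ)}(x; σ) = σ^k L_k^{(ℓ)}(x/σ)`. -/
def laguerreVar (l k : ℕ) (x σ : ℝ) : ℝ := σ ^ k * laguerre l k (x / σ)

/-- The Wick ordered monomial `:z^k z̄^ℓ:` with variance parameter `σ`. -/
def wickMonomial (k l : ℕ) (σ : ℝ) (z : ℂ) : ℂ :=
  if l ≤ k then
    (-1) ^ l * (l.factorial : ℂ) * (laguerreVar (k - l) l (‖z‖ ^ 2) σ : ℂ) * z ^ (k - l)
  else
    (-1) ^ k * (k.factorial : ℂ) * (laguerreVar (l - k) k (‖z‖ ^ 2) σ : ℂ)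
      * (starRingEnd ℂ) z ^ (l - k)

/-! ### The noise and the stochastic convolution -/

section Noise

variable {Ω : Type*} [MeasurableSpace Ω]

/-- The four real one-sided processes carried by a two-sided complex process `β_n`: real
(`c = true`) or imaginary part, in forward (`d = true`) or backward time, normalized by `√2`. -/
def component (β : ℤ × ℤ → ℝ → Ω → ℂ) (i : (ℤ × ℤ) × Bool × Bool) (t : ℝ≥0) (ω : Ω) : ℝ :=
  let z := β i.1 (if i.2.2 then (t : ℝ) else -(t : ℝ)) ω
  √2 * (if i.2.1 then z.re else z.im)

/-- `(β_n)` are the Fourier modes of a cylindrical Wiener process whose time derivative is a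
complex space-time white noise: independent two-sided complex Brownian motions, with
`𝔼|β_n(t)|² = |t|` and independent real and imaginary parts of equal variance. -/
structure IsCylindricalWiener (β : ℤ × ℤ → ℝ → Ω → ℂ) (P : Measure Ω) : Prop where
  brownian : ∀ i, IsBrownianReal (component β i) P
  indep : iIndepFun (fun i ω t => component β i t ω) P

/-- The Wiener integral `∫_{-∞}^t e^{-(t-t') a (|n|²+1)} dβ_n(t')`. The integrand is a
deterministic smooth function, so that integration by parts gives it path by path (almost surely
the paths of `β_n` are continuous and grow slower than `|t'|` as `t' → -∞`). -/
def stochConv (a : ℂ) (β : ℤ × ℤ → ℝ → Ω → ℂ) (n : ℤ × ℤ) (t : ℝ) (ω : Ω) : ℂ :=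
  β n t ω - symb a n * ∫ s in Set.Iic t, Complex.exp (-((t - s : ℝ) : ℂ) * symb a n) * β n s ω

/-- A smooth frequency cutoff: `1` for `|ξ| ≤ 1/2` and `0` for `|ξ| ≥ 1`. -/
structure IsFreqCutoff (χ : EuclideanSpace ℝ (Fin 2) → ℝ) : Prop where
  smooth : ContDiff ℝ (⊤ : ℕ∞) χ
  eq_one : ∀ ξ, ‖ξ‖ ≤ 1 / 2 → χ ξ = 1
  eq_zero : ∀ ξ, 1 ≤ ‖ξ‖ → χ ξ = 0

/-- The truncated stochastic convolution `Ψ_N(t, x)`. -/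
def psiN (χ : EuclideanSpace ℝ (Fin 2) → ℝ) (a : ℂ) (γ : ℝ) (β : ℤ × ℤ → ℝ → Ω → ℂ)
    (N : ℕ) (t : ℝ) (x : ℝ × ℝ) (ω : Ω) : ℂ :=
  (√(2 * γ) : ℂ) *
    ∑' n : ℤ × ℤ, (χ ((N : ℝ)⁻¹ • freq n) : ℂ) * stochConv a β n t ω * char2 n x

/-- The variance `σ_N = 𝔼|Ψ_N(t, x)|²`. -/
def sigmaN (P : Measure Ω) (χ : EuclideanSpace ℝ (Fin 2) → ℝ) (a : ℂ) (γ : ℝ)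
    (β : ℤ × ℤ → ℝ → Ω → ℂ) (N : ℕ) (t : ℝ) (x : ℝ × ℝ) : ℝ :=
  ∫ ω, ‖psiN χ a γ β N t x ω‖ ^ 2 ∂P

/-- The Fourier coefficients of a `2π`-periodic function of two variables. -/
def coeffs (f : ℝ × ℝ → ℂ) : Dist := fun n =>
  (((2 * Real.pi) ^ 2 : ℝ) : ℂ)⁻¹ *
    ∫ x in Set.Ioc 0 (2 * Real.pi) ×ˢ Set.Ioc 0 (2 * Real.pi), f x * char2 (-n) x

/-- The Wick ordered truncated monomial `:Ψ_N^k Ψ̄_N^ℓ:` at time `t`. -/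
def wickN (P : Measure Ω) (χ : EuclideanSpace ℝ (Fin 2) → ℝ) (a : ℂ) (γ : ℝ)
    (β : ℤ × ℤ → ℝ → Ω → ℂ) (N k l : ℕ) (t : ℝ) (ω : Ω) : Dist :=
  coeffs fun x => wickMonomial k l (sigmaN P χ a γ β N t x) (psiN χ a γ β N t x ω)

/-- `Z k ℓ` is the limit `:Ψ^k Ψ̄^ℓ:` of `:Ψ_N^k Ψ̄_N^ℓ:` in `L^p(Ω; C([0,T]; C^{-ε}))`, for all
`ε > 0`, `T > 0` and `1 ≤ p < ∞`. -/
structure IsWickLimit (P : Measure Ω) (φ₀ χ : EuclideanSpace ℝ (Fin 2) → ℝ) (a : ℂ) (γ : ℝ)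
    (β : ℤ × ℤ → ℝ → Ω → ℂ) (Z : ℕ → ℕ → ℝ → Ω → Dist) : Prop where
  aemeasurable : ∀ k l t n, 0 ≤ t → AEMeasurable (fun ω => Z k l t ω n) P
  cont : ∀ k l, ∀ ε : ℝ, 0 < ε →
    ∀ᵐ ω ∂P, ContC φ₀ (-ε) (Set.Ici 0) (fun t => Z k l t ω)
  lim : ∀ k l, ∀ ε T p : ℝ, 0 < ε → 0 < T → 1 ≤ p →
    Tendsto
      (fun N : ℕ => ∫⁻ ω, (⨆ t ∈ Set.Icc (0 : ℝ) T,
        besovNorm φ₀ (-ε) (wickN P χ a γ β N k l t ω - Z k l t ω)) ^ p ∂P)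
      atTop (𝓝 0)

end Noise

/-! ### The equation for `v = u - Ψ` -/

/-- The nonlinearity
`-c ∑_{i ≤ m, j ≤ m-1} (m choose i) (m-1 choose j) v^i v̄^j z_{m-i,m-1-j}`. -/
def nonlin (c : ℂ) (m : ℕ) (z : ℕ → ℕ → Dist) (v : Dist) : Dist :=
  -c • ∑ i ∈ Finset.range (m + 1), ∑ j ∈ Finset.range m,
    ((m.choose i : ℂ) * ((m - 1).choose j : ℂ)) •
      prod (z (m - i) (m - 1 - j)) (prod (powD v i) (powD (conjD v) j))

/-- `v ∈ C((0,T]; C^{2ε}) ∩ C([0,T]; C^{s₀})` is a mild solution on `[0,T]`, for the enhanced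
noise `z k ℓ t = :Ψ^k Ψ̄^ℓ:(t)` (so that `z 1 0 = Ψ`), of
`∂_t v = a (Δ - 1) v + nonlin c m z v`, `v(0) = u₀ - Ψ(0)`. That is,
`v(t) = S(t) (u₀ - Ψ(0)) + ∫_0^t S(t - t') nonlin c m z(t') v(t') dt'` with
`S(t) = e^{t a (Δ - 1)}`, the integral being taken in the sense of distributions. -/
structure IsMildSolution (φ₀ : EuclideanSpace ℝ (Fin 2) → ℝ) (a c : ℂ) (m : ℕ) (s₀ ε : ℝ)
    (z : ℕ → ℕ → ℝ → Dist) (u₀ : Dist) (T : ℝ) (v : ℝ → Dist) : Prop where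
  cont_pos : ContC φ₀ (2 * ε) (Set.Ioc 0 T) v
  cont : ContC φ₀ s₀ (Set.Icc 0 T) v
  integrable : ∀ t ∈ Set.Icc 0 T, ∀ n, IntervalIntegrable
    (fun t' => Complex.exp (-((t - t' : ℝ) : ℂ) * symb a n) *
      nonlin c m (fun k l => z k l t') (v t') n) volume 0 t
  mild : ∀ t ∈ Set.Icc 0 T, ∀ n,
    v t n = Complex.exp (-(t : ℂ) * symb a n) * (u₀ n - z 1 0 0 n) +
      ∫ t' in (0 : ℝ)..t, Complex.exp (-((t - t' : ℝ) : ℂ) * symb a n) *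
        nonlin c m (fun k l => z k l t') (v t') n

/-- The time `K max(1, ‖u₀‖_{C^{s₀}})^{-θ}`. -/
def lifetime (φ₀ : EuclideanSpace ℝ (Fin 2) → ℝ) (s₀ θ K : ℝ) (u₀ : Dist) : ℝ :=
  K * (max 1 (besovNorm φ₀ s₀ u₀).toReal) ^ (-θ)

end SCGL

end

noncomputable section

namespace SCGL

open ENNReal (ofReal_one mul_iSup sum_lt_top ofReal ofReal_mul ofReal_lt_top toReal_mono
  toReal_ofReal ofReal_pow ofReal_toReal ofReal_le_ofReal coe_mul coe_add coe_toNNReal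
  ofReal_ne_top mul_lt_top add_lt_top coe_ne_top mul_ne_top tendsto_nhds_zero add_ne_top
  sum_le_tsum tsum_le_tsum pow_ne_top ofReal_add coe_le_coe ofReal_coe_nnreal ofReal_inv_of_pos)
open Complex (exp_add exp I norm_real ofReal_re ofReal_im ofRealCLM ofReal_zero norm_exp
  ofReal_sum mul_conj' continuous_ofReal re_add_im)
open Function (support mem_support comp_apply)
open Finset (sum_insert sum_le_sum sum_mul sum_congr sum_mul_sum mul_sum sum_comm sum_subset
  range sum_range_succ mem_range sum_sub_distrib mem_univ sum_add_distrib sum_coe_sort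
  sum_eq_zero)
open Set (Ioc Icc uIcc_of_le Ioo Ici Iic Ioi indicator_of_mem)
open Real (norm_of_nonneg norm_eq_abs norm_ofNat sq_sqrt rpow_le_rpow_of_exponent_le rpow_add
  mul_rpow rpow_natCast rpow_mul rpow_nonneg rpow_le_rpow_of_nonpos div_rpow rpow_neg
  rpow_pos_of_pos rpow_le_rpow rpow_one exp_pos nnabs)
open Nat (cast_nonneg)

variable {ϕ : E2 → ℝ} {f g u₀ : Dist} {r s t R : ℝ} {a : ℂ} {v F : ℝ → Dist} {n : ℤ × ℤ} {x : ℝ × ℝ}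
  {S : Finset (ℤ × ℤ)}

local notation "𝐄" => ENNReal
local notation "ℤ²" => ℤ × ℤ
local notation "π" => Real.pi
local notation "conj" => starRingEnd ℂ
local notation "dy(" s ")" => ofReal ((2 : ℝ) ^ s)
local notation "𝐁" => besovNorm ϕ
local notation "Cutoff" => IsDyadicCutoff ϕ

/-! ### Trigonometric polynomials and their sup norm -/

/-- The function with Fourier coefficients `f` (meaningful for finite support). -/
def ev (f : Dist) (x : ℝ × ℝ) : ℂ := ∑' n : ℤ², f n * char2 n x

/-- The sup norm of the function with Fourier coefficients `f`. -/
def supN (f : Dist) : 𝐄 := ⨆ x : ℝ × ℝ, ‖ev f x‖ₑ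

lemma norm_char2 (n : ℤ²) (x : ℝ × ℝ) : ‖char2 n x‖ = 1 := by
  rw [char2, mul_comm]; exact Complex.norm_exp_ofReal_mul_I _

lemma enorm_char2 (n : ℤ²) (x : ℝ × ℝ) : ‖char2 n x‖ₑ = 1 := by
  rw [← ofReal_norm, norm_char2, ofReal_one]

lemma char2_add_arg (n : ℤ²) (x y : ℝ × ℝ) : char2 n (x + y) = char2 n x * char2 n y := by
  rw [char2, char2, char2, ← exp_add]
  congr 1; simp only [Prod.fst_add, Prod.snd_add]; push_cast; ring

lemma char2_add (n m : ℤ²) (x : ℝ × ℝ) : char2 (n + m) x = char2 n x * char2 m x := by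
  rw [char2, char2, char2, ← exp_add]
  congr 1; simp only [Prod.fst_add, Prod.snd_add]; push_cast; ring

@[simp] lemma char2_zero (x : ℝ × ℝ) : char2 0 x = 1 := by simp [char2]

lemma char2_neg (n : ℤ²) (x : ℝ × ℝ) : char2 (-n) x = conj (char2 n x) := by
  rw [char2, char2, ← Complex.exp_conj]
  congr 1; simp only [Prod.fst_neg, Prod.snd_neg, map_mul, Complex.conj_I, Complex.conj_ofReal]
  push_cast; ring

lemma continuous_char2 (n : ℤ²) : Continuous (char2 n) := by unfold char2; fun_prop

lemma ev_eq_sum (s : Finset ℤ²) (h : support f ⊆ s) (x : ℝ × ℝ) : ev f x = ∑ n ∈ s, f n * char2 n x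
    := by
  refine tsum_eq_sum fun n hn => ?_
  have : f n = 0 := by by_contra h0; exact hn (h h0)
  simp [this]

lemma summable_ev (h : (support f).Finite) (x : ℝ × ℝ) : Summable fun n => f n * char2 n x := by
  refine summable_of_ne_finset_zero (s := h.toFinset) fun n hn => ?_
  have : f n = 0 := by simpa using hn
  simp [this]

lemma continuous_ev (h : (support f).Finite) : Continuous (ev f) := by
  have : ev f = fun x => ∑ n ∈ h.toFinset, f n * char2 n x := by
    ext x; exact ev_eq_sum _ (by simp) x
  rw [this]; exact continuous_finsetSum _ fun n _ => continuous_const.mul (continuous_char2 n)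

lemma ev_add (hf : (support f).Finite) (hg : (support g).Finite) (x : ℝ × ℝ) : ev (f + g) x = ev f x
    + ev g x := by rw [ev, ev, ev, ← (summable_ev hf x).tsum_add (summable_ev hg x)]; simp [add_mul]

lemma ev_smul (c : ℂ) (f : Dist) (x : ℝ × ℝ) : ev (c • f) x = c * ev f x := by
  rw [ev, ev, ← tsum_mul_left]; simp [mul_assoc]

lemma ev_single_zero (x : ℝ × ℝ) : ev (Pi.single 0 1) x = 1 := by rw [ev_eq_sum {0} (by simp)]; simp

lemma support_add_finite (hf : (support f).Finite) (hg : (support g).Finite) : (support (f +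
    g)).Finite :=
  (hf.union hg).subset (Function.support_add f g)

lemma support_neg_finite (hf : (support f).Finite) : (support (-f)).Finite := by
  rwa [Function.support_neg]

lemma support_mul_finite (m : ℤ² → ℂ) (hf : (support f).Finite) : (support fun n => m n * f
    n).Finite :=
  hf.subset fun n hn => right_ne_zero_of_mul (mem_support.1 hn)

lemma support_sum_finite {ι : Type*} (s : Finset ι) {f : ι → Dist} (hf : ∀ i ∈ s, (support (f
    i)).Finite) : (support (∑ i ∈ s, f i)).Finite := by
  classical
  induction s using Finset.induction_on with
  | empty => simp
  | insert a s ha ih =>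
    rw [sum_insert ha]
    exact support_add_finite (hf a (by simp)) (ih fun i hi => hf i (by simp [hi]))

lemma ev_le_supN (f : Dist) (x : ℝ × ℝ) : ‖ev f x‖ₑ ≤ supN f := le_iSup (fun x => ‖ev f x‖ₑ) x

lemma supN_zero : supN 0 = 0 := by simp [supN, ev]

lemma supN_add_le (hf : (support f).Finite) (hg : (support g).Finite) : supN (f + g) ≤ supN f + supN
    g := by
  refine iSup_le fun x => ?_; rw [ev_add hf hg]
  exact (enorm_add_le _ _).trans (add_le_add (ev_le_supN f x) (ev_le_supN g x))

lemma supN_sum_le {ι : Type*} (s : Finset ι) {f : ι → Dist} (hf : ∀ i ∈ s, (support (f i)).Finite) :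
    supN (∑ i ∈ s, f i) ≤ ∑ i ∈ s, supN (f i) := by
  classical
  induction s using Finset.induction_on with
  | empty => simp [supN_zero]
  | insert a s ha ih =>
    rw [sum_insert ha, sum_insert ha]
    have h' : ∀ i ∈ s, (support (f i)).Finite := fun i hi => hf i (by simp [hi])
    exact (supN_add_le (hf a (by simp)) (support_sum_finite s h')).trans
      (add_le_add le_rfl (ih h'))

lemma supN_smul (c : ℂ) (f : Dist) : supN (c • f) = ‖c‖ₑ * supN f := by
  simp only [supN, ev_smul, enorm_mul, mul_iSup]

lemma supN_neg (f : Dist) : supN (-f) = supN f := by rw [← neg_one_smul ℂ, supN_smul]; simp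

lemma supN_lt_top (h : (support f).Finite) : supN f < ∞ := by
  refine lt_of_le_of_lt (b := ∑ n ∈ h.toFinset, ‖f n‖ₑ) (iSup_le fun x => ?_)
    (sum_lt_top.2 fun _ _ => enorm_lt_top)
  rw [ev_eq_sum h.toFinset (by simp)]; refine (enorm_sum_le _ _).trans (sum_le_sum fun n _ => ?_)
  rw [enorm_mul, enorm_char2, mul_one]

/-! ### Orthogonality of the characters -/

abbrev torusSq : Set (ℝ × ℝ) := Ioc 0 (2 * π) ×ˢ Ioc 0 (2 * π)

lemma integral_exp_int (k : ℤ) : ∫ x in Ioc 0 (2 * π), exp (I * ((k : ℝ) * x : ℝ)) = if k = 0 then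
    ((2 * π : ℝ) : ℂ) else 0 := by
  rw [← intervalIntegral.integral_of_le (by positivity)]; split_ifs with h
  · subst h; simp
  · have hc : I * (k : ℂ) ≠ 0 := by simp [h]
    have : ∀ x : ℝ, exp (I * ((k : ℝ) * x : ℝ)) =
        exp ((I * (k : ℂ)) * x) := by intro x; push_cast; ring_nf
    simp_rw [this]; rw [integral_exp_mul_complex hc]
    have h1 : exp (I * (k : ℂ) * ((2 * π : ℝ) : ℂ)) = 1 := by
      rw [Complex.exp_eq_one_iff]; exact ⟨k, by push_cast; ring⟩
    rw [h1]; simp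

lemma volume_sq : (volume : Measure (ℝ × ℝ)) torusSq = ofReal ((2 * π) ^ 2) := by
  rw [Measure.volume_eq_prod, Measure.prod_prod, Real.volume_Ioc, sub_zero,
    ← ofReal_mul (by positivity), sq]

instance : IsFiniteMeasure (volume.restrict torusSq) := ⟨by
  rw [Measure.restrict_apply_univ, volume_sq]; exact ofReal_lt_top⟩

lemma integral_char2 (n : ℤ²) : ∫ x in torusSq, char2 n x = if n = 0 then (((2 * π) ^ 2 : ℝ) : ℂ)
    else 0 := by
  have : ∀ x : ℝ × ℝ, char2 n x = exp (I * ((n.1 : ℝ) * x.1 : ℝ)) *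
      exp (I * ((n.2 : ℝ) * x.2 : ℝ)) := by intro x; rw [char2, ← exp_add]; congr 1; push_cast; ring
  simp_rw [this]; rw [Measure.volume_eq_prod, setIntegral_prod_mul
    (fun x : ℝ => exp (I * ((n.1 : ℝ) * x : ℝ)))
    (fun x : ℝ => exp (I * ((n.2 : ℝ) * x : ℝ))), integral_exp_int,
    integral_exp_int]
  rcases n with ⟨a, b⟩; by_cases ha : a = 0 <;> by_cases hb : b = 0 <;> simp [ha, hb] <;> ring

lemma integrable_sq_of_continuous {f : ℝ × ℝ → ℂ} (hf : Continuous f) : IntegrableOn f torusSq := by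
  refine IntegrableOn.mono_set (t := Icc 0 (2 * π) ×ˢ Icc 0 (2 * π)) ?_
    (Set.prod_mono Set.Ioc_subset_Icc_self Set.Ioc_subset_Icc_self)
  exact hf.continuousOn.integrableOn_compact (isCompact_Icc.prod isCompact_Icc)

lemma coeffs_ev (h : (support f).Finite) : coeffs (ev f) = f := by
  ext n; rw [coeffs]
  have h1 : ∀ x, ev f x * char2 (-n) x = ∑ m ∈ h.toFinset, f m * char2 (m - n) x := by
    intro x; rw [ev_eq_sum h.toFinset (by simp), sum_mul]; refine sum_congr rfl fun m _ => ?_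
    rw [mul_assoc, ← char2_add, sub_eq_add_neg]
  change _ * ∫ x in torusSq, _ = _
  simp_rw [h1]; rw [integral_finsetSum]
  · simp_rw [integral_const_mul, integral_char2, sub_eq_zero]
    have hpi : ((2 * (π : ℂ)) ^ 2) ≠ 0 := by exact_mod_cast (by positivity : (2 * π) ^ 2 ≠ 0)
    by_cases hn : f n = 0
    · simp [hn]
    · simp [hn]; field_simp
  · exact fun m _ => integrable_sq_of_continuous (continuous_const.mul (continuous_char2 _))

lemma enorm_coeffs_le {f : ℝ × ℝ → ℂ} {C : 𝐄} (hC : ∀ x, ‖f x‖ₑ ≤ C) (n : ℤ²) : ‖coeffs f n‖ₑ ≤ C :=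
    by
  rw [coeffs, enorm_mul]
  have h1 : ‖∫ x in torusSq, f x * char2 (-n) x‖ₑ ≤ ofReal ((2 * π) ^ 2) * C := by
    refine (enorm_integral_le_lintegral_enorm _).trans ?_
    calc ∫⁻ x in torusSq, ‖f x * char2 (-n) x‖ₑ ≤ ∫⁻ x in torusSq, C := by
          refine lintegral_mono fun x => ?_; rw [enorm_mul, enorm_char2, mul_one]; exact hC x
      _ = _ := by rw [setLIntegral_const, volume_sq, mul_comm]
  refine (mul_le_mul_right h1 _).trans ?_; rw [← mul_assoc]
  have : ‖((((2 * π) ^ 2 : ℝ) : ℂ))⁻¹‖ₑ * ofReal ((2 * π) ^ 2) = 1 := by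
    have hp : (0:ℝ) < (2 * π) ^ 2 := by positivity
    rw [← ofReal_norm, norm_inv, norm_real, norm_of_nonneg hp.le,
      ← ofReal_mul (by positivity), inv_mul_cancel₀ hp.ne', ofReal_one]
  rw [this, one_mul]

lemma coeff_le_supN (h : (support f).Finite) (n : ℤ²) : ‖f n‖ₑ ≤ supN f := by
  conv_lhs => rw [← coeffs_ev h]
  exact enorm_coeffs_le (ev_le_supN f) n

lemma integral_norm_sq_ev (s : Finset ℤ²) (h : support f ⊆ s) : ∫ x in torusSq, ‖ev f x‖ ^ 2 = (2 *
    π) ^ 2 * ∑ n ∈ s, ‖f n‖ ^ 2 := by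
  have h1 : ∀ x, ((‖ev f x‖ ^ 2 : ℝ) : ℂ) = ∑ n ∈ s, ∑ m ∈ s,
      (f n * conj (f m)) * char2 (n - m) x := by
    intro x
    rw [← Complex.normSq_eq_norm_sq, Complex.normSq_eq_conj_mul_self, mul_comm, ev_eq_sum s h,
      map_sum, sum_mul_sum]
    refine sum_congr rfl fun n _ => sum_congr rfl fun m _ => ?_
    rw [map_mul, sub_eq_add_neg, char2_add, char2_neg]; ring
  have h2 : ((∫ x in torusSq, ‖ev f x‖ ^ 2 : ℝ) : ℂ) =
      (((2 * π) ^ 2 * ∑ n ∈ s, ‖f n‖ ^ 2 : ℝ) : ℂ) := by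
    rw [← integral_complex_ofReal]; simp_rw [h1]
    rw [integral_finsetSum _ fun n _ => integrable_sq_of_continuous (by
      exact continuous_finsetSum _ fun m _ => continuous_const.mul (continuous_char2 _))]
    push_cast; rw [mul_sum]; refine sum_congr rfl fun n hn => ?_
    rw [integral_finsetSum _ fun m _ => integrable_sq_of_continuous (by
      exact continuous_const.mul (continuous_char2 _))]
    simp_rw [integral_const_mul, integral_char2, sub_eq_zero]; rw [Finset.sum_eq_single n]
    · rw [if_pos rfl, Complex.mul_conj, Complex.normSq_eq_norm_sq]; push_cast; ring
    · intro m _ hm; rw [if_neg (Ne.symm hm), mul_zero]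
    · exact fun h => absurd hn h
  exact_mod_cast h2

lemma sum_enorm_sq_le_supN (h : (support f).Finite) (s : Finset ℤ²) : ∑ n ∈ s, ‖f n‖ₑ ^ 2 ≤ supN f ^
    2 := by
  have hs := supN_lt_top h; set M := (supN f).toReal; have hM : ∀ x, ‖ev f x‖ ≤ M := fun x => by
    have := toReal_mono hs.ne (ev_le_supN f x); simpa using this
  have h1 := integral_norm_sq_ev (f := f) (s ∪ h.toFinset) (by
    intro n hn; simp; right; exact hn)
  have h2 : ∫ x in torusSq, ‖ev f x‖ ^ 2 ≤ ∫ x in torusSq, M ^ 2 := by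
    refine integral_mono_of_nonneg (.of_forall fun x => by positivity)
      (integrable_const _) (.of_forall fun x => ?_)
    exact pow_le_pow_left₀ (norm_nonneg _) (hM x) 2
  have h3 : ∫ x in torusSq, M ^ 2 = (2 * π) ^ 2 * M ^ 2 := by
    rw [setIntegral_const, measureReal_def, volume_sq, toReal_ofReal (by positivity), smul_eq_mul]
  rw [h1, h3] at h2
  have h4 : ∑ n ∈ s ∪ h.toFinset, ‖f n‖ ^ 2 ≤ M ^ 2 := le_of_mul_le_mul_left h2 (by positivity)
  have h5 : ∑ n ∈ s, ‖f n‖ ^ 2 ≤ M ^ 2 := (Finset.sum_le_sum_of_subset_of_nonneg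
    Finset.subset_union_left fun _ _ _ => by positivity).trans h4
  have : ∑ n ∈ s, ‖f n‖ₑ ^ 2 = ofReal (∑ n ∈ s, ‖f n‖ ^ 2) := by
    rw [ENNReal.ofReal_sum_of_nonneg fun _ _ => by positivity]; refine sum_congr rfl fun n _ => ?_
    rw [ofReal_pow (norm_nonneg _), ofReal_norm]
  rw [this, ← ofReal_toReal hs.ne, ← ofReal_pow ENNReal.toReal_nonneg]; exact ofReal_le_ofReal h5

/-! ### Products of trigonometric polynomials -/

open scoped Pointwise in
lemma support_prod_subset (f g : Dist) : support (prod f g) ⊆ support f + support g := by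
  intro n hn; by_contra hc
  refine hn ?_; rw [prod]; convert tsum_zero with k; by_contra h0
  exact hc ⟨n - k, left_ne_zero_of_mul h0, k, right_ne_zero_of_mul h0, by simp⟩

open scoped Pointwise in
lemma support_prod_finite (hf : (support f).Finite) (hg : (support g).Finite) : (support (prod f
    g)).Finite :=
  (hf.add hg).subset (support_prod_subset f g)

open scoped Pointwise in
lemma ev_prod (hf : (support f).Finite) (hg : (support g).Finite) (x : ℝ × ℝ) : ev (prod f g) x = ev
    f x * ev g x := by
  classical
  rw [ev_eq_sum (hf.toFinset + hg.toFinset) (by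
    simpa using support_prod_subset f g), ev_eq_sum hf.toFinset (by simp),
    ev_eq_sum hg.toFinset (by simp), sum_mul_sum]
  have h1 : ∀ n, prod f g n = ∑ k ∈ hg.toFinset, f (n - k) * g k := fun n =>
    tsum_eq_sum fun k hk => by
      have : g k = 0 := by simpa using hk
      simp [this]
  simp_rw [h1, sum_mul]; rw [sum_comm, sum_comm (s := hf.toFinset)]
  refine sum_congr rfl fun k hk => ?_
  have h2 : ∑ n ∈ hf.toFinset, f n * char2 n x * (g k * char2 k x) =
      ∑ n ∈ hf.toFinset.map (addRightEmbedding k), f (n - k) * g k * char2 n x := by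
    rw [Finset.sum_map]; refine sum_congr rfl fun n _ => ?_
    simp only [addRightEmbedding_apply, add_sub_cancel_right, char2_add]; ring
  rw [h2]
  symm
  refine sum_subset ?_ ?_
  · intro n hn; obtain ⟨m, hm, rfl⟩ := Finset.mem_map.1 hn; exact Finset.add_mem_add hm hk
  · intro n _ hn
    have : f (n - k) = 0 := by
      by_contra h0
      exact hn (Finset.mem_map.2 ⟨n - k, by simpa using h0, by simp⟩)
    simp [this]

lemma supN_prod_le (hf : (support f).Finite) (hg : (support g).Finite) : supN (prod f g) ≤ supN f *
    supN g := by
  refine iSup_le fun x => ?_; rw [ev_prod hf hg, enorm_mul]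
  exact mul_le_mul' (ev_le_supN f x) (ev_le_supN g x)

lemma support_conjD_finite (hf : (support f).Finite) : (support (conjD f)).Finite := by
  refine (hf.preimage (f := fun n => -n) neg_injective.injOn).subset fun n hn => ?_
  simpa [conjD] using hn

lemma ev_conjD (x : ℝ × ℝ) : ev (conjD f) x = conj (ev f x) := by
  rw [ev, ev, Complex.conj_tsum, ← (Equiv.neg ℤ²).tsum_eq]; congr 1; ext n; simp [conjD, char2_neg]

lemma supN_conjD (f : Dist) : supN (conjD f) = supN f := by
  simp only [supN, ev_conjD]; congr 1; ext x; rw [← ofReal_norm, ← ofReal_norm, RCLike.norm_conj]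

/-! ### Fourier multipliers -/

abbrev E2 := EuclideanSpace ℝ (Fin 2)

/-- `h(r D)` is bounded by `C` for the sup norm, for all `r`. -/
def IsMult (h : E2 → ℂ) (C : ℝ≥0) : Prop :=
  ∀ (r : ℝ) (f : Dist), (support f).Finite → supN (fun n => h (r • freq n) * f n) ≤ C * supN f

lemma IsMult.mul {h₁ h₂ : E2 → ℂ} {C₁ C₂ : ℝ≥0} (H₁ : IsMult h₁ C₁) (H₂ : IsMult h₂ C₂) : IsMult
    (fun ξ => h₁ ξ * h₂ ξ) (C₁ * C₂) := by
  intro r f hf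
  have := H₁ r (fun n => h₂ (r • freq n) * f n) (support_mul_finite _ hf); simp only [mul_assoc]
  refine this.trans ?_; rw [coe_mul, mul_assoc]; exact mul_le_mul_right (H₂ r f hf) _

lemma IsMult.add {h₁ h₂ : E2 → ℂ} {C₁ C₂ : ℝ≥0} (H₁ : IsMult h₁ C₁) (H₂ : IsMult h₂ C₂) : IsMult
    (fun ξ => h₁ ξ + h₂ ξ) (C₁ + C₂) := by
  intro r f hf
  have : (fun n => (h₁ (r • freq n) + h₂ (r • freq n)) * f n) =
      (fun n => h₁ (r • freq n) * f n) + fun n => h₂ (r • freq n) * f n := by ext n; simp [add_mul]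
  rw [this]; refine (supN_add_le (support_mul_finite _ hf) (support_mul_finite _ hf)).trans ?_
  rw [coe_add, add_mul]; exact add_le_add (H₁ r f hf) (H₂ r f hf)

lemma IsMult.const_mul {h : E2 → ℂ} {C : ℝ≥0} (H : IsMult h C) (c : ℂ) : IsMult (fun ξ => c * h ξ)
    (‖c‖₊ * C) := by
  intro r f hf
  have : (fun n => c * h (r • freq n) * f n) = c • fun n => h (r • freq n) * f n := by
    ext n; simp [mul_assoc]
  rw [this, supN_smul, coe_mul, mul_assoc]; exact mul_le_mul_right (H r f hf) _

lemma isMult_of_integral {X : Type*} [MeasurableSpace X] (μ : Measure X) (k : X → ℂ) (y : X → E2)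
    (hk : Integrable k μ) (hy : Measurable y) (h : E2 → ℂ) (H : ∀ ξ, h ξ = ∫ z, k z * exp (I * ((y z
    0 * ξ 0 + y z 1 * ξ 1 : ℝ) : ℂ)) ∂μ) : IsMult h (∫⁻ z, ‖k z‖ₑ ∂μ).toNNReal := by
  intro r f hf; have hfin : ∫⁻ z, ‖k z‖ₑ ∂μ < ∞ := hk.2; rw [coe_toNNReal hfin.ne]
  refine iSup_le fun x => ?_
  have hchar : ∀ n z, exp (I * ((y z 0 * (r • freq n) 0 + y z 1 * (r • freq n) 1 : ℝ)
      : ℂ)) * char2 n x = char2 n (x + (r * y z 0, r * y z 1)) := by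
    intro n z; rw [char2_add_arg, mul_comm (char2 n x)]; congr 1; rw [char2]; congr 2
    simp only [freq, PiLp.smul_apply, smul_eq_mul, Matrix.cons_val_zero, Matrix.cons_val_one]
    push_cast; ring
  have hint : ∀ n, Integrable (fun z => k z * char2 n (x + (r * y z 0, r * y z 1))) μ := by
    intro n; refine hk.mul_bdd (c := 1) ?_ (.of_forall fun z => (norm_char2 _ _).le)
    refine Measurable.aestronglyMeasurable ?_; refine (continuous_char2 n).measurable.comp ?_
    have h0 : Measurable fun z => y z 0 := (PiLp.continuous_apply 2 _ 0).measurable.comp hy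
    have h1 : Measurable fun z => y z 1 := (PiLp.continuous_apply 2 _ 1).measurable.comp hy
    fun_prop
  have hev : ev (fun n => h (r • freq n) * f n) x =
      ∫ z, k z * ev f (x + (r * y z 0, r * y z 1)) ∂μ := by
    rw [ev_eq_sum hf.toFinset (by
      intro n hn; simpa using right_ne_zero_of_mul (mem_support.1 hn))]
    have : ∀ z, k z * ev f (x + (r * y z 0, r * y z 1)) =
        ∑ n ∈ hf.toFinset, f n * (k z * char2 n (x + (r * y z 0, r * y z 1))) := by
      intro z; rw [ev_eq_sum hf.toFinset (by simp), mul_sum]; exact sum_congr rfl fun n _ => by ring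
    simp_rw [this]; rw [integral_finsetSum _ fun n _ => (hint n).const_mul _]
    refine sum_congr rfl fun n _ => ?_
    rw [integral_const_mul, H, mul_comm _ (f n), mul_assoc, ← integral_mul_const]
    simp_rw [mul_assoc, hchar]
  rw [hev]; refine (enorm_integral_le_lintegral_enorm _).trans ?_
  rw [← lintegral_mul_const'' _ hk.1.enorm]; refine lintegral_mono fun z => ?_; rw [enorm_mul]
  exact mul_le_mul_right (ev_le_supN _ _) _

section

open scoped FourierTransform RealInnerProductSpace ContDiff

/-! ### Smooth compactly supported and Gaussian multipliers -/

lemma exists_isMult_of_contDiff {h : E2 → ℂ} (hs : ContDiff ℝ ∞ h) (hc : HasCompactSupport h) : ∃ C,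
    IsMult h C := by
  let f : SchwartzMap E2 ℂ := hc.toSchwartzMap hs; let g : SchwartzMap E2 ℂ := 𝓕 f
  have hf : ∀ ξ, h ξ = (𝓕⁻ g : SchwartzMap E2 ℂ) ξ := fun ξ => by
    rw [FourierTransform.fourierInv_fourier_eq]; rfl
  refine ⟨_, isMult_of_integral volume g (fun v => (2 * π) • v) g.integrable
    (by fun_prop) h fun ξ => ?_⟩
  rw [hf, SchwartzMap.fourierInv_coe, Real.fourierInv_eq']
  refine integral_congr_ae (.of_forall fun v => ?_); simp only [smul_eq_mul]; rw [mul_comm]; congr 2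
  simp only [PiLp.inner_apply, Fin.sum_univ_two, PiLp.smul_apply, smul_eq_mul]
  simp only [RCLike.inner_apply, conj_trivial]; push_cast; ring

lemma exists_isMult_fourier {k : ℝ → ℂ} (hk : Integrable k) (i : Fin 2) : ∃ C, IsMult (fun ξ => 𝓕 k
    (ξ i)) C := by
  refine ⟨_, isMult_of_integral volume k
    (fun v => EuclideanSpace.single i (-(2 * π) * v)) hk ?_ _ fun ξ => ?_⟩
  · have : Continuous fun v : ℝ => (EuclideanSpace.single i (-(2 * π) * v) : E2) := by
      have : (fun v : ℝ => (EuclideanSpace.single i (-(2 * π) * v) : E2)) =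
          fun v : ℝ => (-(2 * π) * v) • (EuclideanSpace.single i (1 : ℝ) : E2) := by
        ext v j; by_cases h : j = i <;> simp [h]
      rw [this]; fun_prop
    exact this.measurable
  · rw [Real.fourier_real_eq_integral_exp_smul]; refine integral_congr_ae (.of_forall fun v => ?_)
    simp only [smul_eq_mul]; rw [mul_comm]; congr 2
    fin_cases i <;> simp <;> ring

lemma exists_isMult_gauss1 (ha : 0 < a.re) (i : Fin 2) : (∃ C, IsMult (fun ξ => exp (-a * (ξ i : ℂ)
    ^ 2)) C) ∧ ∃ C, IsMult (fun ξ => (ξ i : ℂ) ^ 2 * exp (-a * (ξ i : ℂ) ^ 2)) C := by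
  have ha0 : a ≠ 0 := fun h => by simp [h] at ha
  have hpi : (π : ℂ) ≠ 0 := by exact_mod_cast Real.pi_ne_zero
  set b : ℂ := π / a with hb; have hb0 : b ≠ 0 := div_ne_zero hpi ha0; have hbre : 0 < b.re := by
    rw [hb, Complex.div_re]; simp only [ofReal_re, ofReal_im, zero_mul, zero_div, add_zero]
    have := Complex.normSq_pos.2 ha0
    have := Real.pi_pos; positivity
  have hpb : 0 < ((π : ℂ) * b).re := by rw [Complex.re_ofReal_mul]; exact mul_pos Real.pi_pos hbre
  set G : ℝ → ℂ := fun x => exp (-(π * b) * (x : ℂ) ^ 2) with hG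
  have hFG : 𝓕 G = fun t : ℝ => 1 / b ^ (1 / 2 : ℂ) * exp (-a * (t : ℂ) ^ 2) := by
    have := fourier_gaussian_pi hbre; have h2 : -(π : ℂ) / b = -a := by rw [hb]; field_simp
    rw [h2] at this; rw [← this, hG]; congr 1; ext x; congr 1; ring
  have hc : b ^ (1 / 2 : ℂ) ≠ 0 := by
    rw [Complex.cpow_def_of_ne_zero hb0]; exact Complex.exp_ne_zero _
  have hGd : ∀ x, HasDerivAt G (-(2 * π * b) * x * G x) x := by
    intro x; have h1 : HasDerivAt (fun y : ℝ => (y : ℂ)) 1 x := ofRealCLM.hasDerivAt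
    have h2 := ((h1.pow 2).const_mul (-((π : ℂ) * b))).cexp; refine h2.congr_deriv ?_
    change exp (-((π : ℂ) * b) * (x : ℂ) ^ 2) * _ = _; simp only [hG]; push_cast; ring
  have hGint : Integrable G := integrable_cexp_neg_mul_sq hpb
  have hG1int : Integrable fun x : ℝ => -(2 * π * b) * x * G x := by
    refine ((integrable_mul_cexp_neg_mul_sq hpb).const_mul (-(2 * π * b))).congr
      (.of_forall fun x => ?_)
    simp only [hG, mul_assoc]
  have hG2d : ∀ x : ℝ, HasDerivAt (fun x : ℝ => -(2 * π * b) * x * G x)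
      (-(2 * π * b) * G x + (2 * π * b) ^ 2 * ((x : ℂ) ^ 2 * G x)) x := by
    intro x; have h1 : HasDerivAt (fun y : ℝ => (y : ℂ)) 1 x := ofRealCLM.hasDerivAt
    refine ((h1.const_mul (-(2 * π * b))).mul (hGd x)).congr_deriv ?_; ring
  have hx2 : Integrable fun x : ℝ => (x : ℂ) ^ 2 * G x := by
    have h := integrable_rpow_mul_exp_neg_mul_sq hpb (s := 2) (by norm_num)
    refine h.mono' ?_ (.of_forall fun x => ?_)
    · refine Continuous.aestronglyMeasurable ?_; rw [hG]; fun_prop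
    · rw [norm_mul, hG, norm_cexp_neg_mul_sq, norm_pow, norm_real, norm_eq_abs, sq_abs]; simp
  have hG2int := (hGint.const_mul (-(2 * π * b))).add
    (hx2.const_mul ((2 * π * b) ^ 2))
  have hd1 : deriv G = fun x : ℝ => -(2 * π * b) * x * G x := funext fun x => (hGd x).deriv
  have hd2 : deriv (deriv G) = fun x : ℝ =>
      -(2 * π * b) * G x + (2 * π * b) ^ 2 * ((x : ℂ) ^ 2 * G x) := by
    rw [hd1]; exact funext fun x => (hG2d x).deriv
  have hF2 : ∀ t : ℝ, 𝓕 (deriv (deriv G)) t = (2 * π * I * t) ^ 2 * 𝓕 G t := by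
    intro t; rw [Real.fourier_deriv (by rw [hd1]; exact hG1int)
      (by rw [hd1]; exact fun x => (hG2d x).differentiableAt) (by rw [hd2]; exact hG2int),
      Real.fourier_deriv hGint (fun x => (hGd x).differentiableAt) (by rw [hd1]; exact hG1int)]
    simp only [smul_eq_mul]; ring
  constructor
  · obtain ⟨C, hC⟩ := exists_isMult_fourier hGint i; refine ⟨‖b ^ (1 / 2 : ℂ)‖₊ * C, ?_⟩
    · convert hC.const_mul (b ^ (1 / 2 : ℂ)) using 2 with ξ; rw [hFG]; field_simp
  · obtain ⟨C, hC⟩ := exists_isMult_fourier (k := deriv (deriv G)) (by rw [hd2]; exact hG2int) i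
    refine ⟨‖b ^ (1 / 2 : ℂ) * (-(4 * (π : ℂ) ^ 2))⁻¹‖₊ * C, ?_⟩
    · convert hC.const_mul (b ^ (1 / 2 : ℂ) * (-(4 * (π : ℂ) ^ 2))⁻¹) using 2 with ξ
      rw [hF2, hFG]; field_simp; linear_combination (4 * (ξ i : ℂ) ^ 2) * Complex.I_sq

lemma exists_isMult_gauss (ha : 0 < a.re) : (∃ C, IsMult (fun ξ => exp (-a * ((ξ 0 ^ 2 + ξ 1 ^ 2 :
    ℝ) : ℂ))) C) ∧ ∃ C, IsMult (fun ξ => ((ξ 0 ^ 2 + ξ 1 ^ 2 : ℝ) : ℂ) * exp (-a * ((ξ 0 ^ 2 + ξ 1 ^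
    2 : ℝ) : ℂ))) C := by
  obtain ⟨⟨C0, h0⟩, ⟨D0, g0⟩⟩ := exists_isMult_gauss1 ha 0
  obtain ⟨⟨C1, h1⟩, ⟨D1, g1⟩⟩ := exists_isMult_gauss1 ha 1
  have he : ∀ ξ : E2, exp (-a * ((ξ 0 ^ 2 + ξ 1 ^ 2 : ℝ) : ℂ)) =
      exp (-a * (ξ 0 : ℂ) ^ 2) * exp (-a * (ξ 1 : ℂ) ^ 2) := by
    intro ξ; rw [← exp_add]; congr 1; push_cast; ring
  constructor
  · refine ⟨C0 * C1, ?_⟩; simp_rw [he]; exact h0.mul h1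
  · refine ⟨D0 * C1 + C0 * D1, ?_⟩; convert (g0.mul h1).add (h0.mul g1) using 2 with ξ
    rw [he]; push_cast; ring

/-! ### Frequencies and the dyadic partition -/

lemma norm_freq_sq (n : ℤ²) : ‖freq n‖ ^ 2 = (n.1 : ℝ) ^ 2 + (n.2 : ℝ) ^ 2 := by
  rw [EuclideanSpace.norm_sq_eq]; simp [freq]

lemma freq_add (n m : ℤ²) : freq (n + m) = freq n + freq m := by ext i; fin_cases i <;> simp [freq]

lemma freq_neg (n : ℤ²) : freq (-n) = -freq n := by ext i; fin_cases i <;> simp [freq]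

lemma freq_sub (n m : ℤ²) : freq (n - m) = freq n - freq m := by
  rw [sub_eq_add_neg, freq_add, freq_neg, sub_eq_add_neg]

lemma finite_norm_freq_le (R : ℝ) : {n : ℤ² | ‖freq n‖ ≤ R}.Finite := by
  obtain ⟨K, hK⟩ := exists_nat_ge R
  refine (Set.finite_Icc ((-K : ℤ), (-K : ℤ)) ((K : ℤ), (K : ℤ))).subset fun n hn => ?_
  have h1 : ‖freq n‖ ≤ K := le_trans hn hK; have h2 := norm_freq_sq n
  have h3 : ‖freq n‖ ^ 2 ≤ (K : ℝ) ^ 2 := pow_le_pow_left₀ (norm_nonneg _) h1 2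
  have ha : |(n.1 : ℝ)| ≤ K := abs_le_of_sq_le_sq (by nlinarith [sq_nonneg (n.2 : ℝ)]) (by positivity)
  have hb : |(n.2 : ℝ)| ≤ K := abs_le_of_sq_le_sq (by nlinarith [sq_nonneg (n.1 : ℝ)]) (by positivity)
  rw [abs_le] at ha hb; refine ⟨⟨?_, ?_⟩, ⟨?_, ?_⟩⟩
  · exact_mod_cast ha.1
  · exact_mod_cast hb.1
  · exact_mod_cast ha.2
  · exact_mod_cast hb.2

lemma IsDyadicCutoff.dyadic_eq_zero_of_le (h : Cutoff) (j : ℕ) {ξ : E2} (hξ : 8 / 5 * 2 ^ j ≤ ‖ξ‖) :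
    dyadic ϕ j ξ = 0 := by
  cases j with
  | zero => exact h.eq_zero ξ (by simpa using hξ)
  | succ j =>
    have hp : (0:ℝ) < 2 ^ j := by positivity
    rw [pow_succ] at hξ; simp only [dyadic]; rw [h.eq_zero, h.eq_zero, sub_zero]
    · rw [norm_smul, norm_inv, norm_pow, norm_ofNat, le_inv_mul_iff₀ hp]; nlinarith
    · rw [norm_smul, norm_inv, norm_pow, norm_ofNat, le_inv_mul_iff₀ (by positivity), pow_succ]
      nlinarith

lemma IsDyadicCutoff.dyadic_succ_eq_zero_of_ge (h : Cutoff) (j : ℕ) {ξ : E2} (hξ : ‖ξ‖ ≤ 5 / 8 * 2 ^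
    j) : dyadic ϕ (j + 1) ξ = 0 := by
  have hp : (0:ℝ) < 2 ^ j := by positivity
  simp only [dyadic]; rw [h.eq_one, h.eq_one, sub_self]
  · rw [norm_smul, norm_inv, norm_pow, norm_ofNat, inv_mul_le_iff₀ hp]; nlinarith
  · rw [norm_smul, norm_inv, norm_pow, norm_ofNat, inv_mul_le_iff₀ (by positivity), pow_succ]
    nlinarith

lemma sum_dyadic (ϕ : E2 → ℝ) (J : ℕ) (ξ : E2) : ∑ j ∈ range (J + 1), dyadic ϕ j ξ = ϕ (((2 : ℝ) ^
    J)⁻¹ • ξ) := by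
  induction J with
  | zero => simp [dyadic]
  | succ J ih => rw [sum_range_succ, ih]; simp [dyadic]

/-- The Littlewood-Paley block on the Fourier side. -/
def bl (ϕ : E2 → ℝ) (j : ℕ) (f : Dist) : Dist := fun n => (dyadic ϕ j (freq n) : ℂ) * f n

lemma besovNorm_eq (ϕ : E2 → ℝ) (s : ℝ) (f : Dist) :
    besovNorm ϕ s f = ⨆ j : ℕ, dy((j : ℝ) * s) * supN (bl ϕ j f) := rfl

lemma IsDyadicCutoff.support_bl_finite (h : Cutoff) (j : ℕ) (f : Dist) : (support (bl ϕ j f)).Finite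
    := by
  refine (finite_norm_freq_le (8 / 5 * 2 ^ j)).subset fun n hn => ?_; by_contra hc
  refine hn ?_; simp only [Set.mem_ofPred_eq, not_le] at hc
  simp [bl, h.dyadic_eq_zero_of_le j hc.le]

lemma bl_add (ϕ : E2 → ℝ) (j : ℕ) (f g : Dist) : bl ϕ j (f + g) = bl ϕ j f + bl ϕ j g := by
  ext n; simp [bl, mul_add]

lemma bl_smul (ϕ : E2 → ℝ) (j : ℕ) (c : ℂ) (f : Dist) : bl ϕ j (c • f) = c • bl ϕ j f := by
  ext n; simp [bl]; ring

lemma bl_sum {ι : Type*} (ϕ : E2 → ℝ) (j : ℕ) (s : Finset ι) (f : ι → Dist) : bl ϕ j (∑ i ∈ s, f i)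
    = ∑ i ∈ s, bl ϕ j (f i) := by ext n; simp [bl, mul_sum]

lemma IsDyadicCutoff.dyadic_mul_eq_zero (h : Cutoff) {i j : ℕ} (hij : i + 3 ≤ j) {ξ η : E2} (hη :
    ‖η‖ = ‖ξ‖) : dyadic ϕ i ξ * dyadic ϕ j η = 0 := by
  obtain ⟨k, rfl⟩ : ∃ k, j = i + k + 2 + 1 := ⟨j - i - 3, by omega⟩
  by_cases hξ : 8 / 5 * 2 ^ i ≤ ‖ξ‖
  · rw [h.dyadic_eq_zero_of_le i hξ, zero_mul]
  · rw [h.dyadic_succ_eq_zero_of_ge, mul_zero]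
    have : (2:ℝ) ^ i * 1 ≤ 2 ^ i * 2 ^ k := by gcongr; exact one_le_pow₀ (by norm_num)
    rw [pow_add, pow_add, hη]; push Not at hξ; nlinarith [pow_pos (two_pos : (0:ℝ) < 2) i]

/-- The indices of the blocks that overlap the `j`-th one. -/
def nbhd (j : ℕ) : Finset ℕ := Finset.Icc (j - 2) (j + 2)

lemma mem_nbhd {i j : ℕ} : i ∈ nbhd j ↔ i ≤ j + 2 ∧ j ≤ i + 2 := by
  simp only [nbhd, Finset.mem_Icc]; omega

lemma IsDyadicCutoff.exists_sum_dyadic_eq_one (h : Cutoff) (R : ℝ) : ∃ J₀, ∀ J ≥ J₀, ∀ ξ : E2, ‖ξ‖ ≤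
    R → ∑ j ∈ range (J + 1), dyadic ϕ j ξ = 1 := by
  obtain ⟨J₀, hJ⟩ := pow_unbounded_of_one_lt (8 / 5 * R) (by norm_num : (1:ℝ) < 2)
  refine ⟨J₀, fun J hJJ ξ hξ => ?_⟩; rw [sum_dyadic, h.eq_one]
  have h2 : (2:ℝ) ^ J₀ ≤ 2 ^ J := pow_le_pow_right₀ (by norm_num) hJJ
  rw [norm_smul, norm_inv, norm_pow, norm_ofNat, inv_mul_le_iff₀ (by positivity)]; nlinarith

lemma IsDyadicCutoff.dyadic_mul_sum_nbhd (h : Cutoff) (j : ℕ) {ξ η : E2} (hη : ‖η‖ = ‖ξ‖) : dyadic ϕ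
    j η * ∑ i ∈ nbhd j, dyadic ϕ i ξ = dyadic ϕ j η := by
  obtain ⟨J₀, hJ⟩ := h.exists_sum_dyadic_eq_one ‖ξ‖; have h1 := hJ (J₀ + j + 2) (by omega) ξ le_rfl
  have h2 : ∑ i ∈ nbhd j, dyadic ϕ j η * dyadic ϕ i ξ =
      ∑ i ∈ range (J₀ + j + 2 + 1), dyadic ϕ j η * dyadic ϕ i ξ := by
    refine sum_subset (fun i hi => ?_) fun i _ hi => ?_
    · rw [mem_nbhd] at hi; rw [mem_range]; omega
    · rw [mem_nbhd, not_and_or, not_le, not_le] at hi; rcases hi with hi | hi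
      · exact h.dyadic_mul_eq_zero (by omega) hη.symm
      · rw [mul_comm]; exact h.dyadic_mul_eq_zero (by omega) hη
  rw [mul_sum, h2, ← mul_sum, h1, mul_one]

lemma IsDyadicCutoff.bl_eq_sum_nbhd (h : Cutoff) (j : ℕ) (f : Dist) : bl ϕ j f = ∑ i ∈ nbhd j, bl ϕ
    j (bl ϕ i f) := by
  ext n; simp only [bl, Finset.sum_apply]; rw [← mul_sum, ← sum_mul, ← mul_assoc]; congr 1
  exact_mod_cast (h.dyadic_mul_sum_nbhd j rfl : dyadic ϕ j (freq n) * _ = _).symm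

end

section

open scoped ContDiff

/-! ### Multipliers attached to the dyadic partition -/

lemma IsDyadicCutoff.hasCompactSupport (h : Cutoff) : HasCompactSupport ϕ := by
  refine HasCompactSupport.of_support_subset_isCompact (isCompact_closedBall 0 (8 / 5)) ?_
  intro ξ hξ; by_contra hc
  simp only [Metric.mem_closedBall, dist_zero_right, not_le] at hc; exact hξ (h.eq_zero ξ hc.le)

lemma contDiff_ofReal_comp {f : E2 → ℝ} (h : ContDiff ℝ ∞ f) :
    ContDiff ℝ ∞ fun ξ => (f ξ : ℂ) := ofRealCLM.contDiff.comp h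

/-- The multiplier `ϕ(·/2) - ϕ`, which generates the blocks of positive index. -/
def ann (ϕ : E2 → ℝ) (ξ : E2) : ℝ := ϕ ((2 : ℝ)⁻¹ • ξ) - ϕ ξ

lemma dyadic_succ (ϕ : E2 → ℝ) (j : ℕ) (ξ : E2) : dyadic ϕ (j + 1) ξ = ann ϕ (((2 : ℝ) ^ j)⁻¹ • ξ)
    := by simp only [dyadic, ann, smul_smul, pow_succ, mul_inv]; congr 3; ring

lemma IsDyadicCutoff.contDiff_ann (h : Cutoff) : ContDiff ℝ ∞ (ann ϕ) :=
  (h.smooth.comp (contDiff_const_smul _)).sub h.smooth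

lemma IsDyadicCutoff.ann_eq_zero_of_ge (h : Cutoff) {ξ : E2} (hξ : 16 / 5 ≤ ‖ξ‖) : ann ϕ ξ = 0 := by
  have := h.dyadic_eq_zero_of_le 1 (ξ := ξ) (by linarith)
  rw [dyadic_succ] at this; simpa using this

lemma IsDyadicCutoff.ann_eq_zero_of_le (h : Cutoff) {ξ : E2} (hξ : ‖ξ‖ ≤ 5 / 8) : ann ϕ ξ = 0 := by
  have := h.dyadic_succ_eq_zero_of_ge 0 (ξ := ξ) (by linarith)
  rw [dyadic_succ] at this; simpa using this

lemma IsDyadicCutoff.exists_isMult (h : Cutoff) : ∃ C, IsMult (fun ξ => (ϕ ξ : ℂ)) C :=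
  exists_isMult_of_contDiff (contDiff_ofReal_comp h.smooth)
    (h.hasCompactSupport.comp_left (g := fun x : ℝ => (x : ℂ)) ofReal_zero)

lemma IsDyadicCutoff.hasCompactSupport_ann (h : Cutoff) : HasCompactSupport (ann ϕ) := by
  refine HasCompactSupport.of_support_subset_isCompact (isCompact_closedBall 0 (16 / 5)) ?_
  intro ξ hξ; by_contra hc
  simp only [Metric.mem_closedBall, dist_zero_right, not_le] at hc
  exact hξ (h.ann_eq_zero_of_ge hc.le)

lemma IsDyadicCutoff.exists_isMult_ann (h : Cutoff) : ∃ C, IsMult (fun ξ => (ann ϕ ξ : ℂ)) C :=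
  exists_isMult_of_contDiff (contDiff_ofReal_comp h.contDiff_ann)
    (h.hasCompactSupport_ann.comp_left (g := fun x : ℝ => (x : ℂ)) ofReal_zero)

lemma IsDyadicCutoff.exists_isMult_ann_div (h : Cutoff) : ∃ C, IsMult (fun ξ => ((ann ϕ ξ / (ξ 0 ^ 2
    + ξ 1 ^ 2) : ℝ) : ℂ)) C := by
  refine exists_isMult_of_contDiff (contDiff_ofReal_comp (f := fun ξ : E2 =>
    ann ϕ ξ / (ξ 0 ^ 2 + ξ 1 ^ 2)) ?_) ?_
  · rw [contDiff_iff_contDiffAt]; intro ξ; by_cases hξ : ξ = 0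
    · refine (contDiffAt_const (c := (0:ℝ))).congr_of_eventuallyEq ?_
      have : Metric.ball (0 : E2) (5 / 8) ∈ 𝓝 ξ := by
        rw [hξ]; exact Metric.ball_mem_nhds _ (by norm_num)
      filter_upwards [this] with η hη; rw [h.ann_eq_zero_of_le, zero_div]
      simpa using (Metric.mem_ball.1 hη).le
    · refine h.contDiff_ann.contDiffAt.div ?_ ?_
      · have h0 : ContDiff ℝ ∞ fun η : E2 => η 0 := contDiff_piLp_apply (p := 2)
        have h1 : ContDiff ℝ ∞ fun η : E2 => η 1 := contDiff_piLp_apply (p := 2)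
        exact ((h0.pow 2).add (h1.pow 2)).contDiffAt
      · intro hc; apply hξ; have h0 : ξ 0 = 0 := by nlinarith [sq_nonneg (ξ 0), sq_nonneg (ξ 1)]
        have h1 : ξ 1 = 0 := by nlinarith [sq_nonneg (ξ 0), sq_nonneg (ξ 1)]
        ext i; fin_cases i <;> simp [h0, h1]
  · refine h.hasCompactSupport_ann.mono ?_; intro ξ hξ hc; exact hξ (by simp [hc])

lemma IsDyadicCutoff.exists_supN_bl_le (h : Cutoff) : ∃ C : ℝ≥0, ∀ (j : ℕ) (f : Dist), (support
    f).Finite → supN (bl ϕ j f) ≤ C * supN f := by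
  obtain ⟨C₀, h₀⟩ := h.exists_isMult; obtain ⟨C₁, h₁⟩ := h.exists_isMult_ann
  refine ⟨max C₀ C₁, fun j f hf => ?_⟩
  cases j with
  | zero =>
    have h1 := h₀ 1 f hf; simp only [one_smul] at h1
    refine (show supN (bl ϕ 0 f) ≤ C₀ * supN f from h1).trans ?_; gcongr; exact le_max_left _ _
  | succ j =>
    have : supN (bl ϕ (j + 1) f) ≤ C₁ * supN f := by
      have := h₁ ((2 : ℝ) ^ j)⁻¹ f hf; simp only [← dyadic_succ] at this; exact this
    refine this.trans ?_; gcongr; exact le_max_right _ _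

lemma IsDyadicCutoff.exists_supN_bl_neg_le (h : Cutoff) : ∃ C : ℝ≥0, ∀ (j : ℕ) (f : Dist), (support
    f).Finite → supN (fun n => (dyadic ϕ j (freq (-n)) : ℂ) * f n) ≤ C * supN f := by
  obtain ⟨C, hC⟩ := h.exists_supN_bl_le; refine ⟨C, fun j f hf => ?_⟩
  have h1 := hC j (conjD f) (support_conjD_finite hf); rw [supN_conjD] at h1; rw [← supN_conjD]
  convert h1 using 2; ext n; simp [conjD, bl]

/-! ### The heat semigroup on blocks -/

/-- The complex heat semigroup `e^{τ a (Δ - 1)}`. -/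
def heat (a : ℂ) (τ : ℝ) (f : Dist) : Dist := fun n => exp (-(τ : ℂ) * symb a n) * f n

lemma support_heat_finite (a : ℂ) (τ : ℝ) (hf : (support f).Finite) :
    (support (heat a τ f)).Finite := support_mul_finite _ hf

lemma heat_zero (a : ℂ) (f : Dist) : heat a 0 f = f := by ext n; simp [heat]

lemma bl_heat (ϕ : E2 → ℝ) (j : ℕ) (a : ℂ) (τ : ℝ) (f : Dist) : bl ϕ j (heat a τ f) = heat a τ (bl ϕ
    j f) := by ext n; simp [bl, heat]; ring

lemma heat_add (a : ℂ) (τ : ℝ) (f g : Dist) : heat a τ (f + g) = heat a τ f + heat a τ g := by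
  ext n; simp [heat, mul_add]

lemma heat_sub (a : ℂ) (τ : ℝ) (f g : Dist) : heat a τ (f - g) = heat a τ f - heat a τ g := by
  ext n; simp [heat, mul_sub]

lemma heat_heat (a : ℂ) (τ σ : ℝ) (f : Dist) : heat a τ (heat a σ f) = heat a (τ + σ) f := by
  ext n; simp only [heat]; rw [← mul_assoc, ← exp_add]; congr 2; push_cast; ring

lemma symb_smul_freq {τ : ℝ} (hτ : 0 ≤ τ) (a : ℂ) (n : ℤ²) : exp (-(τ : ℂ) * symb a n) = exp (-(τ :
    ℂ) * a) * exp (-a * (((√τ • freq n) 0 ^ 2 + (√τ • freq n) 1 ^ 2 : ℝ) : ℂ)) := by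
  rw [← exp_add]; congr 1; have hs : (√τ) ^ 2 = τ := sq_sqrt hτ
  have h1 : ((√τ • freq n) 0 ^ 2 + (√τ • freq n) 1 ^ 2 : ℝ) = τ * ((n.1 : ℝ) ^ 2 + (n.2 : ℝ) ^ 2) := by
    simp [freq, mul_pow, hs, mul_add]
  rw [h1, symb]; push_cast; ring

lemma enorm_exp_le_one {τ : ℝ} (hτ : 0 ≤ τ) (ha : 0 < a.re) : ‖exp (-(τ : ℂ) * a)‖ₑ ≤ 1 := by
  rw [← ofReal_norm, norm_exp, ENNReal.ofReal_le_one, Real.exp_le_one_iff]; simp; positivity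

lemma exists_supN_heat_le (ha : 0 < a.re) : ∃ C : ℝ≥0, ∀ (τ : ℝ), 0 ≤ τ → ∀ f : Dist, (support
    f).Finite → supN (heat a τ f) ≤ C * supN f := by
  obtain ⟨⟨C, hC⟩, -⟩ := exists_isMult_gauss ha; refine ⟨C, fun τ hτ f hf => ?_⟩
  have : heat a τ f = exp (-(τ : ℂ) * a) • fun n =>
      exp (-a * (((√τ • freq n) 0 ^ 2 + (√τ • freq n) 1 ^ 2 : ℝ) : ℂ)) * f n := by
    ext n; simp only [heat, symb_smul_freq hτ, Pi.smul_apply, smul_eq_mul]; ring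
  rw [this, supN_smul]
  calc _ ≤ 1 * _ := mul_le_mul_left (enorm_exp_le_one hτ ha) _
    _ ≤ _ := by rw [one_mul]; exact hC _ f hf

lemma IsDyadicCutoff.exists_supN_heat_bl_le (h : Cutoff) (ha : 0 < a.re) : ∃ C : ℝ≥0, ∀ (τ : ℝ), 0 <
    τ → ∀ (j : ℕ) (f : Dist), (support f).Finite → supN (heat a τ (bl ϕ (j + 1) f)) ≤ C * ofReal ((τ
    * 4 ^ j)⁻¹) * supN f := by
  obtain ⟨-, ⟨C, hC⟩⟩ := exists_isMult_gauss ha; obtain ⟨D, hD⟩ := h.exists_isMult_ann_div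
  refine ⟨C * D, fun τ hτ j f hf => ?_⟩
  have key : heat a τ (bl ϕ (j + 1) f) = (exp (-(τ : ℂ) * a) * (((τ * 4 ^ j)⁻¹ : ℝ) : ℂ)) •
      fun n => ((((√τ • freq n) 0 ^ 2 + (√τ • freq n) 1 ^ 2 : ℝ) : ℂ) *
        exp (-a * (((√τ • freq n) 0 ^ 2 + (√τ • freq n) 1 ^ 2 : ℝ) : ℂ))) *
      (((ann ϕ (((2 : ℝ) ^ j)⁻¹ • freq n) / ((((2 : ℝ) ^ j)⁻¹ • freq n) 0 ^ 2 +
        (((2 : ℝ) ^ j)⁻¹ • freq n) 1 ^ 2) : ℝ) : ℂ) * f n) := by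
    ext n; simp only [heat, symb_smul_freq hτ.le, Pi.smul_apply, smul_eq_mul, bl, dyadic_succ]
    have h1 : ((√τ • freq n) 0 ^ 2 + (√τ • freq n) 1 ^ 2 : ℝ) =
        τ * 4 ^ j * ((((2 : ℝ) ^ j)⁻¹ • freq n) 0 ^ 2 + (((2 : ℝ) ^ j)⁻¹ • freq n) 1 ^ 2) := by
      have h4 : (4 : ℝ) ^ j = (2 ^ j) ^ 2 := by rw [← pow_mul, mul_comm, pow_mul]; norm_num
      simp [freq, mul_pow, sq_sqrt hτ.le, h4]; field_simp
    by_cases h0 : ann ϕ (((2 : ℝ) ^ j)⁻¹ • freq n) = 0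
    · simp [h0]
    · have hq : ((((2 : ℝ) ^ j)⁻¹ • freq n) 0 ^ 2 + (((2 : ℝ) ^ j)⁻¹ • freq n) 1 ^ 2 : ℝ) ≠ 0 := by
        intro hc; apply h0; apply h.ann_eq_zero_of_le
        have : ‖((2 : ℝ) ^ j)⁻¹ • freq n‖ ^ 2 = 0 := by
          rw [EuclideanSpace.norm_sq_eq, Fin.sum_univ_two, norm_eq_abs, norm_eq_abs,
            sq_abs, sq_abs]; exact hc
        rw [pow_eq_zero_iff two_ne_zero] at this; rw [this]; norm_num
      generalize ((((2 : ℝ) ^ j)⁻¹ • freq n) 0 ^ 2 + (((2 : ℝ) ^ j)⁻¹ • freq n) 1 ^ 2 : ℝ) = q at *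
      rw [h1]; generalize exp (-a * ((τ * 4 ^ j * q : ℝ) : ℂ)) = e
      have hτ' : (τ : ℂ) ≠ 0 := by exact_mod_cast hτ.ne'
      have hq' : (q : ℂ) ≠ 0 := by exact_mod_cast hq
      push_cast; field_simp
  rw [key, supN_smul, enorm_mul]
  have hE : ‖(((τ * 4 ^ j)⁻¹ : ℝ) : ℂ)‖ₑ = ofReal ((τ * 4 ^ j)⁻¹) := by
    rw [← ofReal_norm, norm_real, norm_of_nonneg (by positivity)]
  rw [hE]; refine (mul_le_mul' (mul_le_mul_left (enorm_exp_le_one hτ.le ha) _)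
    ((hC _ _ (support_mul_finite _ hf)).trans (mul_le_mul_right (hD _ f hf) _))).trans ?_
  rw [coe_mul, one_mul]; exact le_of_eq (by ring)

/-- Smoothing of the heat semigroup on a block, with any gain between `0` and `2` derivatives. -/
lemma IsDyadicCutoff.exists_heat_smoothing (h : Cutoff) (ha : 0 < a.re) : ∃ C : ℝ≥0, ∀ κ : ℝ, 0 ≤ κ
    → κ ≤ 1 → ∀ τ : ℝ, 0 < τ → τ ≤ 1 → ∀ (j : ℕ) (f : Dist), (support f).Finite → supN (heat a τ (bl
    ϕ j f)) ≤ C * ofReal ((τ * 4 ^ j) ^ (-κ)) * supN f := by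
  obtain ⟨C₁, h₁⟩ := exists_supN_heat_le ha; obtain ⟨C₂, h₂⟩ := h.exists_supN_heat_bl_le ha
  obtain ⟨C₃, h₃⟩ := h.exists_supN_bl_le
  refine ⟨C₁ * C₃ + 4 * C₂, fun κ hκ hκ1 τ hτ hτ1 j f hf => ?_⟩
  have hp : 0 < τ * 4 ^ j := by positivity
  have base : supN (heat a τ (bl ϕ j f)) ≤ C₁ * C₃ * supN f := by
    rw [mul_assoc]
    exact (h₁ τ hτ.le _ (h.support_bl_finite j f)).trans (mul_le_mul_right (h₃ j f hf) _)
  by_cases hle : τ * 4 ^ j ≤ 1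
  · refine base.trans ?_
    have : (1 : 𝐄) ≤ ofReal ((τ * 4 ^ j) ^ (-κ)) := by
      rw [← ofReal_one]
      exact ofReal_le_ofReal (Real.one_le_rpow_of_pos_of_le_one_of_nonpos hp hle (by linarith))
    refine mul_le_mul_left ?_ _
    calc (C₁ : 𝐄) * C₃ ≤ ((C₁ * C₃ + 4 * C₂ : ℝ≥0) : 𝐄) * 1 := by
          rw [mul_one, ← coe_mul]; exact_mod_cast le_self_add
      _ ≤ _ := by gcongr
  · push Not at hle
    obtain ⟨i, rfl⟩ : ∃ i, j = i + 1 := by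
      refine ⟨j - 1, ?_⟩; rcases Nat.eq_zero_or_pos j with h0 | h0
      · subst h0; simp at hle; linarith
      · omega
    refine (h₂ τ hτ i f hf).trans ?_; gcongr ?_ * supN f
    have e1 : (τ * 4 ^ i)⁻¹ = 4 * (τ * 4 ^ (i + 1))⁻¹ := by rw [pow_succ]; field_simp
    have e2 : (τ * 4 ^ (i + 1))⁻¹ ≤ (τ * 4 ^ (i + 1)) ^ (-κ) := by
      rw [← Real.rpow_neg_one]; exact rpow_le_rpow_of_exponent_le hle.le (by linarith)
    rw [e1, ofReal_mul (by norm_num), ← mul_assoc]; gcongr; push_cast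
    calc (C₂ : 𝐄) * ofReal 4 = 4 * C₂ := by rw [mul_comm]; norm_num
      _ ≤ _ := le_add_self

end

/-! ### The Besov norm -/

lemma mul_supN_bl_le (ϕ : E2 → ℝ) (s : ℝ) (f : Dist) (j : ℕ) : dy((j : ℝ) * s) * supN (bl ϕ j f) ≤
    besovNorm ϕ s f :=
  le_iSup (fun j : ℕ => dy((j : ℝ) * s) * supN (bl ϕ j f)) j

lemma ofReal_two_rpow_mul (x y : ℝ) : ofReal ((2 : ℝ) ^ x) * ofReal ((2 : ℝ) ^ y) = dy(x + y) := by
  rw [← ofReal_mul (by positivity), rpow_add two_pos]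

lemma supN_bl_le_besov (ϕ : E2 → ℝ) (s : ℝ) (f : Dist) (j : ℕ) : supN (bl ϕ j f) ≤ dy(-((j : ℝ) *
    s)) * besovNorm ϕ s f := by
  refine le_trans ?_ (mul_le_mul_right (mul_supN_bl_le ϕ s f j) _)
  rw [← mul_assoc, ofReal_two_rpow_mul]; simp

lemma besov_zero (ϕ : E2 → ℝ) (s : ℝ) : besovNorm ϕ s 0 = 0 := by
  have : ∀ j, bl ϕ j 0 = 0 := fun j => by ext n; simp [bl]
  simp [besovNorm_eq, this, supN_zero]

lemma besov_smul (ϕ : E2 → ℝ) (s : ℝ) (c : ℂ) (f : Dist) : besovNorm ϕ s (c • f) = ‖c‖ₑ * besovNorm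
    ϕ s f := by simp only [besovNorm_eq, bl_smul, supN_smul, mul_iSup]; congr 1; ext j; ring

lemma besov_neg (ϕ : E2 → ℝ) (s : ℝ) (f : Dist) : besovNorm ϕ s (-f) = besovNorm ϕ s f := by
  rw [← neg_one_smul ℂ, besov_smul]; simp

lemma besov_sub_comm (ϕ : E2 → ℝ) (s : ℝ) (f g : Dist) : besovNorm ϕ s (f - g) = besovNorm ϕ s (g -
    f) := by rw [← neg_sub, besov_neg]

lemma IsDyadicCutoff.besov_add_le (h : Cutoff) (s : ℝ) (f g : Dist) : 𝐁 s (f + g) ≤ 𝐁 s f + 𝐁 s g :=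
    by
  rw [besovNorm_eq]; refine iSup_le fun j => ?_; rw [bl_add]
  refine (mul_le_mul_right (supN_add_le (h.support_bl_finite j f) (h.support_bl_finite j g)) _).trans ?_
  rw [mul_add]; exact add_le_add (mul_supN_bl_le ϕ s f j) (mul_supN_bl_le ϕ s g j)

lemma IsDyadicCutoff.besov_sub_le (h : Cutoff) (s : ℝ) (f g : Dist) : 𝐁 s (f - g) ≤ 𝐁 s f + 𝐁 s g :=
    by rw [sub_eq_add_neg, ← besov_neg ϕ s g]; exact h.besov_add_le s f (-g)

lemma IsDyadicCutoff.besov_triangle (h : Cutoff) (s : ℝ) (f g k : Dist) : 𝐁 s (f - k) ≤ 𝐁 s (f - g)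
    + 𝐁 s (g - k) := by rw [← sub_add_sub_cancel f g k]; exact h.besov_add_le s _ _

lemma IsDyadicCutoff.besov_sum_le {ι : Type*} (h : Cutoff) (s : ℝ) (S : Finset ι) (f : ι → Dist) : 𝐁
    s (∑ i ∈ S, f i) ≤ ∑ i ∈ S, 𝐁 s (f i) := by
  classical
  induction S using Finset.induction_on with
  | empty => simp [besov_zero]
  | insert a S ha ih =>
    rw [sum_insert ha, sum_insert ha]; exact (h.besov_add_le s _ _).trans (add_le_add le_rfl ih)

lemma besov_mono (ϕ : E2 → ℝ) {s' s : ℝ} (hs : s' ≤ s) (f : Dist) : besovNorm ϕ s' f ≤ besovNorm ϕ s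
    f := by rw [besovNorm_eq, besovNorm_eq]; refine iSup_mono fun j => ?_; gcongr; norm_num

lemma besov_le_of_bl (ϕ : E2 → ℝ) (s σ : ℝ) {W : 𝐄} (H : ∀ j : ℕ, supN (bl ϕ j g) ≤ W * dy((j : ℝ) *
    σ) * ∑ i ∈ nbhd j, supN (bl ϕ i f)) : besovNorm ϕ (s - σ) g ≤ ofReal (5 * 2 ^ (2 * |s|)) * W *
    besovNorm ϕ s f := by
  rw [besovNorm_eq ϕ (s - σ)]; refine iSup_le fun j => ?_
  have h1 : ∑ i ∈ nbhd j, supN (bl ϕ i f) ≤ 5 * (dy(2 * |s| - (j : ℝ) * s) * besovNorm ϕ s f) := by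
    have hcard : (nbhd j).card ≤ 5 := by simp [nbhd]; omega
    have : ∀ i ∈ nbhd j, supN (bl ϕ i f) ≤ dy(2 * |s| - (j : ℝ) * s) * besovNorm ϕ s f := by
      intro i hi; refine (supN_bl_le_besov ϕ s f i).trans ?_; rw [mem_nbhd] at hi
      have ha : (i : ℝ) ≤ j + 2 := by exact_mod_cast hi.1
      have hb : (j : ℝ) ≤ i + 2 := by exact_mod_cast hi.2
      gcongr
      · norm_num
      · have : ((j : ℝ) - i) * s ≤ 2 * |s| := by
          refine (le_abs_self _).trans ?_; rw [abs_mul]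
          refine mul_le_mul_of_nonneg_right ?_ (abs_nonneg s); rw [abs_le]; constructor <;> linarith
        linarith
    refine (Finset.sum_le_card_nsmul _ _ _ this).trans ?_; rw [nsmul_eq_mul]; gcongr
    exact_mod_cast hcard
  refine (mul_le_mul_right ((H j).trans (mul_le_mul_right h1 _)) _).trans ?_
  have h5 : ofReal (5 * 2 ^ (2 * |s|)) = 5 * ofReal (2 ^ (2 * |s|)) := by
    rw [ofReal_mul (by norm_num)]; norm_num
  rw [h5]; have h6 : dy((j : ℝ) * (s - σ)) * dy((j : ℝ) * σ) *
      dy(2 * |s| - (j : ℝ) * s) = ofReal (2 ^ (2 * |s|)) := by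
    rw [ofReal_two_rpow_mul, ofReal_two_rpow_mul]; congr 2; ring
  rw [← h6]; exact le_of_eq (by ring)

lemma IsDyadicCutoff.besov_le_of_mult (h : Cutoff) (s σ : ℝ) {W : 𝐄} (m : ℤ² → ℂ) (H : ∀ (j : ℕ) (f
    : Dist), (support f).Finite → supN (fun n => m n * bl ϕ j f n) ≤ W * dy((j : ℝ) * σ) * supN f)
    (f : Dist) : 𝐁 (s - σ) (fun n => m n * f n) ≤ ofReal (5 * 2 ^ (2 * |s|)) * W * 𝐁 s f := by
  refine besov_le_of_bl ϕ s σ fun j => ?_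
  have : bl ϕ j (fun n => m n * f n) = ∑ i ∈ nbhd j, fun n => m n * bl ϕ j (bl ϕ i f) n := by
    ext n
    have := congrFun (h.bl_eq_sum_nbhd j f) n; simp only [Finset.sum_apply] at this ⊢
    rw [← mul_sum, ← this]; simp only [bl]; ring
  rw [this]
  refine (supN_sum_le _ fun i _ => support_mul_finite _ (h.support_bl_finite _ _)).trans ?_
  rw [mul_sum]; exact sum_le_sum fun i _ => H j _ (h.support_bl_finite i f)

lemma IsDyadicCutoff.exists_besov_heat_le (h : Cutoff) (ha : 0 < a.re) (s : ℝ) : ∃ C : ℝ≥0, ∀ κ : ℝ,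
    0 ≤ κ → κ ≤ 1 → ∀ τ : ℝ, 0 < τ → τ ≤ 1 → ∀ f : Dist, 𝐁 (s + 2 * κ) (heat a τ f) ≤ C * ofReal (τ
    ^ (-κ)) * 𝐁 s f := by
  obtain ⟨C, hC⟩ := h.exists_heat_smoothing ha
  refine ⟨(5 * 2 ^ (2 * |s|) : ℝ).toNNReal * C, fun κ hκ hκ1 τ hτ hτ1 f => ?_⟩
  have := h.besov_le_of_mult s (-(2 * κ)) (W := C * ofReal (τ ^ (-κ)))
    (fun n => exp (-(τ : ℂ) * symb a n)) (fun j g hg => by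
      refine (hC κ hκ hκ1 τ hτ hτ1 j g hg).trans_eq ?_
      rw [mul_assoc (C : 𝐄) (ofReal (τ ^ (-κ))), ← ofReal_mul (by positivity),
        mul_rpow hτ.le (by positivity)]
      congr 4; rw [show (4 : ℝ) = 2 ^ (2 : ℝ) by norm_num, ← rpow_natCast, ← rpow_mul (by norm_num),
        ← rpow_mul (by norm_num)]
      congr 1; ring) f
  rw [sub_neg_eq_add] at this; refine this.trans_eq ?_; rw [coe_mul, ← ofReal]; ring

lemma IsDyadicCutoff.exists_besov_heat_le_self (h : Cutoff) (ha : 0 < a.re) (s : ℝ) : ∃ C : ℝ≥0, ∀ τ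
    : ℝ, 0 ≤ τ → ∀ f : Dist, 𝐁 s (heat a τ f) ≤ C * 𝐁 s f := by
  obtain ⟨C, hC⟩ := exists_supN_heat_le ha; refine ⟨C, fun τ hτ f => ?_⟩
  rw [besovNorm_eq, besovNorm_eq, mul_iSup]; refine iSup_mono fun j => ?_
  rw [bl_heat, mul_left_comm]; exact mul_le_mul_right (hC τ hτ _ (h.support_bl_finite j f)) _

lemma conjD_sub (f g : Dist) : conjD (f - g) = conjD f - conjD g := by ext n; simp [conjD]

lemma IsDyadicCutoff.exists_besov_conjD_le (h : Cutoff) (s : ℝ) : ∃ C : ℝ≥0, ∀ f : Dist, 𝐁 s (conjD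
    f) ≤ C * 𝐁 s f := by
  obtain ⟨C, hC⟩ := h.exists_supN_bl_neg_le
  refine ⟨(5 * 2 ^ (2 * |s|) : ℝ).toNNReal * C, fun f => ?_⟩
  have := besov_le_of_bl ϕ s 0 (f := f) (g := conjD f) (W := C) fun j => by
    have e : bl ϕ j (conjD f) = conjD (∑ i ∈ nbhd j,
        fun n => (dyadic ϕ j (freq (-n)) : ℂ) * bl ϕ i f n) := by
      ext n
      have := h.dyadic_mul_sum_nbhd j (show ‖freq n‖ = ‖freq (-n)‖ by rw [freq_neg, norm_neg])
      simp only [bl, conjD, Finset.sum_apply, neg_neg]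
      rw [← mul_sum, ← sum_mul, ← mul_assoc, ← ofReal_sum,
        ← Complex.ofReal_mul, this, map_mul, Complex.conj_ofReal]
    rw [e, supN_conjD]
    refine (supN_sum_le _ fun i _ => support_mul_finite _ (h.support_bl_finite _ _)).trans ?_
    simp only [mul_zero, Real.rpow_zero, ofReal_one, mul_one]; rw [mul_sum]
    exact sum_le_sum fun i _ => hC j _ (h.support_bl_finite i f)
  rw [sub_zero] at this; rw [coe_mul, ← ofReal]; exact this

/-! ### Coefficients, lower semicontinuity and low-pass filters -/

lemma IsDyadicCutoff.exists_coeff_le (h : Cutoff) (s : ℝ) (n : ℤ²) : ∃ C : ℝ≥0, ∀ f : Dist, ‖f n‖ₑ ≤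
    C * 𝐁 s f := by
  obtain ⟨J, hJ⟩ := h.exists_sum_dyadic_eq_one ‖freq n‖
  refine ⟨∑ j ∈ range (J + 1), ((2 : ℝ) ^ (-((j : ℝ) * s))).toNNReal, fun f => ?_⟩
  have h1 : f n = ∑ j ∈ range (J + 1), bl ϕ j f n := by
    simp only [bl]; rw [← sum_mul, ← ofReal_sum, hJ J le_rfl _ le_rfl]; simp
  rw [h1, ENNReal.ofNNReal_finsetSum, sum_mul]
  refine (enorm_sum_le _ _).trans (sum_le_sum fun j _ => ?_)
  exact (coeff_le_supN (h.support_bl_finite j f) n).trans (supN_bl_le_besov ϕ s f j)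

lemma IsDyadicCutoff.eq_zero_of_besov_eq_zero (h : Cutoff) (hf : 𝐁 s f = 0) : f = 0 := by
  ext n; obtain ⟨C, hC⟩ := h.exists_coeff_le s n
  have := hC f; rw [hf, mul_zero] at this; simpa using this

lemma IsDyadicCutoff.tendsto_ev_bl (h : Cutoff) {α : Type*} {l : Filter α} {F : α → Dist} (hF : ∀ n,
    Tendsto (fun k => F k n) l (𝓝 (f n))) (j : ℕ) (x : ℝ × ℝ) : Tendsto (fun k => ev (bl ϕ j (F k))
    x) l (𝓝 (ev (bl ϕ j f) x)) := by
  set S := (finite_norm_freq_le (8 / 5 * 2 ^ j)).toFinset with hS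
  have hsupp : ∀ g : Dist, support (bl ϕ j g) ⊆ S := by
    intro g n hn; rw [hS, Set.Finite.coe_toFinset]; by_contra hc
    refine hn ?_; simp only [Set.mem_ofPred_eq, not_le] at hc
    simp [bl, h.dyadic_eq_zero_of_le j hc.le]
  simp_rw [fun g => ev_eq_sum S (hsupp g)]
  exact tendsto_finsetSum _ fun n _ => ((hF n).const_mul _).mul_const _

lemma IsDyadicCutoff.besov_le_of_tendsto (h : Cutoff) {α : Type*} {l : Filter α} [l.NeBot] {F : α →
    Dist} (hF : ∀ n, Tendsto (fun k => F k n) l (𝓝 (f n))) {b : α → 𝐄} {B : 𝐄} (hb : Tendsto b l (𝓝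
    B)) (hB : ∀ᶠ k in l, 𝐁 s (F k) ≤ b k) : 𝐁 s f ≤ B := by
  rw [besovNorm_eq]; refine iSup_le fun j => ?_; rw [supN, mul_iSup]; refine iSup_le fun x => ?_
  refine le_of_tendsto_of_tendsto (ENNReal.Tendsto.const_mul (h.tendsto_ev_bl hF j x).enorm
    (Or.inr ofReal_ne_top)) hb (hB.mono fun k hk => ?_)
  exact (mul_le_mul_right (ev_le_supN _ x) _).trans ((mul_supN_bl_le ϕ s (F k) j).trans hk)

/-- The low-pass filter `∑_{j ≤ J} δ_j`. -/
def lp (ϕ : E2 → ℝ) (J : ℕ) (f : Dist) : Dist := fun n => (ϕ (((2 : ℝ) ^ J)⁻¹ • freq n) : ℂ) * f n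

lemma IsDyadicCutoff.support_lp_subset (h : Cutoff) (J : ℕ) (f : Dist) : support (lp ϕ J f) ⊆ {n :
    ℤ² | ‖freq n‖ ≤ 8 / 5 * 2 ^ J} := by
  intro n hn; by_contra hc
  refine hn ?_; simp only [Set.mem_ofPred_eq, not_le] at hc; rw [lp, h.eq_zero]
  · simp
  · rw [norm_smul, norm_inv, norm_pow, norm_ofNat, le_inv_mul_iff₀ (by positivity)]; nlinarith

lemma IsDyadicCutoff.support_lp_finite (h : Cutoff) (J : ℕ) (f : Dist) : (support (lp ϕ J f)).Finite
    :=
  (finite_norm_freq_le _).subset (h.support_lp_subset J f)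

lemma IsDyadicCutoff.exists_besov_sub_lp_le (h : Cutoff) : ∃ C : ℝ≥0, ∀ (s s' : ℝ), s' ≤ s → ∀ (J :
    ℕ) (f : Dist), 𝐁 s' (f - lp ϕ J f) ≤ C * ofReal (2 ^ (((J : ℝ) - 1) * (s' - s))) * 𝐁 s f := by
  obtain ⟨C, hC⟩ := h.exists_isMult; refine ⟨1 + C, fun s s' hs J f => ?_⟩; rw [besovNorm_eq]
  refine iSup_le fun j => ?_; by_cases hj : j + 2 ≤ J
  · have : bl ϕ j (f - lp ϕ J f) = 0 := by
      ext n; simp only [bl, lp, Pi.sub_apply, Pi.zero_apply]; by_cases hn : 8 / 5 * 2 ^ j ≤ ‖freq n‖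
      · rw [h.dyadic_eq_zero_of_le j hn]; simp
      · rw [h.eq_one (((2 : ℝ) ^ J)⁻¹ • freq n)]
        · simp
        · rw [norm_smul, norm_inv, norm_pow, norm_ofNat, inv_mul_le_iff₀ (by positivity)]
          have : (2:ℝ) ^ (j + 2) ≤ 2 ^ J := pow_le_pow_right₀ (by norm_num) hj; rw [pow_add] at this
          push Not at hn
          nlinarith [pow_pos (two_pos : (0:ℝ) < 2) j]
    rw [this, supN_zero, mul_zero]; exact zero_le
  · have hj' : (J : ℝ) - 1 ≤ j := by
      have : J ≤ j + 1 := by omega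
      have : (J : ℝ) ≤ j + 1 := by exact_mod_cast this
      linarith
    have h1 : supN (bl ϕ j (f - lp ϕ J f)) ≤ (1 + C : ℝ≥0) * supN (bl ϕ j f) := by
      have e : bl ϕ j (f - lp ϕ J f) = bl ϕ j f +
          -fun n => (ϕ (((2 : ℝ) ^ J)⁻¹ • freq n) : ℂ) * bl ϕ j f n := by ext n; simp [bl, lp]; ring
      rw [e, coe_add, add_mul, ENNReal.coe_one, one_mul]
      refine (supN_add_le (h.support_bl_finite j f) (support_neg_finite
        (support_mul_finite _ (h.support_bl_finite j f)))).trans ?_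
      rw [supN_neg]; exact add_le_add le_rfl (hC _ _ (h.support_bl_finite j f))
    have h2 : dy((j : ℝ) * s') ≤ ofReal (2 ^ (((J : ℝ) - 1) * (s' - s))) * dy((j : ℝ) * s) := by
      rw [ofReal_two_rpow_mul]; gcongr
      · norm_num
      · nlinarith
    refine (mul_le_mul' h2 h1).trans ?_
    calc _ = ((1 + C : ℝ≥0) : 𝐄) * ofReal (2 ^ (((J : ℝ) - 1) * (s' - s))) *
        (dy((j : ℝ) * s) * supN (bl ϕ j f)) := by ring
      _ ≤ _ := mul_le_mul_right (mul_supN_bl_le ϕ s f j) _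

/-! ### The closure `C^s` of the trigonometric polynomials -/

lemma IsDyadicCutoff.besov_lt_top_of_finite (h : Cutoff) (s : ℝ) (hf : (support f).Finite) : 𝐁 s f <
    ∞ := by
  obtain ⟨R, hR⟩ : ∃ R : ℝ, ∀ n ∈ support f, ‖freq n‖ ≤ R := by
    obtain ⟨R, hR⟩ := (hf.image fun n => ‖freq n‖).bddAbove; exact ⟨R, fun n hn => hR ⟨n, hn, rfl⟩⟩
  obtain ⟨J, hJ⟩ := pow_unbounded_of_one_lt (8 / 5 * R) (by norm_num : (1:ℝ) < 2)
  refine lt_of_le_of_lt (b := ∑ j ∈ range (J + 1), dy((j : ℝ) * s) * supN (bl ϕ j f)) ?_ ?_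
  · rw [besovNorm_eq]; refine iSup_le fun j => ?_; by_cases hj : j < J + 1
    · exact Finset.single_le_sum (f := fun j : ℕ => dy((j : ℝ) * s) *
        supN (bl ϕ j f)) (fun _ _ => zero_le) (mem_range.2 hj)
    · obtain ⟨i, rfl⟩ : ∃ i, j = i + 1 := ⟨j - 1, by omega⟩
      have : bl ϕ (i + 1) f = 0 := by
        ext n; by_cases hn : f n = 0
        · simp [bl, hn]
        · rw [bl, h.dyadic_succ_eq_zero_of_ge]
          · simp
          · have h1 := hR n hn
            have : (2:ℝ) ^ J ≤ 2 ^ i := pow_le_pow_right₀ (by norm_num) (by omega); linarith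
      rw [this, supN_zero, mul_zero]; exact zero_le
  · exact sum_lt_top.2 fun j _ =>
      mul_lt_top ofReal_lt_top (supN_lt_top (h.support_bl_finite j f))

lemma MemC.of_finite (ϕ : E2 → ℝ) (s : ℝ) (hf : (support f).Finite) :
    MemC ϕ s f := fun δ hδ => ⟨f, hf, by rwa [sub_self, besov_zero]⟩

lemma MemC.zero (ϕ : E2 → ℝ) (s : ℝ) : MemC ϕ s 0 := MemC.of_finite ϕ s (by simp)

lemma MemC.lt_top (h : Cutoff) (hf : MemC ϕ s f) : 𝐁 s f < ∞ := by
  obtain ⟨g, hg, hfg⟩ := hf 1 one_pos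
  calc 𝐁 s f = 𝐁 s (f - g + g) := by rw [sub_add_cancel]
    _ ≤ _ := h.besov_add_le s _ _
    _ < ∞ := add_lt_top.2 ⟨hfg.trans ENNReal.one_lt_top, h.besov_lt_top_of_finite s hg⟩

lemma MemC.of_approx (h : Cutoff) (H : ∀ δ : 𝐄, 0 < δ → ∃ g, MemC ϕ s g ∧ 𝐁 s (f - g) < δ) : MemC ϕ
    s f := by
  intro δ hδ; obtain ⟨g, hg, h1⟩ := H (δ / 2) (ENNReal.half_pos hδ.ne')
  obtain ⟨k, hk, h2⟩ := hg (δ / 2) (ENNReal.half_pos hδ.ne')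
  refine ⟨k, hk, (h.besov_triangle s f g k).trans_lt ?_⟩
  calc _ < δ / 2 + δ / 2 := ENNReal.add_lt_add h1 h2
    _ = δ := ENNReal.add_halves δ

lemma MemC.map (h : Cutoff) {s s' : ℝ} {T : Dist → Dist} (hsub : ∀ f g, T (f - g) = T f - T g) (hfin
    : ∀ f, (support f).Finite → MemC ϕ s' (T f)) {C : 𝐄} (hCt : C ≠ ∞) (hC : ∀ f, 𝐁 s' (T f) ≤ C * 𝐁
    s f) (hf : MemC ϕ s f) : MemC ϕ s' (T f) := by
  refine MemC.of_approx h fun δ hδ => ?_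
  obtain ⟨g, hg, h1⟩ := hf (δ / (C + 1)) (ENNReal.div_pos hδ.ne' (by simp [hCt]))
  refine ⟨T g, hfin g hg, ?_⟩; rw [← hsub]; rcases eq_or_ne C 0 with h0 | h0
  · refine (hC _).trans_lt ?_; rw [h0, zero_mul]; exact hδ
  · calc _ ≤ C * 𝐁 s (f - g) := hC _
      _ < C * (δ / (C + 1)) := (ENNReal.mul_lt_mul_iff_right h0 hCt).2 h1
      _ ≤ (C + 1) * (δ / (C + 1)) := by gcongr; exact le_self_add
      _ ≤ δ := ENNReal.mul_div_le

lemma MemC.add (h : Cutoff) (hf : MemC ϕ s f) (hg : MemC ϕ s g) : MemC ϕ s (f + g) := by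
  intro δ hδ; obtain ⟨f', hf', h1⟩ := hf (δ / 2) (ENNReal.half_pos hδ.ne')
  obtain ⟨g', hg', h2⟩ := hg (δ / 2) (ENNReal.half_pos hδ.ne')
  refine ⟨f' + g', support_add_finite hf' hg', ?_⟩; rw [add_sub_add_comm]
  refine (h.besov_add_le s _ _).trans_lt ?_
  calc _ < δ / 2 + δ / 2 := ENNReal.add_lt_add h1 h2
    _ = δ := ENNReal.add_halves δ

lemma MemC.smul (h : IsDyadicCutoff ϕ) (c : ℂ) (hf : MemC ϕ s f) : MemC ϕ s (c • f) :=
  MemC.map h (T := fun f => c • f) (fun f g => smul_sub c f g)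
    (fun _ hf => MemC.of_finite ϕ s (support_mul_finite (fun _ => c) hf))
    (C := ‖c‖ₑ) enorm_ne_top (fun f => (besov_smul ϕ s c f).le) hf

lemma MemC.neg (h : Cutoff) (hf : MemC ϕ s f) :
    MemC ϕ s (-f) := by rw [← neg_one_smul ℂ]; exact hf.smul h _

lemma MemC.sub (h : Cutoff) (hf : MemC ϕ s f) (hg : MemC ϕ s g) : MemC ϕ s (f - g) := by
  rw [sub_eq_add_neg]; exact hf.add h (hg.neg h)

lemma MemC.sum (h : Cutoff) {ι : Type*} (S : Finset ι) {f : ι → Dist} (hf : ∀ i ∈ S, MemC ϕ s (f i))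
    : MemC ϕ s (∑ i ∈ S, f i) := by
  classical
  induction S using Finset.induction_on with
  | empty => simpa using MemC.zero ϕ s
  | insert a S ha ih =>
    rw [sum_insert ha]; exact (hf a (by simp)).add h (ih fun i hi => hf i (by simp [hi]))

lemma MemC.mono {s s' : ℝ} (hs : s' ≤ s) (hf : MemC ϕ s f) : MemC ϕ s' f := by
  intro δ hδ; obtain ⟨g, hg, h1⟩ := hf δ hδ; exact ⟨g, hg, (besov_mono ϕ hs _).trans_lt h1⟩

lemma MemC.conjD (h : Cutoff) (hf : MemC ϕ s f) : MemC ϕ s (conjD f) := by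
  obtain ⟨C, hC⟩ := h.exists_besov_conjD_le s
  exact MemC.map h conjD_sub (fun f hf => MemC.of_finite ϕ s (support_conjD_finite hf))
    (C := C) coe_ne_top hC hf

lemma tendsto_two_rpow_neg {η : ℝ} (hη : η < 0) (C : 𝐄) (hC : C ≠ ∞) : Tendsto (fun J : ℕ => C *
    ofReal (2 ^ (((J : ℝ) - 1) * η))) atTop (𝓝 0) := by
  have h1 : Tendsto (fun J : ℕ => (2 : ℝ) ^ (((J : ℝ) - 1) * η)) atTop (𝓝 0) := by
    have : ∀ J : ℕ, (2 : ℝ) ^ (((J : ℝ) - 1) * η) = 2 ^ (-η) * ((2 : ℝ) ^ η) ^ J := by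
      intro J; rw [← rpow_natCast, ← rpow_mul two_pos.le, ← rpow_add two_pos]; congr 1; ring
    simp_rw [this]; simpa using (tendsto_pow_atTop_nhds_zero_of_lt_one (by positivity)
      (Real.rpow_lt_one_of_one_lt_of_neg one_lt_two hη)).const_mul ((2 : ℝ) ^ (-η))
  have h2 := ENNReal.tendsto_ofReal h1; rw [ENNReal.ofReal_zero] at h2
  simpa using ENNReal.Tendsto.const_mul h2 (Or.inr hC)

lemma MemC.of_besov_lt_top (h : Cutoff) {s s' : ℝ} (hs : s' < s) (hf : 𝐁 s f < ∞) : MemC ϕ s' f :=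
    by
  obtain ⟨C, hC⟩ := h.exists_besov_sub_lp_le; intro δ hδ
  have h1 := tendsto_two_rpow_neg (sub_neg.2 hs) (C * 𝐁 s f)
    (mul_ne_top coe_ne_top hf.ne)
  obtain ⟨J, hJ⟩ := (h1.eventually (gt_mem_nhds hδ)).exists
  refine ⟨lp ϕ J f, h.support_lp_finite J f, (hC s s' hs.le J f).trans_lt ?_⟩
  rwa [mul_right_comm]

lemma IsDyadicCutoff.besov_le_sum (h : Cutoff) (s : ℝ) (S : Finset ℤ²) (hf : support f ⊆ S) : 𝐁 s f
    ≤ ∑ n ∈ S, ‖f n‖ₑ * 𝐁 s (Pi.single n 1) := by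
  have : f = ∑ n ∈ S, f n • (Pi.single n 1 : Dist) := by
    ext m
    simp only [Finset.sum_apply, Pi.smul_apply, Pi.single_apply, smul_eq_mul, mul_ite, mul_one,
      mul_zero, Finset.sum_ite_eq]
    split_ifs with hm
    · rfl
    · by_contra h0; exact hm (hf h0)
  conv_lhs => rw [this]
  refine (h.besov_sum_le s S _).trans (sum_le_sum fun n _ => ?_); rw [besov_smul]

/-- Convergence of the coefficients within a fixed finite set of frequencies. -/
lemma IsDyadicCutoff.tendsto_besov_of_finite (h : Cutoff) (s : ℝ) (S : Finset ℤ²) {α : Type*} {l :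
    Filter α} {F : α → Dist} (hS : ∀ k, support (F k) ⊆ S) (hF : ∀ n ∈ S, Tendsto (fun k => F k n) l
    (𝓝 0)) : Tendsto (fun k => 𝐁 s (F k)) l (𝓝 0) := by
  refine tendsto_of_tendsto_of_tendsto_of_le_of_le tendsto_const_nhds ?_
    (fun _ => zero_le) fun k => h.besov_le_sum s S (hS k)
  have : (0 : 𝐄) = ∑ n ∈ S, 0 * 𝐁 s (Pi.single n 1) := by simp
  rw [this]; refine tendsto_finsetSum _ fun n hn => ENNReal.Tendsto.mul_const ?_
    (Or.inr (h.besov_lt_top_of_finite s ?_).ne)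
  · simpa using (hF n hn).enorm
  · exact (Set.finite_singleton n).subset (by simp)

lemma IsDyadicCutoff.tendsto_besov_of_bdd (h : IsDyadicCutoff ϕ) {s s' : ℝ} (hs : s' < s) {α :
    Type*} {l : Filter α} {F : α → Dist} (hF : ∀ n, Tendsto (fun k => F k n) l (𝓝 0)) {B : 𝐄} (hBt :
    B ≠ ∞) (hB : ∀ᶠ k in l, besovNorm ϕ s (F k) ≤ B) : Tendsto (fun k => besovNorm ϕ s' (F k)) l (𝓝
    0) := by
  obtain ⟨C, hC⟩ := h.exists_besov_sub_lp_le; rw [tendsto_nhds_zero]; intro δ hδ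
  have h1 := tendsto_two_rpow_neg (sub_neg.2 hs) (C * B) (mul_ne_top coe_ne_top hBt)
  obtain ⟨J, hJ⟩ := (h1.eventually (gt_mem_nhds (ENNReal.half_pos hδ.ne'))).exists
  have h2 := h.tendsto_besov_of_finite s' (finite_norm_freq_le (8 / 5 * 2 ^ J)).toFinset
    (F := fun k => lp ϕ J (F k)) (l := l) (fun k => by
      rw [Set.Finite.coe_toFinset]; exact h.support_lp_subset J (F k)) (fun n _ => by
      simpa [lp] using (hF n).const_mul (ϕ (((2 : ℝ) ^ J)⁻¹ • freq n) : ℂ))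
  rw [tendsto_nhds_zero] at h2
  filter_upwards [hB, h2 (δ / 2) (ENNReal.half_pos hδ.ne')] with k hk1 hk2
  calc besovNorm ϕ s' (F k) = besovNorm ϕ s' (lp ϕ J (F k) + (F k - lp ϕ J (F k))) := by
        congr 1; abel
    _ ≤ _ := h.besov_add_le s' _ _
    _ ≤ δ / 2 + δ / 2 := by
        refine add_le_add hk2 (le_trans ?_ hJ.le); refine (hC s s' hs.le J (F k)).trans ?_
        rw [mul_right_comm]; gcongr
    _ = δ := ENNReal.add_halves δ

lemma contC_of_bdd (h : Cutoff) {s s' : ℝ} (hs : s' < s) {I : Set ℝ} (hv : ∀ n, ContinuousOn (fun t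
    => v t n) I) (hB : ∀ t ∈ I, ∃ B : 𝐄, B ≠ ∞ ∧ ∀ᶠ τ in 𝓝[I] t, 𝐁 s (v τ) ≤ B) : ContC ϕ s' I v :=
    by
  intro t ht; obtain ⟨B, hBt, hB'⟩ := hB t ht; have h0 : 𝐁 s (v t) ≤ B := hB'.self_of_nhdsWithin ht
  refine ⟨MemC.of_besov_lt_top h hs (h0.trans_lt hBt.lt_top), ?_⟩
  refine h.tendsto_besov_of_bdd hs (B := B + B) (fun n => ?_) (by simp [hBt])
    (hB'.mono fun τ hτ => (h.besov_sub_le s _ _).trans (add_le_add hτ h0))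
  have := Tendsto.sub_const (hv n t ht) (v t n); simpa using this

lemma ContC.add (h : Cutoff) {I : Set ℝ} {v w : ℝ → Dist} (hv : ContC ϕ s I v) (hw : ContC ϕ s I w)
    : ContC ϕ s I (fun t => v t + w t) := by
  intro t ht; refine ⟨(hv t ht).1.add h (hw t ht).1, ?_⟩
  have := (hv t ht).2.add (hw t ht).2; rw [add_zero] at this
  refine tendsto_of_tendsto_of_tendsto_of_le_of_le tendsto_const_nhds this
    (fun _ => zero_le) fun τ => ?_
  simp only [add_sub_add_comm]; exact h.besov_add_le s _ _

lemma ContC.mono_set {I J : Set ℝ} (hIJ : I ⊆ J) (hv : ContC ϕ s J v) :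
    ContC ϕ s I v := fun t ht =>
  ⟨(hv t (hIJ ht)).1, (hv t (hIJ ht)).2.mono_left (nhdsWithin_mono t hIJ)⟩

lemma ContC.continuousOn_coeff (h : Cutoff) {I : Set ℝ} (hv : ContC ϕ s I v) (n : ℤ²) : ContinuousOn
    (fun t => v t n) I := by
  obtain ⟨C, hC⟩ := h.exists_coeff_le s n; intro t ht
  rw [ContinuousWithinAt, tendsto_iff_edist_tendsto_0]
  have := ENNReal.Tendsto.const_mul (hv t ht).2 (Or.inr (coe_ne_top (r := C)))
  rw [mul_zero] at this; refine tendsto_of_tendsto_of_tendsto_of_le_of_le tendsto_const_nhds this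
    (fun _ => zero_le) fun τ => ?_
  rw [edist_eq_enorm_sub]; exact hC (v τ - v t)

lemma ContC.continuousOn_besov (h : Cutoff) {I : Set ℝ} (hv : ContC ϕ s I v) : ContinuousOn (fun t
    => (𝐁 s (v t)).toReal) I := by
  intro t ht; rw [ContinuousWithinAt, tendsto_iff_dist_tendsto_zero]
  have h1 := (ENNReal.tendsto_toReal ENNReal.zero_ne_top).comp (hv t ht).2
  rw [ENNReal.toReal_zero] at h1; refine squeeze_zero' (.of_forall fun _ => dist_nonneg) ?_ h1
  filter_upwards [self_mem_nhdsWithin] with τ hτ; have fτ := (hv τ hτ).1.lt_top h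
  have ft := (hv t ht).1.lt_top h; have fd := ((hv τ hτ).1.sub h (hv t ht).1).lt_top h
  rw [Real.dist_eq, abs_sub_le_iff]; constructor
  · rw [sub_le_iff_le_add, comp_apply, ← ENNReal.toReal_add fd.ne ft.ne]
    refine toReal_mono (add_ne_top.2 ⟨fd.ne, ft.ne⟩) ?_
    simpa using h.besov_add_le s (v τ - v t) (v t)
  · rw [sub_le_iff_le_add, comp_apply, ← ENNReal.toReal_add fd.ne fτ.ne]
    refine toReal_mono (add_ne_top.2 ⟨fd.ne, fτ.ne⟩) ?_; rw [besov_sub_comm]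
    simpa using h.besov_add_le s (v t - v τ) (v τ)

/-! ### Products -/

lemma IsDyadicCutoff.norm_lt_of_dyadic_ne_zero (h : Cutoff) {j : ℕ} {ξ : E2} (hξ : dyadic ϕ j ξ ≠ 0)
    : ‖ξ‖ < 8 / 5 * 2 ^ j := by
  by_contra hc
  exact hξ (h.dyadic_eq_zero_of_le j (not_lt.1 hc))

lemma IsDyadicCutoff.lt_norm_of_dyadic_ne_zero (h : Cutoff) {j : ℕ} (hj : j ≠ 0) {ξ : E2} (hξ :
    dyadic ϕ j ξ ≠ 0) : 5 / 16 * 2 ^ j < ‖ξ‖ := by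
  obtain ⟨i, rfl⟩ := Nat.exists_eq_succ_of_ne_zero hj; by_contra hc
  refine hξ (h.dyadic_succ_eq_zero_of_ge i ?_); rw [Nat.succ_eq_add_one, pow_succ] at hc
  push Not at hc
  linarith

lemma IsDyadicCutoff.not_of_norm_le (h : Cutoff) {a b c : ℕ} {ξ η ζ : E2} (hξ : dyadic ϕ a ξ ≠ 0)
    (hη : dyadic ϕ b η ≠ 0) (hζ : dyadic ϕ c ζ ≠ 0) (hn : ‖ξ‖ ≤ ‖η‖ + ‖ζ‖) (hb : b + 4 ≤ a) (hc : c
    + 4 ≤ a) : False := by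
  have h1 := h.lt_norm_of_dyadic_ne_zero (by omega) hξ; have h2 := h.norm_lt_of_dyadic_ne_zero hη
  have h3 := h.norm_lt_of_dyadic_ne_zero hζ; have e1 : (2:ℝ) ^ b * 16 ≤ 2 ^ a := by
    have := pow_le_pow_right₀ (by norm_num : (1:ℝ) ≤ 2) hb
    rw [pow_add] at this; norm_num at this; exact this
  have e2 : (2:ℝ) ^ c * 16 ≤ 2 ^ a := by
    have := pow_le_pow_right₀ (by norm_num : (1:ℝ) ≤ 2) hc
    rw [pow_add] at this; norm_num at this; exact this
  nlinarith [pow_pos (two_pos : (0:ℝ) < 2) a]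

lemma prod_ne_zero (hn : prod f g n ≠ 0) : ∃ k, f (n - k) ≠ 0 ∧ g k ≠ 0 := by
  by_contra hc
  push Not at hc
  refine hn ?_; rw [prod]; convert tsum_zero with k; by_cases hk : f (n - k) = 0
  · simp [hk]
  · simp [hc k hk]

lemma IsDyadicCutoff.bl_prod_eq_zero (h : Cutoff) {j k l : ℕ} (H : k + 4 ≤ j ∧ l + 4 ≤ j ∨ k + 4 ≤ l
    ∧ j + 4 ≤ l) (f g : Dist) : bl ϕ j (prod (bl ϕ k f) (bl ϕ l g)) = 0 := by
  ext n; by_contra hn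
  obtain ⟨h1, h2⟩ := mul_ne_zero_iff.1 hn; obtain ⟨m, h3, h4⟩ := prod_ne_zero h2
  have e1 : dyadic ϕ j (freq n) ≠ 0 := by exact_mod_cast h1
  have e2 : dyadic ϕ k (freq (n - m)) ≠ 0 := by exact_mod_cast left_ne_zero_of_mul h3
  have e3 : dyadic ϕ l (freq m) ≠ 0 := by exact_mod_cast left_ne_zero_of_mul h4
  have e : freq n = freq (n - m) + freq m := by rw [← freq_add, sub_add_cancel]
  rcases H with H | H
  · exact h.not_of_norm_le e1 e2 e3 (e ▸ norm_add_le _ _) H.1 H.2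
  · refine h.not_of_norm_le e3 e2 e1 ?_ H.1 H.2; rw [add_comm, ← sub_eq_of_eq_add' e]
    exact norm_sub_le _ _

lemma summable_prod_of_finite_left (hf : (support f).Finite) (n : ℤ²) : Summable fun k => f (n - k)
    * g k := by
  refine summable_of_hasFiniteSupport ((hf.preimage (f := fun k => n - k)
    sub_right_injective.injOn).subset fun k hk => ?_)
  exact left_ne_zero_of_mul (mem_support.1 hk)

lemma prod_sum_left {ι : Type*} (S : Finset ι) (f : ι → Dist) (g : Dist) (hs : ∀ i ∈ S, ∀ n,
    Summable fun k => f i (n - k) * g k) : prod (∑ i ∈ S, f i) g = ∑ i ∈ S, prod (f i) g := by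
  ext n; simp only [prod, Finset.sum_apply, sum_mul]
  exact Summable.tsum_finsetSum fun i hi => hs i hi n

lemma prod_sum_right {ι : Type*} (S : Finset ι) (f : Dist) (g : ι → Dist) (hs : ∀ i ∈ S, ∀ n,
    Summable fun k => f (n - k) * g i k) : prod f (∑ i ∈ S, g i) = ∑ i ∈ S, prod f (g i) := by
  ext n; simp only [prod, Finset.sum_apply, mul_sum]
  exact Summable.tsum_finsetSum fun i hi => hs i hi n

lemma IsDyadicCutoff.exists_eq_sum_bl (h : Cutoff) (n : ℤ²) : ∃ J, ∀ f, ∀ I > J, f n = (∑ i ∈ range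
    I, bl ϕ i f) n := by
  obtain ⟨J, hJ⟩ := h.exists_sum_dyadic_eq_one ‖freq n‖; refine ⟨J, fun f I hI => ?_⟩
  obtain ⟨i, rfl⟩ := Nat.exists_eq_succ_of_ne_zero (Nat.ne_zero_of_lt hI)
  simp only [bl, Finset.sum_apply]
  rw [← sum_mul, ← ofReal_sum, hJ i (Nat.lt_succ_iff.1 hI) _ le_rfl]; simp

def geo (r : ℝ) : 𝐄 := ∑' i : ℕ, dy(-((i : ℝ) * r))

lemma geo_lt_top (hr : 0 < r) : geo r < ∞ := by
  have h1 : ∀ i : ℕ, dy(-((i : ℝ) * r)) = (dy(-r)) ^ i := by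
    intro i; rw [← ofReal_pow (by positivity), ← rpow_natCast, ← rpow_mul two_pos.le]; congr 2; ring
  simp_rw [geo, h1, ENNReal.tsum_geometric]
  rw [ENNReal.inv_lt_top, tsub_pos_iff_lt, ENNReal.ofReal_lt_one]
  exact Real.rpow_lt_one_of_one_lt_of_neg one_lt_two (by linarith)

lemma sum_comp_le_geo (r : ℝ) {S : Finset ℕ} {d : ℕ → ℕ} (hd : Set.InjOn d S) : ∑ i ∈ S, dy(-((d i :
    ℝ) * r)) ≤ geo r := by
  rw [← Finset.sum_image (f := fun i : ℕ => dy(-((i : ℝ) * r))) hd]; exact sum_le_tsum _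

/-! ### Absolute convergence of products -/

lemma tsum_mul_bl_le (h : Cutoff) (i j : ℕ) (f g : Dist) (n : ℤ²) : ∑' k, ‖bl ϕ i f (n - k)‖ₑ * ‖bl
    ϕ j g k‖ₑ ≤ supN (bl ϕ i f) * supN (bl ϕ j g) := by
  have hf := h.support_bl_finite i f; have hg := h.support_bl_finite j g
  rw [tsum_eq_sum (s := hg.toFinset) fun k hk => by
    have : bl ϕ j g k = 0 := by simpa using hk
    simp [this]]
  have := ENNReal.inner_le_Lp_mul_Lq hg.toFinset (fun k => ‖bl ϕ i f (n - k)‖ₑ)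
    (fun k => ‖bl ϕ j g k‖ₑ) (Real.HolderConjugate.two_two)
  refine this.trans ?_; have key : ∀ (u : Dist), (support u).Finite → ∀ S : Finset ℤ²,
      (∑ k ∈ S, ‖u k‖ₑ ^ (2 : ℝ)) ^ (1 / 2 : ℝ) ≤ supN u := by
    intro u hu S; have h1 := sum_enorm_sq_le_supN hu S
    calc (∑ k ∈ S, ‖u k‖ₑ ^ (2 : ℝ)) ^ (1 / 2 : ℝ) ≤ (supN u ^ 2) ^ (1 / 2 : ℝ) := by
          gcongr; simpa using h1
      _ = supN u := by rw [← ENNReal.rpow_natCast, ← ENNReal.rpow_mul]; norm_num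
  refine mul_le_mul' ?_ (key _ hg _)
  have := key _ hf (hg.toFinset.image fun k => n - k)
  rwa [Finset.sum_image (fun a _ b _ hab => sub_right_injective hab)] at this

lemma IsDyadicCutoff.enorm_le_tsum_bl (h : Cutoff) (f : Dist) (n : ℤ²) : ‖f n‖ₑ ≤ ∑' j, ‖bl ϕ j f
    n‖ₑ := by
  obtain ⟨J, hJ⟩ := h.exists_eq_sum_bl n; rw [hJ f (J + 1) J.lt_succ_self, Finset.sum_apply]
  exact (enorm_sum_le _ _).trans (sum_le_tsum _)

lemma IsDyadicCutoff.exists_tsum_bl_prod_le (h : Cutoff) (hrs : 0 < r + s) (n : ℤ²) : ∃ C : ℝ≥0, ∀ f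
    g : Dist, ∑' k, (∑' i, ‖bl ϕ i f (n - k)‖ₑ) * ∑' j, ‖bl ϕ j g k‖ₑ ≤ C * (𝐁 r f * 𝐁 s g) := by
  obtain ⟨c, hc⟩ := pow_unbounded_of_one_lt (16 / 5 * (‖freq n‖ + 8 / 5)) (by norm_num : (1:ℝ) < 2)
  have hgt := geo_lt_top (r := (r + s) / 2) (by linarith)
  set K : 𝐄 := ofReal (2 ^ ((c : ℝ) * |r - s| / 2)) * (geo ((r + s) / 2) *
    geo ((r + s) / 2)) with hK
  have hKt : K < ∞ := mul_lt_top ofReal_lt_top (mul_lt_top hgt hgt)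
  refine ⟨K.toNNReal, fun f g => ?_⟩; rw [coe_toNNReal hKt.ne]; set M := 𝐁 r f * 𝐁 s g with hM
  have near : ∀ {i j : ℕ} {a b : E2}, dyadic ϕ i a ≠ 0 → dyadic ϕ j b ≠ 0 →
      ‖a‖ ≤ ‖freq n‖ + ‖b‖ → i ≤ j + c := by
    intro i j a b ha hb hab; by_contra hcon
    have h1 := h.lt_norm_of_dyadic_ne_zero (by omega) ha; have h2 := h.norm_lt_of_dyadic_ne_zero hb
    have h3 : (2:ℝ) ^ (j + c) ≤ 2 ^ i := pow_le_pow_right₀ (by norm_num) (by omega)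
    rw [pow_add] at h3; have h4 : (1:ℝ) ≤ 2 ^ j := one_le_pow₀ (by norm_num)
    nlinarith [norm_nonneg (freq n)]
  have h1 : ∀ i j, ∑' k, ‖bl ϕ i f (n - k)‖ₑ * ‖bl ϕ j g k‖ₑ ≤
      ofReal (2 ^ ((c : ℝ) * |r - s| / 2)) * M * (dy(-((i : ℝ) * ((r + s) / 2))) *
        dy(-((j : ℝ) * ((r + s) / 2)))) := by
    intro i j; by_cases hij : i ≤ j + c ∧ j ≤ i + c
    · refine (tsum_mul_bl_le h i j f g n).trans ?_
      refine (mul_le_mul' (supN_bl_le_besov ϕ r f i) (supN_bl_le_besov ϕ s g j)).trans ?_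
      have : dy(-((i : ℝ) * r)) * dy(-((j : ℝ) * s))
          ≤ ofReal (2 ^ ((c : ℝ) * |r - s| / 2)) * (dy(-((i : ℝ) * ((r + s) / 2))) *
            dy(-((j : ℝ) * ((r + s) / 2)))) := by
        rw [ofReal_two_rpow_mul, ofReal_two_rpow_mul, ofReal_two_rpow_mul]
        refine ofReal_le_ofReal (rpow_le_rpow_of_exponent_le one_le_two ?_)
        have ha : (i : ℝ) ≤ j + c := by exact_mod_cast hij.1
        have hb : (j : ℝ) ≤ i + c := by exact_mod_cast hij.2
        have : -(((i : ℝ) - j) * (r - s)) ≤ c * |r - s| := by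
          refine (neg_le_abs _).trans ?_; rw [abs_mul]
          refine mul_le_mul_of_nonneg_right ?_ (abs_nonneg _); rw [abs_le]; constructor <;> linarith
        linarith
      calc _ = (dy(-((i : ℝ) * r)) * dy(-((j : ℝ) * s))) * M := by rw [hM]; ring
        _ ≤ _ := mul_le_mul_left this _
        _ = _ := by ring
    · refine le_trans (le_of_eq ?_) zero_le; rw [ENNReal.tsum_eq_zero]; intro k; by_contra hne
      obtain ⟨e1, e2⟩ := mul_ne_zero_iff.1 hne; rw [enorm_ne_zero] at e1 e2
      have e1' : dyadic ϕ i (freq (n - k)) ≠ 0 := by exact_mod_cast left_ne_zero_of_mul e1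
      have e2' : dyadic ϕ j (freq k) ≠ 0 := by exact_mod_cast left_ne_zero_of_mul e2
      refine hij ⟨near e1' e2' ?_, near e2' e1' ?_⟩
      · rw [freq_sub]; exact norm_sub_le _ _
      · have : freq k = freq n - freq (n - k) := by rw [← freq_sub]; congr 1; abel
        rw [this]; exact norm_sub_le _ _
  calc _ = ∑' i, ∑' j, ∑' k, ‖bl ϕ i f (n - k)‖ₑ * ‖bl ϕ j g k‖ₑ := by
        simp_rw [← ENNReal.tsum_mul_right, ← ENNReal.tsum_mul_left]; rw [ENNReal.tsum_comm]
        congr 1; ext i; rw [ENNReal.tsum_comm]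
    _ ≤ ∑' i : ℕ, ∑' j : ℕ, ofReal (2 ^ ((c : ℝ) * |r - s| / 2)) * M *
        (dy(-((i : ℝ) * ((r + s) / 2))) *
        dy(-((j : ℝ) * ((r + s) / 2)))) :=
        tsum_le_tsum fun i => tsum_le_tsum fun j => h1 i j
    _ = _ := by
        simp_rw [ENNReal.tsum_mul_left, ENNReal.tsum_mul_right]; rw [hK]; simp only [geo]; ring

/-! ### Bounds for products -/

lemma IsDyadicCutoff.exists_supN_bl_prod_le (h : Cutoff) {r s τ c : ℝ} (hτ : 0 < τ) (H : ∀ j k l :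
    ℕ, (j < k + 4 ∨ j < l + 4) → (l < k + 4 ∨ l < j + 4) → (j * s - k * r - l * s : ℝ) ≤ c - |(j :
    ℝ) - l| * τ - k * τ ∨ (j * s - k * r - l * s : ℝ) ≤ c - |(j : ℝ) - k| * τ - l * τ) : ∃ C : ℝ≥0,
    ∀ (j I : ℕ) (f g : Dist), dy((j : ℝ) * s) * supN (bl ϕ j (prod (∑ i ∈ range I, bl ϕ i f) (∑ i ∈
    range I, bl ϕ i g))) ≤ C * (𝐁 r f * 𝐁 s g) := by
  obtain ⟨C, hC⟩ := h.exists_supN_bl_le; set e : ℕ → 𝐄 := fun i => dy(-((i : ℝ) * τ)) with he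
  set K : 𝐄 := C * ofReal ((2 : ℝ) ^ c) with hK; have hg := (geo_lt_top hτ).ne
  refine ⟨(K * (geo τ * (2 * geo τ) + geo τ * (2 * geo τ))).toNNReal, fun j I f g => ?_⟩
  rw [coe_toNNReal (by finiteness)]; set M := 𝐁 r f * 𝐁 s g
  set d : ℕ → ℕ := fun l => (j - l) + (l - j) with hd
  have hde : ∀ l : ℕ, dy(-(|(j : ℝ) - l| * τ)) = e (d l) := fun l => by
    have : ((d l : ℕ) : ℝ) = |(j : ℝ) - l| := by
      rcases le_total j l with hl | hl
      · simp [hd, hl, abs_of_nonpos]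
      · simp [hd, hl, abs_of_nonneg]
    rw [he, ← this]
  have hsum : ∀ S : Finset ℕ, ∑ l ∈ S, e (d l) ≤ 2 * geo τ := fun S => by
    rw [← Finset.sum_filter_add_sum_filter_not S (· ≤ j), two_mul]
    refine add_le_add (sum_comp_le_geo τ ?_) (sum_comp_le_geo τ ?_) <;> intro a ha b hb hab <;>
      simp [hd] at ha hb hab <;> omega
  have term : ∀ k l, dy((j : ℝ) * s) * supN (bl ϕ j (prod (bl ϕ k f) (bl ϕ l g))) ≤
        K * M * (e k * e (d l) + e l * e (d k)) := fun k l => by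
    by_cases hz : k + 4 ≤ j ∧ l + 4 ≤ j ∨ k + 4 ≤ l ∧ j + 4 ≤ l
    · simp [h.bl_prod_eq_zero hz, supN_zero]
    have hW : dy((j : ℝ) * s - k * r - l * s) ≤
        ofReal ((2 : ℝ) ^ c) * (e k * e (d l) + e l * e (d k)) := by
      rw [← hde, ← hde, mul_add, he]; simp only [ofReal_two_rpow_mul]
      refine (H j k l (by omega) (by omega)).elim (fun H => le_add_right ?_)
        fun H => le_add_left ?_ <;>
      exact ofReal_le_ofReal (rpow_le_rpow_of_exponent_le one_le_two (by linarith))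
    have hf := h.support_bl_finite k f; have hg := h.support_bl_finite l g
    calc _ ≤ dy((j : ℝ) * s) * (C * ((dy(-((k : ℝ) * r)) * 𝐁 r f) *
          (dy(-((l : ℝ) * s)) * 𝐁 s g))) :=
          mul_le_mul_right ((hC j _ (support_prod_finite hf hg)).trans (mul_le_mul_right
            ((supN_prod_le hf hg).trans (mul_le_mul' (supN_bl_le_besov ϕ r f k)
            (supN_bl_le_besov ϕ s g l))) _)) _
      _ = C * M * (dy((j : ℝ) * s) * (dy(-((k : ℝ) * r)) * dy(-((l : ℝ) * s)))) := by ring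
      _ ≤ C * M * (ofReal ((2 : ℝ) ^ c) * (e k * e (d l) + e l * e (d k))) := by
          rw [ofReal_two_rpow_mul, ofReal_two_rpow_mul, ← add_assoc, ← sub_eq_add_neg,
            ← sub_eq_add_neg]
          exact mul_le_mul_right hW _
      _ = _ := by rw [hK]; ring
  have hbf := fun k => h.support_bl_finite k f
  have e1 : bl ϕ j (prod (∑ i ∈ range I, bl ϕ i f) (∑ i ∈ range I, bl ϕ i g)) =
      ∑ k ∈ range I, ∑ l ∈ range I, bl ϕ j (prod (bl ϕ k f) (bl ϕ l g)) := by
    rw [prod_sum_left _ _ _ fun k _ n => summable_prod_of_finite_left (hbf k) n, bl_sum]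
    refine sum_congr rfl fun k _ => ?_
    rw [prod_sum_right _ _ _ fun l _ n => summable_prod_of_finite_left (hbf k) n, bl_sum]
  rw [e1]
  calc _ ≤ dy((j : ℝ) * s) * ∑ k ∈ range I, ∑ l ∈ range I,
        supN (bl ϕ j (prod (bl ϕ k f) (bl ϕ l g))) :=
        mul_le_mul_right ((supN_sum_le _ fun k _ => support_sum_finite _ fun l _ =>
          h.support_bl_finite _ _).trans (sum_le_sum fun k _ => supN_sum_le _ fun l _ =>
          h.support_bl_finite _ _)) _
    _ ≤ ∑ k ∈ range I, ∑ l ∈ range I, K * M * (e k * e (d l) + e l * e (d k)) := by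
        simp only [mul_sum]; exact sum_le_sum fun k _ => sum_le_sum fun l _ => term k l
    _ = K * M * ((∑ k ∈ range I, e k) * (∑ l ∈ range I, e (d l)) +
        (∑ l ∈ range I, e l) * (∑ k ∈ range I, e (d k))) := by
        simp only [← mul_sum, sum_add_distrib, ← sum_mul]
    _ ≤ K * M * (geo τ * (2 * geo τ) + geo τ * (2 * geo τ)) := by
        have := sum_le_tsum (f := e) (range I); gcongr <;> first | exact this | exact hsum _
    _ = _ := by ring

lemma IsDyadicCutoff.exists_supN_bl_prod_le_of_neg (h : Cutoff) (hs : s < 0) (hrs : 0 < r + s) : ∃ C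
    : ℝ≥0, ∀ (j I : ℕ) (f g : Dist), dy((j : ℝ) * s) * supN (bl ϕ j (prod (∑ i ∈ range I, bl ϕ i f)
    (∑ i ∈ range I, bl ϕ i g))) ≤ C * (𝐁 r f * 𝐁 s g) := by
  obtain ⟨τ, h0, h1, h2⟩ : ∃ τ, 0 < τ ∧ τ ≤ -s ∧ 2 * τ ≤ r + s :=
    ⟨min (-s) ((r + s) / 2), by simp [hs, hrs], min_le_left _ _,
      by linarith [min_le_right (-s) ((r + s) / 2)]⟩
  refine h.exists_supN_bl_prod_le (c := -3 * s + 3 * τ) h0 fun j k l _ hh => Or.inl ?_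
  have hj := cast_nonneg (α := ℝ) j; have hk := cast_nonneg (α := ℝ) k
  have e1 := mul_nonneg hk (by linarith : 0 ≤ r + s - 2 * τ)
  have e2 := mul_nonneg hk (by linarith : 0 ≤ -s - τ); have e3 := mul_nonneg hk h0.le
  rcases le_or_gt l j with hl | hl
  · have hl' : (l : ℝ) ≤ j := by exact_mod_cast hl
    rw [abs_of_nonneg (by linarith)]
    nlinarith [mul_nonneg (sub_nonneg.2 hl') (by linarith : 0 ≤ -s - τ)]
  · have hl' : (j : ℝ) ≤ l := by exact_mod_cast hl.le
    rw [abs_of_nonpos (by linarith)]; rcases hh with hh | hh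
    · have hh' : (l : ℝ) ≤ k + 3 := by exact_mod_cast Nat.lt_succ_iff.1 hh
      nlinarith [mul_nonneg (by linarith : (0 : ℝ) ≤ k + 3 - l) (by linarith : 0 ≤ -s + τ),
        mul_nonneg hj (by linarith : 0 ≤ -s + τ)]
    · have hh' : (l : ℝ) ≤ j + 3 := by exact_mod_cast Nat.lt_succ_iff.1 hh
      nlinarith [mul_nonneg (by linarith : (0 : ℝ) ≤ j + 3 - l) (by linarith : 0 ≤ -s + τ)]

lemma IsDyadicCutoff.exists_supN_bl_prod_le_of_pos (h : Cutoff) (hr : 0 < r) : ∃ C : ℝ≥0, ∀ (j I :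
    ℕ) (f g : Dist), dy((j : ℝ) * r) * supN (bl ϕ j (prod (∑ i ∈ range I, bl ϕ i f) (∑ i ∈ range I,
    bl ϕ i g))) ≤ C * (𝐁 r f * 𝐁 r g) := by
  refine h.exists_supN_bl_prod_le (c := 6 * r) hr fun j k l hh _ => ?_
  have key : ∀ i : ℕ, j < i + 4 → 0 ≤ (6 - |(j : ℝ) - i| - (j - i)) * r := fun i hi => by
    have hi' : (j : ℝ) ≤ i + 3 := by exact_mod_cast Nat.lt_succ_iff.1 hi
    refine mul_nonneg ?_ hr.le; rcases abs_cases ((j : ℝ) - i) with e | e <;> linarith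
  exact hh.elim (fun hh => Or.inr (by linarith [key k hh])) fun hh => Or.inl (by linarith [key l hh])

lemma prod_comm (f g : Dist) : prod f g = prod g f := by
  ext n; rw [prod, prod, ← (Equiv.subLeft n).tsum_eq]; congr 1; ext k; simp [mul_comm]

lemma zero_prod (f : Dist) : prod 0 f = 0 := by ext n; simp [prod]

section Regular

variable (h : IsDyadicCutoff ϕ) {r s : ℝ} (hrs : 0 < r + s)
include h hrs

lemma tsum_enorm_prod_lt_top (hf : 𝐁 r f < ∞) (hg : 𝐁 s g < ∞) (n : ℤ²) : ∑' k, (∑' i, ‖bl ϕ i f (n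
    - k)‖ₑ) * ∑' j, ‖bl ϕ j g k‖ₑ < ∞ := by
  obtain ⟨C, hC⟩ := h.exists_tsum_bl_prod_le hrs n; exact (hC f g).trans_lt (by finiteness)

lemma summable_prod (hf : 𝐁 r f < ∞) (hg : 𝐁 s g < ∞) (n : ℤ²) : Summable fun k => f (n - k) * g k
    := by
  have h1 : ∑' k, ‖f (n - k) * g k‖ₑ < ∞ := by
    simp_rw [enorm_mul]; exact (tsum_le_tsum fun k => mul_le_mul' (h.enorm_le_tsum_bl f _)
      (h.enorm_le_tsum_bl g k)).trans_lt (tsum_enorm_prod_lt_top h hrs hf hg n)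
  refine Summable.of_norm ?_
  have := ENNReal.summable_toReal h1.ne; simpa using this

lemma prod_sub_prod {f f' g g' : Dist} (hf : 𝐁 r f < ∞) (hf' : 𝐁 r f' < ∞) (hg : 𝐁 s g < ∞) (hg' : 𝐁
    s g' < ∞) : prod f g - prod f' g' = prod (f - f') g + prod f' (g - g') := by
  ext n; have h1 := summable_prod h hrs hf hg n; have h2 := summable_prod h hrs hf' hg n
  have h3 := summable_prod h hrs hf' hg' n
  simp only [prod, Pi.sub_apply, Pi.add_apply, sub_mul, mul_sub]
  rw [h1.tsum_sub h2, h2.tsum_sub h3]; ring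

lemma tendsto_prod_sum_bl (hf : 𝐁 r f < ∞) (hg : 𝐁 s g < ∞) (n : ℤ²) : Tendsto (fun I => prod (∑ i ∈
    range I, bl ϕ i f) (∑ i ∈ range I, bl ϕ i g) n) atTop (𝓝 (prod f g n)) := by
  have H := (tsum_enorm_prod_lt_top h hrs hf hg n).ne
  refine tendsto_tsum_of_dominated_convergence (ENNReal.summable_toReal H) (fun k => ?_)
    (.of_forall fun I k => ?_)
  · obtain ⟨J, hJ⟩ := h.exists_eq_sum_bl (n - k); obtain ⟨L, hL⟩ := h.exists_eq_sum_bl k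
    refine tendsto_const_nhds.congr' ?_
    filter_upwards [eventually_gt_atTop J, eventually_gt_atTop L] with I h1 h2
    rw [hJ f I h1, hL g I h2]
  · have key : ∀ (f : Dist) n, ‖(∑ i ∈ range I, bl ϕ i f) n‖ₑ ≤ ∑' i, ‖bl ϕ i f n‖ₑ :=
      fun f n => by rw [Finset.sum_apply]; exact (enorm_sum_le _ _).trans (sum_le_tsum _)
    rw [← toReal_enorm, enorm_mul]
    exact toReal_mono (ENNReal.ne_top_of_tsum_ne_top H k) (mul_le_mul' (key _ _) (key _ _))

lemma prod_bound {C : ℝ≥0} (hC : ∀ (j I : ℕ) (f g : Dist), dy((j : ℝ) * s) * supN (bl ϕ j (prod (∑ i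
    ∈ range I, bl ϕ i f) (∑ i ∈ range I, bl ϕ i g))) ≤ C * (𝐁 r f * 𝐁 s g)) (hf : MemC ϕ r f) (hg :
    MemC ϕ s g) : MemC ϕ s (prod f g) ∧ 𝐁 s (prod f g) ≤ C * (𝐁 r f * 𝐁 s g) := by
  have bound : ∀ {f g : Dist}, MemC ϕ r f → MemC ϕ s g →
      𝐁 s (prod f g) ≤ C * (𝐁 r f * 𝐁 s g) := fun {f g} hf hg =>
    h.besov_le_of_tendsto (l := atTop)
      (fun n => tendsto_prod_sum_bl h hrs (hf.lt_top h) (hg.lt_top h) n) tendsto_const_nhds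
      (.of_forall fun I => by
        rw [besovNorm_eq]; exact iSup_le fun j => hC j I f g)
  refine ⟨MemC.of_approx h fun δ hδ => ?_, bound hf hg⟩; have ft := hf.lt_top h
  have small : ∀ X : 𝐄, X ≠ ∞ → ∃ δ' > 0, C * (X * δ') < δ / 2 := fun X hX => by
    have h0 : Tendsto (fun δ' => C * (X * δ')) (𝓝 0) (𝓝 0) := by
      simpa using ENNReal.Tendsto.const_mul (ENNReal.Tendsto.const_mul (tendsto_id (x := 𝓝 0))
        (Or.inr hX)) (Or.inr (coe_ne_top (r := C)))
    obtain ⟨δ', h1, h2⟩ := (((h0.eventually_lt_const (ENNReal.half_pos hδ.ne')).filter_mono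
      (nhdsWithin_le_nhds (s := Ioi 0))).and self_mem_nhdsWithin).exists
    exact ⟨δ', h2, h1⟩
  obtain ⟨δ₁, h1, h1'⟩ := small _ (hg.lt_top h).ne; obtain ⟨F, hF, hF'⟩ := hf δ₁ h1
  have hFm := MemC.of_finite ϕ r hF; obtain ⟨δ₂, h2, h2'⟩ := small _ (hFm.lt_top h).ne
  obtain ⟨G, hG, hG'⟩ := hg δ₂ h2; have hGm := MemC.of_finite ϕ s hG
  refine ⟨prod F G, MemC.of_finite ϕ s (support_prod_finite hF hG), ?_⟩
  rw [prod_sub_prod h hrs ft (hFm.lt_top h) (hg.lt_top h) (hGm.lt_top h), ← ENNReal.add_halves δ]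
  refine (h.besov_add_le s _ _).trans_lt (ENNReal.add_lt_add
    (((bound (hf.sub h hFm) hg).trans ?_).trans_lt h1')
    (((bound hFm (hg.sub h hGm)).trans ?_).trans_lt h2'))
  · rw [mul_comm (𝐁 r _)]; gcongr
  · gcongr

lemma contC_prod {C : ℝ≥0} (hC : ∀ f g : Dist, MemC ϕ r f → MemC ϕ s g → MemC ϕ t (prod f g) ∧ 𝐁 t
    (prod f g) ≤ C * (𝐁 r f * 𝐁 s g)) {I : Set ℝ} {v w : ℝ → Dist} (hv : ContC ϕ r I v) (hw : ContC
    ϕ s I w) : ContC ϕ t I fun τ => prod (v τ) (w τ) := by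
  intro τ hτ; obtain ⟨v1, v2⟩ := hv τ hτ; obtain ⟨w1, w2⟩ := hw τ hτ; refine ⟨(hC _ _ v1 w1).1, ?_⟩
  have vt := v1.lt_top h; have wt := w1.lt_top h
  have lim : Tendsto (fun σ => C * (𝐁 r (v σ - v τ) * (𝐁 s (w τ) + 𝐁 s (w σ - w τ))) +
      C * (𝐁 r (v τ) * 𝐁 s (w σ - w τ))) (𝓝[I] τ) (𝓝 0) := by
    have a0 : Tendsto (fun σ => 𝐁 s (w τ) + 𝐁 s (w σ - w τ)) (𝓝[I] τ)
        (𝓝 (𝐁 s (w τ))) := by simpa using (tendsto_const_nhds (x := 𝐁 s (w τ))).add w2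
    have a1 := ENNReal.Tendsto.const_mul (ENNReal.Tendsto.mul v2 (Or.inr wt.ne) a0
      (Or.inr ENNReal.zero_ne_top)) (Or.inr (coe_ne_top (r := C)))
    have a2 := ENNReal.Tendsto.const_mul (ENNReal.Tendsto.const_mul w2 (Or.inr vt.ne))
      (Or.inr (coe_ne_top (r := C)))
    simpa using a1.add a2
  refine tendsto_of_tendsto_of_tendsto_of_le_of_le' tendsto_const_nhds lim
    (.of_forall fun _ => zero_le) ?_
  filter_upwards [self_mem_nhdsWithin] with σ hσ; obtain ⟨v3, -⟩ := hv σ hσ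
  obtain ⟨w3, -⟩ := hw σ hσ; rw [prod_sub_prod h hrs (v3.lt_top h) vt (w3.lt_top h) wt]
  refine (h.besov_add_le t _ _).trans (add_le_add ((hC _ _ (v3.sub h v1) w3).2.trans ?_)
    (hC _ _ v1 (w3.sub h w1)).2)
  gcongr
  have := h.besov_add_le s (w τ) (w σ - w τ)
  rwa [add_sub_cancel] at this

end Regular

lemma IsDyadicCutoff.exists_prod_neg (h : Cutoff) (hs : s < 0) (hrs : 0 < r + s) : ∃ C : ℝ≥0, ∀ f g
    : Dist, MemC ϕ s f → MemC ϕ r g → MemC ϕ s (prod f g) ∧ 𝐁 s (prod f g) ≤ C * (𝐁 s f * 𝐁 r g) :=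
    by
  obtain ⟨C, hC⟩ := h.exists_supN_bl_prod_le_of_neg hs hrs; refine ⟨C, fun f g hf hg => ?_⟩
  rw [prod_comm, mul_comm (𝐁 s f)]; exact prod_bound h hrs hC hg hf

/-- `C^r` is an algebra for `r > 0`. -/
lemma IsDyadicCutoff.exists_prod_pos (h : Cutoff) (hr : 0 < r) : ∃ C : ℝ≥0, ∀ f g : Dist, MemC ϕ r f
    → MemC ϕ r g → MemC ϕ r (prod f g) ∧ 𝐁 r (prod f g) ≤ C * (𝐁 r f * 𝐁 r g) := by
  obtain ⟨C, hC⟩ := h.exists_supN_bl_prod_le_of_pos hr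
  exact ⟨C, fun f g hf hg => prod_bound h (by linarith) hC hf hg⟩

/-! ### Polynomial maps -/

/-- Bounds of a polynomial map of degree `d` on `C^r`. -/
def PolyLike (ϕ : E2 → ℝ) (r : ℝ) (d : ℕ) (P : Dist → Dist) : Prop :=
  ∃ C : ℝ≥0, ∀ R : ℝ≥0, 1 ≤ R → ∀ v w : Dist, MemC ϕ r v → MemC ϕ r w →
    besovNorm ϕ r v ≤ R → besovNorm ϕ r w ≤ R →
    MemC ϕ r (P v) ∧ besovNorm ϕ r (P v) ≤ C * (R : 𝐄) ^ d ∧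
    besovNorm ϕ r (P v - P w) * R ≤ C * (R : 𝐄) ^ d * besovNorm ϕ r (v - w)

lemma PolyLike.id (ϕ : E2 → ℝ) (r : ℝ) : PolyLike ϕ r 1 fun v => v :=
  ⟨1, fun R _ v w hv _ hvR _ => ⟨hv, by simpa using hvR, by simp [mul_comm]⟩⟩

lemma PolyLike.conj (h : Cutoff) (r : ℝ) : PolyLike ϕ r 1 conjD := by
  obtain ⟨C, hC⟩ := h.exists_besov_conjD_le r
  refine ⟨C, fun R _ v w hv _ hvR _ => ⟨hv.conjD h, ?_, ?_⟩⟩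
  · rw [pow_one]; exact (hC v).trans (mul_le_mul_right hvR _)
  · rw [← conjD_sub, pow_one, mul_right_comm]; exact mul_le_mul_left (hC _) _

lemma PolyLike.one (h : Cutoff) (r : ℝ) : PolyLike ϕ r 0 fun _ => (Pi.single 0 1 : Dist) := by
  have hfin : (support (Pi.single 0 1 : Dist)).Finite :=
    (Set.finite_singleton 0).subset (by simp)
  refine ⟨(𝐁 r (Pi.single 0 1)).toNNReal, fun R _ v w _ _ _ _ =>
    ⟨MemC.of_finite ϕ r hfin, ?_, ?_⟩⟩
  · rw [coe_toNNReal (h.besov_lt_top_of_finite r hfin).ne]; simp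
  · simp [besov_zero]

lemma polyLike_prod (h : Cutoff) (hr : 0 < r) {d e : ℕ} {P Q : Dist → Dist} (hP : PolyLike ϕ r d P)
    (hQ : PolyLike ϕ r e Q) : PolyLike ϕ r (d + e) fun v => prod (P v) (Q v) := by
  obtain ⟨C, hC⟩ := h.exists_prod_pos hr; obtain ⟨A, hA⟩ := hP; obtain ⟨B, hB⟩ := hQ
  refine ⟨2 * C * A * B, fun R hR v w hv hw hvR hwR => ?_⟩
  obtain ⟨p1, p2, p3⟩ := hA R hR v w hv hw hvR hwR; obtain ⟨q1, q2, q3⟩ := hB R hR v w hv hw hvR hwR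
  obtain ⟨p1', p2', -⟩ := hA R hR w v hw hv hwR hvR; obtain ⟨q1', -, -⟩ := hB R hR w v hw hv hwR hvR
  refine ⟨(hC _ _ p1 q1).1, (hC _ _ p1 q1).2.trans ?_, ?_⟩
  · calc _ ≤ C * (A * (R : 𝐄) ^ d * (B * (R : 𝐄) ^ e)) := by gcongr
      _ = 1 * C * A * B * (R : 𝐄) ^ (d + e) := by rw [pow_add]; ring
      _ ≤ _ := by push_cast; gcongr; norm_num
  · rw [prod_sub_prod h (by linarith : 0 < r + r) (p1.lt_top h) (p1'.lt_top h) (q1.lt_top h)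
      (q1'.lt_top h)]
    calc _ ≤ (C * (𝐁 r (P v - P w) * 𝐁 r (Q v)) + C * (𝐁 r (P w) * 𝐁 r (Q v - Q w))) * R := by
          gcongr; exact (h.besov_add_le r _ _).trans (add_le_add (hC _ _ (p1.sub h p1') q1).2
            (hC _ _ p1' (q1.sub h q1')).2)
      _ = C * ((𝐁 r (P v - P w) * R) * 𝐁 r (Q v)) +
          C * (𝐁 r (P w) * (𝐁 r (Q v - Q w) * R)) := by ring
      _ ≤ C * ((A * (R : 𝐄) ^ d * 𝐁 r (v - w)) * (B * (R : 𝐄) ^ e)) +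
          C * ((A * (R : 𝐄) ^ d) * (B * (R : 𝐄) ^ e * 𝐁 r (v - w))) := by gcongr
      _ = _ := by push_cast; rw [pow_add]; ring

lemma polyLike_powD (h : Cutoff) (hr : 0 < r) {P : Dist → Dist} (hP : PolyLike ϕ r 1 P) (k : ℕ) :
    PolyLike ϕ r k fun v => powD (P v) k := by
  induction k with
  | zero => exact PolyLike.one h r
  | succ k ih =>
    have := polyLike_prod h hr hP ih; rw [add_comm] at this; exact this

/-- The monomial `v^i v̄^j`. -/
lemma polyLike_monomial (h : Cutoff) (hr : 0 < r) (i j : ℕ) : PolyLike ϕ r (i + j) fun v => prod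
    (powD v i) (powD (conjD v) j) :=
  polyLike_prod h hr (polyLike_powD h hr (PolyLike.id ϕ r) i)
    (polyLike_powD h hr (PolyLike.conj h r) j)

lemma PolyLike.contC (h : Cutoff) {d : ℕ} {P : Dist → Dist} (hP : PolyLike ϕ r d P) {I : Set ℝ} (hv
    : ContC ϕ r I v) : ContC ϕ r I fun t => P (v t) := by
  obtain ⟨C, hC⟩ := hP; intro t ht; obtain ⟨v1, v2⟩ := hv t ht; have vt := v1.lt_top h
  set R : ℝ≥0 := (𝐁 r (v t)).toNNReal + 1 with hR; have hR1 : 1 ≤ R := le_add_self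
  have hRe : (R : 𝐄) = 𝐁 r (v t) + 1 := by rw [hR, coe_add, coe_toNNReal vt.ne, ENNReal.coe_one]
  refine ⟨(hC R hR1 _ _ v1 v1 (by rw [hRe]; exact le_self_add)
    (by rw [hRe]; exact le_self_add)).1, ?_⟩
  have lim := ENNReal.Tendsto.const_mul v2 (Or.inr (show (C * (R : 𝐄) ^ d) ≠ ∞ from
    mul_ne_top coe_ne_top (pow_ne_top coe_ne_top)))
  rw [mul_zero] at lim; refine tendsto_of_tendsto_of_tendsto_of_le_of_le' tendsto_const_nhds lim
    (.of_forall fun _ => zero_le) ?_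
  rw [tendsto_nhds_zero] at v2; filter_upwards [v2 1 one_pos, self_mem_nhdsWithin] with τ hτ1 hτ
  have hτR : 𝐁 r (v τ) ≤ R := by
    have := h.besov_add_le r (v t) (v τ - v t); rw [add_sub_cancel] at this
    rw [hRe]; exact this.trans (add_le_add le_rfl hτ1)
  have := (hC R hR1 _ _ (hv τ hτ).1 v1 hτR (by rw [hRe]; exact le_self_add)).2.2
  refine le_trans ?_ this
  calc _ = 𝐁 r (P (v τ) - P (v t)) * 1 := (mul_one _).symm
    _ ≤ _ := by gcongr; exact_mod_cast hR1

/-! ### The nonlinearity -/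

/-- Bounds for the nonlinearity: growth of order `2m - 1` and local Lipschitz continuity. -/
lemma IsDyadicCutoff.exists_nonlin_le (h : Cutoff) {ε : ℝ} (hε : 0 < ε) (c : ℂ) {m : ℕ} (hm : 1 ≤ m)
    : ∃ C : ℝ≥0, ∀ (z : ℕ → ℕ → Dist) (κ : 𝐄), (∀ k ≤ m, ∀ l ≤ m, MemC ϕ (-ε) (z k l) ∧ 𝐁 (-ε) (z k
    l) ≤ κ) → ∀ R : ℝ≥0, 1 ≤ R → ∀ v w : Dist, MemC ϕ (2 * ε) v → MemC ϕ (2 * ε) w → 𝐁 (2 * ε) v ≤ R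
    → 𝐁 (2 * ε) w ≤ R → MemC ϕ (-ε) (nonlin c m z v) ∧ 𝐁 (-ε) (nonlin c m z v) ≤ C * κ * (R : 𝐄) ^
    (2 * m - 1) ∧ 𝐁 (-ε) (nonlin c m z v - nonlin c m z w) ≤ C * κ * (R : 𝐄) ^ (2 * m - 2) * 𝐁 (2 *
    ε) (v - w) := by
  obtain ⟨D, hD⟩ := h.exists_prod_neg (r := 2 * ε) (s := -ε) (by linarith) (by linarith)
  choose A hA using fun i j : ℕ => polyLike_monomial h (r := 2 * ε) (by linarith) i j
  set b : ℕ → ℕ → ℂ := fun i j => (m.choose i : ℂ) * ((m - 1).choose j : ℂ) with hb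
  set K : ℝ≥0 := ‖c‖₊ * ∑ i ∈ range (m + 1), ∑ j ∈ range m, ‖b i j‖₊ * (D * A i j)
    with hK
  refine ⟨K, fun z κ hz R hR v w hv hw hvR hwR => ?_⟩
  have hR1 : (1 : 𝐄) ≤ R := by exact_mod_cast hR
  have hzz : ∀ i j, MemC ϕ (-ε) (z (m - i) (m - 1 - j)) ∧
      𝐁 (-ε) (z (m - i) (m - 1 - j)) ≤ κ := fun i j => hz _ (by omega) _ (by omega)
  have hKe : (K : 𝐄) = ‖c‖ₑ * ∑ i ∈ range (m + 1), ∑ j ∈ range m, ‖b i j‖ₑ * (D * A i j) := by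
    rw [hK]; push_cast; rfl
  have hterm : ∀ i j, MemC ϕ (-ε) (b i j • prod (z (m - i) (m - 1 - j))
      (prod (powD v i) (powD (conjD v) j))) := fun i j =>
    ((hD _ _ (hzz i j).1 (hA i j R hR v w hv hw hvR hwR).1).1).smul h _
  refine ⟨?_, ?_, ?_⟩
  · exact (MemC.sum h _ fun i _ => MemC.sum h _ fun j _ => hterm i j).smul h (-c)
  · rw [nonlin, besov_smul, enorm_neg, hKe, mul_assoc, mul_assoc]; refine mul_le_mul_right ?_ _
    rw [sum_mul]; refine (h.besov_sum_le _ _ _).trans (sum_le_sum fun i hi => ?_); rw [sum_mul]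
    refine (h.besov_sum_le _ _ _).trans (sum_le_sum fun j hj => ?_); rw [mem_range] at hi hj
    obtain ⟨q1, q2, -⟩ := hA i j R hR v w hv hw hvR hwR; rw [besov_smul, mul_assoc]
    refine mul_le_mul_right ((hD _ _ (hzz i j).1 q1).2.trans ?_) _
    calc _ ≤ D * (κ * (A i j * (R : 𝐄) ^ (i + j))) := by gcongr; exact (hzz i j).2
      _ ≤ D * (κ * (A i j * (R : 𝐄) ^ (2 * m - 1))) :=
          mul_le_mul_right (mul_le_mul_right (mul_le_mul_right
            (pow_le_pow_right₀ hR1 (by omega)) _) _) _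
      _ = _ := by ring
  · have e : nonlin c m z v - nonlin c m z w = -c • ∑ i ∈ range (m + 1), ∑ j ∈ range m,
        b i j • prod (z (m - i) (m - 1 - j))
          (prod (powD v i) (powD (conjD v) j) - prod (powD w i) (powD (conjD w) j)) := by
      rw [nonlin, nonlin, ← smul_sub, ← sum_sub_distrib]; congr 1
      refine sum_congr rfl fun i _ => ?_; rw [← sum_sub_distrib]; refine sum_congr rfl fun j _ => ?_
      rw [← smul_sub]; congr 1; have q1 := (hA i j R hR v w hv hw hvR hwR).1
      have q2 := (hA i j R hR w v hw hv hwR hvR).1; have z1 := (hzz i j).1.lt_top h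
      have := prod_sub_prod h (r := -ε) (s := 2 * ε) (by linarith) z1 z1 (q1.lt_top h) (q2.lt_top h)
      rw [this, sub_self, zero_prod, zero_add]
    rw [e, besov_smul, enorm_neg, hKe]; simp only [mul_assoc]; refine mul_le_mul_right ?_ _
    rw [sum_mul]; refine (h.besov_sum_le _ _ _).trans (sum_le_sum fun i hi => ?_); rw [sum_mul]
    refine (h.besov_sum_le _ _ _).trans (sum_le_sum fun j hj => ?_); rw [mem_range] at hi hj
    obtain ⟨q1, q2, q3⟩ := hA i j R hR v w hv hw hvR hwR
    have q1' := (hA i j R hR w v hw hv hwR hvR).1; rw [besov_smul, mul_assoc]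
    refine mul_le_mul_right ((hD _ _ (hzz i j).1 (q1.sub h q1')).2.trans ?_) _
    have q4 : 𝐁 (2 * ε) (prod (powD v i) (powD (conjD v) j) - prod (powD w i) (powD (conjD w) j)) ≤
        A i j * ((R : 𝐄) ^ (2 * m - 2) * 𝐁 (2 * ε) (v - w)) := by
      have hR0 : (R : 𝐄) ≠ 0 := (one_pos.trans_le hR1).ne'
      refine (ENNReal.mul_le_mul_iff_left hR0 coe_ne_top).1 (q3.trans ?_)
      calc _ ≤ A i j * (R : 𝐄) ^ (2 * m - 2 + 1) * 𝐁 (2 * ε) (v - w) :=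
            mul_le_mul_left (mul_le_mul_right (pow_le_pow_right₀ hR1 (by omega)) _) _
        _ = _ := by rw [pow_succ]; ring
    calc _ ≤ D * (κ * (A i j * ((R : 𝐄) ^ (2 * m - 2) * 𝐁 (2 * ε) (v - w)))) := by
          gcongr; exact (hzz i j).2
      _ = _ := by ring

lemma ContC.smul (h : Cutoff) {I : Set ℝ} (c : ℂ) (hv : ContC ϕ s I v) : ContC ϕ s I fun t => c • v
    t := by
  intro t ht; refine ⟨(hv t ht).1.smul h c, ?_⟩; simp_rw [← smul_sub, besov_smul]
  simpa using ENNReal.Tendsto.const_mul (hv t ht).2 (Or.inr enorm_ne_top)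

lemma ContC.sum (h : Cutoff) {I : Set ℝ} {ι : Type*} (S : Finset ι) {v : ι → ℝ → Dist} (hv : ∀ i ∈
    S, ContC ϕ s I (v i)) : ContC ϕ s I fun t => ∑ i ∈ S, v i t := by
  classical
  induction S using Finset.induction_on with
  | empty =>
    intro t _; refine ⟨by simpa using MemC.zero ϕ s, ?_⟩
    simp only [Finset.sum_empty, sub_self, besov_zero]; exact tendsto_const_nhds
  | insert a S ha ih =>
    simp_rw [sum_insert ha]; exact (hv a (by simp)).add h (ih fun i hi => hv i (by simp [hi]))

lemma contC_nonlin (h : Cutoff) {ε : ℝ} (hε : 0 < ε) (c : ℂ) (m : ℕ) {I : Set ℝ} {z : ℕ → ℕ → ℝ →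
    Dist} (hz : ∀ k l, ContC ϕ (-ε) I (z k l)) (hv : ContC ϕ (2 * ε) I v) : ContC ϕ (-ε) I fun t =>
    nonlin c m (fun k l => z k l t) (v t) := by
  obtain ⟨D, hD⟩ := h.exists_prod_neg (r := 2 * ε) (s := -ε) (by linarith) (by linarith)
  refine ContC.smul h (-c) (ContC.sum h _ fun i _ => ContC.sum h _ fun j _ => ContC.smul h _ ?_)
  exact contC_prod h (by linarith) hD (hz _ _) ((polyLike_monomial h (by linarith) i j).contC h hv)

/-! ### The Duhamel integral -/

/-- The Duhamel integral `∫_{t₀}^t S(t - t') F(t') dt'`. -/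
def duh (a : ℂ) (F : ℝ → Dist) (t₀ t : ℝ) : Dist := fun n =>
  ∫ t' in t₀..t, exp (-((t - t' : ℝ) : ℂ) * symb a n) * F t' n

lemma intervalIntegrable_exp_mul (a : ℂ) {t₀ t₁ : ℝ} (hF : IntervalIntegrable (fun t' => F t' n)
    volume t₀ t₁) (t : ℝ) : IntervalIntegrable (fun t' => exp (-((t - t' : ℝ) : ℂ) * symb a n) * F
    t' n) volume t₀ t₁ :=
  hF.continuousOn_mul (by fun_prop)

lemma intervalIntegrable_of_exp_mul {t₀ t₁ t : ℝ} (hF : IntervalIntegrable (fun t' => exp (-((t - t'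
    : ℝ) : ℂ) * symb a n) * F t' n) volume t₀ t₁) : IntervalIntegrable (fun t' => F t' n) volume t₀
    t₁ := by
  have := hF.continuousOn_mul (g := fun t' => exp (((t - t' : ℝ) : ℂ) * symb a n))
    (by fun_prop)
  refine this.congr fun t' _ => ?_
  rw [← mul_assoc, ← exp_add, neg_mul, add_neg_cancel, Complex.exp_zero, one_mul]

lemma duh_apply (a : ℂ) (F : ℝ → Dist) (t₀ t : ℝ) (n : ℤ²) : duh a F t₀ t n = exp (-(t : ℂ) * symb a
    n) * ∫ t' in t₀..t, exp ((t' : ℂ) * symb a n) * F t' n := by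
  rw [duh, ← intervalIntegral.integral_const_mul]; congr 1; ext t'; rw [← mul_assoc, ← exp_add]
  congr 2; push_cast; ring

lemma duh_sub (a : ℂ) {F G : ℝ → Dist} {t₀ t : ℝ} (hF : ∀ n, IntervalIntegrable (fun t' => F t' n)
    volume t₀ t) (hG : ∀ n, IntervalIntegrable (fun t' => G t' n) volume t₀ t) : duh a (fun t' => F
    t' - G t') t₀ t = duh a F t₀ t - duh a G t₀ t := by
  ext n; rw [Pi.sub_apply, duh, duh, duh, ← intervalIntegral.integral_sub
    (intervalIntegrable_exp_mul a (hF n) t) (intervalIntegrable_exp_mul a (hG n) t)]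
  simp [mul_sub]

lemma duh_eq_add (a : ℂ) {t₀ t₁ t : ℝ} (h₁ : ∀ n, IntervalIntegrable (fun t' => F t' n) volume t₀
    t₁) (h₂ : ∀ n, IntervalIntegrable (fun t' => F t' n) volume t₁ t) : duh a F t₀ t = heat a (t -
    t₁) (duh a F t₀ t₁) + duh a F t₁ t := by
  ext n; rw [Pi.add_apply, heat, duh, duh, duh, ← intervalIntegral.integral_add_adjacent_intervals
    (intervalIntegrable_exp_mul a (h₁ n) t) (intervalIntegrable_exp_mul a (h₂ n) t),
    ← intervalIntegral.integral_const_mul]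
  congr 2; ext t'; rw [← mul_assoc, ← exp_add]; congr 2; push_cast; ring

lemma continuousOn_duh (a : ℂ) {t₀ T : ℝ} (hT : t₀ ≤ T) (n : ℤ²) (hF : IntervalIntegrable (fun t' =>
    F t' n) volume t₀ T) : ContinuousOn (fun t => duh a F t₀ t n) (Icc t₀ T) := by
  simp_rw [duh_apply]; refine ContinuousOn.mul (by fun_prop) ?_
  have h1 : IntervalIntegrable (fun t' : ℝ => exp ((t' : ℂ) * symb a n) * F t' n)
    volume t₀ T := hF.continuousOn_mul (by fun_prop)
  have := intervalIntegral.continuousOn_primitive_interval' h1 (a := t₀) Set.left_mem_uIcc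
  rwa [uIcc_of_le hT] at this

lemma IsDyadicCutoff.besov_duh_le_lintegral (h : Cutoff) {σ : ℝ} {t₀ t : ℝ} (ht : t₀ ≤ t) (hF : ∀ n,
    IntervalIntegrable (fun t' => F t' n) volume t₀ t) {G : ℝ → 𝐄} (hG : ∀ t' ∈ Ioo t₀ t, 𝐁 σ (heat
    a (t - t') (F t')) ≤ G t') : 𝐁 σ (duh a F t₀ t) ≤ ∫⁻ t' in Ioo t₀ t, G t' := by
  rw [besovNorm_eq]; refine iSup_le fun j => ?_; rw [supN, mul_iSup]; refine iSup_le fun x => ?_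
  set S := (h.support_bl_finite j fun _ => 1).toFinset with hS
  have hsub : ∀ f : Dist, support (bl ϕ j f) ⊆ S := by
    intro f n hn; rw [hS, Set.Finite.coe_toFinset]; simp only [mem_support, bl] at hn ⊢
    rw [mul_one]; exact left_ne_zero_of_mul hn
  have e : ev (bl ϕ j (duh a F t₀ t)) x =
      ∫ t' in Ioo t₀ t, ev (bl ϕ j (heat a (t - t') (F t'))) x := by
    simp_rw [ev_eq_sum S (hsub _)]
    have hint : ∀ n, Integrable (fun t' => exp (-((t - t' : ℝ) : ℂ) * symb a n) * F t' n)
        (volume.restrict (Ioo t₀ t)) := fun n => by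
      have := (intervalIntegrable_iff_integrableOn_Ioc_of_le ht).1
        (intervalIntegrable_exp_mul a (hF n) t)
      exact this.mono_set Set.Ioo_subset_Ioc_self
    rw [integral_finsetSum]
    · refine sum_congr rfl fun n _ => ?_; simp only [bl, heat, duh]
      rw [intervalIntegral.integral_of_le ht, integral_Ioc_eq_integral_Ioo,
        integral_mul_const, integral_const_mul]
    · intro n _; exact (((hint n).const_mul (dyadic ϕ j (freq n) : ℂ))).mul_const (char2 n x)
  rw [e]
  calc _ ≤ ofReal (2 ^ ((j : ℝ) * σ)) *
        ∫⁻ t' in Ioo t₀ t, ‖ev (bl ϕ j (heat a (t - t') (F t'))) x‖ₑ := by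
        gcongr; exact enorm_integral_le_lintegral_enorm _
    _ = ∫⁻ t' in Ioo t₀ t, ofReal (2 ^ ((j : ℝ) * σ)) * ‖ev (bl ϕ j (heat a (t - t') (F t'))) x‖ₑ :=
        (lintegral_const_mul' _ _ ofReal_ne_top).symm
    _ ≤ _ := by
        refine setLIntegral_mono' measurableSet_Ioo fun t' ht' => le_trans ?_ (hG t' ht')
        refine le_trans ?_ (mul_supN_bl_le ϕ σ _ j); gcongr; exact ev_le_supN _ _

lemma lintegral_rpow_left {b : ℝ} (hb : b < 1) {t₀ t : ℝ} (ht : t₀ ≤ t) : ∫⁻ x in Ioo t₀ t, ofReal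
    ((x - t₀) ^ (-b)) = ofReal ((t - t₀) ^ (1 - b) / (1 - b)) := by
  have hi : IntervalIntegrable (fun x : ℝ => (x - t₀) ^ (-b)) volume t₀ t := by
    have := (intervalIntegral.intervalIntegrable_rpow' (a := 0) (b := t - t₀)
      (by linarith : -1 < -b)).comp_sub_right t₀
    simpa using this
  rw [← ofReal_integral_eq_lintegral_ofReal, ← integral_Ioc_eq_integral_Ioo,
    ← intervalIntegral.integral_of_le ht, intervalIntegral.integral_comp_sub_right
      (fun x => x ^ (-b)), integral_rpow (Or.inl (by linarith)), sub_self,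
    Real.zero_rpow (by linarith), sub_zero, neg_add_eq_sub]
  · exact ((intervalIntegrable_iff_integrableOn_Ioc_of_le ht).1 hi).mono_set Set.Ioo_subset_Ioc_self
  · filter_upwards [ae_restrict_mem measurableSet_Ioo] with x hx
    exact rpow_nonneg (by linarith [hx.1]) _

lemma lintegral_rpow_right {b : ℝ} (hb : b < 1) {t₀ t : ℝ} (ht : t₀ ≤ t) : ∫⁻ x in Ioo t₀ t, ofReal
    ((t - x) ^ (-b)) = ofReal ((t - t₀) ^ (1 - b) / (1 - b)) := by
  have hi : IntervalIntegrable (fun x : ℝ => (t - x) ^ (-b)) volume t₀ t := by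
    have := ((intervalIntegral.intervalIntegrable_rpow' (a := 0) (b := t - t₀)
      (by linarith : -1 < -b)).comp_sub_left t).symm
    simpa using this
  rw [← ofReal_integral_eq_lintegral_ofReal, ← integral_Ioc_eq_integral_Ioo,
    ← intervalIntegral.integral_of_le ht, intervalIntegral.integral_comp_sub_left
      (fun x => x ^ (-b)), integral_rpow (Or.inl (by linarith)), sub_self,
    Real.zero_rpow (by linarith), sub_zero, neg_add_eq_sub]
  · exact ((intervalIntegrable_iff_integrableOn_Ioc_of_le ht).1 hi).mono_set Set.Ioo_subset_Ioc_self
  · filter_upwards [ae_restrict_mem measurableSet_Ioo] with x hx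
    exact rpow_nonneg (by linarith [hx.2]) _

lemma exists_lintegral_rpow_mul_le {κ b : ℝ} (hκ : 0 ≤ κ) (hκ1 : κ < 1) (hb : 0 ≤ b) (hb1 : b < 1) :
    ∃ C : ℝ≥0, ∀ t₀ t : ℝ, t₀ < t → ∫⁻ x in Ioo t₀ t, ofReal ((t - x) ^ (-κ)) * ofReal ((x - t₀) ^
    (-b)) ≤ C * ofReal ((t - t₀) ^ (1 - κ - b)) := by
  refine ⟨(2 ^ κ / (1 - b) + 2 ^ b / (1 - κ)).toNNReal, fun t₀ t ht => ?_⟩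
  have hd : 0 < t - t₀ := by linarith
  have hpt : ∀ x ∈ Ioo t₀ t, ofReal ((t - x) ^ (-κ)) * ofReal ((x - t₀) ^ (-b)) ≤
      ofReal (((t - t₀) / 2) ^ (-κ)) * ofReal ((x - t₀) ^ (-b)) +
      ofReal (((t - t₀) / 2) ^ (-b)) * ofReal ((t - x) ^ (-κ)) := by
    intro x hx; rcases le_total (x - t₀) ((t - t₀) / 2) with hl | hl
    · refine le_add_right ?_; exact mul_le_mul_left (ofReal_le_ofReal
        (rpow_le_rpow_of_nonpos (by linarith) (by linarith) (by linarith))) _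
    · refine le_add_left ?_; rw [mul_comm]; exact mul_le_mul_left (ofReal_le_ofReal
        (rpow_le_rpow_of_nonpos (by linarith) (by linarith) (by linarith))) _
  refine (setLIntegral_mono' measurableSet_Ioo hpt).trans ?_
  rw [lintegral_add_left (by fun_prop), lintegral_const_mul' _ _ ofReal_ne_top,
    lintegral_const_mul' _ _ ofReal_ne_top, lintegral_rpow_left hb1 ht.le,
    lintegral_rpow_right hκ1 ht.le, ← ofReal_mul (by positivity),
    ← ofReal_mul (by positivity), ← ofReal_add, ← ofReal.eq_1,
    ← ofReal_mul]
  · refine ofReal_le_ofReal (le_of_eq ?_)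
    have h1 : ((t - t₀) / 2) ^ (-κ) = 2 ^ κ * (t - t₀) ^ (-κ) := by
      rw [div_rpow hd.le (by norm_num), rpow_neg (by norm_num : (0 : ℝ) ≤ 2)]; field_simp
    have h2 : ((t - t₀) / 2) ^ (-b) = 2 ^ b * (t - t₀) ^ (-b) := by
      rw [div_rpow hd.le (by norm_num), rpow_neg (by norm_num : (0 : ℝ) ≤ 2)]; field_simp
    have h3 : (t - t₀) ^ (-κ) * (t - t₀) ^ (1 - b) = (t - t₀) ^ (1 - κ - b) := by
      rw [← rpow_add hd]; congr 1; ring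
    have h4 : (t - t₀) ^ (-b) * (t - t₀) ^ (1 - κ) = (t - t₀) ^ (1 - κ - b) := by
      rw [← rpow_add hd]; congr 1; ring
    rw [h1, h2, add_mul]; nth_rw 1 [← h3]
    rw [← h4]; ring
  · have : 0 < 1 - b := by linarith
    have : 0 < 1 - κ := by linarith
    positivity
  · have : 0 < 1 - b := by linarith
    positivity
  · have : 0 < 1 - κ := by linarith
    positivity

/-- Smoothing of the Duhamel integral, for a forcing that is singular at the initial time. -/
lemma IsDyadicCutoff.exists_besov_duh_le (h : Cutoff) (ha : 0 < a.re) (s : ℝ) {κ b : ℝ} (hκ : 0 ≤ κ)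
    (hκ1 : κ < 1) (hb : 0 ≤ b) (hb1 : b < 1) : ∃ C : ℝ≥0, ∀ (F : ℝ → Dist) (t₀ t : ℝ) (M : 𝐄), t₀ <
    t → t ≤ t₀ + 1 → (∀ n, IntervalIntegrable (fun t' => F t' n) volume t₀ t) → (∀ t' ∈ Ioo t₀ t, 𝐁
    s (F t') ≤ M * ofReal ((t' - t₀) ^ (-b))) → 𝐁 (s + 2 * κ) (duh a F t₀ t) ≤ C * M * ofReal ((t -
    t₀) ^ (1 - κ - b)) := by
  obtain ⟨C₁, h₁⟩ := h.exists_besov_heat_le ha s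
  obtain ⟨C₂, h₂⟩ := exists_lintegral_rpow_mul_le hκ hκ1 hb hb1
  refine ⟨C₁ * C₂, fun F t₀ t M ht ht1 hF hM => ?_⟩
  refine (h.besov_duh_le_lintegral ht.le hF (G := fun x => C₁ * M *
    (ofReal ((t - x) ^ (-κ)) * ofReal ((x - t₀) ^ (-b)))) fun x hx => ?_).trans ?_
  · refine (h₁ κ hκ hκ1.le (t - x) (by linarith [hx.2]) (by linarith [hx.1]) _).trans ?_
    calc _ ≤ C₁ * ofReal ((t - x) ^ (-κ)) * (M * ofReal ((x - t₀) ^ (-b))) := by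
          gcongr; exact hM x hx
      _ = _ := by ring
  · rw [lintegral_const_mul _ (by fun_prop)]
    calc _ ≤ C₁ * M * (C₂ * ofReal ((t - t₀) ^ (1 - κ - b))) := by gcongr; exact h₂ t₀ t ht
      _ = _ := by push_cast; ring

lemma intervalIntegrable_of_besov_le (h : Cutoff) {s b : ℝ} (hb1 : b < 1) {t₀ T : ℝ} (hT : t₀ ≤ T)
    {M : 𝐄} (hMt : M ≠ ∞) (hF : ContinuousOn (fun t => F t n) (Ioc t₀ T)) (hM : ∀ t' ∈ Ioc t₀ T, 𝐁 s
    (F t') ≤ M * ofReal ((t' - t₀) ^ (-b))) : IntervalIntegrable (fun t' => F t' n) volume t₀ T :=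
    by
  obtain ⟨C, hC⟩ := h.exists_coeff_le s n; rw [intervalIntegrable_iff_integrableOn_Ioc_of_le hT]
  refine ⟨hF.aestronglyMeasurable measurableSet_Ioc, ?_⟩
  have := setLIntegral_mono' (μ := volume) measurableSet_Ioc fun t' ht' => (hC (F t')).trans
    (mul_le_mul_right (hM t' ht') _)
  refine this.trans_lt ?_; simp_rw [← mul_assoc]
  rw [lintegral_const_mul _ (by fun_prop), setLIntegral_congr Ioo_ae_eq_Ioc.symm,
    lintegral_rpow_left hb1 hT]
  exact mul_lt_top (mul_lt_top ENNReal.coe_lt_top hMt.lt_top) ofReal_lt_top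

/-! ### Continuity of the heat flow and uniform limits -/

lemma contC_of_unif (h : Cutoff) {I : Set ℝ} (H : ∀ δ : 𝐄, 0 < δ → ∃ w, ContC ϕ s I w ∧ ∀ t ∈ I, 𝐁 s
    (v t - w t) ≤ δ) : ContC ϕ s I v := by
  refine fun t ht => ⟨MemC.of_approx h fun δ hδ => ?_, ?_⟩
  · obtain ⟨δ', hδ', hδδ⟩ := exists_between hδ; obtain ⟨w, hw, hvw⟩ := H δ' hδ'
    exact ⟨w t, (hw t ht).1, (hvw t ht).trans_lt hδδ⟩
  · rw [tendsto_nhds_zero]; intro δ hδ; have hδ3 : 0 < δ / 3 := ENNReal.div_pos hδ.ne' (by norm_num)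
    obtain ⟨w, hw, hvw⟩ := H (δ / 3) hδ3
    filter_upwards [(tendsto_nhds_zero.1 (hw t ht).2) (δ / 3) hδ3, self_mem_nhdsWithin]
      with τ h1 hτ
    calc 𝐁 s (v τ - v t) ≤ 𝐁 s (v τ - w τ) + 𝐁 s (w τ - v t) :=
          h.besov_triangle _ _ _ _
      _ ≤ 𝐁 s (v τ - w τ) + (𝐁 s (w τ - w t) + 𝐁 s (w t - v t)) := by
          gcongr; exact h.besov_triangle _ _ _ _
      _ ≤ δ / 3 + (δ / 3 + δ / 3) := by
          rw [besov_sub_comm ϕ s (w t)]; gcongr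
          · exact hvw τ hτ
          · exact hvw t ht
      _ = δ := by rw [← add_assoc, ENNReal.add_thirds]

lemma contC_heat (h : Cutoff) (ha : 0 < a.re) (hf : MemC ϕ s f) : ContC ϕ s (Ici 0) fun t => heat a
    t f := by
  obtain ⟨C, hC⟩ := h.exists_besov_heat_le_self ha s; refine contC_of_unif h fun δ hδ => ?_
  obtain ⟨δ', hδ', hδδ⟩ : ∃ δ' : ℝ≥0, 0 < δ' ∧ C * (δ' : 𝐄) ≤ δ := by
    obtain ⟨r, hr, hr'⟩ := ENNReal.lt_iff_exists_nnreal_btwn.1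
      (ENNReal.div_pos hδ.ne' (by finiteness) : 0 < δ / (C + 1))
    refine ⟨r, by exact_mod_cast hr, ?_⟩
    calc _ ≤ ((C : 𝐄) + 1) * (δ / (C + 1)) := by gcongr; exact le_self_add
      _ ≤ δ := ENNReal.mul_div_le
  obtain ⟨g, hg, hfg⟩ := hf δ' (by exact_mod_cast hδ')
  refine ⟨fun t => heat a t g, fun t ht => ⟨MemC.of_finite ϕ s (support_heat_finite a t hg), ?_⟩,
    fun t ht => ?_⟩
  · refine h.tendsto_besov_of_finite s hg.toFinset (fun τ n hn => ?_) fun n _ => ?_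
    · simp only [Set.Finite.coe_toFinset, mem_support, heat, Pi.sub_apply, ← sub_mul] at hn ⊢
      exact right_ne_zero_of_mul hn
    · have : Continuous fun τ : ℝ => heat a τ g n - heat a t g n := by unfold heat; fun_prop
      have := (this.tendsto t).mono_left (nhdsWithin_le_nhds (s := Ici 0)); simpa using this
  · rw [← heat_sub]; exact (hC t ht _).trans ((mul_le_mul_right hfg.le _).trans hδδ)

/-! ### The estimates behind the fixed point argument -/

/-- The linear and nonlinear estimates used by the fixed point argument, with a common constant
`C`. Here `α` is the exponent of the time weight and `δ` the gain. -/
structure FixedPointEst (ϕ : E2 → ℝ) (a c : ℂ) (m : ℕ) (s₀ ε α δ : ℝ) (C : ℝ≥0) : Prop where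
  one_le : 1 ≤ C
  heat_low : ∀ f t, 0 ≤ t → besovNorm ϕ s₀ (heat a t f) ≤ C * besovNorm ϕ s₀ f
  heat_high : ∀ f t, 0 < t → t ≤ 1 →
    besovNorm ϕ (2 * ε) (heat a t f) ≤ C * besovNorm ϕ s₀ f * ofReal (t ^ (-α))
  heat_top : ∀ f t, 0 < t → t ≤ 1 →
    besovNorm ϕ (3 * ε) (heat a t f) ≤ C * besovNorm ϕ s₀ f * ofReal (t ^ (-(α + ε / 2)))
  duh : ∀ (F : ℝ → Dist) (t₀ t : ℝ) (M : 𝐄), t₀ < t → t ≤ t₀ + 1 →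
    (∀ n, IntervalIntegrable (fun t' => F t' n) volume t₀ t) →
    (∀ t' ∈ Ioo t₀ t, besovNorm ϕ (-ε) (F t') ≤ M * ofReal ((t' - t₀) ^ (-(α * (2 * m - 1 : ℕ))))) →
    besovNorm ϕ (-ε) (duh a F t₀ t) ≤ C * M * ofReal ((t - t₀) ^ δ) ∧
    besovNorm ϕ (2 * ε) (duh a F t₀ t) ≤ C * M * ofReal ((t - t₀) ^ δ) * ofReal ((t - t₀) ^ (-α)) ∧
    besovNorm ϕ (3 * ε) (duh a F t₀ t) ≤ C * M
  nonlin : ∀ (z : ℕ → ℕ → Dist) (κ : 𝐄),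
    (∀ k ≤ m, ∀ l ≤ m, MemC ϕ (-ε) (z k l) ∧ besovNorm ϕ (-ε) (z k l) ≤ κ) →
    ∀ (A : ℝ≥0) (D : 𝐄), 1 ≤ A → ∀ τ : ℝ, 0 < τ → τ ≤ 1 → ∀ v w : Dist,
    MemC ϕ (2 * ε) v → MemC ϕ (2 * ε) w →
    besovNorm ϕ (2 * ε) v ≤ A * ofReal (τ ^ (-α)) →
    besovNorm ϕ (2 * ε) w ≤ A * ofReal (τ ^ (-α)) →
    besovNorm ϕ (2 * ε) (v - w) ≤ D * ofReal (τ ^ (-α)) →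
    besovNorm ϕ (-ε) (nonlin c m z v) ≤
      C * κ * (A : 𝐄) ^ (2 * m - 1) * ofReal (τ ^ (-(α * (2 * m - 1 : ℕ)))) ∧
    besovNorm ϕ (-ε) (nonlin c m z v - nonlin c m z w) ≤
      C * κ * (A : 𝐄) ^ (2 * m - 2) * D * ofReal (τ ^ (-(α * (2 * m - 1 : ℕ))))

lemma IsDyadicCutoff.exists_fixedPointEst (h : Cutoff) (ha : 0 < a.re) (c : ℂ) {m : ℕ} (hm : 2 ≤ m)
    {s₀ ε α δ : ℝ} (hε : 0 < ε) (hεs : ε < -s₀) (hα : α = (2 * ε - s₀) / 2) (hδ : δ = 1 - α * (2 * m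
    - 1 : ℕ) - 2 * ε) (hδ0 : 0 < δ) : ∃ C, FixedPointEst ϕ a c m s₀ ε α δ C := by
  have hα0 : 0 < α := by rw [hα]; linarith
  have hp : (3 : ℝ) ≤ (2 * m - 1 : ℕ) := by
    have : 3 ≤ 2 * m - 1 := by omega
    exact_mod_cast this
  set b : ℝ := α * (2 * m - 1 : ℕ) with hb; have hb0 : 0 ≤ b := by positivity
  have hb3 : 3 * α ≤ b := by rw [hb]; nlinarith
  have hb1 : b < 1 := by linarith
  obtain ⟨C₁, h₁⟩ := h.exists_besov_heat_le_self ha s₀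
  obtain ⟨C₂, h₂⟩ := h.exists_besov_heat_le ha s₀
  obtain ⟨C₃, h₃⟩ := h.exists_besov_duh_le ha (-ε) (κ := 0) le_rfl one_pos hb0 hb1
  obtain ⟨C₄, h₄⟩ := h.exists_besov_duh_le ha (-ε) (κ := 3 * ε / 2) (by linarith) (by linarith) hb0 hb1
  obtain ⟨C₅, h₅⟩ := h.exists_besov_duh_le ha (-ε) (κ := 2 * ε) (by linarith) (by linarith) hb0 hb1
  obtain ⟨C₆, h₆⟩ := h.exists_nonlin_le hε c (m := m) (by omega)
  set C : ℝ≥0 := 1 + C₁ + C₂ + C₃ + C₄ + C₅ + C₆ with hC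
  obtain ⟨c0, c1, c2, c3, c4, c5, c6⟩ : 1 ≤ C ∧ (C₁ : 𝐄) ≤ C ∧ (C₂ : 𝐄) ≤ C ∧
      (C₃ : 𝐄) ≤ C ∧ (C₄ : 𝐄) ≤ C ∧ (C₅ : 𝐄) ≤ C ∧ (C₆ : 𝐄) ≤ C := by
    norm_cast
    refine ⟨?_, ?_, ?_, ?_, ?_, ?_, ?_⟩ <;> rw [hC, ← NNReal.coe_le_coe] <;> push_cast <;>
      linarith [C₁.2, C₂.2, C₃.2, C₄.2, C₅.2, C₆.2]
  refine ⟨C, c0, fun f t ht => ?_, fun f t ht ht1 => ?_, fun f t ht ht1 => ?_,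
    fun F t₀ t M ht ht1 hF hM => ⟨?_, ?_, ?_⟩, ?_⟩
  · exact (h₁ t ht f).trans (by gcongr)
  · have := h₂ α hα0.le (by linarith) t ht ht1 f
    rw [show s₀ + 2 * α = 2 * ε by rw [hα]; ring] at this; refine this.trans ?_; rw [mul_right_comm]
    gcongr
  · have := h₂ (α + ε / 2) (by linarith) (by linarith) t ht ht1 f
    rw [show s₀ + 2 * (α + ε / 2) = 3 * ε by rw [hα]; ring] at this; refine this.trans ?_
    rw [mul_right_comm]; gcongr
  · have := h₃ F t₀ t M ht ht1 hF hM; rw [mul_zero, add_zero] at this; refine this.trans ?_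
    gcongr ?_ * _ * ofReal ?_
    exact Real.rpow_le_rpow_of_exponent_ge (by linarith) (by linarith) (by linarith)
  · have := h₄ F t₀ t M ht ht1 hF hM; rw [show -ε + 2 * (3 * ε / 2) = 2 * ε by ring] at this
    refine this.trans ?_; rw [mul_assoc (C * M : 𝐄), ← ofReal_mul (rpow_nonneg (by linarith) _),
      ← rpow_add (by linarith)]
    gcongr ?_ * _ * ofReal ?_
    exact Real.rpow_le_rpow_of_exponent_ge (by linarith) (by linarith) (by linarith)
  · have := h₅ F t₀ t M ht ht1 hF hM; rw [show -ε + 2 * (2 * ε) = 3 * ε by ring] at this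
    refine this.trans ?_; rw [← mul_one (C * M : 𝐄)]; gcongr ?_ * _ * ?_; rw [ENNReal.ofReal_le_one]
    exact Real.rpow_le_one (by linarith) (by linarith) (by linarith)
  · intro z κ hz A D hA τ hτ hτ1 v w hv hw hvA hwA hD
    have hτα : 1 ≤ τ ^ (-α) := Real.one_le_rpow_of_pos_of_le_one_of_nonpos hτ hτ1 (by linarith)
    set R : ℝ≥0 := A * (τ ^ (-α)).toNNReal with hR; have hRe : (R : 𝐄) = A * ofReal (τ ^ (-α)) := by
      rw [hR, coe_mul]; rfl
    have hR1 : 1 ≤ R := one_le_mul hA (by rw [Real.one_le_toNNReal]; exact hτα)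
    obtain ⟨-, n1, n2⟩ := h₆ z κ hz R hR1 v w hv hw (hvA.trans_eq hRe.symm) (hwA.trans_eq hRe.symm)
    have hpow : ∀ k : ℕ, ofReal (τ ^ (-α)) ^ k = ofReal (τ ^ (-(α * k))) := by
      intro k; rw [← ofReal_pow (rpow_nonneg hτ.le _), ← Real.rpow_mul_natCast hτ.le]; congr 2; ring
    have hb' : ofReal (τ ^ (-α)) ^ (2 * m - 2) * ofReal (τ ^ (-α)) = ofReal (τ ^ (-b)) := by
      rw [← pow_succ, hpow, show 2 * m - 2 + 1 = 2 * m - 1 by omega]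
    constructor
    · refine n1.trans ?_; rw [hRe, mul_pow, hpow, ← mul_assoc]; gcongr
    · refine n2.trans ?_; rw [hRe, mul_pow, ← hb']
      calc _ ≤ C * κ * ((A : 𝐄) ^ (2 * m - 2) * ofReal (τ ^ (-α)) ^ (2 * m - 2)) *
          (D * ofReal (τ ^ (-α))) := by gcongr
        _ = _ := by ring

/-! ### Mild solutions -/

section Mild

variable {a c : ℂ} {m : ℕ} {s₀ ε α δ : ℝ} {z : ℕ → ℕ → ℝ → Dist} {u₀ u₀' : Dist} {T : ℝ}
  {v v' : ℝ → Dist} {C : ℝ≥0}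

lemma IsMildSolution.eq_duh (hv : IsMildSolution ϕ a c m s₀ ε z u₀ T v) (ht : t ∈ Icc 0 T) : v t =
    heat a t (u₀ - z 1 0 0) + duh a (fun t' => nonlin c m (fun k l => z k l t') (v t')) 0 t := by
  ext n; exact hv.mild t ht n

lemma IsMildSolution.intervalIntegrable (hv : IsMildSolution ϕ a c m s₀ ε z u₀ T v) {t₀ t : ℝ} (h0 :
    0 ≤ t₀) (h01 : t₀ ≤ t) (ht : t ≤ T) (n : ℤ²) : IntervalIntegrable (fun t' => nonlin c m (fun k l
    => z k l t') (v t') n) volume t₀ t := by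
  have := intervalIntegrable_of_exp_mul (hv.integrable T ⟨by linarith, le_rfl⟩ n)
  refine this.mono_set ?_; rw [uIcc_of_le h01, uIcc_of_le (by linarith)]
  exact Set.Icc_subset_Icc h0 ht

lemma IsMildSolution.mono (hv : IsMildSolution ϕ a c m s₀ ε z u₀ T v) {T' : ℝ} (hT : T' ≤ T) :
    IsMildSolution ϕ a c m s₀ ε z u₀ T' v :=
  ⟨hv.cont_pos.mono_set (Set.Ioc_subset_Ioc_right hT),
    hv.cont.mono_set (Set.Icc_subset_Icc_right hT),
    fun t ht => hv.integrable t ⟨ht.1, ht.2.trans hT⟩, fun t ht => hv.mild t ⟨ht.1, ht.2.trans hT⟩⟩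

lemma IsMildSolution.restart (hv : IsMildSolution ϕ a c m s₀ ε z u₀ T v) {t₀ t : ℝ} (h0 : 0 ≤ t₀)
    (h01 : t₀ ≤ t) (ht : t ≤ T) : v t = heat a (t - t₀) (v t₀) + duh a (fun t' => nonlin c m (fun k
    l => z k l t') (v t')) t₀ t := by
  rw [hv.eq_duh ⟨h0.trans h01, ht⟩, hv.eq_duh ⟨h0, h01.trans ht⟩, heat_add, heat_heat,
    sub_add_cancel, add_assoc, ← duh_eq_add a
      (fun n => hv.intervalIntegrable le_rfl h0 (h01.trans ht) n)
      (fun n => hv.intervalIntegrable h0 h01 ht n)]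

lemma IsMildSolution.zero (hv : IsMildSolution ϕ a c m s₀ ε z u₀ T v) (hT : 0 ≤ T) : v 0 = u₀ - z 1
    0 0 := by rw [hv.eq_duh ⟨le_rfl, hT⟩, heat_zero]; ext n; simp [duh]

/-- The enhanced noise is bounded by `κ` on `[0,1]`. -/
def NoiseBound (ϕ : E2 → ℝ) (ε : ℝ) (m : ℕ) (z : ℕ → ℕ → ℝ → Dist) (κ : ℝ≥0) : Prop :=
  (∀ k l, ContC ϕ (-ε) (Ici 0) (z k l)) ∧
  ∀ k ≤ m, ∀ l ≤ m, ∀ t ∈ Icc (0 : ℝ) 1, besovNorm ϕ (-ε) (z k l t) ≤ κ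

lemma NoiseBound.at {κ : ℝ≥0} (hz : NoiseBound ϕ ε m z κ) (ht : t ∈ Icc (0 : ℝ) 1) : ∀ k ≤ m, ∀ l ≤
    m, MemC ϕ (-ε) (z k l t) ∧ 𝐁 (-ε) (z k l t) ≤ κ :=
  fun k hk l hl => ⟨(hz.1 k l t ht.1).1, hz.2 k hk l hl t ht⟩

variable (h : IsDyadicCutoff ϕ) (E : FixedPointEst ϕ a c m s₀ ε α δ C) (hm : 2 ≤ m)
  (hα : 0 < α) (hδ : 0 < δ) (hε : 0 < ε) (hεs : ε < -s₀)
include h E hm hα hδ hε hεs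

lemma IsMildSolution.apriori_of_pos {κ A : ℝ≥0} (hz : NoiseBound ϕ ε m z κ) (hv : IsMildSolution ϕ a
    c m s₀ ε z u₀ T v) (hT1 : T ≤ 1) {R : ℝ≥0} (hA1 : 1 ≤ A) (hRA : 4 * (C * R) ≤ A) (hsmall : (4 *
    (C ^ 2 * κ * A ^ (2 * m - 2)) : ℝ) * T ^ δ ≤ 1) {t₀ : ℝ} (ht₀ : 0 < t₀) (ht₀T : t₀ ≤ T) (hR : 𝐁
    s₀ (v t₀) ≤ R) : ∀ t ∈ Icc t₀ T, (𝐁 s₀ (v t)).toReal < A ∧ (t - t₀) ^ α * (𝐁 (2 * ε) (v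
    t)).toReal < A := by
  have hIcc : Icc t₀ T ⊆ Icc 0 T := Set.Icc_subset_Icc_left ht₀.le
  have hIoc : Icc t₀ T ⊆ Ioc 0 T := fun t ht => ⟨ht₀.trans_le ht.1, ht.2⟩
  have hX := (hv.cont.mono_set hIcc).continuousOn_besov h
  have hY := (hv.cont_pos.mono_set hIoc).continuousOn_besov h
  set X : ℝ → ℝ := fun t => (𝐁 s₀ (v t)).toReal
  set Y : ℝ → ℝ := fun t => (t - t₀) ^ α * (𝐁 (2 * ε) (v t)).toReal
  have hYc : ContinuousOn Y (Icc t₀ T) :=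
    (((continuous_id.sub continuous_const).rpow_const fun _ => Or.inr hα.le).continuousOn).mul hY
  have hXlt : ∀ t ∈ Icc t₀ T, 𝐁 s₀ (v t) < ∞ := fun t ht =>
    (hv.cont t (hIcc ht)).1.lt_top h
  have hYlt : ∀ t ∈ Icc t₀ T, 𝐁 (2 * ε) (v t) < ∞ := fun t ht =>
    (hv.cont_pos t (hIoc ht)).1.lt_top h
  by_contra hcon
  push Not at hcon
  obtain ⟨t', ht', hbad⟩ := hcon
  set S : Set ℝ := Icc t₀ T ∩ (fun t => max (X t) (Y t)) ⁻¹' Ici (A : ℝ) with hS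
  have hSc : IsClosed S := (hX.sup hYc).preimage_isClosed_of_isClosed isClosed_Icc isClosed_Ici
  have hScomp : IsCompact S := isCompact_Icc.of_isClosed_subset hSc Set.inter_subset_left
  have hSne : S.Nonempty := ⟨t', ht', by
    simp only [Set.mem_preimage, Set.mem_Ici, le_max_iff]; by_cases hx : X t' < A
    · exact Or.inr (hbad hx)
    · exact Or.inl (not_lt.1 hx)⟩
  obtain ⟨t₁, ht₁S, ht₁⟩ := hScomp.exists_isLeast hSne
  have hA0 : (0 : ℝ) < A := by exact_mod_cast one_pos.trans_le hA1
  have hA1' : (1 : ℝ) ≤ A := by exact_mod_cast hA1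
  have hC1 : (1 : ℝ) ≤ C := by exact_mod_cast E.one_le
  have hRA' : 4 * (C * R : ℝ) ≤ A := by exact_mod_cast hRA
  have hlt : t₀ < t₁ := by
    refine lt_of_le_of_ne ht₁S.1.1 fun heq => ?_
    have := ht₁S.2; rw [← heq] at this
    simp only [Set.mem_preimage, Set.mem_Ici, le_max_iff, Y, X, sub_self, Real.zero_rpow hα.ne',
      zero_mul] at this
    rcases this with h1 | h1
    · have h2 : (𝐁 s₀ (v t₀)).toReal ≤ R := ENNReal.toReal_le_coe_of_le_coe hR; nlinarith [R.2]
    · linarith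
  have hbelow : ∀ t ∈ Ioo t₀ t₁, 𝐁 (2 * ε) (v t) ≤ A * ofReal ((t - t₀) ^ (-α)) := by
    intro t ht; have htI : t ∈ Icc t₀ T := ⟨ht.1.le, ht.2.le.trans ht₁S.1.2⟩
    have hn : t ∉ S := fun hmem => absurd (ht₁ hmem) (not_le.2 ht.2); have hYt : Y t < A := by
      by_contra hge
      exact hn ⟨htI, le_max_of_le_right (not_lt.1 hge)⟩
    have hpos : 0 < t - t₀ := by linarith [ht.1]
    rw [← ofReal_toReal (hYlt t htI).ne, ← ofReal_coe_nnreal, ← ofReal_mul A.coe_nonneg]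
    refine ofReal_le_ofReal ?_
    rw [rpow_neg hpos.le, ← div_eq_mul_inv, le_div_iff₀ (rpow_pos_of_pos hpos _), mul_comm]
    exact hYt.le
  have hτ : 0 < t₁ - t₀ := by linarith
  have ht₁T := ht₁S.1.2; set F : ℝ → Dist := fun t' => nonlin c m (fun k l => z k l t') (v t')
  have hF : ∀ t' ∈ Ioo t₀ t₁, 𝐁 (-ε) (F t') ≤ C * κ * (A : 𝐄) ^ (2 * m - 1) *
      ofReal ((t' - t₀) ^ (-(α * (2 * m - 1 : ℕ)))) := by
    intro t ht; have hmem := (hv.cont_pos t (hIoc ⟨ht.1.le, ht.2.le.trans ht₁T⟩)).1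
    exact (E.nonlin _ κ (hz.at ⟨by linarith [ht.1], by linarith [ht.2]⟩) A 0 hA1 (t - t₀)
      (by linarith [ht.1]) (by linarith [ht.2]) _ _ hmem hmem (hbelow t ht) (hbelow t ht)
      (by rw [sub_self, besov_zero]; exact zero_le)).1
  obtain ⟨d1, d2, -⟩ := E.duh F t₀ t₁ _ hlt (by linarith)
    (fun n => hv.intervalIntegrable ht₀.le hlt.le ht₁T n) hF
  have hcoef : (C : 𝐄) * (C * κ * (A : 𝐄) ^ (2 * m - 1)) * ofReal ((t₁ - t₀) ^ δ) ≤
      ofReal (A / 4) := by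
    have e1 : (C : 𝐄) * (C * κ * (A : 𝐄) ^ (2 * m - 1)) =
        ofReal (C * (C * κ * A ^ (2 * m - 1))) := by
      rw [ofReal_mul C.coe_nonneg, ofReal_mul (by positivity), ofReal_mul C.coe_nonneg,
        ofReal_pow A.coe_nonneg]
      simp
    rw [e1, ← ofReal_mul (by positivity)]; refine ofReal_le_ofReal ?_
    have e2 : (A : ℝ) ^ (2 * m - 1) = A ^ (2 * m - 2) * A := by rw [← pow_succ]; congr 1; omega
    have e3 : (t₁ - t₀) ^ δ ≤ T ^ δ := rpow_le_rpow hτ.le (by linarith) hδ.le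
    calc (C : ℝ) * (C * κ * A ^ (2 * m - 1)) * (t₁ - t₀) ^ δ
        ≤ (C : ℝ) * (C * κ * A ^ (2 * m - 1)) * T ^ δ := by gcongr
      _ = (4 * (C ^ 2 * κ * A ^ (2 * m - 2)) * T ^ δ) * (A / 4) := by rw [e2]; ring
      _ ≤ 1 * (A / 4) := by gcongr
      _ = A / 4 := one_mul _
  have hCR : (C : 𝐄) * R ≤ ofReal (A / 4) := by
    rw [← ofReal_coe_nnreal, ← ofReal_coe_nnreal (p := R), ← ofReal_mul C.coe_nonneg]
    exact ofReal_le_ofReal (by linarith)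
  have hA4 : (0 : ℝ) ≤ A / 4 := by positivity
  have hres := hv.restart ht₀.le hlt.le ht₁T; have b1 : 𝐁 s₀ (v t₁) ≤ ofReal (A / 2) := by
    rw [hres]; refine (h.besov_add_le s₀ _ _).trans ?_
    rw [show (A : ℝ) / 2 = A / 4 + A / 4 by ring, ofReal_add hA4 hA4]; refine add_le_add ?_ ?_
    · exact (E.heat_low _ _ hτ.le).trans ((mul_le_mul_right hR _).trans hCR)
    · exact (besov_mono ϕ (by linarith) _).trans (d1.trans hcoef)
  have b2 : 𝐁 (2 * ε) (v t₁) ≤ ofReal (A / 2 * (t₁ - t₀) ^ (-α)) := by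
    rw [hres]; refine (h.besov_add_le _ _ _).trans ?_
    rw [show (A : ℝ) / 2 = A / 4 + A / 4 by ring, ofReal_mul (by positivity),
      ofReal_add hA4 hA4, add_mul]
    refine add_le_add ?_ ?_
    · refine (E.heat_high _ _ hτ (by linarith)).trans (mul_le_mul_left ?_ _)
      exact (mul_le_mul_right hR _).trans hCR
    · exact d2.trans (mul_le_mul_left hcoef _)
  have b1' : X t₁ ≤ A / 2 := ENNReal.toReal_le_of_le_ofReal (by positivity) b1
  have b2' : Y t₁ ≤ A / 2 := by
    have : (𝐁 (2 * ε) (v t₁)).toReal ≤ A / 2 * (t₁ - t₀) ^ (-α) :=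
      ENNReal.toReal_le_of_le_ofReal (by positivity) b2
    calc Y t₁ ≤ (t₁ - t₀) ^ α * (A / 2 * (t₁ - t₀) ^ (-α)) := by simp only [Y]; gcongr
      _ = A / 2 := by
        rw [rpow_neg hτ.le]
        have := (rpow_pos_of_pos hτ α).ne'; field_simp
  have := ht₁S.2; simp only [Set.mem_preimage, Set.mem_Ici, le_max_iff] at this
  rcases this with h1 | h1 <;> linarith

lemma IsMildSolution.apriori {κ A : ℝ≥0} (hz : NoiseBound ϕ ε m z κ) (hv : IsMildSolution ϕ a c m s₀
    ε z u₀ T v) (hT1 : T ≤ 1) {R : ℝ≥0} (hA1 : 1 ≤ A) (hRA : 4 * (C * R) ≤ A) (hsmall : (4 * (C ^ 2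
    * κ * A ^ (2 * m - 2)) : ℝ) * T ^ δ ≤ 1) (hR : 𝐁 s₀ (u₀ - z 1 0 0) < R) : ∀ t ∈ Ioc 0 T, 𝐁 s₀ (v
    t) ≤ A ∧ 𝐁 (2 * ε) (v t) ≤ A * ofReal (t ^ (-α)) := by
  intro t ht; have hT : 0 < T := ht.1.trans_le ht.2
  have hXt := (hv.cont t ⟨ht.1.le, ht.2⟩).1.lt_top h; have hYt := (hv.cont_pos t ht).1.lt_top h
  have hev : ∀ᶠ t₀ in 𝓝[>] (0 : ℝ), (𝐁 s₀ (v t)).toReal < A ∧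
      (t - t₀) ^ α * (𝐁 (2 * ε) (v t)).toReal < A := by
    have h0 := (hv.cont 0 ⟨le_rfl, hT.le⟩).2; obtain ⟨R', hR', hRR⟩ := exists_between hR
    have h1 : ∀ᶠ t₀ in 𝓝[Icc 0 T] (0 : ℝ), 𝐁 s₀ (v t₀) ≤ R := by
      filter_upwards [(tendsto_nhds_zero.1 h0) (R - 𝐁 s₀ (u₀ - z 1 0 0))
        (tsub_pos_of_lt hR)] with t₀ ht₀
      have := h.besov_add_le s₀ (v 0) (v t₀ - v 0); rw [add_sub_cancel] at this
      refine this.trans ?_; rw [hv.zero hT.le] at ht₀ ⊢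
      calc _ ≤ 𝐁 s₀ (u₀ - z 1 0 0) + (R - 𝐁 s₀ (u₀ - z 1 0 0)) := by gcongr
        _ = R := add_tsub_cancel_of_le hR.le
    have h2 : 𝓝[>] (0 : ℝ) ≤ 𝓝[Icc 0 T] (0 : ℝ) := by
      rw [← nhdsWithin_Ioc_eq_nhdsGT hT]; exact nhdsWithin_mono _ Set.Ioc_subset_Icc_self
    filter_upwards [h2 h1, Ioc_mem_nhdsGT ht.1] with t₀ h3 h4
    exact hv.apriori_of_pos h E hm hα hδ hε hεs hz hT1 hA1 hRA hsmall h4.1 (h4.2.trans ht.2) h3 t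
      ⟨h4.2, ht.2⟩
  constructor
  · obtain ⟨t₀, h1, -⟩ := hev.exists; rw [← ofReal_toReal hXt.ne, ← ofReal_coe_nnreal]
    exact ofReal_le_ofReal h1.le
  · have hlim : Tendsto (fun t₀ : ℝ => (t - t₀) ^ α * (𝐁 (2 * ε) (v t)).toReal) (𝓝[>] 0)
        (𝓝 ((t - 0) ^ α * (𝐁 (2 * ε) (v t)).toReal)) := by
      have : Continuous fun t₀ : ℝ => (t - t₀) ^ α * (𝐁 (2 * ε) (v t)).toReal :=
        ((continuous_const.sub continuous_id).rpow_const fun _ => Or.inr hα.le).mul continuous_const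
      exact (this.tendsto 0).mono_left nhdsWithin_le_nhds
    have hle := le_of_tendsto hlim (hev.mono fun _ hx => hx.2.le); rw [sub_zero] at hle
    rw [← ofReal_toReal hYt.ne, ← ofReal_coe_nnreal, ← ofReal_mul A.coe_nonneg]
    refine ofReal_le_ofReal ?_
    rw [rpow_neg ht.1.le, ← div_eq_mul_inv, le_div_iff₀ (rpow_pos_of_pos ht.1 _), mul_comm]
    exact hle

end Mild

/-- A ball of the solution space, for the part of the norm that carries the time weight. -/
structure InBall (ϕ : E2 → ℝ) (ε α T : ℝ) (A : ℝ≥0) (v : ℝ → Dist) : Prop where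
  cont : ContC ϕ (2 * ε) (Ioc 0 T) v
  high : ∀ t ∈ Ioc 0 T, besovNorm ϕ (2 * ε) (v t) ≤ A * ofReal (t ^ (-α))

abbrev nonlinPath (c : ℂ) (m : ℕ) (z : ℕ → ℕ → ℝ → Dist) (v : ℝ → Dist) (t : ℝ) : Dist :=
  nonlin c m (fun k l => z k l t) (v t)

/-- The right-hand side of the mild formulation with datum `w`. -/
def picard (a c : ℂ) (m : ℕ) (z : ℕ → ℕ → ℝ → Dist) (w : Dist) (v : ℝ → Dist) (t : ℝ) : Dist :=
  heat a t w + duh a (nonlinPath c m z v) 0 t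

lemma picard_zero (a c : ℂ) (m : ℕ) (z : ℕ → ℕ → ℝ → Dist) (w : Dist) (v : ℝ → Dist) : picard a c m
    z w v 0 = w := by rw [picard, heat_zero]; ext n; simp [duh]

lemma le_two_mul_of_le_add_quarter {D X : 𝐄} (hD : D ≠ ∞) (h : D ≤ X + 4⁻¹ * D) : D ≤ 2 * X := by
  rcases eq_or_ne X ∞ with rfl | hX
  · simp
  lift D to ℝ≥0 using hD
  lift X to ℝ≥0 using hX
  have h4 : (4⁻¹ : 𝐄) = ((4⁻¹ : ℝ≥0) : 𝐄) := by simp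
  rw [h4] at h; norm_cast at h ⊢
  rw [← NNReal.coe_le_coe] at h ⊢; push_cast at h ⊢; linarith [X.coe_nonneg, D.coe_nonneg]

lemma exists_rpow_neg_bound (x : ℝ) {I : Set ℝ} (ht : 0 < t) : ∃ B : 𝐄, B ≠ ∞ ∧ ∀ᶠ τ in 𝓝[I] t,
    ofReal (τ ^ x) ≤ B := by
  refine ⟨ofReal (t ^ x + 1), ofReal_ne_top, ?_⟩
  have hc : ContinuousAt (fun τ : ℝ => τ ^ x) t := Real.continuousAt_rpow_const _ _ (Or.inl ht.ne')
  have := hc.eventually (gt_mem_nhds (by linarith : t ^ x < t ^ x + 1))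
  filter_upwards [nhdsWithin_le_nhds this] with τ hτ; exact ofReal_le_ofReal hτ.le

lemma contC_Ioc_of_Icc {s T : ℝ} (H : ∀ t₁, 0 < t₁ → ContC ϕ s (Icc t₁ T) v) : ContC ϕ s (Ioc 0 T) v
    := by
  intro t ht; obtain ⟨h1, h2⟩ := H (t / 2) (by linarith [ht.1]) t ⟨by linarith [ht.1], ht.2⟩
  refine ⟨h1, h2.mono_left ?_⟩; rw [nhdsWithin_le_iff]
  filter_upwards [self_mem_nhdsWithin, nhdsWithin_le_nhds (lt_mem_nhds (show t / 2 < t by linarith [ht.1]))]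
    with τ h3 h4
  exact ⟨h4.le, h3.2⟩

section Mild

variable {a c : ℂ} {m : ℕ} {s₀ ε α δ : ℝ} {z : ℕ → ℕ → ℝ → Dist} {u₀ u₀' : Dist} {T : ℝ}
  {v v' w w' : ℝ → Dist} {C κ A : ℝ≥0}

local notation "Ball" => InBall ϕ ε α T A
local notation "𝒩" => nonlinPath c m z
local notation "Sol" => IsMildSolution ϕ a c m s₀ ε z

variable (h : IsDyadicCutoff ϕ) (E : FixedPointEst ϕ a c m s₀ ε α δ C) (hm : 2 ≤ m)
  (hδ : 0 < δ) (hε : 0 < ε) (hεs : ε < -s₀) (hb1 : α * (2 * m - 1 : ℕ) < 1)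
  (hz : NoiseBound ϕ ε m z κ) (hT1 : T ≤ 1) (hA1 : 1 ≤ A)
  (hsmall : (4 * (C ^ 2 * κ * A ^ (2 * m - 2)) : ℝ) * T ^ δ ≤ 1)

include hsmall in
lemma mul_ofReal_rpow_le_quarter (hδ : 0 < δ) (ht : t ∈ Ioc 0 T) : (C : 𝐄) * (C * κ * (A : 𝐄) ^ (2 *
    m - 2)) * ofReal (t ^ δ) ≤ 4⁻¹ := by
  have e1 : (C : 𝐄) * (C * κ * (A : 𝐄) ^ (2 * m - 2)) =
      ofReal (C * (C * κ * A ^ (2 * m - 2))) := by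
    rw [ofReal_mul C.coe_nonneg, ofReal_mul (by positivity),
      ofReal_mul C.coe_nonneg, ofReal_pow A.coe_nonneg]
    simp
  have e2 : (4 : 𝐄)⁻¹ = ofReal (1 / 4) := by rw [one_div, ofReal_inv_of_pos (by norm_num)]; simp
  rw [e1, e2, ← ofReal_mul (by positivity)]; refine ofReal_le_ofReal ?_
  have e3 : t ^ δ ≤ T ^ δ := rpow_le_rpow ht.1.le ht.2 hδ.le
  have : (C : ℝ) * (C * κ * A ^ (2 * m - 2)) * t ^ δ ≤ (C : ℝ) * (C * κ * A ^ (2 * m - 2)) * T ^ δ := by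
    gcongr
  have e : 4 * (C ^ 2 * κ * A ^ (2 * m - 2) : ℝ) * T ^ δ =
    4 * ((C : ℝ) * (C * κ * A ^ (2 * m - 2)) * T ^ δ) := by ring
  linarith

include h E hz hT1 hA1

lemma InBall.nonlinPath_le (hv : Ball v) (ht : t ∈ Ioc 0 T) : 𝐁 (-ε) (𝒩 v t) ≤ C * κ * (A : 𝐄) ^ (2
    * m - 1) * ofReal (t ^ (-(α * (2 * m - 1 : ℕ)))) :=
  (E.nonlin _ κ (hz.at ⟨ht.1.le, ht.2.trans hT1⟩) A 0 hA1 t ht.1 (ht.2.trans hT1) _ _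
    (hv.cont t ht).1 (hv.cont t ht).1 (hv.high t ht) (hv.high t ht)
    (by rw [sub_self, besov_zero]; exact zero_le)).1

include hε hb1 in
lemma InBall.intervalIntegrable (hT : 0 < T) (hv : Ball v) (n : ℤ²) : IntervalIntegrable (fun t' =>
    𝒩 v t' n) volume 0 T := by
  refine intervalIntegrable_of_besov_le h (s := -ε) hb1 hT.le
    (M := C * κ * (A : 𝐄) ^ (2 * m - 1)) (by finiteness) ?_ fun t ht => ?_
  · exact (contC_nonlin h hε c m (fun k l => (hz.1 k l).mono_set fun t ht => ht.1.le)
      hv.cont).continuousOn_coeff h n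
  · rw [sub_zero]; exact hv.nonlinPath_le h E hz hT1 hA1 ht

include hm hδ hsmall

include hεs in
lemma InBall.duh_sub_le (hv : Ball v) (hw : Ball w) (hvi : ∀ n, IntervalIntegrable (fun t' => 𝒩 v t'
    n) volume 0 T) (hwi : ∀ n, IntervalIntegrable (fun t' => 𝒩 w t' n) volume 0 T) {D : 𝐄} (hD : ∀ t
    ∈ Ioc 0 T, 𝐁 (2 * ε) (v t - w t) ≤ D * ofReal (t ^ (-α))) (ht : t ∈ Ioc 0 T) : 𝐁 s₀ (duh a (𝒩 v)
    0 t - duh a (𝒩 w) 0 t) ≤ 4⁻¹ * D ∧ 𝐁 (2 * ε) (duh a (𝒩 v) 0 t - duh a (𝒩 w) 0 t) ≤ 4⁻¹ * D *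
    ofReal (t ^ (-α)) := by
  have hmono : ∀ {f : ℝ → ℂ}, IntervalIntegrable f volume 0 T → IntervalIntegrable f volume 0 t :=
    fun hf => hf.mono_set (by
      rw [uIcc_of_le ht.1.le, uIcc_of_le (ht.1.le.trans ht.2)]; exact Set.Icc_subset_Icc_right ht.2)
  rw [← duh_sub a (fun n => hmono (hvi n)) fun n => hmono (hwi n)]
  have hcoef := mul_ofReal_rpow_le_quarter hsmall hδ ht
  have hF : ∀ t' ∈ Ioo 0 t, 𝐁 (-ε) (𝒩 v t' - 𝒩 w t') ≤
      C * κ * (A : 𝐄) ^ (2 * m - 2) * D * ofReal ((t' - 0) ^ (-(α * (2 * m - 1 : ℕ)))) := by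
    intro t' ht'; have hm' : t' ∈ Ioc 0 T := ⟨ht'.1, ht'.2.le.trans ht.2⟩; rw [sub_zero]
    exact (E.nonlin _ κ (hz.at ⟨hm'.1.le, hm'.2.trans hT1⟩) A D hA1 t' hm'.1 (hm'.2.trans hT1) _ _
      (hv.cont t' hm').1 (hw.cont t' hm').1 (hv.high t' hm') (hw.high t' hm') (hD t' hm')).2
  obtain ⟨d1, d2, -⟩ := E.duh (fun t' => 𝒩 v t' - 𝒩 w t') 0 t _ ht.1
    (by linarith [ht.2]) (fun n => (hmono (hvi n)).sub (hmono (hwi n))) hF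
  rw [sub_zero] at d1 d2
  have e : (C : 𝐄) * (C * κ * (A : 𝐄) ^ (2 * m - 2) * D) * ofReal (t ^ δ) ≤ 4⁻¹ * D := by
    calc _ = (C : 𝐄) * (C * κ * (A : 𝐄) ^ (2 * m - 2)) * ofReal (t ^ δ) * D := by ring
      _ ≤ _ := by gcongr
  exact ⟨(besov_mono ϕ (by linarith) _).trans (d1.trans e), d2.trans (mul_le_mul_left e _)⟩

include hε hb1 in
lemma InBall.duh_le (hv : Ball v) (ht : t ∈ Ioc 0 T) : 𝐁 (-ε) (duh a (𝒩 v) 0 t) ≤ 4⁻¹ * A ∧ 𝐁 (2 *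
    ε) (duh a (𝒩 v) 0 t) ≤ 4⁻¹ * A * ofReal (t ^ (-α)) ∧ 𝐁 (3 * ε) (duh a (𝒩 v) 0 t) ≤ C * (C * κ *
    (A : 𝐄) ^ (2 * m - 1)) := by
  have hT : 0 < T := ht.1.trans_le ht.2
  obtain ⟨d1, d2, d3⟩ := E.duh (𝒩 v) 0 t (C * κ * (A : 𝐄) ^ (2 * m - 1)) ht.1
    (by linarith [ht.2]) (fun n => (hv.intervalIntegrable h E hε hb1 hz hT1 hA1 hT n).mono_set (by
      rw [uIcc_of_le ht.1.le, uIcc_of_le hT.le]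
      exact Set.Icc_subset_Icc_right ht.2)) (fun t' ht' => by
      rw [sub_zero]; exact hv.nonlinPath_le h E hz hT1 hA1 ⟨ht'.1, ht'.2.le.trans ht.2⟩)
  rw [sub_zero] at d1 d2
  have e : (C : 𝐄) * (C * κ * (A : 𝐄) ^ (2 * m - 1)) * ofReal (t ^ δ) ≤ 4⁻¹ * A := by
    have e2 : (A : 𝐄) ^ (2 * m - 1) = (A : 𝐄) ^ (2 * m - 2) * A := by
      rw [← pow_succ]; congr 1; omega
    calc _ = (C : 𝐄) * (C * κ * (A : 𝐄) ^ (2 * m - 2)) * ofReal (t ^ δ) * A := by rw [e2]; ring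
      _ ≤ _ := by gcongr; exact mul_ofReal_rpow_le_quarter hsmall hδ ht
  exact ⟨d1.trans e, d2.trans (mul_le_mul_left e _), d3⟩

lemma IsMildSolution.lipschitz (hεs : ε < -s₀) (hv : Sol u₀ T v) (hv' : Sol u₀' T v') (hvA : ∀ t ∈
    Ioc 0 T, 𝐁 (2 * ε) (v t) ≤ A * ofReal (t ^ (-α))) (hvA' : ∀ t ∈ Ioc 0 T, 𝐁 (2 * ε) (v' t) ≤ A *
    ofReal (t ^ (-α))) (ht : t ∈ Ioc 0 T) : 𝐁 s₀ (v t - v' t) ≤ (2 * C : ℝ≥0) * 𝐁 s₀ (u₀ - u₀') ∧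
    ofReal (t ^ α) * 𝐁 (2 * ε) (v t - v' t) ≤ (2 * C : ℝ≥0) * 𝐁 s₀ (u₀ - u₀') := by
  have hball : Ball v := ⟨hv.cont_pos, hvA⟩; have hball' : Ball v' := ⟨hv'.cont_pos, hvA'⟩
  have hT : 0 < T := ht.1.trans_le ht.2
  have cancel : ∀ t ∈ Ioc 0 T, ofReal (t ^ α) * ofReal (t ^ (-α)) = 1 := by
    intro t ht; rw [← ofReal_mul (rpow_nonneg ht.1.le _), ← rpow_add ht.1]; simp
  set B := 𝐁 s₀ (u₀ - u₀') with hB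
  set D : 𝐄 := ⨆ t ∈ Ioc 0 T, ofReal (t ^ α) * 𝐁 (2 * ε) (v t - v' t)
    with hDdef
  have hDtop : D ≠ ∞ := by
    refine ne_top_of_le_ne_top (b := (A : 𝐄) + A) (by finiteness) (iSup₂_le fun t ht => ?_)
    calc _ ≤ ofReal (t ^ α) * (A * ofReal (t ^ (-α)) + A * ofReal (t ^ (-α))) := by
          gcongr; exact (h.besov_sub_le _ _ _).trans (add_le_add (hvA t ht) (hvA' t ht))
      _ = (A + A) * (ofReal (t ^ α) * ofReal (t ^ (-α))) := by ring
      _ = _ := by rw [cancel t ht, mul_one]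
  have hD : ∀ t ∈ Ioc 0 T, 𝐁 (2 * ε) (v t - v' t) ≤ D * ofReal (t ^ (-α)) := by
    intro t ht
    have := le_iSup₂ (f := fun t (_ : t ∈ Ioc 0 T) =>
      ofReal (t ^ α) * 𝐁 (2 * ε) (v t - v' t)) t ht
    calc _ = ofReal (t ^ α) * 𝐁 (2 * ε) (v t - v' t) * ofReal (t ^ (-α)) := by
          rw [mul_right_comm, cancel t ht, one_mul]
      _ ≤ _ := by gcongr
  have hdiff : ∀ t ∈ Ioc 0 T, v t - v' t = heat a t (u₀ - u₀') +
      (duh a (𝒩 v) 0 t - duh a (𝒩 v') 0 t) := by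
    intro t ht; rw [hv.eq_duh ⟨ht.1.le, ht.2⟩, hv'.eq_duh ⟨ht.1.le, ht.2⟩,
      show u₀ - u₀' = (u₀ - z 1 0 0) - (u₀' - z 1 0 0) by abel,
      heat_sub a t (u₀ - z 1 0 0) (u₀' - z 1 0 0)]
    abel
  have hd := fun t ht => hball.duh_sub_le h E hm hδ hεs hz hT1 hA1 hsmall hball'
    (fun n => hv.intervalIntegrable le_rfl hT.le le_rfl n)
    (fun n => hv'.intervalIntegrable le_rfl hT.le le_rfl n) hD (t := t) ht
  have hDle : D ≤ C * B + 4⁻¹ * D := by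
    refine iSup₂_le fun t ht => ?_; rw [hdiff t ht]
    calc _ ≤ ofReal (t ^ α) * (C * B * ofReal (t ^ (-α)) + 4⁻¹ * D * ofReal (t ^ (-α))) := by
          gcongr
          exact (h.besov_add_le _ _ _).trans (add_le_add (E.heat_high _ t ht.1 (ht.2.trans hT1))
            (hd t ht).2)
      _ = (C * B + 4⁻¹ * D) * (ofReal (t ^ α) * ofReal (t ^ (-α))) := by ring
      _ = _ := by rw [cancel t ht, mul_one]
  have hD2 : D ≤ 2 * (C * B) := le_two_mul_of_le_add_quarter hDtop hDle
  have hfin : (C : 𝐄) * B + 4⁻¹ * D ≤ (2 * C : ℝ≥0) * B := by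
    calc _ ≤ C * B + 4⁻¹ * (2 * (C * B)) := by gcongr
      _ = (1 + 4⁻¹ * 2) * (C * B) := by ring
      _ ≤ 2 * (C * B) := by
        gcongr; refine (add_le_add le_rfl (?_ : (4⁻¹ * 2 : 𝐄) ≤ 1)).trans_eq one_add_one_eq_two
        rw [mul_comm, ← div_eq_mul_inv]; exact ENNReal.div_le_of_le_mul (by norm_num)
      _ = _ := by push_cast; ring
  refine ⟨?_, ?_⟩
  · rw [hdiff t ht]
    refine ((h.besov_add_le _ _ _).trans (add_le_add (E.heat_low _ t ht.1.le) (hd t ht).1)).trans hfin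
  · refine (le_iSup₂ (f := fun t (_ : t ∈ Ioc 0 T) =>
      ofReal (t ^ α) * 𝐁 (2 * ε) (v t - v' t)) t ht).trans ?_
    rw [← hDdef]; exact hDle.trans hfin

variable (ha : 0 < a.re) (hT0 : 0 < T)
include hε hεs hb1 ha hT0

lemma InBall.contC_picard (hf : MemC ϕ s₀ f) (hv : Ball v) : ContC ϕ s₀ (Icc 0 T) (picard a c m z f
    v) ∧ ContC ϕ (2 * ε) (Ioc 0 T) (picard a c m z f v) := by
  have hd := fun t ht => hv.duh_le h E hm hδ hε hb1 hz hT1 hA1 hsmall (t := t) ht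
  have hduhc : ∀ n, ContinuousOn (fun t => duh a (𝒩 v) 0 t n) (Icc 0 T) :=
    fun n => continuousOn_duh a hT0.le n (hv.intervalIntegrable h E hε hb1 hz hT1 hA1 hT0 n)
  constructor
  · refine ContC.add h ((contC_heat h ha hf).mono_set fun t ht => ht.1)
      (contC_of_bdd h (by linarith : s₀ < -ε) hduhc fun t ht => ⟨4⁻¹ * A, by finiteness, ?_⟩)
    filter_upwards [self_mem_nhdsWithin] with τ hτ; rcases hτ.1.eq_or_lt with rfl | h0
    · have : duh a (𝒩 v) 0 0 = 0 := by ext n; simp [duh]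
      rw [this, besov_zero]; exact zero_le
    · exact (hd τ ⟨h0, hτ.2⟩).1
  · refine contC_of_bdd h (by linarith : 2 * ε < 3 * ε) (fun n => ?_) fun t ht => ?_
    · refine ContinuousOn.add ?_ ((hduhc n).mono Set.Ioc_subset_Icc_self)
      exact Continuous.continuousOn (by unfold heat; fun_prop)
    · obtain ⟨B, hB, hB'⟩ := exists_rpow_neg_bound (-(α + ε / 2)) (I := Ioc 0 T) ht.1
      have := hf.lt_top h
      refine ⟨C * 𝐁 s₀ f * B + C * (C * κ * (A : 𝐄) ^ (2 * m - 1)), by finiteness, ?_⟩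
      filter_upwards [self_mem_nhdsWithin, hB'] with τ hτ hτB
      refine (h.besov_add_le _ _ _).trans (add_le_add ?_ (hd τ hτ).2.2)
      exact (E.heat_top f τ hτ.1 (hτ.2.trans hT1)).trans (mul_le_mul_right hτB _)

lemma InBall.picard (hf : MemC ϕ s₀ f) {R : ℝ≥0} (hR : 𝐁 s₀ f ≤ R) (hRA : 4 * (C * R) ≤ A) (hv :
    Ball v) : Ball (picard a c m z f v) ∧ ∀ t ∈ Icc 0 T, 𝐁 s₀ (SCGL.picard a c m z f v t) ≤ A := by
  have hd := fun t ht => hv.duh_le h E hm hδ hε hb1 hz hT1 hA1 hsmall (t := t) ht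
  have hCR : (C : 𝐄) * 𝐁 s₀ f ≤ 4⁻¹ * A := by
    refine (mul_le_mul_right hR _).trans ?_
    rw [← ENNReal.mul_le_iff_le_inv (by norm_num) (by norm_num)]; exact_mod_cast hRA
  have h2 : (4⁻¹ : 𝐄) * A + 4⁻¹ * A ≤ A := by
    rw [← add_mul]; refine (mul_le_mul_left (?_ : (4⁻¹ + 4⁻¹ : 𝐄) ≤ 1) _).trans_eq (one_mul _)
    rw [← ENNReal.inv_two_add_inv_two]; gcongr <;> norm_num
  refine ⟨⟨(hv.contC_picard h E hm hδ hε hεs hb1 hz hT1 hA1 hsmall ha hT0 hf).2, fun t ht => ?_⟩,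
    fun t ht => ?_⟩
  · refine (h.besov_add_le _ _ _).trans ((add_le_add ((E.heat_high f t ht.1 (ht.2.trans hT1)).trans
      (mul_le_mul_left hCR _)) (hd t ht).2.1).trans ?_)
    rw [← add_mul]; exact mul_le_mul_left h2 _
  · rcases ht.1.eq_or_lt with rfl | h0
    · rw [picard_zero]; refine hR.trans ?_
      have : R ≤ A := by
        have := E.one_le; rw [← NNReal.coe_le_coe] at *
        push_cast at *
        nlinarith [R.coe_nonneg]
      exact_mod_cast this
    · exact (h.besov_add_le _ _ _).trans ((add_le_add ((E.heat_low f t h0.le).trans hCR)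
        ((besov_mono ϕ (by linarith) _).trans (hd t ⟨h0, ht.2⟩).1)).trans h2)

lemma InBall.picard_sub_le (hv : Ball v) (hw : Ball w) {D : 𝐄} (hD : ∀ t ∈ Ioc 0 T, 𝐁 (2 * ε) (v t -
    w t) ≤ D * ofReal (t ^ (-α))) : (∀ t ∈ Icc 0 T, 𝐁 s₀ (SCGL.picard a c m z f v t - SCGL.picard a
    c m z f w t) ≤ 4⁻¹ * D) ∧ ∀ t ∈ Ioc 0 T, 𝐁 (2 * ε) (SCGL.picard a c m z f v t - SCGL.picard a c
    m z f w t) ≤ 4⁻¹ * D * ofReal (t ^ (-α)) := by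
  have key := fun t ht => hv.duh_sub_le h E hm hδ hεs hz hT1 hA1 hsmall hw
    (fun n => hv.intervalIntegrable h E hε hb1 hz hT1 hA1 hT0 n)
    (fun n => hw.intervalIntegrable h E hε hb1 hz hT1 hA1 hT0 n) hD (t := t) ht
  have e : ∀ t, SCGL.picard a c m z f v t - SCGL.picard a c m z f w t =
      duh a (𝒩 v) 0 t - duh a (𝒩 w) 0 t := fun t => by simp only [SCGL.picard]; abel
  refine ⟨fun t ht => ?_, fun t ht => ?_⟩
  · rcases ht.1.eq_or_lt with rfl | h0
    · rw [picard_zero, picard_zero, sub_self, besov_zero]; exact zero_le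
    · rw [e]; exact (key t ⟨h0, ht.2⟩).1
  · rw [e]; exact (key t ht).2

lemma exists_mildSolution (hf : MemC ϕ s₀ (u₀ - z 1 0 0)) {R : ℝ≥0} (hR : besovNorm ϕ s₀ (u₀ - z 1 0
    0) ≤ R) (hRA : 4 * (C * R) ≤ A) : ∃ v, Sol u₀ T v := by
  set f := u₀ - z 1 0 0 with hfdef; set Φ : (ℝ → Dist) → ℝ → Dist := picard a c m z f with hΦ
  have hΦball : ∀ {v}, Ball v → Ball (Φ v) ∧
      ∀ t ∈ Icc 0 T, besovNorm ϕ s₀ (Φ v t) ≤ A := fun hv =>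
    hv.picard h E hm hδ hε hεs hb1 hz hT1 hA1 hsmall ha hT0 hf hR hRA
  have hΦsub := fun {v w} (hv : Ball v) (hw : Ball w) {D : 𝐄} hD =>
    hv.picard_sub_le (f := f) h E hm hδ hε hεs hb1 hz hT1 hA1 hsmall ha hT0 hw (D := D) hD
  set V : ℕ → ℝ → Dist := fun k => Φ^[k] 0 with hV
  have hVs : ∀ k, V (k + 1) = Φ (V k) := fun k => Function.iterate_succ_apply' _ _ _
  have h0ball : Ball 0 := ⟨fun t _ => ⟨MemC.zero ϕ _, by
    simp only [Pi.zero_apply, sub_self, besov_zero]; exact tendsto_const_nhds⟩, fun t _ => by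
    simp [besov_zero]⟩
  have hball : ∀ k, Ball (V k) := by
    intro k; induction k with
    | zero => exact h0ball
    | succ k ih => rw [hVs]; exact (hΦball ih).1
  set D : ℕ → 𝐄 := fun k => 4⁻¹ ^ k * A with hD
  have hstep : ∀ k, (∀ t ∈ Icc 0 T, besovNorm ϕ s₀ (V (k + 1) t - V k t) ≤ D k) ∧
      ∀ t ∈ Ioc 0 T, besovNorm ϕ (2 * ε) (V (k + 1) t - V k t) ≤ D k * ofReal (t ^ (-α)) := by
    intro k; induction k with
    | zero =>
      have e : V 0 = 0 := rfl; have hD0 : D 0 = A := by simp [hD]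
      refine ⟨fun t ht => ?_, fun t ht => ?_⟩
      · rw [hVs, e, hD0, Pi.zero_apply, sub_zero]; exact (hΦball h0ball).2 t ht
      · rw [hVs, e, hD0, Pi.zero_apply, sub_zero]; exact (hΦball h0ball).1.high t ht
    | succ k ih =>
      have hDs : D (k + 1) = 4⁻¹ * D k := by simp only [hD]; rw [pow_succ]; ring
      have := hΦsub (hball (k + 1)) (hball k) ih.2; rw [hDs, hVs (k + 1), hVs k]; rw [hVs k] at this
      exact this
  have hDsum : ∀ k j, ∑ i ∈ range j, D (k + i) ≤ 2 * D k := by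
    intro k j; have h4 : ∀ j, ∑ i ∈ range j, (4⁻¹ : 𝐄) ^ i ≤ 2 := by
      intro j
      calc _ ≤ ∑' i : ℕ, (4⁻¹ : 𝐄) ^ i := sum_le_tsum _
        _ ≤ ∑' i : ℕ, (2⁻¹ : 𝐄) ^ i := by gcongr; norm_num
        _ = 2 := by rw [ENNReal.tsum_geometric, ENNReal.one_sub_inv_two, inv_inv]
    calc _ = (∑ i ∈ range j, (4⁻¹ : 𝐄) ^ i) * D k := by
          rw [sum_mul]; refine sum_congr rfl fun i _ => ?_; simp only [hD]; rw [pow_add]; ring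
      _ ≤ _ := by gcongr; exact h4 j
  have htele : ∀ k j t, V (k + j) t - V k t = ∑ i ∈ range j, (V (k + i + 1) t - V (k + i) t) := by
    intro k j t; exact (Finset.sum_range_sub (fun i => V (k + i) t) j).symm
  have hdist : ∀ k j, (∀ t ∈ Icc 0 T, besovNorm ϕ s₀ (V (k + j) t - V k t) ≤ 2 * D k) ∧
      ∀ t ∈ Ioc 0 T, besovNorm ϕ (2 * ε) (V (k + j) t - V k t) ≤ 2 * D k * ofReal (t ^ (-α)) := by
    refine fun k j => ⟨fun t ht => ?_, fun t ht => ?_⟩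
    · rw [htele]
      exact (h.besov_sum_le _ _ _).trans ((sum_le_sum fun i _ => (hstep (k + i)).1 t ht).trans
        (hDsum k j))
    · rw [htele]
      refine (h.besov_sum_le _ _ _).trans ((sum_le_sum fun i _ => (hstep (k + i)).2 t ht).trans ?_)
      rw [← sum_mul]; exact mul_le_mul_left (hDsum k j) _
  have hDlim : ∀ X : 𝐄, X ≠ ∞ → Tendsto (fun k => X * D k) atTop (𝓝 0) := by
    intro X hX
    have : Tendsto (fun k : ℕ => (4⁻¹ : 𝐄) ^ k) atTop (𝓝 0) :=
      ENNReal.tendsto_pow_atTop_nhds_zero_of_lt_one (by norm_num)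
    have := ENNReal.Tendsto.const_mul (ENNReal.Tendsto.mul_const this
      (Or.inr (coe_ne_top (r := A)))) (Or.inr hX)
    simpa [hD] using this
  have hlim : ∀ t ∈ Icc 0 T, ∀ n, ∃ y, Tendsto (fun k => V k t n) atTop (𝓝 y) := by
    intro t ht n; obtain ⟨Cn, hCn⟩ := h.exists_coeff_le s₀ n
    refine cauchySeq_tendsto_of_complete (cauchySeq_of_edist_le_geometric 4⁻¹ (Cn * A) (by norm_num)
      (by finiteness) fun k => ?_)
    rw [edist_comm, edist_eq_enorm_sub]; refine (hCn (V (k + 1) t - V k t)).trans ?_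
    rw [mul_assoc, mul_comm (A : 𝐄)]; exact mul_le_mul_right ((hstep k).1 t ht) _
  choose! v hv using hlim; have hvV : ∀ k, (∀ t ∈ Icc 0 T, besovNorm ϕ s₀ (v t - V k t) ≤ 2 * D k) ∧
      ∀ t ∈ Ioc 0 T, besovNorm ϕ (2 * ε) (v t - V k t) ≤ 2 * D k * ofReal (t ^ (-α)) := by
    refine fun k => ⟨fun t ht => ?_, fun t ht => ?_⟩
    · refine h.besov_le_of_tendsto (l := atTop) (F := fun j => V (k + j) t - V k t) (fun n => ?_)
        tendsto_const_nhds (.of_forall fun j => (hdist k j).1 t ht)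
      have := (hv t ht n).comp (tendsto_add_atTop_nat k); simp only [add_comm k]
      exact this.sub_const _
    · refine h.besov_le_of_tendsto (l := atTop) (F := fun j => V (k + j) t - V k t) (fun n => ?_)
        tendsto_const_nhds (.of_forall fun j => (hdist k j).2 t ht)
      have := (hv t (Set.Ioc_subset_Icc_self ht) n).comp (tendsto_add_atTop_nat k)
      simp only [add_comm k]; exact this.sub_const _
  have small : ∀ X : 𝐄, X ≠ ∞ → ∀ δ' : 𝐄, 0 < δ' → ∃ k, X * D (k + 1) ≤ δ' := by
    intro X hX δ' hδ'; obtain ⟨k, hk⟩ := (((hDlim X hX).comp (tendsto_add_atTop_nat 1)).eventually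
      (gt_mem_nhds hδ')).exists
    exact ⟨k, hk.le⟩
  have hcs : ContC ϕ s₀ (Icc 0 T) v := by
    refine contC_of_unif h fun δ' hδ' => ?_; obtain ⟨k, hk⟩ := small 2 (by norm_num) δ' hδ'
    refine ⟨V (k + 1), ?_, fun t ht => ((hvV (k + 1)).1 t ht).trans hk⟩; rw [hVs]
    exact ((hball k).contC_picard h E hm hδ hε hεs hb1 hz hT1 hA1 hsmall ha hT0 hf).1
  have hαb : 0 ≤ α ∨ α < 0 := le_or_gt 0 α; have hc2 : ContC ϕ (2 * ε) (Ioc 0 T) v := by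
    refine contC_Ioc_of_Icc fun t₁ ht₁ => contC_of_unif h fun δ' hδ' => ?_
    obtain ⟨k, hk⟩ := small (2 * ofReal (max (t₁ ^ (-α)) (T ^ (-α)))) (by finiteness) δ' hδ'
    refine ⟨V (k + 1), (hball (k + 1)).cont.mono_set fun t ht => Set.mem_Ioc.2 ⟨ht₁.trans_le ht.1, ht.2⟩,
      fun t ht => ((hvV (k + 1)).2 t ⟨ht₁.trans_le ht.1, ht.2⟩).trans (le_trans ?_ hk)⟩
    rw [mul_right_comm]; gcongr; rcases hαb with hα | hα
    · exact le_max_of_le_left (rpow_le_rpow_of_nonpos ht₁ ht.1 (by linarith))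
    · exact le_max_of_le_right (rpow_le_rpow (ht₁.le.trans ht.1) ht.2 (by linarith))
  have hvball : Ball v := by
    refine ⟨hc2, fun t ht => ?_⟩; exact h.besov_le_of_tendsto (l := atTop) (F := fun j => V j t)
      (fun n => hv t (Set.Ioc_subset_Icc_self ht) n) tendsto_const_nhds
      (.of_forall fun j => (hball j).high t ht)
  have hfix : ∀ t ∈ Icc 0 T, v t = Φ v t := by
    intro t ht; rw [← sub_eq_zero]
    refine h.eq_zero_of_besov_eq_zero (s := s₀) (le_antisymm ?_ zero_le)
    refine ge_of_tendsto (hDlim 4 (by norm_num)) (.of_forall fun k => ?_)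
    have h1 := (hvV (k + 1)).1 t ht
    have h2 := (hΦsub (hball k) hvball (D := 2 * D k) (fun t ht => by
      rw [besov_sub_comm]; exact (hvV k).2 t ht)).1 t ht
    rw [hVs] at h1; refine (h.besov_triangle s₀ _ (Φ (V k) t) _).trans ((add_le_add h1 h2).trans ?_)
    have hD1 : D (k + 1) ≤ D k := by
      simp only [hD]; gcongr ?_ * _; exact pow_le_pow_right_of_le_one' (by norm_num) (by omega)
    calc 2 * D (k + 1) + 4⁻¹ * (2 * D k) ≤ 2 * D k + 1 * (2 * D k) := by gcongr; norm_num
      _ = 4 * D k := by ring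
  have hint := hvball.intervalIntegrable h E hε hb1 hz hT1 hA1 hT0
  refine ⟨v, hc2, hcs, fun t ht n => ?_, fun t ht n => ?_⟩
  · refine intervalIntegrable_exp_mul a ((hint n).mono_set ?_) t
    rw [uIcc_of_le ht.1, uIcc_of_le hT0.le]; exact Set.Icc_subset_Icc_right ht.2
  · exact congrFun (hfix t ht) n

end Mild



/-- Local well-posedness of the equation for `v`, for a fixed enhanced noise, with lifetime
`K max(1, ‖u₀‖)^{-θ}`. -/
def LWP (ϕ : E2 → ℝ) (a c : ℂ) (m : ℕ) (s₀ ε θ K : ℝ) (z : ℕ → ℕ → ℝ → Dist) : Prop :=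
  0 < K ∧
  (∀ u₀ : Dist, MemC ϕ s₀ u₀ →
    (∃ v : ℝ → Dist, IsMildSolution ϕ a c m s₀ ε z u₀ (lifetime ϕ s₀ θ K u₀) v) ∧
    ∀ v v' : ℝ → Dist, IsMildSolution ϕ a c m s₀ ε z u₀ (lifetime ϕ s₀ θ K u₀) v →
      IsMildSolution ϕ a c m s₀ ε z u₀ (lifetime ϕ s₀ θ K u₀) v' →
      Set.EqOn v v' (Icc 0 (lifetime ϕ s₀ θ K u₀))) ∧
  ∃ L : ℝ≥0, ∀ u₀ u₀' : Dist, MemC ϕ s₀ u₀ → MemC ϕ s₀ u₀' → ∀ v v' : ℝ → Dist,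
    IsMildSolution ϕ a c m s₀ ε z u₀ (lifetime ϕ s₀ θ K u₀) v →
    IsMildSolution ϕ a c m s₀ ε z u₀' (lifetime ϕ s₀ θ K u₀') v' →
    ∀ t : ℝ, 0 < t → t ≤ lifetime ϕ s₀ θ K u₀ → t ≤ lifetime ϕ s₀ θ K u₀' →
      besovNorm ϕ s₀ (v t - v' t) ≤ L * besovNorm ϕ s₀ (u₀ - u₀') ∧
      ofReal (t ^ ((2 * ε - s₀) / 2)) * besovNorm ϕ (2 * ε) (v t - v' t)
        ≤ L * besovNorm ϕ s₀ (u₀ - u₀')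

/-- Pathwise well-posedness, with an explicit dependence of the lifetime on the size of the
enhanced noise. -/
theorem IsDyadicCutoff.exists_lwp (h : Cutoff) (ha : 0 < a.re) (c : ℂ) {m : ℕ} (hm : 2 ≤ m) {s₀ ε α
    δ : ℝ} (hε : 0 < ε) (hεs : ε < -s₀) (hα : α = (2 * ε - s₀) / 2) (hδ : δ = 1 - α * (2 * m - 1 :
    ℕ) - 2 * ε) (hδ0 : 0 < δ) : ∃ B : ℝ, 1 ≤ B ∧ ∀ (z : ℕ → ℕ → ℝ → Dist) (κ : ℝ≥0), 1 ≤ κ →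
    NoiseBound ϕ ε m z κ → LWP ϕ a c m s₀ ε ((2 * m - 2 : ℕ) / δ) ((B * κ ^ (2 * m - 1)) ^ (-(1 /
    δ))) z := by
  obtain ⟨C, E⟩ := h.exists_fixedPointEst ha c hm hε hεs hα hδ hδ0
  have hα0 : 0 < α := by rw [hα]; linarith
  have hb1 : α * (2 * m - 1 : ℕ) < 1 := by linarith
  have hC1 : (1 : ℝ) ≤ C := by exact_mod_cast E.one_le
  set B : ℝ := 4 * (C ^ 2 * (12 * C) ^ (2 * m - 2)) with hB; have hB1 : 1 ≤ B := by
    have h1 : (1 : ℝ) ≤ C ^ 2 := one_le_pow₀ hC1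
    have h2 : (1 : ℝ) ≤ (12 * C) ^ (2 * m - 2) := one_le_pow₀ (by linarith)
    rw [hB]; nlinarith [one_le_mul_of_one_le_of_one_le h1 h2]
  refine ⟨B, hB1, fun z κ hκ hz => ?_⟩; have hκ1 : (1 : ℝ) ≤ κ := by exact_mod_cast hκ
  set K : ℝ := (B * κ ^ (2 * m - 1)) ^ (-(1 / δ)) with hK
  have hBκ : 1 ≤ B * κ ^ (2 * m - 1) := one_le_mul_of_one_le_of_one_le hB1 (one_le_pow₀ hκ1)
  have hK0 : 0 < K := rpow_pos_of_pos (by linarith) _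
  have hK1 : K ≤ 1 := Real.rpow_le_one_of_one_le_of_nonpos hBκ (by
    have : 0 < 1 / δ := by positivity
    linarith)
  have hKδ : K ^ δ = (B * κ ^ (2 * m - 1))⁻¹ := by
    rw [hK, ← rpow_mul (by linarith), neg_mul, one_div_mul_cancel hδ0.ne', Real.rpow_neg_one]
  set θ : ℝ := (2 * m - 2 : ℕ) / δ with hθ; have hθ0 : 0 ≤ θ := by positivity
  set U : Dist → ℝ≥0 := fun u => (max 1 (𝐁 s₀ u).toReal).toNNReal with hU
  have hUe : ∀ u, (U u : ℝ) = max 1 (𝐁 s₀ u).toReal := fun u =>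
    Real.coe_toNNReal _ (by positivity)
  have hU1 : ∀ u, 1 ≤ U u := fun u => by rw [← NNReal.coe_le_coe, hUe]; exact le_max_left _ _
  have hlife : ∀ u, lifetime ϕ s₀ θ K u = K * (U u : ℝ) ^ (-θ) := fun u => by rw [lifetime, hUe]
  have hlife0 : ∀ u, 0 < lifetime ϕ s₀ θ K u := fun u => by
    rw [hlife]
    have : (0 : ℝ) < U u := by exact_mod_cast one_pos.trans_le (hU1 u)
    positivity
  have hlife1 : ∀ u, lifetime ϕ s₀ θ K u ≤ 1 := fun u => by
    rw [hlife]; have h1 : (U u : ℝ) ^ (-θ) ≤ 1 :=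
      Real.rpow_le_one_of_one_le_of_nonpos (by exact_mod_cast hU1 u) (by linarith)
    have h2 : 0 ≤ (U u : ℝ) ^ (-θ) := by positivity
    nlinarith
  set A : Dist → ℝ≥0 := fun u => 12 * C * κ * U u with hA; have hA1 : ∀ u, 1 ≤ A u := fun u => by
    have := E.one_le
    calc (1 : ℝ≥0) = 1 * 1 * 1 * 1 := by norm_num
      _ ≤ 12 * C * κ * U u := by
        gcongr
        · norm_num
        · exact hU1 u
  have hsmall : ∀ u, (4 * (C ^ 2 * κ * (A u) ^ (2 * m - 2)) : ℝ) * lifetime ϕ s₀ θ K u ^ δ ≤ 1 := by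
    intro u; have hU0 : (0 : ℝ) < U u := by exact_mod_cast one_pos.trans_le (hU1 u)
    have e1 : lifetime ϕ s₀ θ K u ^ δ = (B * κ ^ (2 * m - 1))⁻¹ * ((U u : ℝ) ^ (2 * m - 2))⁻¹ := by
      rw [hlife, mul_rpow hK0.le (by positivity), hKδ, ← rpow_mul hU0.le, neg_mul, hθ,
        div_mul_cancel₀ _ hδ0.ne', rpow_neg hU0.le, rpow_natCast]
    have e2 : (κ : ℝ) ^ (2 * m - 1) = κ ^ (2 * m - 2) * κ := by rw [← pow_succ]; congr 1; omega
    rw [e1, e2, hB, hA]; push_cast; refine le_of_eq ?_; have hκ0 : (κ : ℝ) ≠ 0 := by linarith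
    have hC0 : (C : ℝ) ≠ 0 := by linarith
    rw [mul_pow _ (U u : ℝ), mul_pow _ (κ : ℝ)]
    have : (12 * C : ℝ) ^ (2 * m - 2) ≠ 0 := by positivity
    field_simp
  set R : Dist → ℝ≥0 := fun u => 3 * κ * U u with hR
  have hRA : ∀ u, 4 * (C * R u) ≤ A u := fun u => le_of_eq (by simp only [hR, hA]; ring)
  have hz0 : MemC ϕ s₀ (z 1 0 0) ∧ 𝐁 s₀ (z 1 0 0) ≤ κ := by
    obtain ⟨h1, h2⟩ := hz.at (t := 0) ⟨le_rfl, zero_le_one⟩ 1 (by omega) 0 (by omega)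
    exact ⟨h1.mono (by linarith), (besov_mono ϕ (by linarith) _).trans h2⟩
  have hdata : ∀ u, MemC ϕ s₀ u → 𝐁 s₀ (u - z 1 0 0) < R u := by
    intro u hu; have hut := hu.lt_top h; refine (h.besov_sub_le _ _ _).trans_lt ?_
    have h1 : 𝐁 s₀ u ≤ U u := by
      rw [← ofReal_toReal hut.ne, hU]
      exact coe_le_coe.2 (Real.toNNReal_le_toNNReal (le_max_right _ _))
    refine (add_le_add h1 hz0.2).trans_lt ?_
    have : U u + κ < 3 * κ * U u := by
      have := hU1 u; rw [← NNReal.coe_lt_coe]; rw [← NNReal.coe_le_coe] at this; push_cast at *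
      nlinarith
    exact_mod_cast this
  have apri : ∀ u w v T, MemC ϕ s₀ w → T ≤ lifetime ϕ s₀ θ K u → 0 < T →
      (U w ≤ U u) → IsMildSolution ϕ a c m s₀ ε z w T v →
      ∀ t ∈ Ioc 0 T, 𝐁 (2 * ε) (v t) ≤ A u * ofReal (t ^ (-α)) := by
    intro u w v T hw hT hT0 hUU hv t ht; have hRR : R w ≤ R u := by simp only [hR]; gcongr
    refine (hv.apriori h E hm hα0 hδ0 hε hεs hz (hT.trans (hlife1 u)) (hA1 u) (hRA u) ?_
      ((hdata w hw).trans_le (by exact_mod_cast hRR)) t ht).2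
    refine le_trans ?_ (hsmall u); gcongr
  have lip : ∀ u u' v v', MemC ϕ s₀ u → MemC ϕ s₀ u' →
      IsMildSolution ϕ a c m s₀ ε z u (lifetime ϕ s₀ θ K u) v →
      IsMildSolution ϕ a c m s₀ ε z u' (lifetime ϕ s₀ θ K u') v' →
      ∀ t : ℝ, 0 < t → t ≤ lifetime ϕ s₀ θ K u → t ≤ lifetime ϕ s₀ θ K u' →
      𝐁 s₀ (v t - v' t) ≤ (2 * C : ℝ≥0) * 𝐁 s₀ (u - u') ∧
      ofReal (t ^ α) * 𝐁 (2 * ε) (v t - v' t)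
        ≤ (2 * C : ℝ≥0) * 𝐁 s₀ (u - u') := by
    intro u u' v v' hu hu' hv hv' t ht htu htu'
    obtain ⟨w, hwT, hwT', hUw, hUw', hw'⟩ : ∃ w, lifetime ϕ s₀ θ K w ≤ lifetime ϕ s₀ θ K u ∧
        lifetime ϕ s₀ θ K w ≤ lifetime ϕ s₀ θ K u' ∧ U u ≤ U w ∧ U u' ≤ U w ∧
        t ≤ lifetime ϕ s₀ θ K w := by
      have mono : ∀ {x y}, U x ≤ U y → lifetime ϕ s₀ θ K y ≤ lifetime ϕ s₀ θ K x := by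
        intro x y hxy; rw [hlife, hlife]
        have : (0 : ℝ) < U x := by exact_mod_cast one_pos.trans_le (hU1 x)
        have := rpow_le_rpow_of_nonpos this (show (U x : ℝ) ≤ U y by exact_mod_cast hxy)
          (by linarith : -θ ≤ 0)
        gcongr
      rcases le_total (U u) (U u') with hle | hle
      · exact ⟨u', mono hle, le_rfl, hle, le_rfl, htu'⟩
      · exact ⟨u, le_rfl, mono hle, le_rfl, hle, htu⟩
    have hv1 := hv.mono hwT; have hv1' := hv'.mono hwT'
    exact hv1.lipschitz h E hm hδ0 hz (hlife1 w) (hA1 w) (hsmall w) hεs hv1'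
      (apri w u v _ hu le_rfl (hlife0 w) hUw hv1) (apri w u' v' _ hu' le_rfl (hlife0 w) hUw' hv1')
      ⟨ht, hw'⟩
  refine ⟨hK0, fun u hu => ⟨?_, fun v v' hv hv' t ht => ?_⟩, 2 * C, ?_⟩
  · exact exists_mildSolution h E hm hδ0 hε hεs hb1 hz (hlife1 u) (hA1 u) (hsmall u) ha (hlife0 u)
      (hu.sub h hz0.1) (hdata u hu).le (hRA u)
  · rcases ht.1.eq_or_lt with rfl | h0
    · rw [hv.zero (hlife0 u).le, hv'.zero (hlife0 u).le]
    · have := (lip u u v v' hu hu hv hv' t h0 ht.2 ht.2).1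
      rw [sub_self u, besov_zero, mul_zero] at this
      exact sub_eq_zero.1 (h.eq_zero_of_besov_eq_zero (le_antisymm this zero_le))
  · rw [← hα]
    exact fun u u' hu hu' v v' hv hv' t ht h1 h2 => lip u u' v v' hu hu' hv hv' t ht h1 h2

/-! ### The random lifetime -/

section Random

variable {Ω : Type*} [MeasurableSpace Ω] {P : Measure Ω}

lemma aemeasurable_besov (h : Cutoff) (s : ℝ) {f : Ω → Dist} (hf : ∀ n, AEMeasurable (fun ω => f ω
    n) P) : AEMeasurable (fun ω => 𝐁 s (f ω)) P := by
  have hsup : ∀ (j : ℕ) (g : Dist), supN (bl ϕ j g) =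
      ⨆ q : ℚ × ℚ, ‖ev (bl ϕ j g) ((q.1 : ℝ), (q.2 : ℝ))‖ₑ := by
    intro j g; refine le_antisymm (iSup_le fun x => ?_) (iSup_le fun q => ev_le_supN _ _)
    have hd : DenseRange fun q : ℚ × ℚ => ((q.1 : ℝ), (q.2 : ℝ)) :=
      Rat.denseRange_cast.prodMap Rat.denseRange_cast
    have hcont := continuous_ev (h.support_bl_finite j g)
    have hclosed : IsClosed {x | ‖ev (bl ϕ j g) x‖ₑ ≤
        ⨆ q : ℚ × ℚ, ‖ev (bl ϕ j g) ((q.1 : ℝ), (q.2 : ℝ))‖ₑ} :=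
      isClosed_le hcont.enorm continuous_const
    exact hd.induction_on (p := fun x => ‖ev (bl ϕ j g) x‖ₑ ≤
        ⨆ q : ℚ × ℚ, ‖ev (bl ϕ j g) ((q.1 : ℝ), (q.2 : ℝ))‖ₑ) x hclosed
      fun q => le_iSup (fun q : ℚ × ℚ => ‖ev (bl ϕ j g) ((q.1 : ℝ), (q.2 : ℝ))‖ₑ) q
  simp_rw [besovNorm_eq, hsup]
  refine AEMeasurable.iSup fun j => AEMeasurable.const_mul (AEMeasurable.iSup fun q => ?_) _
  refine AEMeasurable.enorm ?_; set S := (h.support_bl_finite j fun _ => 1).toFinset with hS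
  have hsub : ∀ f : Dist, support (bl ϕ j f) ⊆ S := by
    intro f n hn; rw [hS, Set.Finite.coe_toFinset]; simp only [mem_support, bl] at hn ⊢
    rw [mul_one]; exact left_ne_zero_of_mul hn
  simp_rw [ev_eq_sum S (hsub _), bl]
  exact Finset.aemeasurable_fun_sum _ fun n _ => ((hf n).const_mul _).mul_const _

lemma ContC.besov_le_iSup_rat (h : Cutoff) (hv : ContC ϕ s (Ici 0) v) (ht : t ∈ Icc (0 : ℝ) 1) : 𝐁 s
    (v t) ≤ ⨆ q : {q : ℚ // (q : ℝ) ∈ Icc (0 : ℝ) 1}, 𝐁 s (v q) := by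
  set M := ⨆ q : {q : ℚ // (q : ℝ) ∈ Icc (0 : ℝ) 1}, 𝐁 s (v q)
  have hmem : t ∈ closure (Icc (0 : ℝ) 1 ∩ Set.range ((↑) : ℚ → ℝ)) := by
    have h1 : Ioo (0 : ℝ) 1 ⊆ closure (Ioo (0 : ℝ) 1 ∩ Set.range ((↑) : ℚ → ℝ)) :=
      Rat.denseRange_cast.open_subset_closure_inter isOpen_Ioo
    have h2 := closure_mono h1; rw [closure_Ioo (by norm_num), closure_closure] at h2
    exact closure_mono (Set.inter_subset_inter_left _ Set.Ioo_subset_Icc_self) (h2 ht)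
  have : (𝓝[Icc (0 : ℝ) 1 ∩ Set.range ((↑) : ℚ → ℝ)] t).NeBot :=
    mem_closure_iff_nhdsWithin_neBot.1 hmem
  have hle : 𝓝[Icc (0 : ℝ) 1 ∩ Set.range ((↑) : ℚ → ℝ)] t ≤ 𝓝[Ici 0] t :=
    nhdsWithin_mono _ fun x hx => hx.1.1
  have hlim : Tendsto (fun τ => 𝐁 s (v τ - v t) + M)
      (𝓝[Icc (0 : ℝ) 1 ∩ Set.range ((↑) : ℚ → ℝ)] t) (𝓝 M) := by
    simpa using ((hv t ht.1).2.mono_left hle).add (tendsto_const_nhds (x := M))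
  refine ge_of_tendsto hlim ?_; filter_upwards [self_mem_nhdsWithin] with τ hτ
  obtain ⟨hτ1, q, rfl⟩ := hτ; have h1 : 𝐁 s (v q) ≤ M :=
    le_iSup (fun q : {q : ℚ // (q : ℝ) ∈ Icc (0 : ℝ) 1} => 𝐁 s (v q)) ⟨q, hτ1⟩
  have := h.besov_sub_le s (v q) (v q - v t); rw [sub_sub_cancel] at this; rw [add_comm]
  exact this.trans (add_le_add h1 le_rfl)

lemma ContC.exists_bound (h : Cutoff) (hv : ContC ϕ s (Ici 0) v) : ∃ B : 𝐄, B ≠ ∞ ∧ ∀ t ∈ Icc (0 :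
    ℝ) 1, 𝐁 s (v t) ≤ B := by
  have hc := (hv.mono_set (fun t (ht : t ∈ Icc (0 : ℝ) 1) => ht.1)).continuousOn_besov h
  obtain ⟨B, hB⟩ := isCompact_Icc.bddAbove_image hc
  refine ⟨ofReal B, ofReal_ne_top, fun t ht => ?_⟩; rw [← ofReal_toReal ((hv t ht.1).1.lt_top h).ne]
  exact ofReal_le_ofReal (hB ⟨t, ht, rfl⟩)

/-- A measurable random variable dominating the enhanced noise on `[0,1]`. -/
lemma exists_measurable_noiseBound (h : Cutoff) {ε : ℝ} (m : ℕ) {Z : ℕ → ℕ → ℝ → Ω → Dist} (hmeas :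
    ∀ k l t n, 0 ≤ t → AEMeasurable (fun ω => Z k l t ω n) P) (hcont : ∀ k l, ∀ᵐ ω ∂P, ContC ϕ (-ε)
    (Ici 0) (fun t => Z k l t ω)) : ∃ κ : Ω → ℝ≥0, Measurable κ ∧ ∀ᵐ ω ∂P, 1 ≤ κ ω ∧ NoiseBound ϕ ε
    m (fun k l t => Z k l t ω) (κ ω) := by
  set M : Ω → 𝐄 := fun ω => 1 + ∑ k ∈ range (m + 1), ∑ l ∈ range (m + 1),
    ⨆ q : {q : ℚ // (q : ℝ) ∈ Icc (0 : ℝ) 1}, 𝐁 (-ε) (Z k l q ω) with hM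
  have hMm : AEMeasurable M P := by
    refine AEMeasurable.const_add (Finset.aemeasurable_fun_sum _ fun k _ =>
      Finset.aemeasurable_fun_sum _ fun l _ => ?_) _
    exact AEMeasurable.iSup fun q : {q : ℚ // (q : ℝ) ∈ Icc (0 : ℝ) 1} =>
      aemeasurable_besov h _ fun n => hmeas k l _ n q.2.1
  refine ⟨fun ω => (hMm.mk M ω).toNNReal, hMm.measurable_mk.ennreal_toNNReal, ?_⟩
  filter_upwards [hMm.ae_eq_mk, ae_all_iff.2 fun k => ae_all_iff.2 (hcont k)] with ω hω hc
  rw [← hω]; have hMt : M ω ≠ ∞ := by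
    simp only [hM]; refine add_ne_top.2 ⟨ENNReal.one_ne_top, (sum_lt_top.2 fun k _ =>
      sum_lt_top.2 fun l _ => ?_).ne⟩
    obtain ⟨B, hB, hB'⟩ := (hc k l).exists_bound h
    exact (iSup_le fun q : {q : ℚ // (q : ℝ) ∈ Icc (0 : ℝ) 1} => hB' q q.2).trans_lt hB.lt_top
  refine ⟨?_, hc, fun k hk l hl t ht => ?_⟩
  · rw [← coe_le_coe, coe_toNNReal hMt]; exact le_self_add
  · rw [coe_toNNReal hMt]; refine ((hc k l).besov_le_iSup_rat h ht).trans ?_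
    refine le_trans ?_ (le_add_self : _ ≤ M ω)
    exact (Finset.single_le_sum_of_canonicallyOrdered (f := fun l =>
      ⨆ q : {q : ℚ // (q : ℝ) ∈ Icc (0 : ℝ) 1}, 𝐁 (-ε) (Z k l q ω))
      (mem_range.2 (by omega : l < m + 1))).trans
      (Finset.single_le_sum_of_canonicallyOrdered (f := fun k => ∑ l ∈ range (m + 1),
        ⨆ q : {q : ℚ // (q : ℝ) ∈ Icc (0 : ℝ) 1}, 𝐁 (-ε) (Z k l q ω))
      (mem_range.2 (by omega : k < m + 1)))

end Random

theorem exists_random_lifetime {m : ℕ} (hm : 2 ≤ m) {s₀ : ℝ} (hs₀ : -2 / (2 * (m : ℝ) - 1) < s₀)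
    (hs₀_neg : s₀ < 0) : ∃ ε₀ : ℝ, 0 < ε₀ ∧ ∀ ε : ℝ, 0 < ε → ε < ε₀ → ∃ θ : ℝ, 0 < θ ∧ ∀ (a c : ℂ),
    0 < a.re → ∀ ϕ : E2 → ℝ, IsDyadicCutoff ϕ → ∀ (Ω : Type*) [MeasurableSpace Ω] (P : Measure Ω) (Z
    : ℕ → ℕ → ℝ → Ω → Dist), (∀ k l t n, 0 ≤ t → AEMeasurable (fun ω => Z k l t ω n) P) → (∀ k l, ∀ᵐ
    ω ∂P, ContC ϕ (-ε) (Ici 0) (fun t => Z k l t ω)) → ∃ K : Ω → ℝ, Measurable K ∧ ∀ᵐ ω ∂P, LWP ϕ a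
    c m s₀ ε θ (K ω) (fun k l t => Z k l t ω) := by
  have hm' : (2 : ℝ) ≤ m := by exact_mod_cast hm
  have hp : ((2 * m - 1 : ℕ) : ℝ) = 2 * m - 1 := by rw [Nat.cast_sub (by omega)]; push_cast; ring
  have hgap : 0 < 2 + s₀ * (2 * m - 1) := by rw [div_lt_iff₀ (by linarith)] at hs₀; linarith
  refine ⟨min (-s₀) ((2 + s₀ * (2 * m - 1)) / (2 * (2 * m + 1))), lt_min (by linarith)
    (by positivity), fun ε hε hεε => ?_⟩
  have hεs : ε < -s₀ := hεε.trans_le (min_le_left _ _); have hε2 := hεε.trans_le (min_le_right _ _)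
  rw [lt_div_iff₀ (by positivity)] at hε2; set α : ℝ := (2 * ε - s₀) / 2 with hα
  set δ : ℝ := 1 - α * (2 * m - 1 : ℕ) - 2 * ε with hδ
  have hδ0 : 0 < δ := by rw [hδ, hp, hα]; nlinarith
  refine ⟨(2 * m - 2 : ℕ) / δ, div_pos (by exact_mod_cast (by omega : 0 < 2 * m - 2)) hδ0, ?_⟩
  intro a c ha ϕ h Ω _ P Z hmeas hcont
  obtain ⟨B, hB, hlwp⟩ := h.exists_lwp ha c hm hε hεs hα hδ hδ0
  obtain ⟨κ, hκ, hκ'⟩ := exists_measurable_noiseBound h m hmeas hcont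
  refine ⟨fun ω => (B * κ ω ^ (2 * m - 1)) ^ (-(1 / δ)), ?_, ?_⟩
  · exact ((hκ.coe_nnreal_real.pow_const _).const_mul B).pow_const _
  · filter_upwards [hκ'] with ω hω; exact hlwp _ _ hω.1 hω.2

/-! ### Polynomials in independent standard Gaussian variables -/

section GaussPoly

lemma integrable_pow_gaussianReal (k : ℕ) : Integrable (fun x : ℝ => x ^ k) (gaussianReal 0 1) := by
  have h := (memLp_id_gaussianReal (μ := 0) (v := 1) (k : ℝ≥0)).integrable_norm_pow'
  refine (integrable_norm_iff (by fun_prop)).1 (h.congr ?_); filter_upwards with x; simp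

lemma integral_pow_gaussianReal_succ (k : ℕ) : ∫ x : ℝ, x ^ (k + 1) ∂gaussianReal 0 1 = k * ∫ x : ℝ,
    x ^ (k - 1) ∂gaussianReal 0 1 := by
  have hd : ∀ x, HasDerivAt (gaussianPDFReal 0 1) (-x * gaussianPDFReal 0 1 x) x := by
    intro x; have h0 : gaussianPDFReal 0 1 = fun x => (√(2 * π))⁻¹ * Real.exp (-(x ^ 2) / 2) := by
      ext y; simp [gaussianPDFReal]
    rw [h0]; have h1 : HasDerivAt (fun x : ℝ => -(x ^ 2) / 2) (-x) x :=
      ((hasDerivAt_pow 2 x).neg.div_const 2).congr_deriv (by push_cast; ring)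
    exact (h1.exp.const_mul _).congr_deriv (by ring)
  have hi : ∀ j : ℕ, Integrable (fun x : ℝ => x ^ j * gaussianPDFReal 0 1 x) := by
    intro j; have h := integrable_pow_gaussianReal j; rw [gaussianReal_of_var_ne_zero _ one_ne_zero,
      integrable_withDensity_iff (measurable_gaussianPDF 0 1)
        (ae_of_all _ fun x => gaussianPDF_lt_top)] at h
    simpa [toReal_gaussianPDF] using h
  have hI : ∀ j : ℕ, ∫ x : ℝ, x ^ j ∂gaussianReal 0 1 = ∫ x : ℝ, x ^ j * gaussianPDFReal 0 1 x := by
    intro j; rw [integral_gaussianReal_eq_integral_smul one_ne_zero]; simp [mul_comm]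
  have key := integral_mul_deriv_eq_deriv_mul_of_integrable (u := fun x : ℝ => x ^ k)
    (u' := fun x : ℝ => k * x ^ (k - 1)) (v := gaussianPDFReal 0 1)
    (v' := fun x => -x * gaussianPDFReal 0 1 x) (fun x _ => hasDerivAt_pow k x) (fun x _ => hd x)
    (((hi (k + 1)).neg).congr (ae_of_all _ fun x => by
      simp only [Pi.neg_apply, Pi.mul_apply, pow_succ]; ring))
    (((hi (k - 1)).const_mul (k : ℝ)).congr (ae_of_all _ fun x => by
      simp only [Pi.mul_apply]; ring))
    ((hi k).congr (ae_of_all _ fun x => by simp))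
  rw [hI, hI]; have e1 : ∫ x : ℝ, x ^ k * (-x * gaussianPDFReal 0 1 x) =
      -∫ x : ℝ, x ^ (k + 1) * gaussianPDFReal 0 1 x := by rw [← integral_neg]; congr 1; ext x; ring
  have e2 : ∫ x : ℝ, k * x ^ (k - 1) * gaussianPDFReal 0 1 x =
      k * ∫ x : ℝ, x ^ (k - 1) * gaussianPDFReal 0 1 x := by
    rw [← integral_const_mul]; congr 1; ext x; ring
  rw [e1, e2] at key; linarith

open MvPolynomial in
/-- Evaluation of a complex polynomial at a real point. -/
def pev {ι : Type*} (F : MvPolynomial ι ℂ) (x : ι → ℝ) : ℂ := eval (fun i => (x i : ℂ)) F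

variable {ι : Type*} [Fintype ι]

local notation "𝐏" => MvPolynomial ι ℂ

/-- The standard Gaussian measure on `ι → ℝ`. -/
abbrev stdG (ι : Type*) [Fintype ι] : Measure (ι → ℝ) := Measure.pi fun _ => gaussianReal 0 1

/-- Gaussian expectation of a polynomial. -/
def gE (F : 𝐏) : ℂ := ∫ x, pev F x ∂stdG ι

open MvPolynomial

omit [Fintype ι] in
lemma pev_mul (F G : 𝐏) (x : ι → ℝ) : pev (F * G) x = pev F x * pev G x :=
  map_mul _ _ _

omit [Fintype ι] in
lemma pev_pow (F : 𝐏) (q : ℕ) (x : ι → ℝ) : pev (F ^ q) x = pev F x ^ q :=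
  map_pow _ _ _

omit [Fintype ι] in
lemma pev_sum {κ : Type*} (s : Finset κ) (F : κ → 𝐏) (x : ι → ℝ) :
    pev (∑ r ∈ s, F r) x = ∑ r ∈ s, pev (F r) x := map_sum _ _ _

lemma continuous_pev (F : 𝐏) : Continuous (pev F) := by unfold pev; simp only [eval_eq']; fun_prop

lemma integrable_monomial_stdG (d : ι →₀ ℕ) : Integrable (fun x : ι → ℝ => ∏ i, (x i : ℂ) ^ d i)
    (stdG ι) := by
  refine Integrable.fintype_prod (f := fun i (x : ℝ) => (x : ℂ) ^ d i) fun i => ?_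
  have := (integrable_pow_gaussianReal (d i)).ofReal (𝕜 := ℂ)
  refine this.congr (ae_of_all _ fun x => by simp)

lemma integrable_pev (F : 𝐏) : Integrable (pev F) (stdG ι) := by
  unfold pev; simp only [eval_eq']
  exact integrable_finsetSum _ fun d _ => (integrable_monomial_stdG d).const_mul _

lemma gE_add (F G : 𝐏) : gE (F + G) = gE F + gE G := by
  unfold gE; rw [← integral_add (integrable_pev F) (integrable_pev G)]; simp [pev]

lemma gE_C_mul (c : ℂ) (F : 𝐏) : gE (C c * F) = c * gE F := by
  unfold gE; rw [← integral_const_mul]; simp [pev]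

lemma gE_sum {κ : Type*} (s : Finset κ) (F : κ → 𝐏) : gE (∑ r ∈ s, F r) = ∑ r ∈ s, gE (F r) := by
  unfold gE; rw [← integral_finsetSum _ fun r _ => integrable_pev _]; simp [pev_sum]

lemma gE_C (c : ℂ) : gE (C c : 𝐏) = c := by simp [gE, pev]

lemma gE_monomial (d : ι →₀ ℕ) (c : ℂ) : gE (monomial d c) = c * ∏ i, ((∫ x : ℝ, x ^ d i
    ∂gaussianReal 0 1 : ℝ) : ℂ) := by
  unfold gE pev; simp only [eval_monomial, Finsupp.prod_fintype _ _ (fun i => pow_zero _)]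
  rw [integral_const_mul, integral_fintype_prod_eq_prod (fun i (x : ℝ) => (x : ℂ) ^ d i)]; congr 1
  refine Finset.prod_congr rfl fun i _ => ?_; rw [← integral_complex_ofReal]; simp

lemma gE_X_mul (i : ι) (F : 𝐏) : gE (X i * F) = gE (pderiv i F) := by
  classical
  induction F using MvPolynomial.induction_on' with
  | monomial d c =>
    rw [mul_comm, ← pow_one (X i), ← monomial_add_single, pderiv_monomial, gE_monomial, gE_monomial]
    rw [← Finset.mul_prod_erase _ _ (mem_univ i), ← Finset.mul_prod_erase _ _ (mem_univ i)]
    have h1 : ∀ j ∈ Finset.univ.erase i,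
        ((∫ x : ℝ, x ^ (d + Finsupp.single i 1 : ι →₀ ℕ) j ∂gaussianReal 0 1 : ℝ) : ℂ) =
        ((∫ x : ℝ, x ^ (d - Finsupp.single i 1 : ι →₀ ℕ) j ∂gaussianReal 0 1 : ℝ) : ℂ) := by
      simp_all
    rw [Finset.prod_congr rfl h1]
    have h2 : (d + Finsupp.single i 1 : ι →₀ ℕ) i = d i + 1 := by simp
    have h3 : (d - Finsupp.single i 1 : ι →₀ ℕ) i = d i - 1 := by simp
    rw [h2, h3, integral_pow_gaussianReal_succ]; push_cast; ring
  | add F G hF hG => rw [mul_add, gE_add, hF, hG, map_add, gE_add]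

/-- The polynomial with conjugate coefficients. -/
def cj (F : 𝐏) : 𝐏 := map conj F

omit [Fintype ι] in
lemma pev_cj (F : 𝐏) (x : ι → ℝ) : pev (cj F) x = conj (pev F x) := by
  unfold pev cj; rw [map_eval]; congr 2; ext i; simp

omit [Fintype ι] in
lemma pderiv_cj (i : ι) (F : 𝐏) : pderiv i (cj F) = cj (pderiv i F) :=
  pderiv_map

omit [Fintype ι] in
lemma norm_pev_cj (F : 𝐏) (x : ι → ℝ) : ‖pev (cj F) x‖ = ‖pev F x‖ := by
  rw [pev_cj, RCLike.norm_conj]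

/-- Even absolute moments of a polynomial. -/
def gM (q : ℕ) (F : 𝐏) : ℝ := ∫ x, ‖pev F x‖ ^ (2 * q) ∂stdG ι

lemma gM_nonneg (q : ℕ) (F : 𝐏) : 0 ≤ gM q F :=
  integral_nonneg fun _ => by positivity

lemma integrable_norm_pev_mul (p r : ℕ) (F H : 𝐏) : Integrable (fun x => ‖pev F x‖ ^ p * ‖pev H x‖ ^
    r) (stdG ι) :=
  (integrable_pev (F ^ p * H ^ r)).norm.congr (ae_of_all _ fun x => by
    simp [pev_mul, pev_pow])

lemma integrable_norm_pev_pow (p : ℕ) (F : 𝐏) : Integrable (fun x => ‖pev F x‖ ^ p) (stdG ι) := by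
  simpa using integrable_norm_pev_mul p 0 F F

lemma gE_mul_cj (p : ℕ) (F : 𝐏) : gE (F * (F ^ p * cj F ^ (p + 1))) = (gM (p + 1) F : ℂ) := by
  unfold gE gM; rw [← integral_complex_ofReal]; refine integral_congr_ae (ae_of_all _ fun x => ?_)
  simp only [pev_mul, pev_pow, pev_cj]; push_cast; rw [pow_mul, ← mul_conj']; ring

/-- The homogeneous Wiener chaos of degree `D`: eigenfunctions of the Ornstein-Uhlenbeck operator
all of whose iterated derivatives are eigenfunctions. -/
def IsChaos : ℕ → 𝐏 → Prop
  | 0, F => ∃ c, F = C c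
  | D + 1, F => ∑ i, (X i * pderiv i F - pderiv i (pderiv i F)) = C ((D + 1 : ℕ) : ℂ) * F ∧
      ∀ i, IsChaos D (pderiv i F)

lemma IsChaos.add {D : ℕ} {F G : 𝐏} (hF : IsChaos D F) (hG : IsChaos D G) : IsChaos D (F + G) := by
  induction D generalizing F G with
  | zero =>
    obtain ⟨c, rfl⟩ := hF; obtain ⟨d, rfl⟩ := hG; exact ⟨c + d, by simp⟩
  | succ D ih =>
    refine ⟨?_, fun i => by rw [map_add]; exact ih (hF.2 i) (hG.2 i)⟩
    rw [mul_add, ← hF.1, ← hG.1, ← sum_add_distrib]; refine sum_congr rfl fun i _ => ?_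
    simp only [map_add]; ring

lemma IsChaos.C_mul {D : ℕ} {F : 𝐏} (c : ℂ) (hF : IsChaos D F) : IsChaos D (C c * F) := by
  induction D generalizing F with
  | zero =>
    obtain ⟨d, rfl⟩ := hF; exact ⟨c * d, by simp⟩
  | succ D ih =>
    refine ⟨?_, fun i => by
      rw [pderiv_C_mul]; exact ih (hF.2 i)⟩
    rw [mul_left_comm, ← hF.1, mul_sum]; refine sum_congr rfl fun i _ => ?_
    simp only [pderiv_C_mul]; ring

lemma isChaos_zero (D : ℕ) : IsChaos D (0 : 𝐏) := by
  induction D with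
  | zero => exact ⟨0, by simp⟩
  | succ D ih => exact ⟨by simp, fun i => by simpa using ih⟩

lemma IsChaos.sum {D : ℕ} {κ : Type*} (s : Finset κ) {F : κ → 𝐏} (hF : ∀ r ∈ s, IsChaos D (F r)) :
    IsChaos D (∑ r ∈ s, F r) := by
  classical
  induction s using Finset.induction_on with
  | empty => simpa using isChaos_zero D
  | insert a s ha ih =>
    rw [sum_insert ha]; exact (hF a (Finset.mem_insert_self a s)).add
      (ih fun r hr => hF r (Finset.mem_insert_of_mem hr))

lemma gE_eigen {F : 𝐏} {c : ℂ} (hF : ∑ i, (X i * pderiv i F - pderiv i (pderiv i F)) = C c * F) (G :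
    𝐏) : c * gE (F * G) = ∑ i, gE (pderiv i F * pderiv i G) := by
  have h1 : c * gE (F * G) = gE (∑ i, (X i * pderiv i F - pderiv i (pderiv i F)) * G) := by
    rw [← sum_mul, hF, mul_assoc, gE_C_mul]
  rw [h1, gE_sum]; refine sum_congr rfl fun i _ => ?_; have h2 := gE_X_mul i (pderiv i F * G)
  rw [pderiv_mul, gE_add] at h2; have h3 : (X i * pderiv i F - pderiv i (pderiv i F)) * G =
      X i * (pderiv i F * G) + C (-1) * (pderiv i (pderiv i F) * G) := by
    simp only [map_neg, map_one]; ring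
  rw [h3, gE_add, gE_C_mul, h2]; ring

lemma sum_gM_one {F : 𝐏} {D : ℕ} (hF : ∑ i, (X i * pderiv i F - pderiv i (pderiv i F)) = C (D : ℂ) *
    F) : ∑ i, gM 1 (pderiv i F) = D * gM 1 F := by
  have h := gE_eigen hF (cj F); have h0 : ∀ G : 𝐏, gE (G * cj G) = (gM 1 G : ℂ) := fun G => by
    simpa using gE_mul_cj 0 G
  simp only [pderiv_cj, h0] at h; exact_mod_cast h.symm

lemma eigen_mul_gM_le {F : 𝐏} {D : ℕ} (hF : ∑ i, (X i * pderiv i F - pderiv i (pderiv i F)) = C (D :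
    ℂ) * F) (p : ℕ) : D * gM (p + 1) F ≤ (2 * p + 1) * ∑ i, ∫ x, ‖pev F x‖ ^ (2 * p) * ‖pev (pderiv
    i F) x‖ ^ 2 ∂stdG ι := by
  have h := gE_eigen hF (F ^ p * cj F ^ (p + 1)); rw [gE_mul_cj] at h
  have h1 : (D : ℝ) * gM (p + 1) F = ‖(D : ℂ) * (gM (p + 1) F : ℂ)‖ := by
    rw [norm_mul, Complex.norm_natCast, norm_real, norm_of_nonneg (gM_nonneg _ _)]
  rw [h1, h, mul_sum]; refine (norm_sum_le _ _).trans (sum_le_sum fun i _ => ?_); unfold gE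
  rw [← integral_const_mul]
  refine norm_integral_le_of_norm_le ((integrable_norm_pev_mul (2 * p) 2 F _).const_mul _)
    (ae_of_all _ fun x => ?_)
  have h2 : pderiv i (F ^ p * cj F ^ (p + 1)) =
      (p : 𝐏) * F ^ (p - 1) * pderiv i F * cj F ^ (p + 1) +
        ((p + 1 : ℕ) : 𝐏) * (F ^ p * cj F ^ p * cj (pderiv i F)) := by
    rw [pderiv_mul, pderiv_pow, pderiv_pow, pderiv_cj, Nat.add_sub_cancel]; ring
  have h3 : ∀ n : ℕ, pev (n : 𝐏) x = n := fun n => map_natCast _ n; rw [pev_mul, h2, norm_mul]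
  have h4 : ‖pev ((p : 𝐏) * F ^ (p - 1) * pderiv i F * cj F ^ (p + 1) +
        ((p + 1 : ℕ) : 𝐏) * (F ^ p * cj F ^ p * cj (pderiv i F))) x‖ ≤
      (2 * p + 1) * (‖pev F x‖ ^ (2 * p) * ‖pev (pderiv i F) x‖) := by
    have h5 : ∀ A B : 𝐏, pev (A + B) x = pev A x + pev B x :=
      fun A B => map_add _ _ _
    rw [h5]; refine (norm_add_le _ _).trans_eq ?_
    simp only [pev_mul, pev_pow, norm_mul, norm_pow, norm_pev_cj, h3, Complex.norm_natCast]
    rcases p with _ | p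
    · simp
    · simp only [Nat.add_sub_cancel]; push_cast; ring
  calc _ ≤ ‖pev (pderiv i F) x‖ * _ := mul_le_mul_of_nonneg_left h4 (norm_nonneg _)
    _ = _ := by ring

lemma integral_norm_pev_mul_le {p : ℕ} (hp : 0 < p) (F H : 𝐏) : ∫ x, ‖pev F x‖ ^ (2 * p) * ‖pev H x‖
    ^ 2 ∂stdG ι ≤ gM (p + 1) F ^ ((p : ℝ) / (p + 1)) * gM (p + 1) H ^ ((1 : ℝ) / (p + 1)) := by
  have hp' : (0 : ℝ) < p := by exact_mod_cast hp
  have hc : (((p : ℝ) + 1) / p).HolderConjugate (p + 1) := by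
    rw [Real.holderConjugate_iff]; constructor
    · rw [lt_div_iff₀ hp']; linarith
    · field_simp
  have e1 : ∀ x : ι → ℝ, (‖pev F x‖ ^ (2 * p)) ^ (((p : ℝ) + 1) / p) =
      ‖pev F x‖ ^ (2 * (p + 1)) := by
    intro x; rw [← rpow_natCast, ← rpow_natCast, ← rpow_mul (norm_nonneg _)]; congr 1; push_cast
    field_simp
  have e2 : ∀ x : ι → ℝ, (‖pev H x‖ ^ 2) ^ ((p : ℝ) + 1) = ‖pev H x‖ ^ (2 * (p + 1)) := by
    intro x; rw [← rpow_natCast, ← rpow_natCast, ← rpow_mul (norm_nonneg _)]; congr 1; push_cast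
    ring
  have hm : ∀ (G : 𝐏) (r : ℕ) (t : 𝐄),
      Integrable (fun x => ‖(‖pev G x‖ ^ r)‖ ^ t.toReal) (stdG ι) → t ≠ 0 → t ≠ ∞ →
      MemLp (fun x => ‖pev G x‖ ^ r) t (stdG ι) := by
    intro G r t h h0 h1; exact (integrable_norm_rpow_iff
      ((continuous_pev G).norm.pow r).aestronglyMeasurable h0 h1).1 h
  have := integral_mul_le_Lp_mul_Lq_of_nonneg (μ := stdG ι) hc
    (f := fun x => ‖pev F x‖ ^ (2 * p)) (g := fun x => ‖pev H x‖ ^ 2)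
    (ae_of_all _ fun x => by positivity) (ae_of_all _ fun x => by positivity)
    (hm _ _ _ (by
      rw [toReal_ofReal hc.nonneg]; simp only [norm_eq_abs, abs_pow, abs_norm, e1]
      exact integrable_norm_pev_pow _ F) (by simpa using hc.pos) ofReal_ne_top)
    (hm _ _ _ (by
      rw [toReal_ofReal hc.symm.nonneg]; simp only [norm_eq_abs, abs_pow, abs_norm, e2]
      exact integrable_norm_pev_pow _ H) (by simpa using hc.symm.pos) ofReal_ne_top)
  simp only [e1, e2] at this; convert this using 2
  · unfold gM; congr 1; field_simp
  · rfl

/-- Hypercontractivity in a homogeneous Wiener chaos. -/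
theorem IsChaos.gM_le {D : ℕ} {F : 𝐏} (hF : IsChaos D F) (p : ℕ) : gM (p + 1) F ≤ (2 * p + 1 : ℝ) ^
    (D * (p + 1)) * gM 1 F ^ (p + 1) := by
  rcases Nat.eq_zero_or_pos p with rfl | hp
  · simp
  induction D generalizing F with
  | zero =>
    obtain ⟨c, rfl⟩ := hF; simp [gM, pev, ← pow_mul]
  | succ D ih =>
    set m := gM (p + 1) F with hm; have hm0 : 0 ≤ m := gM_nonneg _ _
    rcases hm0.eq_or_lt with h0 | hpos
    · rw [← h0]
      have := gM_nonneg 1 F; positivity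
    have h1 := eigen_mul_gM_le hF.1 p; have hp1 : ((p : ℝ) + 1) ≠ 0 := by positivity
    have h2 : ∀ i, gM (p + 1) (pderiv i F) ^ ((1 : ℝ) / (p + 1)) ≤
        (2 * p + 1 : ℝ) ^ D * gM 1 (pderiv i F) := by
      intro i; have hb : 0 ≤ (2 * p + 1 : ℝ) ^ D * gM 1 (pderiv i F) :=
        mul_nonneg (by positivity) (gM_nonneg _ _)
      have h3 := ih (hF.2 i); rw [pow_mul, ← mul_pow] at h3
      refine (rpow_le_rpow (gM_nonneg _ _) h3 (by positivity)).trans_eq ?_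
      rw [← rpow_natCast, ← rpow_mul hb]; push_cast; rw [mul_one_div_cancel hp1, rpow_one]
    have h4 : (D + 1 : ℝ) * m ≤
        (D + 1) * (m ^ ((p : ℝ) / (p + 1)) * ((2 * p + 1 : ℝ) ^ (D + 1) * gM 1 F)) := by
      have h5 := sum_gM_one hF.1; push_cast at h1 h5
      calc (D + 1 : ℝ) * m ≤ _ := h1
        _ ≤ (2 * p + 1) * ∑ i, m ^ ((p : ℝ) / (p + 1)) *
            ((2 * p + 1 : ℝ) ^ D * gM 1 (pderiv i F)) := by
          refine mul_le_mul_of_nonneg_left (sum_le_sum fun i _ => ?_) (by positivity)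
          exact (integral_norm_pev_mul_le hp F _).trans
            (mul_le_mul_of_nonneg_left (h2 i) (by positivity))
        _ = _ := by rw [← mul_sum, ← mul_sum, h5]; ring
    have h6 : m ≤ m ^ ((p : ℝ) / (p + 1)) * ((2 * p + 1 : ℝ) ^ (D + 1) * gM 1 F) :=
      le_of_mul_le_mul_left h4 (by positivity)
    have h7 : m = m ^ ((p : ℝ) / (p + 1)) * m ^ ((1 : ℝ) / (p + 1)) := by
      rw [← rpow_add hpos, ← add_div, div_self hp1, rpow_one]
    have h8 : m ^ ((1 : ℝ) / (p + 1)) ≤ (2 * p + 1 : ℝ) ^ (D + 1) * gM 1 F := by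
      refine le_of_mul_le_mul_left (h7.symm.trans_le h6) (by positivity)
    calc m = (m ^ ((1 : ℝ) / (p + 1))) ^ (p + 1) := by
          rw [← rpow_natCast, ← rpow_mul hm0]; push_cast; rw [one_div_mul_cancel hp1, rpow_one]
      _ ≤ ((2 * p + 1 : ℝ) ^ (D + 1) * gM 1 F) ^ (p + 1) :=
          pow_le_pow_left₀ (by positivity) h8 _
      _ = _ := by rw [mul_pow, ← pow_mul]

end GaussPoly

/-! ### Complex Hermite polynomials -/

section Hermite

variable {R : Type*} [CommRing R]

/-- The complex Hermite polynomial `:z^k w^l:` with variance `σ`. -/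
def herm (σ z w : R) : ℕ → ℕ → R
  | 0, l => w ^ l
  | k + 1, l => z * herm σ z w k l - l * σ * herm σ z w k (l - 1)

lemma herm_zero (σ z w : R) (l : ℕ) : herm σ z w 0 l = w ^ l := rfl

lemma herm_succ (σ z w : R) (k l : ℕ) :
    herm σ z w (k + 1) l = z * herm σ z w k l - l * σ * herm σ z w k (l - 1) := rfl

lemma herm_succ_right (σ z w : R) (k l : ℕ) : herm σ z w k (l + 1) = w * herm σ z w k l - k * σ *
    herm σ z w (k - 1) l := by
  induction k generalizing l with
  | zero => simp [herm_zero, pow_succ, mul_comm]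
  | succ k ih =>
    have e1 : (k : R) * herm σ z w k l =
        k * (z * herm σ z w (k - 1) l - l * σ * herm σ z w (k - 1) (l - 1)) := by
      rcases k with _ | k
      · simp
      · rw [herm_succ]; simp
    have e2 : (l : R) * herm σ z w k l =
        l * (w * herm σ z w k (l - 1) - k * σ * herm σ z w (k - 1) (l - 1)) := by
      rcases l with _ | l
      · simp
      · rw [ih]; simp
    rw [herm_succ, ih, herm_succ, Nat.add_sub_cancel, Nat.add_sub_cancel]; push_cast
    linear_combination σ * e1 - σ * e2

lemma mul_herm_eq (σ z w : R) (k l : ℕ) : (k : R) * herm σ z w k l = k * (z * herm σ z w (k - 1) l -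
    l * σ * herm σ z w (k - 1) (l - 1)) := by
  rcases k with _ | k
  · simp
  · rw [herm_succ]; simp

lemma mul_herm_eq_right (σ z w : R) (k l : ℕ) : (l : R) * herm σ z w k l = l * (w * herm σ z w k (l
    - 1) - k * σ * herm σ z w (k - 1) (l - 1)) := by
  rcases l with _ | l
  · simp
  · rw [herm_succ_right]; simp

lemma herm_swap (σ z w : R) (k l : ℕ) : herm σ z w k l = herm σ w z l k := by
  induction k generalizing l with
  | zero =>
    induction l with
    | zero => simp [herm_zero]
    | succ l ih => rw [herm_succ, ← ih]; simp [herm_zero, pow_succ, mul_comm]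
  | succ k ih => rw [herm_succ, herm_succ_right, ih, ih]

lemma herm_succ_succ (σ z w : R) (k l : ℕ) : herm σ z w (k + 1) (l + 1) = (z * w - σ * (k + l + 1))
    * herm σ z w k l - σ ^ 2 * (k * l) * herm σ z w (k - 1) (l - 1) := by
  have e1 := mul_herm_eq σ z w k l; rw [herm_succ, herm_succ_right, Nat.add_sub_cancel]; push_cast
  linear_combination σ * e1

lemma herm_map {S : Type*} [CommRing S] (f : R →+* S) (σ z w : R) (k l : ℕ) : f (herm σ z w k l) =
    herm (f σ) (f z) (f w) k l := by
  induction k generalizing l with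
  | zero => simp [herm_zero]
  | succ k ih => simp [herm_succ, ih]

lemma herm_derivation {S : Type*} [CommRing S] [Algebra S R] (d : Derivation S R R) {σ : R} (hσ : d
    σ = 0) (z w : R) (k l : ℕ) : d (herm σ z w k l) = k * d z * herm σ z w (k - 1) l + l * d w *
    herm σ z w k (l - 1) := by
  induction k generalizing l with
  | zero =>
    simp only [herm_zero, Derivation.leibniz_pow, smul_eq_mul, nsmul_eq_mul]; push_cast; ring
  | succ k ih =>
    have e1 := mul_herm_eq σ z w k l; have hn : ∀ n : ℕ, d (n : R) = 0 := fun n => d.map_natCast n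
    rw [herm_succ, map_sub, d.leibniz, d.leibniz, d.leibniz, hσ, hn, ih, ih, herm_succ,
      Nat.add_sub_cancel]
    simp only [smul_eq_mul]; push_cast; linear_combination -d z * e1

end Hermite

section WickMonomial

lemma laguerreVar_zero (l : ℕ) (x σ : ℝ) : laguerreVar l 0 x σ = 1 := by
  simp [laguerreVar, laguerre]

lemma laguerreVar_one (l : ℕ) (x : ℝ) {σ : ℝ} (hσ : σ ≠ 0) : laguerreVar l 1 x σ = σ * (1 + l) - x
    := by simp only [laguerreVar, laguerre]; field_simp

lemma laguerreVar_succ_succ (l k : ℕ) (x : ℝ) {σ : ℝ} (hσ : σ ≠ 0) : (k + 2) * laguerreVar l (k + 2)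
    x σ = (σ * (2 * (k + 1) + 1 + l) - x) * laguerreVar l (k + 1) x σ - σ ^ 2 * (k + 1 + l) *
    laguerreVar l k x σ := by
  have hk : (k + 2 : ℝ) ≠ 0 := by positivity
  simp only [laguerreVar, laguerre]; field_simp; ring

lemma herm_eq_laguerre {σ : ℝ} (hσ : σ ≠ 0) (z w : ℂ) {x : ℝ} (hx : z * w = x) (d l : ℕ) : herm (σ :
    ℂ) z w (l + d) l = (-1) ^ l * (l.factorial : ℂ) * (laguerreVar d l x σ : ℂ) * z ^ d := by
  induction l using Nat.strong_induction_on with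
  | _ l ih =>
    match l with
    | 0 => rw [zero_add, herm_swap, herm_zero]; simp [laguerreVar_zero]
    | 1 =>
      have h0 : herm (σ : ℂ) z w d 0 = z ^ d := by rw [herm_swap, herm_zero]
      rw [add_comm 1 d, herm_succ_succ, laguerreVar_one d x hσ, h0, hx]
      simp only [Nat.factorial_one, pow_one]; push_cast; ring
    | l + 2 =>
      have h1 := ih (l + 1) (by omega); have h0 := ih l (by omega)
      have hr := laguerreVar_succ_succ d l x hσ
      have hr' : ((l : ℂ) + 2) * (laguerreVar d (l + 2) x σ : ℂ) =
        (σ * (2 * (l + 1) + 1 + d) - x) * (laguerreVar d (l + 1) x σ : ℂ)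
          - σ ^ 2 * (l + 1 + d) * (laguerreVar d l x σ : ℂ) := by exact_mod_cast congrArg Complex.ofReal hr
      have e1 : l + 2 + d = (l + 1 + d) + 1 := by ring
      have e2 : l + 1 + d - 1 = l + d := by omega
      rw [e1, herm_succ_succ, e2, Nat.add_sub_cancel, h1, h0, hx]; simp only [Nat.factorial_succ]
      push_cast; linear_combination ((-1) ^ (l + 1) * ((l + 1) * (l.factorial : ℂ)) * z ^ d) * hr'

lemma wickMonomial_eq {σ : ℝ} (hσ : σ ≠ 0) (k l : ℕ) (z : ℂ) : wickMonomial k l σ z = herm (σ : ℂ) z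
    (conj z) k l := by
  have hx : z * conj z = ((‖z‖ ^ 2 : ℝ) : ℂ) := by rw [mul_conj']; push_cast; rfl
  unfold wickMonomial; split_ifs with h
  · obtain ⟨d, rfl⟩ := Nat.exists_eq_add_of_le h
    rw [herm_eq_laguerre hσ _ _ hx, Nat.add_sub_cancel_left]
  · obtain ⟨d, rfl⟩ := Nat.exists_eq_add_of_le (not_le.1 h).le
    rw [herm_swap, herm_eq_laguerre hσ _ _ ((mul_comm _ _).trans hx), Nat.add_sub_cancel_left]

end WickMonomial

/-! ### Complex Hermite polynomials of Gaussian variables -/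

section HermiteGauss

open MvPolynomial

variable {ι : Type*} [Fintype ι]

local notation "𝐏" => MvPolynomial ι ℂ

/-- The linear form with coefficients `A`. -/
def lin (A : ι → ℂ) : 𝐏 := ∑ i, C (A i) * X i

/-- The Wick power `:z^k z̄^l:` of the linear form `z` with coefficients `A`. -/
def hermP (A : ι → ℂ) (k l : ℕ) : 𝐏 :=
  herm (C ((∑ i, ‖A i‖ ^ 2 : ℝ) : ℂ)) (lin A) (lin fun i => conj (A i)) k l

lemma herm_eq_hermP (A : ι → ℂ) (k l : ℕ) : herm (C ((∑ i, ‖A i‖ ^ 2 : ℝ) : ℂ)) (lin A)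
    (lin fun i => conj (A i)) k l = hermP A k l := rfl

lemma pderiv_lin (A : ι → ℂ) (i : ι) : pderiv i (lin A) = C (A i) := by
  classical
  simp [lin, pderiv_X, Pi.single_apply]

lemma pev_lin (A : ι → ℂ) (x : ι → ℝ) : pev (lin A) x = ∑ i, A i * x i := by simp [lin, pev]

lemma pev_hermP (A : ι → ℂ) (k l : ℕ) (x : ι → ℝ) : pev (hermP A k l) x = herm ((∑ i, ‖A i‖ ^ 2 : ℝ)
    : ℂ) (∑ i, A i * x i) (conj (∑ i, A i * x i)) k l := by
  unfold hermP; rw [pev, herm_map, ← pev, ← pev, ← pev, pev_lin, pev_lin]; simp [pev]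

lemma pderiv_hermP (A : ι → ℂ) (k l : ℕ) (i : ι) : pderiv i (hermP A k l) = C (k * A i) * hermP A (k
    - 1) l + C (l * conj (A i)) * hermP A k (l - 1) := by
  unfold hermP; rw [herm_derivation (pderiv i) pderiv_C, pderiv_lin, pderiv_lin]; simp

lemma isChaos_hermP {A : ι → ℂ} (hA : ∑ i, A i ^ 2 = 0) (k l : ℕ) : IsChaos (k + l) (hermP A k l) :=
    by
  have hA' : ∑ i, conj (A i) ^ 2 = 0 := by rw [← map_zero conj, ← hA, map_sum]; simp
  have hs : ∑ i, A i * conj (A i) = ((∑ i, ‖A i‖ ^ 2 : ℝ) : ℂ) := by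
    push_cast; exact sum_congr rfl fun i _ => mul_conj' _
  generalize hD : k + l = D
  induction D generalizing k l with
  | zero =>
    obtain ⟨rfl, rfl⟩ : k = 0 ∧ l = 0 := by omega
    exact ⟨1, by simp [hermP, herm_zero]⟩
  | succ D ih =>
    constructor
    · have e1 := mul_herm_eq (C ((∑ i, ‖A i‖ ^ 2 : ℝ) : ℂ)) (lin A)
        (lin fun i => conj (A i)) k l
      have e2 := mul_herm_eq_right (C ((∑ i, ‖A i‖ ^ 2 : ℝ) : ℂ)) (lin A)
        (lin fun i => conj (A i)) k l
      simp only [herm_eq_hermP] at e1 e2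
      have h1 : ∀ i, X i * pderiv i (hermP A k l) - pderiv i (pderiv i (hermP A k l)) =
          C (A i) * X i * ((k : 𝐏) * hermP A (k - 1) l) +
          C (conj (A i)) * X i * ((l : 𝐏) * hermP A k (l - 1)) -
          C (A i ^ 2) * ((k : 𝐏) * ((k - 1 : ℕ) : 𝐏) * hermP A (k - 1 - 1) l) -
          C (A i * conj (A i)) * (2 * (k : 𝐏) * (l : 𝐏) * hermP A (k - 1) (l - 1)) -
          C (conj (A i) ^ 2) * ((l : 𝐏) * ((l - 1 : ℕ) : 𝐏) * hermP A k (l - 1 - 1)) := by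
        intro i; simp only [pderiv_hermP, map_add, pderiv_C_mul]
        simp only [map_mul, map_natCast, map_pow]; ring
      rw [sum_congr rfl fun i _ => h1 i]
      simp only [sum_sub_distrib, sum_add_distrib, ← sum_mul, ← map_sum, hA,
        hA', hs, map_zero, zero_mul, sub_zero]
      rw [← hD]; have hl : ∀ B : ι → ℂ, ∑ i, C (B i) * X i = lin B := fun _ => rfl
      rw [hl A, hl fun i => conj (A i)]; rw [show (C ((k + l : ℕ) : ℂ) : 𝐏) = k + l by simp]
      linear_combination -e1 - e2
    · intro i; rw [pderiv_hermP]; refine IsChaos.add ?_ ?_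
      · rcases k with _ | k
        · simpa using isChaos_zero D
        · exact (ih k l (by omega)).C_mul _
      · rcases l with _ | l
        · simpa using isChaos_zero D
        · exact (ih k l (by omega)).C_mul _

lemma gE_lin_mul (A : ι → ℂ) (H : 𝐏) : gE (lin A * H) = gE (∑ i, C (A i) * pderiv i H) := by
  rw [lin, sum_mul, gE_sum, gE_sum]; refine sum_congr rfl fun i _ => ?_
  rw [mul_assoc, gE_C_mul, gE_X_mul, gE_C_mul]

lemma sum_mul_pderiv_hermP (A B : ι → ℂ) (k l : ℕ) : ∑ i, C (A i) * pderiv i (hermP B k l) = C (∑ i,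
    A i * B i) * ((k : 𝐏) * hermP B (k - 1) l) + C (∑ i, A i * conj (B i)) * ((l : 𝐏) * hermP B k (l
    - 1)) := by
  rw [map_sum, map_sum, sum_mul, sum_mul, ← sum_add_distrib]; refine sum_congr rfl fun i _ => ?_
  simp only [pderiv_hermP, map_mul, map_natCast]; ring

lemma gE_hermP_succ_mul {A : ι → ℂ} (hA : ∑ i, A i ^ 2 = 0) (k l : ℕ) (G : 𝐏) : gE (hermP A (k + 1)
    l * G) = gE (hermP A k l * ∑ i, C (A i) * pderiv i G) := by
  have hs : ∑ i, A i * conj (A i) = ((∑ i, ‖A i‖ ^ 2 : ℝ) : ℂ) := by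
    push_cast; exact sum_congr rfl fun i _ => mul_conj' _
  have h1 := gE_lin_mul A (hermP A k l * G); have h2 : ∑ i, C (A i) * pderiv i (hermP A k l * G) =
      (∑ i, C (A i) * pderiv i (hermP A k l)) * G + hermP A k l * ∑ i, C (A i) * pderiv i G := by
    rw [sum_mul, mul_sum, ← sum_add_distrib]; refine sum_congr rfl fun i _ => ?_; rw [pderiv_mul]
    ring
  have h0 : ∑ i, A i * A i = 0 := by simpa [pow_two] using hA
  rw [h2, gE_add, sum_mul_pderiv_hermP, h0, hs, map_zero, zero_mul, zero_add] at h1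
  have h3 : hermP A (k + 1) l * G = lin A * (hermP A k l * G) + C (-1) *
      (C ((∑ i, ‖A i‖ ^ 2 : ℝ) : ℂ) * ((l : 𝐏) * hermP A k (l - 1)) * G) := by
    rw [hermP, herm_succ, herm_eq_hermP, herm_eq_hermP]; simp only [map_neg, map_one]; ring
  rw [h3, gE_add, h1, gE_C_mul]; ring

lemma gE_hermP_mul_hermP {A B : ι → ℂ} (hA : ∑ i, A i ^ 2 = 0) (hAB : ∑ i, A i * B i = 0) (k l : ℕ)
    : gE (hermP A k l * hermP B l k) = k.factorial * (∑ i, A i * conj (B i)) ^ k * gE (hermP A 0 l *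
    hermP B l 0) := by
  induction k with
  | zero => simp
  | succ k ih =>
    rw [gE_hermP_succ_mul hA, sum_mul_pderiv_hermP, hAB, map_zero, zero_mul, zero_add,
      Nat.add_sub_cancel]
    have : hermP A k l * (C (∑ i, A i * conj (B i)) *
        (((k + 1 : ℕ) : 𝐏) * hermP B l k)) =
        C (((k + 1 : ℕ) : ℂ) * ∑ i, A i * conj (B i)) * (hermP A k l * hermP B l k) := by
      rw [map_mul, map_natCast]; ring
    rw [this, gE_C_mul, ih, Nat.factorial_succ]; push_cast; ring

lemma hermP_swap (A : ι → ℂ) (k l : ℕ) : hermP A k l = hermP (fun i => conj (A i)) l k := by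
  rw [hermP, herm_swap, hermP]; simp

lemma gE_herm {A B : ι → ℂ} (hA : ∑ i, A i ^ 2 = 0) (hAB : ∑ i, A i * B i = 0) (k l : ℕ) : gE (hermP
    A k l * hermP B l k) = k.factorial * l.factorial * ((∑ i, A i * conj (B i)) ^ k * (∑ i, conj (A
    i) * B i) ^ l) := by
  have hA' : ∑ i, conj (A i) ^ 2 = 0 := by rw [← map_zero conj, ← hA, map_sum]; simp
  have hAB' : ∑ i, conj (A i) * conj (B i) = 0 := by rw [← map_zero conj, ← hAB, map_sum]; simp
  rw [gE_hermP_mul_hermP hA hAB, hermP_swap A 0 l, hermP_swap B l 0, gE_hermP_mul_hermP hA' hAB']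
  simp only [hermP, herm_zero, pow_zero, mul_one, Complex.conj_conj]
  rw [← map_one (C (R := ℂ)), gE_C]; ring

end HermiteGauss

/-! ### Gaussian Hilbert spaces -/

section GaussSpace

variable {Ω : Type*} [MeasurableSpace Ω] {P : Measure Ω} [IsProbabilityMeasure P]

/-- A subspace of `L²` all of whose elements are centered Gaussian variables. -/
def IsGaussSpace (P : Measure Ω) (𝒢 : Submodule ℝ (Lp ℝ 2 P)) : Prop :=
  ∀ f ∈ 𝒢, P.map f = gaussianReal 0 (‖f‖₊ ^ 2)

lemma integral_exp_of_isGaussSpace {𝒢 : Submodule ℝ (Lp ℝ 2 P)} (h𝒢 : IsGaussSpace P 𝒢) {f : Lp ℝ 2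
    P} (hf : f ∈ 𝒢) : ∫ ω, exp (f ω * I) ∂P = exp (-(‖f‖ ^ 2 / 2 : ℝ)) := by
  have h := charFun_gaussianReal (μ := 0) (v := ‖f‖₊ ^ 2) 1
  rw [← h𝒢 f hf, charFun_apply_real, integral_map (Lp.aestronglyMeasurable f).aemeasurable
    (by fun_prop)] at h
  simp only [Complex.ofReal_one, one_mul] at h; rw [h]; congr 1; simp

/-- Finitely many elements of a Gaussian Hilbert space are linear combinations of independent
standard Gaussian variables. -/
lemma exists_stdG {𝒢 : Submodule ℝ (Lp ℝ 2 P)} (h𝒢 : IsGaussSpace P 𝒢) {κ : Type*} [Finite κ] {f : κ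
    → Lp ℝ 2 P} (hf : ∀ j, f j ∈ 𝒢) : ∃ (n : ℕ) (A : κ → Fin n → ℝ) (h : Ω → Fin n → ℝ),
    AEMeasurable h P ∧ P.map h = stdG (Fin n) ∧ ∀ j, f j =ᵐ[P] fun ω => ∑ i, A j i * h ω i := by
  let S := Submodule.span ℝ (Set.range f)
  have : FiniteDimensional ℝ S := FiniteDimensional.span_of_finite ℝ (Set.finite_range f)
  have hS : S ≤ 𝒢 := Submodule.span_le.2 (by rintro _ ⟨j, rfl⟩; exact hf j)
  let b := stdOrthonormalBasis ℝ S
  let h : Ω → Fin (Module.finrank ℝ S) → ℝ := fun ω i => (b i : Lp ℝ 2 P) ω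
  have hsum : ∀ c : Fin (Module.finrank ℝ S) → ℝ,
      ((∑ i, c i • b i : S) : Lp ℝ 2 P) =ᵐ[P] fun ω => ∑ i, c i * h ω i := by
    intro c; rw [AddSubmonoidClass.coe_finsetSum]
    have h1 : ∀ᵐ ω ∂P, ∀ i, ((c i • b i : S) : Lp ℝ 2 P) ω = c i * h ω i := by
      rw [ae_all_iff]; intro i; filter_upwards [Lp.coeFn_smul (c i) (b i : Lp ℝ 2 P)] with ω hω
      simpa using hω
    filter_upwards [h1, Lp.coeFn_finsetSum Finset.univ fun i => ((c i • b i : S) : Lp ℝ 2 P)]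
      with ω h1 h2
    rw [h2, Finset.sum_apply]; exact sum_congr rfl fun i _ => h1 i
  have hm : AEMeasurable h P := aemeasurable_pi_lambda _ fun i =>
    (Lp.aestronglyMeasurable (b i : Lp ℝ 2 P)).aemeasurable
  refine ⟨_, fun j i => b.repr ⟨f j, Submodule.subset_span ⟨j, rfl⟩⟩ i, h, hm, ?_, fun j => ?_⟩
  · apply (MeasurableEquiv.toLp 2 (Fin (Module.finrank ℝ S) → ℝ)).map_measurableEquiv_injective
    rw [MeasurableEquiv.coe_toLp, map_pi_eq_stdGaussian,
      AEMeasurable.map_map_of_aemeasurable (by fun_prop) hm]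
    have : IsProbabilityMeasure (P.map (WithLp.toLp 2 ∘ h)) :=
      Measure.isProbabilityMeasure_map (by fun_prop)
    apply Measure.ext_of_charFun; ext t
    rw [charFun_stdGaussian, charFun_apply, integral_map (by fun_prop) (by fun_prop)]
    have h2 := integral_exp_of_isGaussSpace h𝒢 (hS (∑ i, t i • b i).2)
    have h3 : ‖((∑ i, t i • b i : S) : Lp ℝ 2 P)‖ = ‖t‖ := by
      rw [b.sum_repr_symm t]; exact b.repr.symm.norm_map t
    rw [h3] at h2; have h4 : ∫ ω, exp (inner ℝ ((WithLp.toLp 2 ∘ h) ω) t * I) ∂P =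
        ∫ ω, exp (((∑ i, t i • b i : S) : Lp ℝ 2 P) ω * I) ∂P := by
      refine integral_congr_ae ?_; filter_upwards [hsum t] with ω hω; rw [hω]
      simp [PiLp.inner_apply]
    rw [h4, h2]; congr 1; push_cast; ring
  · have := hsum fun i => b.repr ⟨f j, Submodule.subset_span ⟨j, rfl⟩⟩ i
    rwa [b.sum_repr] at this

/-- A complex variable whose real and imaginary parts belong to `𝒢`. -/
def InC (𝒢 : Submodule ℝ (Lp ℝ 2 P)) (Z : Ω → ℂ) : Prop :=
  ∃ f ∈ 𝒢, ∃ g ∈ 𝒢, Z =ᵐ[P] fun ω => (f ω : ℂ) + (g ω : ℂ) * I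

theorem wick_moments {𝒢 : Submodule ℝ (Lp ℝ 2 P)} (h𝒢 : IsGaussSpace P 𝒢) {ρ : Type*} [Fintype ρ] {Z
    : ρ → Ω → ℂ} (hZ : ∀ r, InC 𝒢 (Z r)) (h0 : ∀ r s, ∫ ω, Z r ω * Z s ω ∂P = 0) (c : ρ → ℂ) (k l :
    ℕ) {σ : ρ → ℝ} (hσ : ∀ r, σ r = ∫ ω, ‖Z r ω‖ ^ 2 ∂P) {W : Ω → ℂ} (hW : ∀ ω, W ω = ∑ r, c r *
    herm (σ r : ℂ) (Z r ω) (conj (Z r ω)) k l) : (∀ q, Integrable (fun ω => ‖W ω‖ ^ q) P) ∧ (∀ p :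
    ℕ, ∫ ω, ‖W ω‖ ^ (2 * (p + 1)) ∂P ≤ (2 * p + 1 : ℝ) ^ ((k + l) * (p + 1)) * (∫ ω, ‖W ω‖ ^ 2 ∂P) ^
    (p + 1)) ∧ ((∫ ω, ‖W ω‖ ^ 2 ∂P : ℝ) : ℂ) = k.factorial * l.factorial * ∑ r, ∑ s, c r * conj (c
    s) * ((∫ ω, Z r ω * conj (Z s ω) ∂P) ^ k * conj (∫ ω, Z r ω * conj (Z s ω) ∂P) ^ l) := by
  choose f hf g hg hfg using hZ
  obtain ⟨n, A, h, hm, hlaw, hA⟩ := exists_stdG h𝒢 (κ := ρ ⊕ ρ) (f := Sum.elim f g)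
    (by rintro (r | r); exacts [hf r, hg r])
  let B : ρ → Fin n → ℂ := fun r i => A (.inl r) i + A (.inr r) i * I
  have hZB : ∀ᵐ ω ∂P, ∀ r, Z r ω = pev (lin (B r)) (h ω) := by
    rw [ae_all_iff]; intro r; filter_upwards [hfg r, hA (.inl r), hA (.inr r)] with ω h1 h2 h3
    simp only [Sum.elim_inl, Sum.elim_inr] at h2 h3; rw [h1, h2, h3, pev_lin]; push_cast
    rw [sum_mul, ← sum_add_distrib]; refine sum_congr rfl fun i _ => ?_; ring
  have htr : ∀ {E : Type} [NormedAddCommGroup E] [NormedSpace ℝ E] (φ : (Fin n → ℝ) → E),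
      Continuous φ → ∫ ω, φ (h ω) ∂P = ∫ x, φ x ∂stdG (Fin n) := by
    intro E _ _ φ hφ; rw [← hlaw, integral_map hm hφ.aestronglyMeasurable]
  have hlin : ∀ u v : Fin n → ℂ, gE (lin u * lin v) = ∑ i, u i * v i := by
    intro u v; rw [gE_lin_mul]; simp only [pderiv_lin, gE_sum]
    exact sum_congr rfl fun i _ => by rw [← map_mul, gE_C]
  have hcj : ∀ u : Fin n → ℂ, cj (lin u) = lin fun i => conj (u i) := by intro u; simp [cj, lin]
  have hB0 : ∀ r s, ∑ i, B r i * B s i = 0 := by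
    intro r s; rw [← h0 r s, ← hlin, gE, ← htr _ (continuous_pev _)]; refine integral_congr_ae ?_
    filter_upwards [hZB] with ω hω; rw [pev_mul, hω, hω]
  have hBs : ∀ r s, ∑ i, B r i * conj (B s i) = ∫ ω, Z r ω * conj (Z s ω) ∂P := by
    intro r s; rw [← hlin, gE, ← htr _ (continuous_pev _)]; refine integral_congr_ae ?_
    filter_upwards [hZB] with ω hω; rw [pev_mul, hω, hω, ← pev_cj, hcj]
  have hBσ : ∀ r, (σ r : ℂ) = ((∑ i, ‖B r i‖ ^ 2 : ℝ) : ℂ) := by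
    intro r
    have := hBs r r; simp only [mul_conj'] at this; rw [hσ]; push_cast
    rw [this, ← integral_complex_ofReal]; push_cast; rfl
  let F : MvPolynomial (Fin n) ℂ := ∑ r, MvPolynomial.C (c r) * hermP (B r) k l
  have hWF : ∀ᵐ ω ∂P, W ω = pev F (h ω) := by
    filter_upwards [hZB] with ω hω; rw [hW, pev_sum]; refine sum_congr rfl fun r _ => ?_
    rw [pev_mul, pev_hermP, hω, hBσ, pev_lin]; simp [pev]
  have hF : IsChaos (k + l) F := IsChaos.sum _ fun r _ =>
    (isChaos_hermP (by simpa [pow_two] using hB0 r r) k l).C_mul _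
  have hM : ∀ p : ℕ, ∫ ω, ‖W ω‖ ^ (2 * p) ∂P = gM p F := by
    intro p; rw [gM, ← htr (fun x => ‖pev F x‖ ^ (2 * p)) ((continuous_pev F).norm.pow _)]
    refine integral_congr_ae ?_; filter_upwards [hWF] with ω hω; rw [hω]
  refine ⟨fun q => ?_, fun p => ?_, ?_⟩
  · have h1 := integrable_norm_pev_pow q F; rw [← hlaw] at h1
    refine (h1.comp_aemeasurable hm).congr ?_; filter_upwards [hWF] with ω hω; simp [hω]
  · have := hF.gM_le p
    rwa [← hM, ← hM, mul_one] at this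
  · have h1 := hM 1; rw [mul_one] at h1; have h2 := gE_mul_cj 0 F
    rw [pow_zero, one_mul, zero_add, pow_one] at h2
    have h3 : cj F = ∑ s, MvPolynomial.C (conj (c s)) * hermP (B s) l k := by
      simp only [F, cj, map_sum, map_mul, MvPolynomial.map_C]; refine sum_congr rfl fun s _ => ?_
      congr 1; simp only [cj] at hcj; rw [hermP, herm_map, hermP, herm_swap, hcj, hcj]; simp
    rw [h1, ← h2, h3, sum_mul, gE_sum, mul_sum]; refine sum_congr rfl fun r _ => ?_
    rw [mul_sum, gE_sum, mul_sum]; refine sum_congr rfl fun s _ => ?_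
    have h4 : MvPolynomial.C (c r) * hermP (B r) k l *
        (MvPolynomial.C (conj (c s)) * hermP (B s) l k) =
        MvPolynomial.C (c r * conj (c s)) * (hermP (B r) k l * hermP (B s) l k) := by
      rw [map_mul]; ring
    rw [h4, gE_C_mul, gE_herm (by simpa [pow_two] using hB0 r r) (hB0 r s), ← hBs, map_sum]
    simp only [map_mul, Complex.conj_conj]; ring

end GaussSpace

/-! ### Wick powers of trigonometric polynomials -/

/-- The coefficients of `f` vanish outside the ball of radius `R`. -/
def SuppIn (R : ℝ) (f : Dist) : Prop := ∀ n, R < ‖freq n‖ → f n = 0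

/-- The frequencies in the ball of radius `R`. -/
def fball (R : ℝ) : Finset ℤ² := (finite_norm_freq_le R).toFinset

lemma mem_fball : n ∈ fball R ↔ ‖freq n‖ ≤ R := by simp [fball]

lemma SuppIn.subset (h : SuppIn R f) : support f ⊆ fball R := by
  intro n hn; rw [Finset.mem_coe, mem_fball]; by_contra hR
  exact hn (h n (not_le.1 hR))

lemma SuppIn.finite (h : SuppIn R f) : (support f).Finite :=
  (fball R).finite_toSet.subset h.subset

lemma SuppIn.mono {R R' : ℝ} (hR : R ≤ R') (h : SuppIn R f) : SuppIn R' f :=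
  fun n hn => h n (hR.trans_lt hn)

lemma SuppIn.prod {R R' : ℝ} (hf : SuppIn R f) (hg : SuppIn R' g) : SuppIn (R + R') (prod f g) := by
  intro n hn; by_contra h
  obtain ⟨k, h1, h2⟩ := prod_ne_zero h
  have h3 : ‖freq (n - k)‖ ≤ R := not_lt.1 fun h' => h1 (hf _ h')
  have h4 : ‖freq k‖ ≤ R' := not_lt.1 fun h' => h2 (hg _ h')
  have h5 : ‖freq n‖ ≤ ‖freq (n - k)‖ + ‖freq k‖ := by
    conv_lhs => rw [← sub_add_cancel n k, freq_add]
    exact norm_add_le _ _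
  linarith

lemma SuppIn.conjD (hf : SuppIn R f) : SuppIn R (conjD f) := by
  intro n hn; simp [SCGL.conjD, hf (-n) (by rwa [freq_neg, norm_neg])]

lemma SuppIn.sub (hf : SuppIn R f) (hg : SuppIn R g) : SuppIn R (f - g) :=
  fun n hn => by simp [hf n hn, hg n hn]

lemma SuppIn.smul (c : ℂ) (hf : SuppIn R f) : SuppIn R (c • f) :=
  fun n hn => by simp [hf n hn]

lemma SuppIn.powD (hf : SuppIn R f) (k : ℕ) : SuppIn (k * R) (powD f k) := by
  induction k with
  | zero =>
    intro n hn
    have : n ≠ 0 := by rintro rfl; have h0 := norm_freq_sq 0; simp at h0 hn; exact hn h0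
    simp [SCGL.powD, this]
  | succ k ih => exact (hf.prod ih).mono (le_of_eq (by push_cast; ring))

/-- The Wick power `:f^k f̄^l:` with variance parameter `σ`. -/
def wickD (σ : ℂ) (f : Dist) : ℕ → ℕ → Dist
  | 0, l => powD (conjD f) l
  | k + 1, l => prod f (wickD σ f k l) - (l * σ) • wickD σ f k (l - 1)

lemma SuppIn.wickD (hR : 0 ≤ R) (hf : SuppIn R f) (σ : ℂ) (k l : ℕ) : SuppIn ((k + l : ℕ) * R)
    (wickD σ f k l) := by
  induction k generalizing l with
  | zero => simpa [SCGL.wickD] using hf.conjD.powD l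
  | succ k ih =>
    refine ((hf.prod (ih l)).mono (le_of_eq (by push_cast; ring))).sub
      (((ih (l - 1)).mono ?_).smul _)
    exact mul_le_mul_of_nonneg_right (by exact_mod_cast (by omega)) hR

lemma ev_sub (hf : (support f).Finite) (hg : (support g).Finite) (x : ℝ × ℝ) : ev (f - g) x = ev f x
    - ev g x := by
  rw [sub_eq_add_neg, ← neg_one_smul ℂ g, ev_add hf (by simpa using support_neg_finite hg), ev_smul]
  ring

lemma powD_finite (hf : (support f).Finite) (k : ℕ) : (support (powD f k)).Finite := by
  induction k with
  | zero => exact (Set.finite_singleton 0).subset (by simp [powD])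
  | succ k ih => exact support_prod_finite hf ih

lemma ev_powD (hf : (support f).Finite) (k : ℕ) (x : ℝ × ℝ) : ev (powD f k) x = ev f x ^ k := by
  induction k with
  | zero => simp [powD, ev_single_zero]
  | succ k ih => rw [powD, ev_prod hf (powD_finite hf k), ih, pow_succ']

lemma ev_wickD (hR : 0 ≤ R) (hf : SuppIn R f) (σ : ℂ) (k l : ℕ) (x : ℝ × ℝ) : ev (wickD σ f k l) x =
    herm σ (ev f x) (conj (ev f x)) k l := by
  induction k generalizing l with
  | zero => rw [wickD, ev_powD hf.conjD.finite, ev_conjD, herm_zero]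
  | succ k ih =>
    have h := fun l => (hf.wickD hR σ k l).finite
    rw [wickD, ev_sub (support_prod_finite hf.finite (h l))
      ((((hf.wickD hR σ k (l - 1)).smul _)).finite), ev_prod hf.finite (h l), ev_smul, ih, ih,
      herm_succ]

/-- A linear functional of trigonometric polynomials is a combination of point evaluations. -/
lemma exists_sum_char2 (S : Finset ℤ²) (τ : ℤ² → ℂ) : ∃ (m : ℕ) (c : Fin m → ℂ) (y : Fin m → ℝ × ℝ),
    ∀ n ∈ S, ∑ r, c r * char2 n (y r) = τ n := by
  let v : ℝ × ℝ → (S → ℂ) := fun y n => char2 n y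
  have hspan : Submodule.span ℂ (Set.range v) = ⊤ := by
    by_contra hne
    obtain ⟨L, hL0, hL⟩ := Submodule.exists_le_ker_of_lt_top _ (lt_top_iff_ne_top.2 hne)
    let f : Dist := fun n => if h : n ∈ S then L (Pi.single ⟨n, h⟩ 1) else 0
    have hf : support f ⊆ S := by
      intro n hn; by_contra h
      exact hn (dif_neg h)
    have hLv : ∀ w : S → ℂ, L w = ∑ n : S, w n * f n := by
      intro w
      conv_lhs => rw [← Finset.univ_sum_single w, map_sum]
      refine sum_congr rfl fun n _ => ?_
      have : (Pi.single n (w n) : S → ℂ) = w n • Pi.single n 1 := by rw [← Pi.single_smul]; simp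
      rw [this, map_smul]; simp [f]
    have hev : ∀ x, ev f x = 0 := by
      intro x; have h1 : L (v x) = 0 := hL (Submodule.subset_span ⟨x, rfl⟩)
      rw [ev_eq_sum S hf, ← h1, hLv, ← sum_coe_sort S]; exact sum_congr rfl fun n _ => mul_comm _ _
    have hf0 : f = 0 := by
      rw [← coeffs_ev (S.finite_toSet.subset hf), funext hev]; ext n; simp [coeffs]
    refine hL0 (LinearMap.ext fun w => ?_); rw [hLv, hf0]; simp
  have hτ : (fun n : S => τ n) ∈ Submodule.span ℂ (Set.range v) := by rw [hspan]; trivial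
  rw [Finsupp.mem_span_range_iff_exists_finsupp] at hτ; obtain ⟨c, hc⟩ := hτ
  refine ⟨c.support.card, fun r => c (c.support.equivFin.symm r),
    fun r => (c.support.equivFin.symm r : ℝ × ℝ), fun n hn => ?_⟩
  have h1 := congrFun hc ⟨n, hn⟩; rw [← h1, Finsupp.sum, Finset.sum_apply, ← sum_coe_sort c.support,
    ← c.support.equivFin.symm.sum_comp]
  rfl

/-! ### Decay of Fourier coefficients of products -/

def jb (n : ℤ²) : ℝ := 1 + ‖freq n‖

lemma one_le_jb (n : ℤ²) : 1 ≤ jb n := by simp [jb]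

lemma jb_pos (n : ℤ²) : 0 < jb n := one_pos.trans_le (one_le_jb n)

lemma jb_neg (n : ℤ²) : jb (-n) = jb n := by simp [jb, freq_neg]

lemma jb_le_add (n k : ℤ²) : jb n ≤ jb (n - k) + jb k := by
  have h5 : ‖freq n‖ ≤ ‖freq (n - k)‖ + ‖freq k‖ := by
    conv_lhs => rw [← sub_add_cancel n k, freq_add]
    exact norm_add_le _ _
  unfold jb; linarith

lemma summable_jb {ρ : ℝ} (hρ : 0 < ρ) : Summable fun n : ℤ² => jb n ^ (-2 - ρ) := by
  have h := EisensteinSeries.summable_one_div_norm_rpow (k := 2 + ρ) (by linarith)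
  have h2 := (finTwoArrowEquiv ℤ).symm.summable_iff.2 h
  refine Summable.of_nonneg_of_le (fun n => by have := jb_pos n; positivity) (fun n => ?_)
    (h2.add (summable_of_hasFiniteSupport (f := fun n : ℤ² => if n = 0 then (1 : ℝ) else 0)
      ((Set.finite_singleton 0).subset (by intro n; simp))))
  have hle : ‖(finTwoArrowEquiv ℤ).symm n‖ ≤ jb n := by
    refine (pi_norm_le_iff_of_nonneg (jb_pos n).le).2 fun i => ?_; have hn := norm_freq_sq n
    have h0 := norm_nonneg (freq n)
    have : ∀ a b : ℝ, ‖freq n‖ ^ 2 = a ^ 2 + b ^ 2 → |a| ≤ jb n := by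
      intro a b hab
      refine (abs_le_of_sq_le_sq (b := ‖freq n‖) (by nlinarith [sq_nonneg b]) h0).trans ?_
      simp [jb]
    fin_cases i
    · simpa [Int.norm_eq_abs] using this _ _ hn
    · simpa [Int.norm_eq_abs] using this _ _ (hn.trans (add_comm _ _))
  by_cases hn : n = 0
  · subst hn; have h0 := norm_freq_sq 0; simp at h0; have hj : jb 0 = 1 := by simp [jb, h0]
    have h1 : (0 : ℝ) ≤ ((fun x : Fin 2 → ℤ => ‖x‖ ^ (-(2 + ρ))) ∘
        (finTwoArrowEquiv ℤ).symm) 0 := by simp only [Function.comp]; positivity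
    rw [hj, Real.one_rpow, if_pos rfl]; linarith
  · have hpos : 0 < ‖(finTwoArrowEquiv ℤ).symm n‖ := by
      rw [norm_pos_iff]; intro h0; apply hn; rw [← (finTwoArrowEquiv ℤ).apply_symm_apply n, h0]; rfl
    simp only [comp_apply, hn, if_false, add_zero]; rw [show -2 - ρ = -(2 + ρ) by ring]
    exact rpow_le_rpow_of_nonpos hpos hle (by linarith)

/-- `|f n| ≤ K (1 + |n|)^{-2+θ}`. -/
def Bd (θ K : ℝ) (f : Dist) : Prop := ∀ n, ‖f n‖ ≤ K * jb n ^ (-2 + θ)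

lemma jb_mul_le {θ : ℝ} (hθ : 0 < θ) (hθ' : 3 * θ ≤ 2) (n k : ℤ²) : jb (n - k) ^ (-2 + θ) * jb k ^
    (-2 + θ) ≤ 4 * jb n ^ (-2 + 3 * θ) * (jb (n - k) ^ (-2 - θ) + jb k ^ (-2 - θ)) := by
  have key : ∀ u v w : ℝ, 1 ≤ u → u ≤ v → 1 ≤ w → w ≤ u + v →
      u ^ (-2 + θ) * v ^ (-2 + θ) ≤ 4 * w ^ (-2 + 3 * θ) * u ^ (-2 - θ) := by
    intro u v w hu huv hw hwuv; have hu0 : 0 < u := by linarith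
    have hv0 : 0 < v := by linarith
    have hw0 : 0 < w := by linarith
    have h1 : v ^ (-2 + 3 * θ) ≤ 4 * w ^ (-2 + 3 * θ) := by
      calc v ^ (-2 + 3 * θ) ≤ (w / 2) ^ (-2 + 3 * θ) :=
            rpow_le_rpow_of_nonpos (by positivity) (by linarith) (by linarith)
        _ = 2 ^ (2 - 3 * θ) * w ^ (-2 + 3 * θ) := by
            rw [div_rpow hw0.le zero_le_two, show (2 : ℝ) - 3 * θ = -(-2 + 3 * θ) by ring,
              rpow_neg zero_le_two]
            field_simp
        _ ≤ 4 * w ^ (-2 + 3 * θ) := by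
            refine mul_le_mul_of_nonneg_right ?_ (by positivity)
            calc (2 : ℝ) ^ (2 - 3 * θ) ≤ 2 ^ (2 : ℝ) :=
                  rpow_le_rpow_of_exponent_le one_le_two (by linarith)
              _ = 4 := by norm_num
    have h2 : v ^ (-(2 * θ)) ≤ u ^ (-(2 * θ)) :=
      rpow_le_rpow_of_nonpos hu0 huv (by linarith)
    calc u ^ (-2 + θ) * v ^ (-2 + θ) = u ^ (-2 + θ) * (v ^ (-2 + 3 * θ) * v ^ (-(2 * θ))) := by
          rw [← rpow_add hv0]; ring_nf
      _ ≤ u ^ (-2 + θ) * (4 * w ^ (-2 + 3 * θ) * u ^ (-(2 * θ))) := by gcongr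
      _ = 4 * w ^ (-2 + 3 * θ) * (u ^ (-2 + θ) * u ^ (-(2 * θ))) := by ring
      _ = _ := by rw [← rpow_add hu0]; ring_nf
  have h0 := jb_pos n; have h1 := jb_pos (n - k); have h2 := jb_pos k
  rcases le_total (jb (n - k)) (jb k) with h | h
  · refine (key _ _ _ (one_le_jb _) h (one_le_jb _) (jb_le_add n k)).trans ?_
    exact mul_le_mul_of_nonneg_left (le_add_of_nonneg_right (by positivity)) (by positivity)
  · rw [mul_comm (jb (n - k) ^ (-2 + θ))]; refine (key _ _ _ (one_le_jb _) h (one_le_jb _)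
      ((jb_le_add n k).trans_eq (add_comm _ _))).trans ?_
    exact mul_le_mul_of_nonneg_left (le_add_of_nonneg_left (by positivity)) (by positivity)

lemma exists_bd_prod {θ : ℝ} (hθ : 0 < θ) (hθ' : 3 * θ ≤ 2) : ∃ C : ℝ, 0 ≤ C ∧ ∀ K L f g, 0 ≤ K → 0
    ≤ L → Bd θ K f → Bd θ L g → Bd (3 * θ) (C * (K * L)) (prod f g) := by
  have hs := summable_jb hθ; set A := ∑' n : ℤ², jb n ^ (-2 - θ) with hA
  have hA0 : 0 ≤ A := tsum_nonneg fun n => by have := jb_pos n; positivity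
  refine ⟨8 * A, by positivity, fun K L f g hK hL hf hg n => ?_⟩
  have h1 : HasSum (fun k => K * L * (4 * jb n ^ (-2 + 3 * θ) *
      (jb (n - k) ^ (-2 - θ) + jb k ^ (-2 - θ)))) (K * L * (4 * jb n ^ (-2 + 3 * θ) * (A + A))) :=
    ((((Equiv.subLeft n).hasSum_iff.2 hs.hasSum).add hs.hasSum).mul_left _).mul_left _
  refine (tsum_of_norm_bounded h1 fun k => ?_).trans_eq (by ring); rw [norm_mul]
  have h3 := jb_pos (n - k); have h4 := jb_pos k
  calc ‖f (n - k)‖ * ‖g k‖ ≤ (K * jb (n - k) ^ (-2 + θ)) * (L * jb k ^ (-2 + θ)) :=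
        mul_le_mul (hf _) (hg _) (norm_nonneg _) (by positivity)
    _ = K * L * (jb (n - k) ^ (-2 + θ) * jb k ^ (-2 + θ)) := by ring
    _ ≤ _ := mul_le_mul_of_nonneg_left (jb_mul_le hθ hθ' n k) (by positivity)

lemma Bd.mono {θ θ' K K' : ℝ} (h : Bd θ K f) (hθ : θ ≤ θ') (hK : K ≤ K')
    (hK' : 0 ≤ K') : Bd θ' K' f := fun n =>
  (h n).trans (mul_le_mul hK (rpow_le_rpow_of_exponent_le (one_le_jb n) (by linarith))
    (rpow_nonneg (jb_pos n).le _) hK')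

lemma Bd.conjD {θ K : ℝ} (h : Bd θ K f) : Bd θ K (conjD f) := fun n => by
  rw [SCGL.conjD, RCLike.norm_conj, ← jb_neg]; exact h (-n)

lemma Bd.add {θ K L : ℝ} (hf : Bd θ K f) (hg : Bd θ L g) : Bd θ (K + L) (f + g) :=
  fun n => (norm_add_le _ _).trans ((add_le_add (hf n) (hg n)).trans_eq (by ring))

/-- Two families with decay rate `θ` and size `K`, whose difference has size `K δ`. -/
structure BdPair (θ K δ : ℝ) (f f' : Dist) : Prop where
  fin : (support f).Finite
  fin' : (support f').Finite
  left : Bd θ K f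
  right : Bd θ K f'
  diff : Bd θ (K * δ) (f - f')

lemma BdPair.mono {θ θ' K K' δ : ℝ} {f f' : Dist} (h : BdPair θ K δ f f') (hθ : θ ≤ θ')
    (hK : K ≤ K') (hK' : 0 ≤ K') (hδ : 0 ≤ δ) : BdPair θ' K' δ f f' where
  fin := h.fin
  fin' := h.fin'
  left := h.left.mono hθ hK hK'
  right := h.right.mono hθ hK hK'
  diff := h.diff.mono hθ (mul_le_mul_of_nonneg_right hK hδ) (by positivity)

lemma BdPair.conjD {θ K δ : ℝ} {f f' : Dist} (h : BdPair θ K δ f f') :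
    BdPair θ K δ (conjD f) (conjD f') where
  fin := support_conjD_finite h.fin
  fin' := support_conjD_finite h.fin'
  left := h.left.conjD
  right := h.right.conjD
  diff := by rw [← conjD_sub]; exact h.diff.conjD

lemma prod_sub_prod_of_finite {f f' g g' : Dist} (hf : (support f).Finite) (hf' : (support
    f').Finite) : prod f g - prod f' g' = prod (f - f') g + prod f' (g - g') := by
  ext n; simp only [prod, Pi.sub_apply, Pi.add_apply, sub_mul, mul_sub]
  have h1 := summable_prod_of_finite_left (g := g) hf n
  have h2 := summable_prod_of_finite_left (g := g) hf' n
  have h3 := summable_prod_of_finite_left (g := g') hf' n; rw [h1.tsum_sub h2, h2.tsum_sub h3]; ring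

lemma exists_bdPair_prod {θ : ℝ} (hθ : 0 < θ) (hθ' : 3 * θ ≤ 2) : ∃ C : ℝ, 0 ≤ C ∧ ∀ K L δ f f' g
    g', 0 ≤ K → 0 ≤ L → 0 ≤ δ → BdPair θ K δ f f' → BdPair θ L δ g g' → BdPair (3 * θ) (C * (K * L))
    δ (prod f g) (prod f' g') := by
  obtain ⟨C, hC, H⟩ := exists_bd_prod hθ hθ'
  refine ⟨2 * C, by positivity, fun K L δ f f' g g' hK hL hδ hf hg => ?_⟩
  have h2 : C * (K * L) ≤ 2 * C * (K * L) := by nlinarith [mul_nonneg hC (mul_nonneg hK hL)]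
  exact
  { fin := support_prod_finite hf.fin hg.fin
    fin' := support_prod_finite hf.fin' hg.fin'
    left := (H _ _ _ _ hK hL hf.left hg.left).mono le_rfl h2 (by positivity)
    right := (H _ _ _ _ hK hL hf.right hg.right).mono le_rfl h2 (by positivity)
    diff := by
      rw [prod_sub_prod_of_finite hf.fin hf.fin']
      exact ((H _ _ _ _ (by positivity) hL hf.diff hg.left).add
        (H _ _ _ _ hK (by positivity) hf.right hg.diff)).mono le_rfl (le_of_eq (by ring))
        (by positivity) }

lemma exists_bdPair_powD (k : ℕ) {θ : ℝ} (hθ : 0 < θ) (hθ' : 3 ^ k * θ ≤ 2) {K : ℝ} (hK : 0 ≤ K) : ∃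
    C : ℝ, 0 ≤ C ∧ ∀ δ f f', 0 ≤ δ → BdPair θ K δ f f' → BdPair (3 ^ k * θ) C δ (powD f k) (powD f'
    k) := by
  induction k with
  | zero =>
    have h1 : Bd (3 ^ 0 * θ) 1 (Pi.single 0 1 : Dist) := by
      intro n; by_cases hn : n = 0
      · subst hn; have h0 := norm_freq_sq 0; simp at h0; simp [jb, h0]
      · have := jb_pos n; simp only [Pi.single_apply, hn, if_false, norm_zero]; positivity
    have hfin : (support (Pi.single 0 1 : Dist)).Finite :=
      (Set.finite_singleton 0).subset (by simp)
    refine ⟨1, zero_le_one, fun δ f f' hδ _ => ⟨hfin, hfin, h1, h1, fun n => ?_⟩⟩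
    have := jb_pos n; simp only [powD, sub_self, Pi.zero_apply, norm_zero]; positivity
  | succ k ih =>
    have h3 : (1 : ℝ) ≤ 3 ^ k := one_le_pow₀ (by norm_num)
    obtain ⟨C, hC, H⟩ := ih (by rw [pow_succ] at hθ'; nlinarith [mul_pos (by positivity : (0:ℝ) < 3 ^ k) hθ])
    obtain ⟨C', hC', H'⟩ := exists_bdPair_prod (θ := 3 ^ k * θ) (by positivity)
      (by rw [pow_succ] at hθ'; linarith)
    refine ⟨C' * (K * C), by positivity, fun δ f f' hδ hf => ?_⟩
    have := H' K C δ f f' _ _ hK hC hδ (hf.mono (by nlinarith) le_rfl hK hδ) (H δ f f' hδ hf)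
    rwa [← mul_assoc, ← pow_succ'] at this

/-- The coefficients of `|c|^{k+l}`-type products, the covariance of Wick powers. -/
def wcov (k l : ℕ) (c : Dist) : Dist := prod (powD c k) (powD (conjD c) l)

lemma exists_bdPair_wcov (k l : ℕ) {θ : ℝ} (hθ : 0 < θ) (hθ' : 3 ^ (k + l + 1) * θ ≤ 2) {K : ℝ} (hK
    : 0 ≤ K) : ∃ C : ℝ, 0 ≤ C ∧ ∀ δ f f', 0 ≤ δ → BdPair θ K δ f f' → BdPair (3 ^ (k + l + 1) * θ) C
    δ (wcov k l f) (wcov k l f') := by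
  have h3 : ∀ {i j : ℕ}, i ≤ j → (3 : ℝ) ^ i * θ ≤ 3 ^ j * θ := fun h =>
    mul_le_mul_of_nonneg_right (pow_le_pow_right₀ (by norm_num) h) hθ.le
  obtain ⟨C₁, hC₁, H₁⟩ := exists_bdPair_powD k hθ ((h3 (by omega)).trans hθ') hK
  obtain ⟨C₂, hC₂, H₂⟩ := exists_bdPair_powD l hθ ((h3 (by omega)).trans hθ') hK
  obtain ⟨C, hC, H⟩ := exists_bdPair_prod (θ := 3 ^ (k + l) * θ) (by positivity)
    (by rw [pow_succ] at hθ'; linarith)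
  refine ⟨C * (C₁ * C₂), by positivity, fun δ f f' hδ hf => ?_⟩
  have := H C₁ C₂ δ _ _ _ _ hC₁ hC₂ hδ ((H₁ δ f f' hδ hf).mono (h3 (by omega)) le_rfl hC₁ hδ)
    ((H₂ δ _ _ hδ hf.conjD).mono (h3 (by omega)) le_rfl hC₂ hδ)
  rwa [← mul_assoc, ← pow_succ'] at this

section WickMoments

variable {Ω : Type*} [MeasurableSpace Ω] {P : Measure Ω} {𝒢 : Submodule ℝ (Lp ℝ 2 P)}

lemma InC.congr {Z Z' : Ω → ℂ} (h : InC 𝒢 Z) (hZ : Z' =ᵐ[P] Z) : InC 𝒢 Z' := by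
  obtain ⟨f, hf, g, hg, h⟩ := h; exact ⟨f, hf, g, hg, hZ.trans h⟩

lemma InC.memLp {Z : Ω → ℂ} (h : InC 𝒢 Z) : MemLp Z 2 P := by
  obtain ⟨f, -, g, -, h⟩ := h; have hf : MemLp (fun ω => ((f ω : ℝ) : ℂ)) 2 P := (Lp.memLp f).ofReal
  have hg : MemLp (fun ω => I * ((g ω : ℝ) : ℂ)) 2 P := (Lp.memLp g).ofReal.const_mul _
  refine (memLp_congr_ae ?_).2 (hf.add hg); filter_upwards [h] with ω hω
  rw [hω, Pi.add_apply, mul_comm I]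

lemma InC.zero : InC 𝒢 (fun _ => 0) := by
  refine ⟨0, 𝒢.zero_mem, 0, 𝒢.zero_mem, ?_⟩; filter_upwards [Lp.coeFn_zero ℝ 2 P] with ω hω; rw [hω]
  simp

lemma InC.add {Z W : Ω → ℂ} (hZ : InC 𝒢 Z) (hW : InC 𝒢 W) : InC 𝒢 (fun ω => Z ω + W ω) := by
  obtain ⟨f, hf, g, hg, h⟩ := hZ; obtain ⟨f', hf', g', hg', h'⟩ := hW
  refine ⟨f + f', 𝒢.add_mem hf hf', g + g', 𝒢.add_mem hg hg', ?_⟩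
  filter_upwards [h, h', Lp.coeFn_add f f', Lp.coeFn_add g g'] with ω h1 h2 h3 h4
  rw [h1, h2, h3, h4]; simp only [Pi.add_apply]; push_cast; ring

lemma InC.const_mul {Z : Ω → ℂ} (c : ℂ) (hZ : InC 𝒢 Z) : InC 𝒢 (fun ω => c * Z ω) := by
  obtain ⟨f, hf, g, hg, h⟩ := hZ
  refine ⟨c.re • f - c.im • g, 𝒢.sub_mem (𝒢.smul_mem _ hf) (𝒢.smul_mem _ hg),
    c.re • g + c.im • f, 𝒢.add_mem (𝒢.smul_mem _ hg) (𝒢.smul_mem _ hf), ?_⟩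
  filter_upwards [h, Lp.coeFn_sub (c.re • f) (c.im • g), Lp.coeFn_add (c.re • g) (c.im • f),
    Lp.coeFn_smul c.re f, Lp.coeFn_smul c.im g, Lp.coeFn_smul c.re g, Lp.coeFn_smul c.im f]
    with ω h1 h2 h3 h4 h5 h6 h7
  rw [h1, h2, h3]
  simp only [Pi.add_apply, Pi.sub_apply, h4, h5, h6, h7, Pi.smul_apply, smul_eq_mul]
  apply Complex.ext <;> simp

lemma InC.sum {κ : Type*} (s : Finset κ) {Z : κ → Ω → ℂ} (hZ : ∀ r ∈ s, InC 𝒢 (Z r)) : InC 𝒢 (fun ω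
    => ∑ r ∈ s, Z r ω) := by
  classical
  induction s using Finset.induction_on with
  | empty => simpa using InC.zero
  | insert a s ha ih =>
    simp only [sum_insert ha]; exact (hZ a (Finset.mem_insert_self a s)).add
      (ih fun r hr => hZ r (Finset.mem_insert_of_mem hr))

lemma InC.integrable_mul {Z W : Ω → ℂ} (hZ : InC 𝒢 Z) (hW : InC 𝒢 W) :
    Integrable (fun ω => Z ω * W ω) P := hZ.memLp.integrable_mul hW.memLp

lemma InC.integrable_mul_conj {Z W : Ω → ℂ} (hZ : InC 𝒢 Z) (hW : InC 𝒢 W) :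
    Integrable (fun ω => Z ω * conj (W ω)) P := hZ.memLp.integrable_mul hW.memLp.star

/-- A pair of random trigonometric polynomials with jointly Gaussian coefficients, uncorrelated at
different frequencies. -/
structure GaussPair (𝒢 : Submodule ℝ (Lp ℝ 2 P)) (R : ℝ) (ξ : Bool → Ω → Dist) : Prop where
  supp : ∀ b ω, SuppIn R (ξ b ω)
  inC : ∀ b n, InC 𝒢 (fun ω => ξ b ω n)
  orth : ∀ b b' n m, ∫ ω, ξ b ω n * ξ b' ω m ∂P = 0
  orth_conj : ∀ b b' n m, n ≠ m → ∫ ω, ξ b ω n * conj (ξ b' ω m) ∂P = 0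

/-- The covariances of the Fourier coefficients. -/
def cov2 (P : Measure Ω) (ξ ζ : Ω → Dist) : Dist :=
  fun n => ∫ ω, ξ ω n * conj (ζ ω n) ∂P

namespace GaussPair

variable {R : ℝ} {ξ : Bool → Ω → Dist} (h : GaussPair 𝒢 R ξ)
include h

lemma ev_eq (b : Bool) (ω : Ω) (y : ℝ × ℝ) : ev (ξ b ω) y = ∑ n ∈ fball R, char2 n y * ξ b ω n := by
  rw [ev_eq_sum _ (h.supp b ω).subset]; exact sum_congr rfl fun n _ => mul_comm _ _

lemma inC_ev (b : Bool) (y : ℝ × ℝ) : InC 𝒢 (fun ω => ev (ξ b ω) y) := by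
  simp only [h.ev_eq]; exact InC.sum _ fun n _ => (h.inC b n).const_mul _

lemma integral_ev_mul (b b' : Bool) (y y' : ℝ × ℝ) : ∫ ω, ev (ξ b ω) y * ev (ξ b' ω) y' ∂P = 0 := by
  simp only [h.ev_eq, sum_mul_sum]
  rw [integral_finsetSum _ fun n _ => integrable_finsetSum _ fun m _ =>
    ((h.inC b n).const_mul _).integrable_mul ((h.inC b' m).const_mul _)]
  refine sum_eq_zero fun n _ => ?_; rw [integral_finsetSum _ fun m _ =>
    ((h.inC b n).const_mul _).integrable_mul ((h.inC b' m).const_mul _)]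
  refine sum_eq_zero fun m _ => ?_; have e : ∀ ω, char2 n y * ξ b ω n * (char2 m y' * ξ b' ω m) =
      char2 n y * char2 m y' * (ξ b ω n * ξ b' ω m) := fun ω => by ring
  simp only [e]; rw [integral_const_mul, h.orth, mul_zero]

lemma suppIn_cov2 (b b' : Bool) : SuppIn R (cov2 P (ξ b) (ξ b')) := fun n hn => by
  simp [cov2, h.supp b _ n hn]

lemma integral_ev_mul_conj (b b' : Bool) (y y' : ℝ × ℝ) : ∫ ω, ev (ξ b ω) y * conj (ev (ξ b' ω) y')
    ∂P = ev (cov2 P (ξ b) (ξ b')) (y - y') := by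
  simp only [h.ev_eq, map_sum, sum_mul_sum]
  rw [integral_finsetSum _ fun n _ => integrable_finsetSum _ fun m _ =>
    ((h.inC b n).const_mul _).integrable_mul_conj ((h.inC b' m).const_mul _),
    ev_eq_sum _ (h.suppIn_cov2 b b').subset]
  refine sum_congr rfl fun n hn => ?_
  have e : ∀ m ω, char2 n y * ξ b ω n * conj (char2 m y' * ξ b' ω m) =
      char2 n y * conj (char2 m y') * (ξ b ω n * conj (ξ b' ω m)) :=
    fun m ω => by rw [map_mul]; ring
  rw [integral_finsetSum _ fun m _ =>
    ((h.inC b n).const_mul _).integrable_mul_conj ((h.inC b' m).const_mul _),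
    Finset.sum_eq_single n]
  · simp only [e]; rw [integral_const_mul, cov2, sub_eq_add_neg, char2_add_arg, mul_comm]; congr 2
    rw [← char2_neg]; simp [char2]
  · intro m _ hmn; simp only [e]; rw [integral_const_mul, h.orth_conj _ _ _ _ hmn.symm, mul_zero]
  · exact fun h' => absurd hn h'

end GaussPair

lemma SuppIn.wcov {c : Dist} (hc : SuppIn R c) (k l : ℕ) : SuppIn ((k + l : ℕ) * R) (wcov k l c) :=
  ((hc.powD k).prod (hc.conjD.powD l)).mono (le_of_eq (by push_cast; ring))

lemma ev_wcov {c : Dist} (hc : SuppIn R c) (k l : ℕ) (y : ℝ × ℝ) : ev (wcov k l c) y = ev c y ^ k *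
    conj (ev c y) ^ l := by
  rw [wcov, ev_prod (hc.powD k).finite (hc.conjD.powD l).finite, ev_powD hc.finite,
    ev_powD hc.conjD.finite, ev_conjD]

lemma sum_sum_ev (S : Finset ℤ²) (hg : support g ⊆ S) {τ : ℤ² → ℂ} {m : ℕ} {c : Fin m → ℂ} {y : Fin
    m → ℝ × ℝ} (hc : ∀ n ∈ S, ∑ r, c r * char2 n (y r) = τ n) : ∑ r, ∑ s, c r * conj (c s) * ev g (y
    r - y s) = ∑ n ∈ S, (‖τ n‖ ^ 2 : ℂ) * g n := by
  have h1 : ∀ n ∈ S, (‖τ n‖ ^ 2 : ℂ) * g n = ∑ r, ∑ s, c r * conj (c s) *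
      (g n * char2 n (y r - y s)) := by
    intro n hn; rw [← mul_conj', ← hc n hn, map_sum, sum_mul_sum, sum_mul]
    refine sum_congr rfl fun r _ => ?_; rw [sum_mul]; refine sum_congr rfl fun s _ => ?_
    rw [sub_eq_add_neg, char2_add_arg, map_mul, ← char2_neg]
    have : char2 (-n) (y s) = char2 n (-y s) := by simp [char2]
    rw [this]; ring
  symm
  rw [sum_congr rfl h1, sum_comm]; refine sum_congr rfl fun r _ => ?_; rw [sum_comm]
  refine sum_congr rfl fun s _ => ?_; rw [ev_eq_sum S hg, mul_sum]

theorem GaussPair.moments [IsProbabilityMeasure P] (h𝒢 : IsGaussSpace P 𝒢) (hR : 0 ≤ R) {ξ : Bool →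
    Ω → Dist} (h : GaussPair 𝒢 R ξ) {σ : Bool → ℝ} (hσ : ∀ b x, σ b = ∫ ω, ‖ev (ξ b ω) x‖ ^ 2 ∂P) (k
    l : ℕ) (τ : ℤ² → ℂ) {W : Ω → ℂ} (hW : ∀ ω, W ω = ∑ n ∈ fball ((k + l : ℕ) * R), τ n * (wickD (σ
    true) (ξ true ω) k l n - wickD (σ false) (ξ false ω) k l n)) : (∀ q, Integrable (fun ω => ‖W ω‖
    ^ q) P) ∧ (∀ p : ℕ, ∫ ω, ‖W ω‖ ^ (2 * (p + 1)) ∂P ≤ (2 * p + 1 : ℝ) ^ ((k + l) * (p + 1)) * (∫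
    ω, ‖W ω‖ ^ 2 ∂P) ^ (p + 1)) ∧ ((∫ ω, ‖W ω‖ ^ 2 ∂P : ℝ) : ℂ) = k.factorial * l.factorial * ∑ n ∈
    fball ((k + l : ℕ) * R), (‖τ n‖ ^ 2 : ℂ) * ((wcov k l (cov2 P (ξ true) (ξ true)) n - wcov k l
    (cov2 P (ξ true) (ξ false)) n) + (wcov k l (cov2 P (ξ false) (ξ false)) n - wcov k l (cov2 P (ξ
    false) (ξ true)) n)) := by
  obtain ⟨m, c, y, hc⟩ := exists_sum_char2 (fball ((k + l : ℕ) * R)) τ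
  let sg : Bool → ℂ := fun b => if b then 1 else -1
  have hT : ∀ f : Dist, SuppIn ((k + l : ℕ) * R) f →
      ∑ n ∈ fball ((k + l : ℕ) * R), τ n * f n = ∑ r, c r * ev f (y r) := by
    intro f hf; have e := fun x => ev_eq_sum (fball ((k + l : ℕ) * R)) hf.subset x
    simp only [e, mul_sum]; rw [sum_comm]; refine sum_congr rfl fun n hn => ?_
    rw [← hc n hn, sum_mul]; exact sum_congr rfl fun r _ => by ring
  have key := wick_moments h𝒢 (ρ := Fin m × Bool) (Z := fun r ω => ev (ξ r.2 ω) (y r.1))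
    (fun r => h.inC_ev _ _) (fun r s => h.integral_ev_mul _ _ _ _) (fun r => sg r.2 * c r.1) k l
    (σ := fun r => σ r.2) (fun r => hσ _ _) (W := W) (fun ω => by
      simp only [hW, mul_sub, sum_sub_distrib]
      rw [hT _ ((h.supp _ _).wickD hR _ _ _), hT _ ((h.supp _ _).wickD hR _ _ _),
        Fintype.sum_prod_type_right, Fintype.sum_bool]
      simp only [sg, if_true, Bool.false_eq_true, if_false, ev_wickD hR (h.supp _ _), one_mul,
        neg_mul, Finset.sum_neg_distrib]
      rw [sub_eq_add_neg])
  refine ⟨key.1, key.2.1, key.2.2.trans ?_⟩; congr 1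
  simp only [h.integral_ev_mul_conj, ← ev_wcov (h.suppIn_cov2 _ _)]
  have hG := fun b b' => sum_sum_ev _ ((h.suppIn_cov2 b b').wcov k l).subset hc
  have hs : ∀ b b' : Bool, ∑ r, ∑ s, sg b * c r * conj (sg b' * c s) *
      ev (wcov k l (cov2 P (ξ b) (ξ b'))) (y r - y s) =
      sg b * sg b' * ∑ n ∈ fball ((k + l : ℕ) * R),
        (‖τ n‖ ^ 2 : ℂ) * wcov k l (cov2 P (ξ b) (ξ b')) n := by
    intro b b'; rw [← hG b b', mul_sum]; refine sum_congr rfl fun r _ => ?_; rw [mul_sum]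
    refine sum_congr rfl fun s _ => ?_
    have : conj (sg b') = sg b' := by cases b' <;> simp [sg]
    rw [map_mul, this]; ring
  simp only [Fintype.sum_prod_type_right, Fintype.sum_bool, sum_add_distrib, hs]
  simp only [sg, if_true, Bool.false_eq_true, if_false, mul_add, mul_sub, sum_add_distrib,
    sum_sub_distrib]
  ring

end WickMoments

lemma IsDyadicCutoff.exists_abs_dyadic_le (h : Cutoff) : ∃ M : ℝ, 0 ≤ M ∧ ∀ j ξ, |dyadic ϕ j ξ| ≤ M
    := by
  obtain ⟨M, hM⟩ := h.hasCompactSupport.exists_bound_of_continuous h.smooth.continuous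
  have hM0 : 0 ≤ M := (norm_nonneg _).trans (hM 0); refine ⟨2 * M, by positivity, fun j ξ => ?_⟩
  rcases j with _ | j
  · exact (hM ξ).trans (by linarith)
  · refine (abs_sub _ _).trans ?_; have h1 := hM (((2 : ℝ) ^ (j + 1))⁻¹ • ξ)
    have h2 := hM (((2 : ℝ) ^ j)⁻¹ • ξ); rw [norm_eq_abs] at h1 h2; linarith

lemma IsDyadicCutoff.exists_sum_dyadic_sq_le (h : Cutoff) {θ : ℝ} (hθ : 0 < θ) : ∃ C : ℝ, 0 ≤ C ∧ ∀
    (j : ℕ) (S : Finset ℤ²), ∑ n ∈ S, dyadic ϕ j (freq n) ^ 2 * jb n ^ (-2 + θ) ≤ C * (2 : ℝ) ^ (j *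
    (2 * θ)) := by
  obtain ⟨M, hM0, hM⟩ := h.exists_abs_dyadic_le; have hs := summable_jb hθ
  refine ⟨M ^ 2 * 4 ^ (2 * θ) * ∑' n, jb n ^ (-2 - θ), mul_nonneg (by positivity)
    (tsum_nonneg fun n => by have := jb_pos n; positivity), fun j S => ?_⟩
  have hterm : ∀ n ∈ S, dyadic ϕ j (freq n) ^ 2 * jb n ^ (-2 + θ) ≤
      M ^ 2 * 4 ^ (2 * θ) * (2 : ℝ) ^ (j * (2 * θ)) * jb n ^ (-2 - θ) := by
    intro n _; have hn := jb_pos n; by_cases h0 : dyadic ϕ j (freq n) = 0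
    · rw [h0]; simp; positivity
    have h1 := h.norm_lt_of_dyadic_ne_zero h0; have h2 : jb n ≤ 4 * 2 ^ j := by
      have : (1 : ℝ) ≤ 2 ^ j := one_le_pow₀ one_le_two; unfold jb; linarith
    have h3 : jb n ^ (2 * θ) ≤ 4 ^ (2 * θ) * (2 : ℝ) ^ (j * (2 * θ)) := by
      rw [rpow_mul zero_le_two, rpow_natCast, ← mul_rpow (by norm_num) (by positivity)]
      exact rpow_le_rpow hn.le h2 (by positivity)
    have h4 : dyadic ϕ j (freq n) ^ 2 ≤ M ^ 2 := by
      rw [← sq_abs]; exact pow_le_pow_left₀ (abs_nonneg _) (hM j _) 2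
    calc dyadic ϕ j (freq n) ^ 2 * jb n ^ (-2 + θ)
        = dyadic ϕ j (freq n) ^ 2 * (jb n ^ (2 * θ) * jb n ^ (-2 - θ)) := by
          rw [← rpow_add hn]; ring_nf
      _ ≤ M ^ 2 * (4 ^ (2 * θ) * (2 : ℝ) ^ (j * (2 * θ)) * jb n ^ (-2 - θ)) := by gcongr
      _ = _ := by ring
  calc _ ≤ ∑ n ∈ S, M ^ 2 * 4 ^ (2 * θ) * (2 : ℝ) ^ (j * (2 * θ)) * jb n ^ (-2 - θ) :=
        sum_le_sum hterm
    _ = M ^ 2 * 4 ^ (2 * θ) * (2 : ℝ) ^ (j * (2 * θ)) * ∑ n ∈ S, jb n ^ (-2 - θ) := by rw [mul_sum]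
    _ ≤ M ^ 2 * 4 ^ (2 * θ) * (2 : ℝ) ^ (j * (2 * θ)) * ∑' n, jb n ^ (-2 - θ) :=
        mul_le_mul_of_nonneg_left (hs.sum_le_tsum S fun n _ => by have := jb_pos n; positivity)
          (by positivity)
    _ = _ := by ring

/-- Nikolskii's inequality for trigonometric polynomials of degree at most `2^{j+1}`. -/
lemma exists_nikolskii (q : ℕ) : ∃ C : ℝ, 0 ≤ C ∧ ∀ (j : ℕ) (f : Dist), SuppIn (2 * 2 ^ j) f → ∀ x,
    ‖ev f x‖ ^ (2 * q) ≤ C * 8 ^ j * ∫ y in torusSq, ‖ev f y‖ ^ (2 * q) := by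
  have hs := summable_jb one_pos; set A := ∑' n : ℤ², jb n ^ (-2 - 1 : ℝ)
  have hA : 0 ≤ A := tsum_nonneg fun n => by have := jb_pos n; positivity
  refine ⟨A * (1 + 2 * q) ^ 3 * ((2 * π) ^ 2)⁻¹, by positivity, fun j f hf x => ?_⟩
  let S := fball (q * (2 * 2 ^ j)); have hg := hf.powD q
  have h1 : ∀ y, ‖ev f y‖ ^ (2 * q) = ‖ev (powD f q) y‖ ^ 2 := by
    intro y; rw [ev_powD hf.finite, norm_pow, ← pow_mul, mul_comm]
  simp only [h1]; rw [integral_norm_sq_ev S hg.subset]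
  have h2 : ‖ev (powD f q) x‖ ≤ ∑ n ∈ S, ‖powD f q n‖ := by
    rw [ev_eq_sum S hg.subset]; exact (norm_sum_le _ _).trans (le_of_eq (sum_congr rfl fun n _ => by
      rw [norm_mul, norm_char2, mul_one]))
  have h3 : (∑ n ∈ S, ‖powD f q n‖) ^ 2 ≤ (∑ n ∈ S, jb n ^ (-2 - 1 : ℝ)) *
      ∑ n ∈ S, jb n ^ (3 : ℕ) * ‖powD f q n‖ ^ 2 := by
    refine Finset.sum_sq_le_sum_mul_sum_of_sq_le_mul S (fun n _ => ?_) (fun n _ => ?_)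
      (fun n _ => le_of_eq ?_)
    · have := jb_pos n; positivity
    · have := jb_pos n; positivity
    · have := jb_pos n
      rw [show (-2 - 1 : ℝ) = -((3 : ℕ) : ℝ) by norm_num, rpow_neg this.le, rpow_natCast]
      field_simp
  have h4 : ∑ n ∈ S, jb n ^ (3 : ℕ) * ‖powD f q n‖ ^ 2 ≤
      ((1 + 2 * q) ^ 3 * 8 ^ j) * ∑ n ∈ S, ‖powD f q n‖ ^ 2 := by
    rw [mul_sum]; refine sum_le_sum fun n hn => mul_le_mul_of_nonneg_right ?_ (by positivity)
    have h5 : jb n ≤ (1 + 2 * q) * 2 ^ j := by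
      have := mem_fball.1 hn; have h6 : (1 : ℝ) ≤ 2 ^ j := one_le_pow₀ one_le_two
      unfold jb; nlinarith
    calc jb n ^ 3 ≤ ((1 + 2 * q) * 2 ^ j) ^ 3 := pow_le_pow_left₀ (jb_pos n).le h5 3
      _ = _ := by rw [mul_pow, ← pow_mul, mul_comm j 3, pow_mul]; norm_num
  have h7 : ∑ n ∈ S, jb n ^ (-2 - 1 : ℝ) ≤ A :=
    hs.sum_le_tsum S fun n _ => by have := jb_pos n; positivity
  calc ‖ev (powD f q) x‖ ^ 2 ≤ (∑ n ∈ S, ‖powD f q n‖) ^ 2 :=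
        pow_le_pow_left₀ (norm_nonneg _) h2 2
    _ ≤ A * (((1 + 2 * q) ^ 3 * 8 ^ j) * ∑ n ∈ S, ‖powD f q n‖ ^ 2) :=
        h3.trans (mul_le_mul h7 h4 (Finset.sum_nonneg fun n _ => by have := jb_pos n; positivity) hA)
    _ = _ := by field_simp

lemma iSup_pow_le {κ : Type*} {a : κ → 𝐄} {n : ℕ} (hn : n ≠ 0) {B : 𝐄} (h : ∀ i, a i ^ n ≤ B) : (⨆
    i, a i) ^ n ≤ B := by
  have hn' : (0 : ℝ) < n := by exact_mod_cast Nat.pos_of_ne_zero hn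
  have : ⨆ i, a i ≤ B ^ (n : ℝ)⁻¹ := iSup_le fun i => by
    rw [ENNReal.le_rpow_inv_iff hn', ENNReal.rpow_natCast]; exact h i
  rwa [ENNReal.le_rpow_inv_iff hn', ENNReal.rpow_natCast] at this

lemma IsDyadicCutoff.suppIn_bl (h : Cutoff) (j : ℕ) (f : Dist) : SuppIn (2 * 2 ^ j) (bl ϕ j f) := by
  intro n hn
  have : dyadic ϕ j (freq n) = 0 := by
    by_contra h0
    have := h.norm_lt_of_dyadic_ne_zero h0; have h6 : (0 : ℝ) < 2 ^ j := by positivity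
    linarith
  simp [bl, this]

lemma IsDyadicCutoff.exists_besov_pow_le (h : Cutoff) {q : ℕ} (hq : q ≠ 0) (ε : ℝ) : ∃ C : ℝ≥0, ∀ f
    : Dist, 𝐁 (-ε) f ^ (2 * q) ≤ ∑' j : ℕ, C * dy(j * (3 - 2 * q * ε)) * ∫⁻ y in torusSq, ‖ev (bl ϕ
    j f) y‖ₑ ^ (2 * q) := by
  obtain ⟨C, hC, H⟩ := exists_nikolskii q; refine ⟨C.toNNReal, fun f => ?_⟩; rw [besovNorm_eq]
  have h2q : 2 * q ≠ 0 := by omega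
  refine iSup_pow_le h2q fun j => ?_; refine le_trans ?_ (ENNReal.le_tsum j)
  rw [mul_pow, ← ofReal_pow (by positivity), supN]
  have h1 : (⨆ x, ‖ev (bl ϕ j f) x‖ₑ) ^ (2 * q) ≤ ofReal (C * 8 ^ j) *
      ∫⁻ y in torusSq, ‖ev (bl ϕ j f) y‖ₑ ^ (2 * q) := by
    refine iSup_pow_le h2q fun x => ?_; have hc : Continuous fun y => ‖ev (bl ϕ j f) y‖ ^ (2 * q) :=
      (continuous_ev (h.support_bl_finite j f)).norm.pow _
    have h3 : ∫⁻ y in torusSq, ‖ev (bl ϕ j f) y‖ₑ ^ (2 * q) =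
        ofReal (∫ y in torusSq, ‖ev (bl ϕ j f) y‖ ^ (2 * q)) := by
      rw [ofReal_integral_eq_lintegral_ofReal]
      · simp only [ofReal_pow (norm_nonneg _), ofReal_norm]
      · have := integrable_sq_of_continuous (continuous_ofReal.comp hc)
        exact (integrable_norm_iff hc.aestronglyMeasurable).1
          (this.norm.congr (ae_of_all _ fun y => by simp))
      · exact ae_of_all _ fun y => by positivity
    rw [h3, ← ofReal_mul (by positivity), ← ofReal_norm, ← ofReal_pow (norm_nonneg _)]
    exact ofReal_le_ofReal (H j _ (h.suppIn_bl j f) x)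
  refine (mul_le_mul_right h1 _).trans_eq ?_; rw [← mul_assoc, ← ofReal_mul (by positivity)]
  congr 1; change _ = ofReal C * _; rw [← ofReal_mul hC]; congr 1
  have e1 : (2 : ℝ) ^ (j * (3 - 2 * q * ε)) = 8 ^ j * ((2 : ℝ) ^ (j * -ε)) ^ (2 * q) := by
    rw [← rpow_natCast _ (2 * q), ← rpow_mul zero_le_two, show (8 : ℝ) ^ j = 2 ^ ((j : ℝ) * 3) by
        rw [mul_comm, rpow_mul zero_le_two, rpow_natCast]; norm_num,
      ← rpow_add two_pos]
    congr 1; push_cast; ring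
  rw [e1]; ring

section MomentBound

variable {Ω : Type*} [MeasurableSpace Ω] {P : Measure Ω} {𝒢 : Submodule ℝ (Lp ℝ 2 P)}

lemma prod_eq_sum (f : Dist) (hg : SuppIn R g) (n : ℤ²) : prod f g n = ∑ k ∈ fball R, f (n - k) * g
    k := by
  rw [prod, tsum_eq_sum (s := fball R)]; intro k hk
  rw [hg k (not_le.1 fun h => hk (mem_fball.2 h)), mul_zero]

lemma measurable_prod {F G : Ω → Dist} (hF : ∀ n, Measurable fun ω => F ω n) (hG : ∀ n, Measurable
    fun ω => G ω n) (hs : ∀ ω, SuppIn R (G ω)) (n : ℤ²) : Measurable fun ω => prod (F ω) (G ω) n :=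
    by
  simp only [fun ω => prod_eq_sum (F ω) (hs ω) n]
  exact Finset.measurable_sum _ fun k _ => (hF _).mul (hG _)

lemma measurable_conjD {F : Ω → Dist} (hF : ∀ n, Measurable fun ω => F ω n) (n : ℤ²) : Measurable
    fun ω => conjD (F ω) n := by
  unfold conjD; exact (Complex.continuous_conj.measurable).comp (hF _)

lemma measurable_powD {F : Ω → Dist} (hF : ∀ n, Measurable fun ω => F ω n) (hs : ∀ ω, SuppIn R (F
    ω)) (k : ℕ) (n : ℤ²) : Measurable fun ω => powD (F ω) k n := by
  induction k generalizing n with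
  | zero => exact measurable_const
  | succ k ih => exact measurable_prod hF ih (fun ω => (hs ω).powD k) n

lemma measurable_wickD {F : Ω → Dist} (hR : 0 ≤ R) (hF : ∀ n, Measurable fun ω => F ω n) (hs : ∀ ω,
    SuppIn R (F ω)) (σ : ℂ) (k l : ℕ) (n : ℤ²) : Measurable fun ω => wickD σ (F ω) k l n := by
  induction k generalizing l n with
  | zero => exact measurable_powD (measurable_conjD hF) (fun ω => (hs ω).conjD) l n
  | succ k ih =>
    exact (measurable_prod hF (ih l) (fun ω => (hs ω).wickD hR σ k l) n).sub
      ((ih (l - 1) n).const_mul _)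

lemma exists_gaussPair_moment_le [IsProbabilityMeasure P] (h𝒢 : IsGaussSpace P 𝒢) (k l : ℕ) {θ : ℝ}
    (hθ : 0 < θ) (hθ' : 3 ^ (k + l + 1) * θ ≤ 2) {K : ℝ} (hK : 0 ≤ K) (p : ℕ) : ∃ C : ℝ, 0 ≤ C ∧ ∀
    (R δ : ℝ) (ξ : Bool → Ω → Dist) (σ : Bool → ℝ), 0 ≤ R → 0 ≤ δ → GaussPair 𝒢 R ξ → (∀ b x, σ b =
    ∫ ω, ‖ev (ξ b ω) x‖ ^ 2 ∂P) → BdPair θ K δ (cov2 P (ξ true) (ξ true)) (cov2 P (ξ true) (ξ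
    false)) → BdPair θ K δ (cov2 P (ξ false) (ξ false)) (cov2 P (ξ false) (ξ true)) → ∀ τ : ℤ² → ℂ,
    ∫⁻ ω, ‖∑ n ∈ fball ((k + l : ℕ) * R), τ n * (wickD (σ true) (ξ true ω) k l n - wickD (σ false)
    (ξ false ω) k l n)‖ₑ ^ (2 * (p + 1)) ∂P ≤ ofReal (C * (δ * ∑ n ∈ fball ((k + l : ℕ) * R), ‖τ n‖
    ^ 2 * jb n ^ (-2 + 3 ^ (k + l + 1) * θ)) ^ (p + 1)) := by
  obtain ⟨C, hC, H⟩ := exists_bdPair_wcov k l hθ hθ' hK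
  refine ⟨(2 * p + 1 : ℝ) ^ ((k + l) * (p + 1)) * (k.factorial * l.factorial * (2 * C)) ^ (p + 1),
    by positivity, fun R δ ξ σ hR hδ hξ hσ h1 h2 τ => ?_⟩
  obtain ⟨m1, m2, m3⟩ := hξ.moments h𝒢 hR hσ k l τ (fun ω => rfl)
  set W := fun ω => ∑ n ∈ fball ((k + l : ℕ) * R), τ n *
    (wickD (σ true) (ξ true ω) k l n - wickD (σ false) (ξ false ω) k l n) with hW
  set S := fball ((k + l : ℕ) * R)
  have hsec : ∫ ω, ‖W ω‖ ^ 2 ∂P ≤ k.factorial * l.factorial * (2 * C) *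
      (δ * ∑ n ∈ S, ‖τ n‖ ^ 2 * jb n ^ (-2 + 3 ^ (k + l + 1) * θ)) := by
    have h0 : 0 ≤ ∫ ω, ‖W ω‖ ^ 2 ∂P := integral_nonneg fun _ => by positivity
    rw [← norm_of_nonneg h0, ← norm_real, m3, norm_mul, norm_mul,
      Complex.norm_natCast, Complex.norm_natCast, mul_assoc ((k.factorial : ℝ) * _)]
    refine mul_le_mul_of_nonneg_left ?_ (by positivity); rw [mul_sum, mul_sum]
    refine (norm_sum_le _ _).trans (sum_le_sum fun n _ => ?_)
    rw [norm_mul, norm_pow, norm_real, norm_norm]; have e1 := (H _ _ _ hδ h1).diff n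
    have e2 := (H _ _ _ hδ h2).diff n; simp only [Pi.sub_apply] at e1 e2
    calc _ ≤ ‖τ n‖ ^ 2 * (C * δ * jb n ^ (-2 + 3 ^ (k + l + 1) * θ) +
          C * δ * jb n ^ (-2 + 3 ^ (k + l + 1) * θ)) :=
          mul_le_mul_of_nonneg_left ((norm_add_le _ _).trans (add_le_add e1 e2)) (by positivity)
      _ = _ := by ring
  have hlin : ∫⁻ ω, ‖W ω‖ₑ ^ (2 * (p + 1)) ∂P = ofReal (∫ ω, ‖W ω‖ ^ (2 * (p + 1)) ∂P) := by
    rw [ofReal_integral_eq_lintegral_ofReal (m1 _) (ae_of_all _ fun ω => by positivity)]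
    simp only [ofReal_pow (norm_nonneg _), ofReal_norm]; rfl
  rw [hlin]; refine ofReal_le_ofReal ((m2 p).trans ?_); rw [mul_assoc, ← mul_pow]
  exact mul_le_mul_of_nonneg_left (pow_le_pow_left₀ (integral_nonneg fun _ => by positivity) hsec _)
    (by positivity)

theorem IsDyadicCutoff.exists_besov_moment_le [IsProbabilityMeasure P] (h : Cutoff) (h𝒢 :
    IsGaussSpace P 𝒢) (k l : ℕ) {ε θ : ℝ} (hθ : 0 < θ) (hθ' : 3 ^ (k + l + 1) * θ ≤ 2) (hθε : 3 ^ (k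
    + l + 1) * θ ≤ ε / 2) {K : ℝ} (hK : 0 ≤ K) {p : ℕ} (hp : 4 ≤ (p + 1) * ε) : ∃ C : ℝ≥0, ∀ (R δ :
    ℝ) (ξ : Bool → Ω → Dist) (σ : Bool → ℝ), 0 ≤ R → 0 ≤ δ → GaussPair 𝒢 R ξ → (∀ b n, Measurable
    fun ω => ξ b ω n) → (∀ b x, σ b = ∫ ω, ‖ev (ξ b ω) x‖ ^ 2 ∂P) → BdPair θ K δ (cov2 P (ξ true) (ξ
    true)) (cov2 P (ξ true) (ξ false)) → BdPair θ K δ (cov2 P (ξ false) (ξ false)) (cov2 P (ξ false)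
    (ξ true)) → ∫⁻ ω, 𝐁 (-ε) (wickD (σ true) (ξ true ω) k l - wickD (σ false) (ξ false ω) k l) ^ (2
    * (p + 1)) ∂P ≤ C * ofReal δ ^ (p + 1) := by
  obtain ⟨C₁, hC₁⟩ := h.exists_besov_pow_le (q := p + 1) (by omega) ε
  obtain ⟨C₂, hC₂0, hC₂⟩ := exists_gaussPair_moment_le h𝒢 k l hθ hθ' hK p
  set θ₁ := 3 ^ (k + l + 1) * θ with hθ₁; have hθ₁0 : 0 < θ₁ := by positivity
  obtain ⟨C₃, hC₃0, hC₃⟩ := h.exists_sum_dyadic_sq_le hθ₁0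
  let A : 𝐄 := C₁ * (ofReal (C₂ * C₃ ^ (p + 1)) * ofReal ((2 * π) ^ 2))
  have hA : A * geo 1 ≠ ∞ := mul_ne_top (by finiteness) (geo_lt_top one_pos).ne
  refine ⟨(A * geo 1).toNNReal, fun R δ ξ σ hR hδ hξ hm hσ h1 h2 => ?_⟩; rw [coe_toNNReal hA]
  let g : Ω → Dist := fun ω => wickD (σ true) (ξ true ω) k l - wickD (σ false) (ξ false ω) k l
  have hgm : ∀ n, Measurable fun ω => g ω n := fun n =>
    (measurable_wickD hR (hm true) (hξ.supp true) _ k l n).sub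
      (measurable_wickD hR (hm false) (hξ.supp false) _ k l n)
  have hgs : ∀ ω, SuppIn ((k + l : ℕ) * R) (g ω) := fun ω =>
    ((hξ.supp true ω).wickD hR _ k l).sub ((hξ.supp false ω).wickD hR _ k l)
  set S := fball ((k + l : ℕ) * R) with hS; have hev : ∀ j ω y, ev (bl ϕ j (g ω)) y =
      ∑ n ∈ S, ((dyadic ϕ j (freq n) : ℂ) * char2 n y) * g ω n := by
    intro j ω y; rw [ev_eq_sum S]
    · exact sum_congr rfl fun n _ => by simp only [bl]; ring
    · exact (Function.support_subset_iff'.2 fun n hn => by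
        simp [bl, Function.notMem_support.1 fun h' => hn ((hgs ω).subset h')])
  have hmj : ∀ j, Measurable fun z : Ω × (ℝ × ℝ) => ‖ev (bl ϕ j (g z.1)) z.2‖ₑ ^ (2 * (p + 1)) := by
    intro j; refine Measurable.pow_const (Measurable.enorm ?_) _; simp only [hev]
    exact Finset.measurable_sum _ fun n _ => (((continuous_char2 n).measurable.comp
      measurable_snd).const_mul _).mul ((hgm n).comp measurable_fst)
  have hj : ∀ j : ℕ, ∫⁻ ω, (C₁ * dy(j * (3 - 2 * (p + 1 : ℕ) * ε)) *
      ∫⁻ y in torusSq, ‖ev (bl ϕ j (g ω)) y‖ₑ ^ (2 * (p + 1))) ∂P ≤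
      A * dy(-((j : ℝ) * 1)) * ofReal δ ^ (p + 1) := by
    intro j; rw [lintegral_const_mul _ (hmj j).lintegral_prod_right', lintegral_lintegral_swap
      (hmj j).aemeasurable]
    have hy : ∀ y, ∫⁻ ω, ‖ev (bl ϕ j (g ω)) y‖ₑ ^ (2 * (p + 1)) ∂P ≤ ofReal (C₂ * C₃ ^ (p + 1)) *
          (dy(j * (2 * θ₁) * (p + 1 : ℕ)) * ofReal δ ^ (p + 1)) := by
      intro y; simp only [hev]; refine (hC₂ R δ ξ σ hR hδ hξ hσ h1 h2
        fun n => (dyadic ϕ j (freq n) : ℂ) * char2 n y).trans ?_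
      rw [← ofReal_pow hδ, ← ofReal_mul (by positivity), ← ofReal_mul (by positivity)]
      refine ofReal_le_ofReal ?_; rw [mul_assoc]; refine mul_le_mul_of_nonneg_left ?_ hC₂0
      rw [Real.rpow_mul_natCast zero_le_two, ← mul_pow, ← mul_pow]
      refine pow_le_pow_left₀ (mul_nonneg hδ (Finset.sum_nonneg fun n _ => by
        have := jb_pos n; positivity)) ?_ _
      have := hC₃ j S
      have e : ∀ n, ‖(dyadic ϕ j (freq n) : ℂ) * char2 n y‖ ^ 2 = dyadic ϕ j (freq n) ^ 2 := by
        intro n; rw [norm_mul, norm_char2, mul_one, norm_real, norm_eq_abs, sq_abs]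
      simp only [e]
      calc _ ≤ δ * (C₃ * (2 : ℝ) ^ (j * (2 * θ₁))) := mul_le_mul_of_nonneg_left this hδ
        _ = _ := by ring
    refine (mul_le_mul_right ((lintegral_mono hy).trans_eq (by
      rw [lintegral_const, Measure.restrict_apply_univ, volume_sq])) _).trans ?_
    have e2 : dy(j * (3 - 2 * (p + 1 : ℕ) * ε)) * dy(j * (2 * θ₁) * (p + 1 : ℕ)) ≤
        dy(-((j : ℝ) * 1)) := by
      rw [← ofReal_mul (by positivity), ← rpow_add two_pos]
      refine ofReal_le_ofReal (rpow_le_rpow_of_exponent_le one_le_two ?_)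
      have hj0 : (0 : ℝ) ≤ j := cast_nonneg j; push_cast; have hp0 : (0 : ℝ) ≤ p := cast_nonneg p
      nlinarith [mul_le_mul_of_nonneg_left hθε (by positivity : (0 : ℝ) ≤ 2 * (p + 1)),
        mul_nonneg hj0 (sub_nonneg.2 hp),
        mul_nonneg hj0 (sub_nonneg.2 (mul_le_mul_of_nonneg_left hθε
          (by positivity : (0 : ℝ) ≤ 2 * (p + 1))))]
    calc _ = A * (dy(j * (3 - 2 * (p + 1 : ℕ) * ε)) *
        dy(j * (2 * θ₁) * (p + 1 : ℕ))) * ofReal δ ^ (p + 1) := by simp only [A]; ring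
      _ ≤ _ := mul_le_mul_left (mul_le_mul_right e2 _) _
  calc ∫⁻ ω, 𝐁 (-ε) (g ω) ^ (2 * (p + 1)) ∂P ≤ ∫⁻ ω, ∑' j : ℕ, (C₁ *
        dy(j * (3 - 2 * (p + 1 : ℕ) * ε)) *
        ∫⁻ y in torusSq, ‖ev (bl ϕ j (g ω)) y‖ₑ ^ (2 * (p + 1))) ∂P :=
        lintegral_mono fun ω => hC₁ (g ω)
    _ = ∑' j : ℕ, ∫⁻ ω, (C₁ * dy(j * (3 - 2 * (p + 1 : ℕ) * ε)) *
        ∫⁻ y in torusSq, ‖ev (bl ϕ j (g ω)) y‖ₑ ^ (2 * (p + 1))) ∂P :=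
        lintegral_tsum fun j => ((hmj j).lintegral_prod_right'.const_mul _).aemeasurable
    _ ≤ ∑' j : ℕ, A * dy(-((j : ℝ) * 1)) * ofReal δ ^ (p + 1) :=
        tsum_le_tsum hj
    _ = _ := by rw [ENNReal.tsum_mul_right, ENNReal.tsum_mul_left, geo]

end MomentBound

/-! ### Stochastic convolutions -/

section Conv

/-- The covariance of two-sided Brownian motion. -/
def bcov (s t : ℝ) : ℝ := (|s| + |t| - |s - t|) / 2

variable {Ω : Type*} [MeasurableSpace Ω] {P : Measure Ω}

/-- A continuous complex process with the covariance of two-sided Brownian motion. -/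
structure IsWienerLike (P : Measure Ω) (B : ℝ → Ω → ℂ) : Prop where
  meas : ∀ t, Measurable (B t)
  cont : ∀ ω, Continuous fun t => B t ω
  memLp : ∀ t, MemLp (B t) 2 P
  cov : ∀ s t, ∫ ω, B s ω * conj (B t ω) ∂P = bcov s t

/-- A continuous complex process with the covariance of two-sided Brownian motion, whose paths
grow slower than `e^{ν|s|}` at `-∞`. -/
structure IsTwoSided (P : Measure Ω) (ν : ℝ) (B : ℝ → Ω → ℂ) : Prop extends IsWienerLike P B where
  int : ∀ ω, IntegrableOn (fun s => Real.exp (ν * s) * ‖B s ω‖) (Iic 0)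

/-- The stochastic convolution of `B` with the kernel `e^{-rμ}`, integrated by parts. -/
def sconv (μ : ℂ) (B : ℝ → Ω → ℂ) (t : ℝ) (ω : Ω) : ℂ :=
  B t ω - μ * ∫ s in Iic t, exp (-((t - s : ℝ) : ℂ) * μ) * B s ω

lemma integral_Iic_eq_Ioi {E : Type*} [NormedAddCommGroup E] [NormedSpace ℝ E] (f : ℝ → E) (t : ℝ) :
    ∫ s in Iic t, f s = ∫ r in Ioi 0, f (t - r) := by
  have h := (volume.measurePreserving_sub_left t).setIntegral_preimage_emb
    (MeasurableEquiv.subLeft t).measurableEmbedding f (Iic t)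
  rw [← h, ← integral_Ici_eq_integral_Ioi]; congr 2; ext r; simp

lemma integrableOn_Iic_iff_Ioi {E : Type*} [NormedAddCommGroup E] (f : ℝ → E) (t : ℝ) : IntegrableOn
    f (Iic t) ↔ IntegrableOn (fun r => f (t - r)) (Ioi 0) := by
  have h := (volume.measurePreserving_sub_left t).integrableOn_comp_preimage
    (MeasurableEquiv.subLeft t).measurableEmbedding (f := f) (s := Iic t)
  rw [← h, ← integrableOn_Ici_iff_integrableOn_Ioi]
  have : (fun x => t - x) ⁻¹' Iic t = Ici 0 := by ext r; simp
  rw [this]; rfl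

lemma bcov_self (t : ℝ) : bcov t t = |t| := by simp [bcov]

lemma bcov_sub (s t : ℝ) : bcov s s + bcov t t - 2 * bcov s t = |s - t| := by
  simp only [bcov, sub_self, abs_zero]; ring

namespace IsWienerLike

variable {B : ℝ → Ω → ℂ} (h : IsWienerLike P B)
include h

lemma integral_norm_sq (t : ℝ) : ∫ ω, ‖B t ω‖ ^ 2 ∂P = |t| := by
  have h1 := h.cov t t; simp only [mul_conj', bcov_self] at h1
  have h2 : ∫ ω, ((‖B t ω‖ ^ 2 : ℝ) : ℂ) ∂P = (|t| : ℝ) := by rw [← h1]; push_cast; rfl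
  rw [integral_complex_ofReal] at h2; exact_mod_cast h2

lemma integral_norm_sub_sq (s t : ℝ) : ∫ ω, ‖B s ω - B t ω‖ ^ 2 ∂P = |s - t| := by
  have h2 : ∫ ω, ((‖B s ω - B t ω‖ ^ 2 : ℝ) : ℂ) ∂P = (|s - t| : ℝ) := by
    have e : ∀ ω, ((‖B s ω - B t ω‖ ^ 2 : ℝ) : ℂ) = (B s ω * conj (B s ω) + B t ω * conj (B t ω)) -
        (B s ω * conj (B t ω) + B t ω * conj (B s ω)) := by
      intro ω; push_cast; rw [← mul_conj', map_sub]; ring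
    have hi : ∀ u v, Integrable (fun ω => B u ω * conj (B v ω)) P :=
      fun u v => (h.memLp u).integrable_mul (h.memLp v).star
    have hi2 : ∀ u v u' v', Integrable (fun ω => B u ω * conj (B v ω) +
        B u' ω * conj (B v' ω)) P := fun u v u' v' => (hi u v).add (hi u' v')
    simp only [e]
    rw [integral_sub (hi2 s s t t) (hi2 s t t s), integral_add (hi s s) (hi t t), integral_add (hi s t) (hi t s), h.cov, h.cov, h.cov, h.cov,
      ← bcov_sub]
    have : bcov t s = bcov s t := by simp only [bcov, abs_sub_comm t s]; ring
    rw [this]; push_cast; ring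
  rw [integral_complex_ofReal] at h2; exact_mod_cast h2

lemma measurable_uncurry : Measurable fun z : ℝ × Ω => B z.1 z.2 := by
  have := measurable_uncurry_of_continuous_of_measurable (u := fun t ω => B t ω)
    (fun ω => h.cont ω) h.meas
  exact this

end IsWienerLike

namespace IsTwoSided

variable {ν : ℝ} {B : ℝ → Ω → ℂ} (h : IsTwoSided P ν B)
include h

lemma integrableOn_Iic (t : ℝ) (ω : Ω) : IntegrableOn (fun s => Real.exp (ν * s) * ‖B s ω‖) (Iic t)
    := by
  have hc : Continuous fun s => Real.exp (ν * s) * ‖B s ω‖ := by have := h.cont ω; fun_prop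
  have h1 : IntegrableOn (fun s => Real.exp (ν * s) * ‖B s ω‖) (Icc 0 t) :=
    hc.continuousOn.integrableOn_Icc
  refine ((h.int ω).union h1).mono_set fun s hs => ?_; rcases le_total s 0 with h0 | h0
  · exact Or.inl h0
  · exact Or.inr ⟨h0, hs⟩

variable {μ : ℂ} (hμ : μ.re = ν)
include hμ

lemma integrableOn_exp_mul (t : ℝ) (ω : Ω) : IntegrableOn (fun s : ℝ => exp (s * μ) * B s ω) (Iic t)
    := by
  have hc : Continuous fun s : ℝ => exp (s * μ) * B s ω := by have := h.cont ω; fun_prop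
  refine (integrable_norm_iff hc.aestronglyMeasurable).1
    ((h.integrableOn_Iic t ω).congr (ae_of_all _ fun s => ?_))
  simp [norm_exp, hμ, mul_comm]

lemma integrableOn_kernel (t : ℝ) (ω : Ω) : IntegrableOn (fun s : ℝ => exp (-((t - s : ℝ) : ℂ) * μ)
    * B s ω) (Iic t) := by
  refine ((h.integrableOn_exp_mul hμ t ω).const_mul (exp (-(t * μ)))).congr
    (ae_of_all _ fun s => ?_)
  simp only []; rw [← mul_assoc, ← exp_add]; congr 2; push_cast; ring

lemma sconv_eq (t : ℝ) (ω : Ω) : sconv μ B t ω = B t ω - μ * (exp (-(t * μ)) * ((∫ s in Iic (0 : ℝ),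
    exp (s * μ) * B s ω) + ∫ s in (0 : ℝ)..t, exp (s * μ) * B s ω)) := by
  rw [← intervalIntegral.integral_Iic_sub_Iic (h.integrableOn_exp_mul hμ 0 ω)
    (h.integrableOn_exp_mul hμ t ω), add_sub_cancel, ← integral_const_mul, sconv]
  congr 3; ext s; rw [← mul_assoc, ← exp_add]; congr 2; push_cast; ring

lemma continuous_sconv (ω : Ω) : Continuous fun t => sconv μ B t ω := by
  simp only [h.sconv_eq hμ]; have hB := h.cont ω
  have hc : Continuous fun s : ℝ => exp (s * μ) * B s ω := by fun_prop
  have h2 : Continuous fun t : ℝ => ∫ s in (0 : ℝ)..t, exp (s * μ) * B s ω :=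
    intervalIntegral.continuous_primitive (fun a b => hc.intervalIntegrable a b) 0
  fun_prop

omit [MeasurableSpace Ω] h hμ in
lemma sconv_eq_Ioi (t : ℝ) (ω : Ω) : sconv μ B t ω = B t ω - μ * ∫ r in Ioi (0 : ℝ), exp (-(r * μ))
    * B (t - r) ω := by rw [sconv, integral_Iic_eq_Ioi]; congr 3; ext r; congr 2; push_cast; ring

lemma integrableOn_Ioi (t : ℝ) (ω : Ω) : IntegrableOn (fun r : ℝ => exp (-(r * μ)) * B (t - r) ω)
    (Ioi 0) := by
  refine ((integrableOn_Iic_iff_Ioi _ _).1 (h.integrableOn_kernel hμ t ω)).congr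
    (ae_of_all _ fun r => ?_)
  simp only []; congr 2; push_cast; ring

omit hμ in
lemma measurable_sconv (t : ℝ) : Measurable (sconv μ B t) := by
  have h1 : StronglyMeasurable fun ω =>
      ∫ r in Ioi (0 : ℝ), exp (-(r * μ)) * B (t - r) ω := by
    refine StronglyMeasurable.integral_prod_left'
      (f := fun z : ℝ × Ω => exp (-(z.1 * μ)) * B (t - z.1) z.2) ?_
    refine Measurable.stronglyMeasurable (Measurable.mul (by fun_prop) ?_)
    exact h.measurable_uncurry.comp (f := fun z : ℝ × Ω => (t - z.1, z.2)) (by fun_prop)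
  have : sconv μ B t = fun ω => B t ω - μ * ∫ r in Ioi (0 : ℝ), exp (-(r * μ)) * B (t - r) ω :=
    funext fun ω => sconv_eq_Ioi t ω
  rw [this]; exact (h.meas t).sub (h1.measurable.const_mul μ)

end IsTwoSided

lemma integrableOn_exp_kernel {μ : ℂ} (hμ : 0 < μ.re) : IntegrableOn (fun r : ℝ => exp (-(r * μ)))
    (Ioi 0) := by
  have := integrableOn_exp_mul_complex_Ioi (a := -μ) (by simpa using hμ) 0
  refine this.congr (ae_of_all _ fun r => ?_); simp [mul_comm]

lemma integral_exp_kernel {μ : ℂ} (hμ : 0 < μ.re) : μ * ∫ r in Ioi (0 : ℝ), exp (-(r * μ)) = 1 := by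
  have := integral_exp_mul_complex_Ioi (a := -μ) (by simpa using hμ) 0
  have h0 : μ ≠ 0 := by rintro rfl; simp at hμ
  have e : ∀ r : ℝ, exp (-(r * μ)) = exp (-μ * r) := fun r => by congr 1; ring
  simp only [e, this]; simp [h0]

lemma lintegral_exp_neg {ν : ℝ} (hν : 0 < ν) : ∫⁻ r in Ioi (0 : ℝ), ofReal (Real.exp (-(r * ν))) =
    ofReal (1 / ν) := by
  have h1 : IntegrableOn (fun r => Real.exp (-(r * ν))) (Ioi 0) := by
    have := exp_neg_integrableOn_Ioi 0 hν
    exact this.congr (ae_of_all _ fun r => by simp [mul_comm])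
  have h2 : ∫ r in Ioi (0 : ℝ), Real.exp (-(r * ν)) = 1 / ν := by
    have := integral_exp_mul_Ioi (a := -ν) (by linarith) 0
    have e : ∀ r : ℝ, Real.exp (-(r * ν)) = Real.exp (-ν * r) := fun r => by congr 1; ring
    simp only [e, this]; simp
  rw [← h2, ofReal_integral_eq_lintegral_ofReal h1 (ae_of_all _ fun r => (exp_pos _).le)]

lemma integral_mul_exp_neg {ν : ℝ} (hν : 0 < ν) : IntegrableOn (fun r => Real.exp (-(r * ν)) * r)
    (Ioi 0) ∧ ∫ r in Ioi (0 : ℝ), Real.exp (-(r * ν)) * r = (1 / ν) ^ 2 := by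
  have h := Real.integral_rpow_mul_exp_neg_mul_Ioi (a := 2) (r := ν) two_pos hν
  have e : ∀ r : ℝ, r ^ ((2 : ℝ) - 1) * Real.exp (-(ν * r)) = Real.exp (-(r * ν)) * r := by
    intro r; rw [show (2 : ℝ) - 1 = 1 by norm_num, rpow_one, mul_comm ν r, mul_comm]
  simp only [e] at h; have h2 : ∫ r in Ioi (0 : ℝ), Real.exp (-(r * ν)) * r = (1 / ν) ^ 2 := by
    rw [h]; rw [Real.Gamma_two, mul_one]; norm_num
  refine ⟨?_, h2⟩; by_contra hn
  rw [integral_undef hn] at h2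
  have : (0 : ℝ) < (1 / ν) ^ 2 := by positivity
  linarith

lemma lintegral_mul_exp_neg {ν : ℝ} (hν : 0 < ν) : ∫⁻ r in Ioi (0 : ℝ), ofReal (Real.exp (-(r * ν)))
    * ofReal r = ofReal ((1 / ν) ^ 2) := by
  obtain ⟨h1, h2⟩ := integral_mul_exp_neg hν; rw [← h2, ofReal_integral_eq_lintegral_ofReal h1]
  · exact lintegral_congr fun r => (ofReal_mul (exp_pos _).le).symm
  · filter_upwards [ae_restrict_mem measurableSet_Ioi] with r hr
    have : (0 : ℝ) < r := hr; positivity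

lemma lintegral_sq_conv_le [SFinite P] {μ : ℂ} (hμ : 0 < μ.re) {D : ℝ → Ω → ℂ} (hD : Measurable fun
    z : ℝ × Ω => D z.1 z.2) : ∫⁻ ω, ‖μ * ∫ r in Ioi (0 : ℝ), exp (-(r * μ)) * D r ω‖ₑ ^ 2 ∂P ≤ ‖μ‖ₑ
    ^ 2 * ofReal (1 / μ.re) * ∫⁻ r in Ioi (0 : ℝ), ofReal (Real.exp (-(r * μ.re))) * ∫⁻ ω, ‖D r ω‖ₑ
    ^ 2 ∂P := by
  set w : ℝ → 𝐄 := fun r => ofReal (Real.exp (-(r * μ.re))) with hw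
  have hwm : Measurable w := by fun_prop
  have hpt : ∀ ω, ‖μ * ∫ r in Ioi (0 : ℝ), exp (-(r * μ)) * D r ω‖ₑ ^ 2 ≤
      ‖μ‖ₑ ^ 2 * ofReal (1 / μ.re) * ∫⁻ r in Ioi (0 : ℝ), w r * ‖D r ω‖ₑ ^ 2 := by
    intro ω; have hDω : Measurable fun r => D r ω := hD.comp measurable_prodMk_right
    rw [enorm_mul, mul_pow, mul_assoc]; refine mul_le_mul_right ?_ _
    have h1 : ‖∫ r in Ioi (0 : ℝ), exp (-(r * μ)) * D r ω‖ₑ ≤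
        ∫⁻ r in Ioi (0 : ℝ), w r ^ (1 / 2 : ℝ) * (w r ^ (1 / 2 : ℝ) * ‖D r ω‖ₑ) := by
      refine (enorm_integral_le_lintegral_enorm _).trans_eq (lintegral_congr fun r => ?_)
      rw [enorm_mul, ← mul_assoc, ← ENNReal.rpow_add_of_nonneg _ _ (by norm_num) (by norm_num)]
      norm_num; congr 1; rw [hw, ← ofReal_norm, norm_exp]; simp
    have h2 : ∫⁻ r in Ioi (0 : ℝ), w r ^ (1 / 2 : ℝ) * (w r ^ (1 / 2 : ℝ) * ‖D r ω‖ₑ) ≤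
        (∫⁻ r in Ioi (0 : ℝ), (w r ^ (1 / 2 : ℝ)) ^ (2 : ℝ)) ^ (1 / 2 : ℝ) *
        (∫⁻ r in Ioi (0 : ℝ), (w r ^ (1 / 2 : ℝ) * ‖D r ω‖ₑ) ^ (2 : ℝ)) ^ (1 / 2 : ℝ) :=
      ENNReal.lintegral_mul_le_Lp_mul_Lq _ Real.HolderConjugate.two_two
        (hwm.pow_const _).aemeasurable ((hwm.pow_const _).mul hDω.enorm).aemeasurable
    have e1 : ∀ r, (w r ^ (1 / 2 : ℝ)) ^ (2 : ℝ) = w r := fun r => by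
      rw [← ENNReal.rpow_mul]; norm_num
    have e2 : ∀ r, (w r ^ (1 / 2 : ℝ) * ‖D r ω‖ₑ) ^ (2 : ℝ) = w r * ‖D r ω‖ₑ ^ 2 := fun r => by
      rw [ENNReal.mul_rpow_of_nonneg _ _ zero_le_two, e1]; norm_num
    have e3 : ∫⁻ r in Ioi (0 : ℝ), w r = ofReal (1 / μ.re) := lintegral_exp_neg hμ
    simp only [e1, e2, e3] at h2
    calc _ ≤ (ofReal (1 / μ.re) ^ (1 / 2 : ℝ) *
          (∫⁻ r in Ioi (0 : ℝ), w r * ‖D r ω‖ₑ ^ 2) ^ (1 / 2 : ℝ)) ^ 2 :=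
          pow_le_pow_left' (h1.trans h2) 2
      _ = _ := by
          rw [mul_pow, ← ENNReal.rpow_natCast, ← ENNReal.rpow_natCast, ← ENNReal.rpow_mul,
            ← ENNReal.rpow_mul]
          norm_num
  refine (lintegral_mono hpt).trans ?_
  have hm : Measurable fun z : ℝ × Ω => w z.1 * ‖D z.1 z.2‖ₑ ^ 2 :=
    (hwm.comp measurable_fst).mul (hD.enorm.pow_const 2)
  rw [lintegral_const_mul _ hm.lintegral_prod_left', lintegral_lintegral_swap
    (f := fun ω r => w r * ‖D r ω‖ₑ ^ 2) (hm.comp measurable_swap).aemeasurable]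
  refine mul_le_mul_right (le_of_eq (lintegral_congr fun r => ?_)) _
  exact lintegral_const_mul _ ((hD.comp measurable_prodMk_left).enorm.pow_const 2)

namespace IsWienerLike

variable {B : ℝ → Ω → ℂ} (h : IsWienerLike P B)
include h

lemma lintegral_sub_sq (s t : ℝ) : ∫⁻ ω, ‖B s ω - B t ω‖ₑ ^ 2 ∂P = ofReal |s - t| := by
  have hi : Integrable (fun ω => ‖B s ω - B t ω‖ ^ 2) P :=
    ((h.memLp s).sub (h.memLp t)).integrable_norm_pow two_ne_zero
  rw [← h.integral_norm_sub_sq s t, ofReal_integral_eq_lintegral_ofReal hi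
    (ae_of_all _ fun ω => by positivity)]
  exact lintegral_congr fun ω => by rw [ofReal_pow (norm_nonneg _), ofReal_norm]

lemma lintegral_sq (t : ℝ) : ∫⁻ ω, ‖B t ω‖ₑ ^ 2 ∂P = ofReal |t| := by
  rw [← h.integral_norm_sq t, ofReal_integral_eq_lintegral_ofReal
    ((h.memLp t).integrable_norm_pow two_ne_zero) (ae_of_all _ fun ω => by positivity)]
  exact lintegral_congr fun ω => by rw [ofReal_pow (norm_nonneg _), ofReal_norm]

lemma integrable_prod_kernel [SFinite P] {μ : ℂ} {ν : ℝ} (hμ : μ.re = ν) (hν : 0 < ν) {W : Ω → ℂ}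
    (hW : MemLp W 2 P) (t : ℝ) : Integrable (fun z : Ω × ℝ => W z.1 * (exp (-(z.2 * μ)) * B (t -
    z.2) z.1)) (P.prod (volume.restrict (Ioi 0))) := by
  have hm : AEStronglyMeasurable
      (fun z : Ω × ℝ => W z.1 * (exp (-(z.2 * μ)) * B (t - z.2) z.1))
      (P.prod (volume.restrict (Ioi 0))) := by
    refine hW.1.comp_fst.mul (Measurable.mul (by fun_prop) ?_).aestronglyMeasurable
    exact h.measurable_uncurry.comp (f := fun z : Ω × ℝ => (t - z.2, z.1)) (by fun_prop)
  refine ⟨hm, ?_⟩; rw [HasFiniteIntegral, lintegral_prod_symm _ hm.enorm]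
  have hA : ∫⁻ ω, ‖W ω‖ₑ ^ 2 ∂P < ⊤ := by
    have := (hW.integrable_norm_pow two_ne_zero).2; simpa [HasFiniteIntegral] using this
  have e : ∀ r ∈ Ioi (0 : ℝ), ∫⁻ ω, ‖W ω * (exp (-(r * μ)) * B (t - r) ω)‖ₑ ∂P ≤
      ofReal (Real.exp (-(r * ν))) * (∫⁻ ω, ‖W ω‖ₑ ^ 2 ∂P + ofReal |t|) +
      ofReal (Real.exp (-(r * ν))) * ofReal r := by
    intro r hr; have h1 : ∀ ω, ‖W ω * (exp (-(r * μ)) * B (t - r) ω)‖ₑ ≤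
        ofReal (Real.exp (-(r * ν))) * (‖W ω‖ₑ ^ 2 + ‖B (t - r) ω‖ₑ ^ 2) := by
      intro ω
      have : ‖exp (-(r * μ))‖ₑ = ofReal (Real.exp (-(r * ν))) := by
        rw [← ofReal_norm, norm_exp]; simp [hμ]
      rw [enorm_mul, enorm_mul, this, mul_left_comm]; refine mul_le_mul_right ?_ _
      rcases le_total ‖W ω‖ₑ ‖B (t - r) ω‖ₑ with hl | hl
      · exact (mul_le_mul_left hl _).trans (by rw [← sq]; exact le_add_self)
      · exact (mul_le_mul_right hl _).trans (by rw [← sq]; exact le_self_add)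
    refine (lintegral_mono h1).trans ?_
    have hs : AEMeasurable (fun ω => ‖W ω‖ₑ ^ 2 + ‖B (t - r) ω‖ₑ ^ 2) P :=
      (hW.1.enorm.pow_const 2).add ((h.meas _).enorm.pow_const 2).aemeasurable
    rw [lintegral_const_mul'' _ hs, lintegral_add_right _
      ((h.meas _).enorm.pow_const 2), h.lintegral_sq, ← mul_add, add_assoc,
      ← ofReal_add (abs_nonneg t) hr.le]
    refine mul_le_mul_right (add_le_add_right (ofReal_le_ofReal ?_) _) _
    exact (abs_sub t r).trans (by rw [abs_of_pos (show 0 < r from hr)])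
  refine (setLIntegral_mono (by fun_prop) e).trans_lt ?_
  rw [lintegral_add_left (by fun_prop), lintegral_mul_const _ (by fun_prop), lintegral_exp_neg hν,
    lintegral_mul_exp_neg hν]
  exact add_lt_top.2 ⟨mul_lt_top ofReal_lt_top
    (add_lt_top.2 ⟨hA, ofReal_lt_top⟩), ofReal_lt_top⟩

end IsWienerLike

namespace IsTwoSided

variable {ν : ℝ} {B : ℝ → Ω → ℂ} (h : IsTwoSided P ν B) {μ : ℂ} (hμ : μ.re = ν) (hν : 0 < ν)
include h hμ hν

lemma sconv_eq_increments (t : ℝ) (ω : Ω) : sconv μ B t ω = μ * ∫ r in Ioi (0 : ℝ), exp (-(r * μ)) *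
    (B t ω - B (t - r) ω) := by
  have hμ0 : 0 < μ.re := hμ ▸ hν; simp only [mul_sub]
  rw [integral_sub ((integrableOn_exp_kernel hμ0).mul_const _) (h.integrableOn_Ioi hμ t ω),
    integral_mul_const, mul_sub, ← mul_assoc, integral_exp_kernel hμ0, one_mul, sconv_eq_Ioi]

lemma lintegral_sconv_sq_le [SFinite P] (t : ℝ) : ∫⁻ ω, ‖sconv μ B t ω‖ₑ ^ 2 ∂P ≤ ofReal (‖μ‖ ^ 2 /
    ν ^ 3) := by
  have hμ0 : 0 < μ.re := hμ ▸ hν; simp only [h.sconv_eq_increments hμ hν t]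
  refine (lintegral_sq_conv_le hμ0 (D := fun r ω => B t ω - B (t - r) ω) ?_).trans ?_
  · exact ((h.meas t).comp measurable_snd).sub
      (h.measurable_uncurry.comp (f := fun z : ℝ × Ω => (t - z.1, z.2)) (by fun_prop))
  have e : ∀ r ∈ Ioi (0 : ℝ), ofReal (Real.exp (-(r * μ.re))) *
      ∫⁻ ω, ‖B t ω - B (t - r) ω‖ₑ ^ 2 ∂P =
      ofReal (Real.exp (-(r * μ.re))) * ofReal r := by
    intro r hr; rw [h.lintegral_sub_sq, sub_sub_cancel, abs_of_pos hr]
  rw [setLIntegral_congr_fun measurableSet_Ioi e, lintegral_mul_exp_neg hμ0, ← ofReal_norm,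
    ← ofReal_pow (norm_nonneg _), ← ofReal_mul (by positivity),
    ← ofReal_mul (by positivity), hμ]
  exact ofReal_le_ofReal (le_of_eq (by field_simp))

lemma lintegral_sconv_sub_sq_le [SFinite P] (s t : ℝ) : ∫⁻ ω, ‖sconv μ B t ω - sconv μ B s ω‖ₑ ^ 2
    ∂P ≤ ofReal (4 * (‖μ‖ / ν) ^ 2 * |t - s|) := by
  have hμ0 : 0 < μ.re := hμ ▸ hν
  have e0 : ∀ ω, sconv μ B t ω - sconv μ B s ω = μ * ∫ r in Ioi (0 : ℝ),
      exp (-(r * μ)) * ((B t ω - B s ω) - (B (t - r) ω - B (s - r) ω)) := by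
    intro ω
    rw [h.sconv_eq_increments hμ hν, h.sconv_eq_increments hμ hν, ← mul_sub, ← integral_sub]
    · congr 2; ext r; ring
    · simp only [mul_sub]
      exact ((integrableOn_exp_kernel hμ0).mul_const _).sub (h.integrableOn_Ioi hμ t ω)
    · simp only [mul_sub]
      exact ((integrableOn_exp_kernel hμ0).mul_const _).sub (h.integrableOn_Ioi hμ s ω)
  simp only [e0]; refine (lintegral_sq_conv_le hμ0
    (D := fun r ω => (B t ω - B s ω) - (B (t - r) ω - B (s - r) ω)) ?_).trans ?_
  · exact ((((h.meas t).sub (h.meas s)).comp measurable_snd)).sub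
      ((h.measurable_uncurry.comp (f := fun z : ℝ × Ω => (t - z.1, z.2)) (by fun_prop)).sub
      (h.measurable_uncurry.comp (f := fun z : ℝ × Ω => (s - z.1, z.2)) (by fun_prop)))
  have e : ∀ r, ∫⁻ ω, ‖(B t ω - B s ω) - (B (t - r) ω - B (s - r) ω)‖ₑ ^ 2 ∂P ≤
      ofReal (4 * |t - s|) := by
    intro r; have h1 : ∀ a b : ℂ, ‖a - b‖ₑ ^ 2 ≤ 2 * ‖a‖ₑ ^ 2 + 2 * ‖b‖ₑ ^ 2 := by
      intro a b; simp only [← ofReal_norm, ← ofReal_pow (norm_nonneg _)]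
      rw [show (2 : 𝐄) = ofReal 2 by simp, ← ofReal_mul zero_le_two,
        ← ofReal_mul zero_le_two, ← ofReal_add (by positivity) (by positivity)]
      refine ofReal_le_ofReal ?_
      have := norm_sub_le a b
      nlinarith [sq_nonneg (‖a‖ - ‖b‖), norm_nonneg (a - b), norm_nonneg a, norm_nonneg b]
    refine (lintegral_mono fun ω => h1 _ _).trans ?_
    have hm : ∀ u v, Measurable fun ω => ‖B u ω - B v ω‖ₑ ^ 2 :=
      fun u v => ((h.meas u).sub (h.meas v)).enorm.pow_const 2
    rw [lintegral_add_left ((hm t s).const_mul 2), lintegral_const_mul _ (hm _ _),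
      lintegral_const_mul _ (hm _ _),
      h.lintegral_sub_sq, h.lintegral_sub_sq, sub_sub_sub_cancel_right,
      show (2 : 𝐄) = ofReal 2 by simp, ← ofReal_mul zero_le_two,
      ← ofReal_add (by positivity) (by positivity)]
    exact ofReal_le_ofReal (le_of_eq (by ring))
  calc _ ≤ ‖μ‖ₑ ^ 2 * ofReal (1 / μ.re) * ∫⁻ r in Ioi (0 : ℝ),
        ofReal (Real.exp (-(r * μ.re))) * ofReal (4 * |t - s|) :=
        mul_le_mul_right (lintegral_mono fun r => mul_le_mul_right (e r) _) _
    _ = _ := by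
      rw [lintegral_mul_const _ (by fun_prop), lintegral_exp_neg hμ0, ← ofReal_norm,
        ← ofReal_pow (norm_nonneg _), ← ofReal_mul (by positivity),
        ← ofReal_mul (by positivity), ← ofReal_mul (by positivity), hμ]
      congr 1; field_simp

lemma memLp_sconv [SFinite P] (t : ℝ) : MemLp (sconv μ B t) 2 P := by
  have hm := (h.measurable_sconv (μ := μ) t)
  refine (memLp_two_iff_integrable_sq_norm hm.aestronglyMeasurable).2
    ⟨(hm.norm.pow_const 2).aestronglyMeasurable, ?_⟩
  refine lt_of_le_of_lt (le_of_eq (lintegral_congr fun ω => ?_))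
    ((h.lintegral_sconv_sq_le hμ hν t).trans_lt ofReal_lt_top)
  rw [enorm_pow, enorm_norm]

lemma integral_mul_sconv [SFinite P] {W : Ω → ℂ} (hW : MemLp W 2 P) (t : ℝ) : ∫ ω, W ω * sconv μ B t
    ω ∂P = ∫ ω, W ω * B t ω ∂P - μ * ∫ r in Ioi (0 : ℝ), exp (-(r * μ)) * ∫ ω, W ω * B (t - r) ω ∂P
    := by
  have hi := h.integrable_prod_kernel hμ hν hW t; have e1 : ∀ ω, W ω * sconv μ B t ω = W ω * B t ω -
      μ * ∫ r in Ioi (0 : ℝ), W ω * (exp (-(r * μ)) * B (t - r) ω) := fun ω => by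
    rw [sconv_eq_Ioi, integral_const_mul]; ring
  have i1 : Integrable (fun ω => W ω * B t ω) P := hW.integrable_mul (h.memLp t)
  have i2 := hi.integral_prod_left; simp only [e1]
  rw [integral_sub i1 (i2.const_mul μ), integral_const_mul, integral_integral_swap hi]; congr 3
  ext r; rw [← integral_const_mul]; congr 1; ext ω; ring

lemma integral_mul_sconv_eq_zero [SFinite P] {W : Ω → ℂ} (hW : MemLp W 2 P) (h0 : ∀ t, ∫ ω, W ω * B
    t ω ∂P = 0) (t : ℝ) : ∫ ω, W ω * sconv μ B t ω ∂P = 0 := by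
  rw [h.integral_mul_sconv hμ hν hW]; simp [h0]

lemma integral_norm_sconv_sq_pos [SFinite P] (t : ℝ) : 0 < ∫ ω, ‖sconv μ B t ω‖ ^ 2 ∂P := by
  have hμ0 : 0 < μ.re := hμ ▸ hν; have hμn : 0 < ‖μ‖ := norm_pos_iff.2 fun h0 => by simp [h0] at hμ0
  refine lt_of_le_of_ne (integral_nonneg fun ω => by positivity) fun hc => ?_
  have hX : sconv μ B t =ᵐ[P] 0 := by
    have := (integral_eq_zero_iff_of_nonneg (fun ω => by positivity)
      ((h.memLp_sconv hμ hν t).integrable_norm_pow two_ne_zero)).1 hc.symm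
    filter_upwards [this] with ω hω; simpa using hω
  set δ : ℝ := 1 / (2 * ‖μ‖) with hδ; have hδ0 : 0 < δ := by positivity
  have hW : MemLp (fun ω => conj (B t ω - B (t - δ) ω)) 2 P :=
    ((h.memLp t).sub (h.memLp (t - δ))).star
  have hc : ∀ r, 0 ≤ r → ∫ ω, conj (B t ω - B (t - δ) ω) * B (t - r) ω ∂P =
      (((|t| - |t - δ| - δ) / 2 + max (δ - r) 0 : ℝ) : ℂ) := by
    intro r hr; have hi : ∀ u v, Integrable (fun ω => B u ω * conj (B v ω)) P :=
      fun u v => (h.memLp u).integrable_mul (h.memLp v).star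
    have e : ∀ ω, conj (B t ω - B (t - δ) ω) * B (t - r) ω =
        B (t - r) ω * conj (B t ω) - B (t - r) ω * conj (B (t - δ) ω) :=
      fun ω => by rw [map_sub]; ring
    simp only [e]; rw [integral_sub (hi _ _) (hi _ _), h.cov, h.cov, ← Complex.ofReal_sub]; congr 1
    simp only [bcov]
    rw [show t - r - t = -r by ring, show t - r - (t - δ) = δ - r by ring, abs_neg,
      abs_of_nonneg hr]
    rcases le_total r δ with hl | hl
    · rw [abs_of_nonneg (by linarith : 0 ≤ δ - r), max_eq_left (by linarith)]; ring
    · rw [abs_of_nonpos (by linarith : δ - r ≤ 0), max_eq_right (by linarith)]; ring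
  have hF := h.integral_mul_sconv hμ hν hW t
  have hL : ∫ ω, conj (B t ω - B (t - δ) ω) * sconv μ B t ω ∂P = 0 := by
    rw [integral_congr_ae (g := fun _ => (0 : ℂ)) (hX.mono fun ω hω => by simp [hω])]; simp
  have h0 := hc 0 le_rfl; rw [sub_zero, sub_zero, max_eq_left hδ0.le] at h0
  set q : ℝ := (|t| - |t - δ| - δ) / 2
  have hj : IntegrableOn (fun r : ℝ => exp (-(r * μ)) * ((max (δ - r) 0 : ℝ) : ℂ))
      (Ioi 0) := by
    refine ((integrableOn_exp_kernel hμ0).norm.mul_const δ).mono'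
      (by fun_prop) ?_
    filter_upwards [ae_restrict_mem measurableSet_Ioi] with r hr; have hr' : (0 : ℝ) < r := hr
    rw [norm_mul, norm_real, norm_of_nonneg (le_max_right _ _)]
    exact mul_le_mul_of_nonneg_left (max_le (by linarith) hδ0.le) (norm_nonneg _)
  have hR : ∫ r in Ioi (0 : ℝ), exp (-(r * μ)) * ∫ ω, conj (B t ω - B (t - δ) ω) * B (t - r) ω ∂P =
      (∫ r in Ioi (0 : ℝ), exp (-(r * μ))) * q +
      ∫ r in Ioi (0 : ℝ), exp (-(r * μ)) * ((max (δ - r) 0 : ℝ) : ℂ) := by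
    rw [← integral_mul_const, ← integral_add ((integrableOn_exp_kernel hμ0).mul_const _) hj]
    refine setIntegral_congr_fun measurableSet_Ioi fun r hr => ?_; rw [hc r (le_of_lt hr)]
    push_cast; ring
  rw [hL, h0, hR, mul_add, ← mul_assoc, integral_exp_kernel hμ0] at hF
  have hb : ‖∫ r in Ioi (0 : ℝ), exp (-(r * μ)) * ((max (δ - r) 0 : ℝ) : ℂ)‖ ≤ δ * δ := by
    rw [setIntegral_eq_of_subset_of_forall_sdiff_eq_zero measurableSet_Ioi
      (Set.Ioc_subset_Ioi_self : Ioc 0 δ ⊆ _) fun r hr => ?_]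
    · refine (norm_setIntegral_le_of_norm_le_const (C := δ) (by simp) fun r hr => ?_).trans
        (by simp [hδ0.le])
      rw [norm_mul, norm_real, norm_of_nonneg (le_max_right _ _), norm_exp]
      have h1 : Real.exp ((-(r * μ)).re) ≤ 1 := by
        rw [Real.exp_le_one_iff]
        have := mul_pos hr.1 hμ0; simp only [Complex.neg_re, Complex.re_ofReal_mul]; linarith
      have h2 : max (δ - r) 0 ≤ δ := max_le (by linarith [hr.1]) hδ0.le
      nlinarith [exp_pos ((-(r * μ)).re)]
    · have : δ < r := lt_of_not_ge fun h1 => hr.2 ⟨hr.1, h1⟩; rw [max_eq_right (by linarith)]; simp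
  have hE : (δ : ℂ) = μ * ∫ r in Ioi (0 : ℝ), exp (-(r * μ)) * ((max (δ - r) 0 : ℝ) : ℂ) := by
    push_cast at hF ⊢; linear_combination -hF
  have hN := congrArg norm hE; rw [norm_mul, norm_real, norm_of_nonneg hδ0.le] at hN
  have h3 := mul_le_mul_of_nonneg_left hb hμn.le
  have h4 : ‖μ‖ * (δ * δ) = δ / 2 := by rw [hδ]; field_simp
  linarith

end IsTwoSided

end Conv

/-! ### The Gaussian space of a family of independent Gaussian processes -/

section GaussClosure

variable {Ω : Type*} [MeasurableSpace Ω] {P : Measure Ω} [IsProbabilityMeasure P]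

lemma isGaussSpace_of_integral_exp {𝒢 : Submodule ℝ (Lp ℝ 2 P)} (h : ∀ f ∈ 𝒢, ∫ ω, exp (f ω * I) ∂P
    = exp (-(‖f‖ ^ 2 / 2 : ℝ))) : IsGaussSpace P 𝒢 := by
  intro f hf; have hm := (Lp.aestronglyMeasurable f).aemeasurable
  have := Measure.isProbabilityMeasure_map hm; refine Measure.ext_of_charFun (funext fun t => ?_)
  rw [charFun_gaussianReal, charFun_apply_real, integral_map hm (by fun_prop)]
  have h1 := h (t • f) (𝒢.smul_mem t hf)
  rw [integral_congr_ae (g := fun ω => exp (t * f ω * I))] at h1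
  · rw [h1, norm_smul, mul_pow, norm_eq_abs, sq_abs]; congr 1; push_cast [NNReal.coe_pow]; ring
  · filter_upwards [Lp.coeFn_smul t f] with ω hω; rw [hω]; simp

lemma continuous_integral_exp : Continuous fun f : Lp ℝ 2 P => ∫ ω, exp (f ω * I) ∂P := by
  refine (LipschitzWith.of_dist_le_mul (K := 1) fun f g => ?_).continuous
  have hi : ∀ f : Lp ℝ 2 P, Integrable (fun ω => exp (f ω * I)) P := fun f =>
    (integrable_const (1 : ℝ)).mono' (by
      have := Lp.aestronglyMeasurable f; exact Complex.continuous_exp.comp_aestronglyMeasurable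
        ((continuous_ofReal.comp_aestronglyMeasurable this).mul_const _))
      (ae_of_all _ fun ω => by rw [Complex.norm_exp_ofReal_mul_I])
  have hn : ∀ a b : ℝ, ‖exp (a * I) - exp (b * I)‖ ≤ ‖a - b‖ := by
    intro a b
    have e : exp (a * I) - exp (b * I) = exp (b * I) * (exp (I * ((a - b : ℝ) : ℂ)) - 1) := by
      rw [mul_sub, ← exp_add, mul_one]; congr 2; push_cast; ring
    rw [e, norm_mul, Complex.norm_exp_ofReal_mul_I, one_mul]
    exact Real.norm_exp_I_mul_ofReal_sub_one_le
  rw [dist_eq_norm, ← integral_sub (hi f) (hi g), NNReal.coe_one, one_mul, dist_eq_norm]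
  have hfg : Integrable (fun ω => ‖(f - g : Lp ℝ 2 P) ω‖) P :=
    ((Lp.memLp (f - g)).integrable one_le_two).norm
  refine (norm_integral_le_of_norm_le hfg ?_).trans ?_
  · filter_upwards [Lp.coeFn_sub f g] with ω hω; rw [hω]; exact hn _ _
  · rw [integral_norm_eq_lintegral_enorm (Lp.aestronglyMeasurable _), Lp.norm_def,
      ← eLpNorm_one_eq_lintegral_enorm]
    exact toReal_mono (Lp.eLpNorm_ne_top _)
      (eLpNorm_le_eLpNorm_of_exponent_le one_le_two (Lp.aestronglyMeasurable _))

lemma IsGaussSpace.topologicalClosure {𝒢 : Submodule ℝ (Lp ℝ 2 P)} (h : IsGaussSpace P 𝒢) :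
    IsGaussSpace P 𝒢.topologicalClosure := by
  refine isGaussSpace_of_integral_exp fun f hf => ?_; have hc : IsClosed {f : Lp ℝ 2 P |
      ∫ ω, exp (f ω * I) ∂P = exp (-(‖f‖ ^ 2 / 2 : ℝ))} :=
    isClosed_eq continuous_integral_exp (by fun_prop)
  exact hc.closure_subset_iff.2 (fun g hg => integral_exp_of_isGaussSpace h hg) hf

lemma isGaussSpace_span {κ T : Type*} {Y : κ → T → Ω → ℝ} (hY : ∀ i, IsGaussianProcess (Y i) P) (h0
    : ∀ i t, ∫ ω, Y i t ω ∂P = 0) (hind : iIndepFun (fun i ω t => Y i t ω) P) (hL : ∀ i t, MemLp (Y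
    i t) 2 P) : IsGaussSpace P (Submodule.span ℝ (Set.range fun j : κ × T => (hL j.1 j.2).toLp (Y
    j.1 j.2))) := by
  classical
  intro f hf; obtain ⟨c, hc⟩ := Finsupp.mem_span_range_iff_exists_finsupp.1 hf
  set s := c.support.image Prod.fst; set T' := c.support.image Prod.snd
  set Z : s → Ω → ℝ := fun i ω => ∑ t ∈ T', c (i, t) * Y i t ω
  have hZ : ∀ i, HasGaussianLaw (Z i) P := fun i =>
    ((hY i).smul fun t => c (i, t)).hasGaussianLaw_fun_sum
  have hZi : iIndepFun Z P := by
    have := (hind.precomp (g := ((↑) : s → κ)) Subtype.val_injective).comp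
      (fun (i : s) (y : T → ℝ) => ∑ t ∈ T', c (i, t) * y t) (fun i => by fun_prop)
    exact this
  have hG := iIndepFun.hasGaussianLaw_sum hZ hZi; have hfZ : f =ᵐ[P] ∑ i, Z i := by
    rw [← hc, Finsupp.sum]; have h1 : ∀ᵐ ω ∂P, ∀ j ∈ c.support,
        (c j • (hL j.1 j.2).toLp (Y j.1 j.2) : Lp ℝ 2 P) ω = c j * Y j.1 j.2 ω := by
      refine (eventually_all_finset c.support).2 fun j _ => ?_
      filter_upwards [Lp.coeFn_smul (c j) ((hL j.1 j.2).toLp (Y j.1 j.2)),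
        (hL j.1 j.2).coeFn_toLp] with ω h1 h2
      rw [h1, Pi.smul_apply, h2, smul_eq_mul]
    filter_upwards [h1, Lp.coeFn_finsetSum c.support
      fun j => c j • (hL j.1 j.2).toLp (Y j.1 j.2)] with ω h1 h2
    rw [h2, Finset.sum_apply, Finset.sum_apply, sum_congr rfl h1]; simp only [Z]
    rw [sum_coe_sort s fun i => ∑ t ∈ T', c (i, t) * Y i t ω, ← Finset.sum_product']
    refine sum_subset (fun j hj => Finset.mem_product.2
      ⟨Finset.mem_image_of_mem _ hj, Finset.mem_image_of_mem _ hj⟩) fun j _ hj => ?_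
    rw [Finsupp.notMem_support_iff.1 hj, zero_mul]
  have hGf := hG.congr hfZ.symm; have hmean : ∫ ω, f ω ∂P = 0 := by
    rw [integral_congr_ae hfZ]; simp only [Finset.sum_apply, Z]
    have hint : ∀ (i : s) t, Integrable (fun ω => c (i, t) * Y i t ω) P := fun i t =>
      ((hL i t).integrable one_le_two).const_mul _
    rw [integral_finsetSum _ fun i _ => integrable_finsetSum _ fun t _ => hint i t]
    refine sum_eq_zero fun i _ => ?_; rw [integral_finsetSum _ fun t _ => hint i t]
    exact sum_eq_zero fun t _ => by rw [integral_const_mul, h0, mul_zero]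
  rw [hGf.map_eq_gaussianReal, hmean, variance_of_integral_eq_zero
    (Lp.aestronglyMeasurable f).aemeasurable hmean]
  congr 1
  have : ∫ ω, f ω ^ 2 ∂P = ‖f‖ ^ 2 := by
    rw [← real_inner_self_eq_norm_sq, L2.inner_def]
    exact integral_congr_ae (ae_of_all _ fun ω => by simp [sq])
  ext; rw [this, Real.coe_toNNReal _ (by positivity)]; simp

omit [IsProbabilityMeasure P] in
lemma inC_of_orthogonal {𝒢 : Submodule ℝ (Lp ℝ 2 P)} (hcl : IsClosed (𝒢 : Set (Lp ℝ 2 P))) {X : Ω →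
    ℂ} (hX : MemLp X 2 P) (h : ∀ g : Lp ℝ 2 P, g ∈ 𝒢ᗮ → ∫ ω, (g ω : ℂ) * X ω ∂P = 0) : InC 𝒢 X := by
  have : CompleteSpace 𝒢 := hcl.completeSpace_coe
  have key : ∀ {Y : Ω → ℝ} (hY : MemLp Y 2 P), (∀ g : Lp ℝ 2 P, g ∈ 𝒢ᗮ →
      ∫ ω, g ω * Y ω ∂P = 0) → hY.toLp Y ∈ 𝒢 := by
    intro Y hY hg; rw [← Submodule.orthogonal_orthogonal 𝒢]; intro g hg'
    rw [L2.inner_def, ← hg g hg']; refine integral_congr_ae ?_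
    filter_upwards [hY.coeFn_toLp] with ω hω; rw [hω]; simp [mul_comm]
  have hi : ∀ g : Lp ℝ 2 P, Integrable (fun ω => (g ω : ℂ) * X ω) P := fun g =>
    (Lp.memLp g).ofReal.integrable_mul hX
  refine ⟨_, key hX.re fun g hg => ?_, _, key hX.im fun g hg => ?_, ?_⟩
  · have := congrArg Complex.re (h g hg)
    rw [← RCLike.re_eq_complex_re, ← integral_re (hi g)] at this; simpa using this
  · have := congrArg Complex.im (h g hg)
    rw [← RCLike.im_eq_complex_im, ← integral_im (hi g)] at this; simpa using this
  · filter_upwards [hX.re.coeFn_toLp, hX.im.coeFn_toLp] with ω h1 h2; rw [h1, h2]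
    exact (re_add_im _).symm

end GaussClosure

section Field

variable {Ω : Type*} [MeasurableSpace Ω] {P : Measure Ω}

lemma exists_modification {ι : Type*} [Countable ι] {β : ι → ℝ → Ω → ℂ} (hm : ∀ n t, AEMeasurable (β
    n t) P) (hc : ∀ᵐ ω ∂P, ∀ n, Continuous fun t => β n t ω) {p : Ω → Prop} (hp : ∀ᵐ ω ∂P, p ω) : ∃
    G : Set Ω, (∀ᵐ ω ∂P, ω ∈ G) ∧ (∀ ω ∈ G, p ω) ∧ (∀ n t, Measurable (G.indicator (β n t))) ∧ ∀ n
    ω, Continuous fun t => G.indicator (β n t) ω := by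
  have hq : ∀ᵐ ω ∂P, ∀ n, ∀ q : ℚ, β n q ω = (hm n q).mk _ ω :=
    ae_all_iff.2 fun n => ae_all_iff.2 fun q => (hm n q).ae_eq_mk
  obtain ⟨T, hT1, hT2, hT3⟩ := exists_measurable_superset_of_null
    (ae_iff.1 (hc.and (hp.and hq)))
  have hG : ∀ ω ∈ Tᶜ, (∀ n, Continuous fun t => β n t ω) ∧ p ω ∧
      ∀ n, ∀ q : ℚ, β n q ω = (hm n q).mk _ ω := fun ω hω => by
    by_contra h
    exact hω (hT1 h)
  have hcont : ∀ n ω, Continuous fun t => Tᶜ.indicator (β n t) ω := by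
    intro n ω; by_cases hω : ω ∈ Tᶜ
    · simpa only [indicator_of_mem hω] using (hG ω hω).1 n
    · simpa only [Set.indicator_of_notMem hω] using continuous_const
  refine ⟨Tᶜ, ?_, fun ω hω => (hG ω hω).2.1, fun n t => ?_, hcont⟩
  · rw [ae_iff]; simpa using hT3
  · obtain ⟨x, hx, hxt⟩ := mem_closure_iff_seq_limit.1 (Rat.denseRange_cast (𝕜 := ℝ) t)
    refine measurable_of_tendsto_metrizable (f := fun k => Tᶜ.indicator (β n (x k)))
      (fun k => ?_) (tendsto_pi_nhds.2 fun ω => ((hcont n ω).tendsto t).comp hxt)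
    obtain ⟨q, hq⟩ := hx k
    have : Tᶜ.indicator (β n (x k)) = Tᶜ.indicator ((hm n q).mk _) := by
      ext ω; by_cases hω : ω ∈ Tᶜ
      · rw [indicator_of_mem hω, indicator_of_mem hω, ← (hG ω hω).2.2 n q, hq]
      · rw [Set.indicator_of_notMem hω, Set.indicator_of_notMem hω]
    rw [this]; exact (hm n q).measurable_mk.indicator hT2.compl

omit [MeasurableSpace Ω] in
lemma component_nnabs (β : ℤ² → ℝ → Ω → ℂ) (n : ℤ²) (c : Bool) (t : ℝ) (ω : Ω) : component β (n, c,
    decide (0 ≤ t)) (nnabs t) ω = √2 * if c then (β n t ω).re else (β n t ω).im := by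
  by_cases ht : 0 ≤ t
  · simp [component, ht]
  · simp [component, ht, abs_of_neg (not_le.1 ht)]

omit [MeasurableSpace Ω] in
lemma eq_component (β : ℤ² → ℝ → Ω → ℂ) (n : ℤ²) (t : ℝ) (ω : Ω) : β n t ω = ((√2)⁻¹ : ℝ) *
    ((component β (n, true, decide (0 ≤ t)) (nnabs t) ω : ℂ) + component β (n, false, decide (0 ≤
    t)) (nnabs t) ω * I) := by
  rw [component_nnabs, component_nnabs]; have h2 : ((√2 : ℝ) : ℂ) ≠ 0 := by simp
  nth_rw 1 [← re_add_im (β n t ω)]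
  push_cast; simp only [if_true]; field_simp

namespace IsCylindricalWiener

variable {β : ℤ² → ℝ → Ω → ℂ} (hβ : IsCylindricalWiener β P)
include hβ

lemma memLp_component (i) (t : ℝ≥0) : MemLp (component β i t) 2 P :=
  ((IsPreBrownianReal.isGaussianProcess (hβ.brownian i).1).hasGaussianLaw_eval t).memLp_two

lemma integral_component_mul [IsProbabilityMeasure P] (i j) (s t : ℝ≥0) : ∫ ω, component β i s ω *
    component β j t ω ∂P = if i = j then ((min s t : ℝ≥0) : ℝ) else 0 := by
  split_ifs with hij
  · subst hij
    have := (hβ.brownian i).covariance_eval s t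
    rw [covariance_eq_sub (hβ.memLp_component i s) (hβ.memLp_component i t),
      (hβ.brownian i).integral_eval, zero_mul, sub_zero] at this
    exact this
  · have h1 : IndepFun (component β i s) (component β j t) P :=
      (hβ.indep.indepFun hij).comp (φ := fun y : ℝ≥0 → ℝ => y s) (ψ := fun y : ℝ≥0 → ℝ => y t)
        (measurable_pi_apply _) (measurable_pi_apply _)
    rw [h1.integral_fun_mul_eq_mul_integral (hβ.memLp_component i s).1 (hβ.memLp_component j t).1,
      (hβ.brownian i).integral_eval, zero_mul]

lemma memLp (n : ℤ²) (t : ℝ) : MemLp (β n t) 2 P := by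
  have h := fun c => (hβ.memLp_component (n, c, decide (0 ≤ t)) (nnabs t)).ofReal (K := ℂ)
  refine (((h true).add ((h false).mul_const I)).const_mul (((√2)⁻¹ : ℝ) : ℂ)).congr_norm
    ?_ (ae_of_all _ fun ω => ?_)
  · have := (((h true).add ((h false).mul_const I)).const_mul (((√2)⁻¹ : ℝ) : ℂ)).1
    exact this.congr (ae_of_all _ fun ω => (eq_component β n t ω).symm)
  · rw [eq_component β n t ω]; rfl

lemma integral_mul_aux [IsProbabilityMeasure P] (n m : ℤ²) (s t : ℝ) (δ : ℝ) : ∫ ω, β n s ω * ((β m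
    t ω).re + δ * (β m t ω).im * I) ∂P = if n = m then ((1 - δ) / 2 * bcov s t : ℝ) else 0 := by
  set p := fun c => component β (n, c, decide (0 ≤ s)) (nnabs s)
  set q := fun c => component β (m, c, decide (0 ≤ t)) (nnabs t)
  have hi : ∀ c c', Integrable (fun ω => p c ω * q c' ω) P := fun c c' =>
    (hβ.memLp_component _ _).integrable_mul (hβ.memLp_component _ _)
  have e : ∀ ω, β n s ω * ((β m t ω).re + δ * (β m t ω).im * I) =
      ((2⁻¹ * (p true ω * q true ω) - 2⁻¹ * δ * (p false ω * q false ω) : ℝ) : ℂ) +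
      ((2⁻¹ * (p false ω * q true ω) + 2⁻¹ * δ * (p true ω * q false ω) : ℝ) : ℂ) * I := by
    intro ω; have h2 : √2 * √2 = 2 := Real.mul_self_sqrt zero_le_two
    simp only [p, q, component_nnabs, if_true, Bool.false_eq_true, if_false]; apply Complex.ext
    · simp only [Complex.add_re, Complex.mul_re, ofReal_re, ofReal_im,
        Complex.I_re, Complex.I_im, Complex.mul_im, Complex.add_im]
      linear_combination (2⁻¹ * δ * ((β n s ω).im * (β m t ω).im) -
        2⁻¹ * ((β n s ω).re * (β m t ω).re)) * h2
    · simp only [Complex.add_re, Complex.mul_re, ofReal_re, ofReal_im,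
        Complex.I_re, Complex.I_im, Complex.mul_im, Complex.add_im]
      linear_combination (-2⁻¹ * δ * ((β n s ω).re * (β m t ω).im) -
        2⁻¹ * ((β n s ω).im * (β m t ω).re)) * h2
  have i1 : Integrable (fun ω => 2⁻¹ * (p true ω * q true ω) -
      2⁻¹ * δ * (p false ω * q false ω)) P := ((hi _ _).const_mul _).sub ((hi _ _).const_mul _)
  have i2 : Integrable (fun ω => 2⁻¹ * (p false ω * q true ω) +
      2⁻¹ * δ * (p true ω * q false ω)) P := ((hi _ _).const_mul _).add ((hi _ _).const_mul _)
  simp only [e]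
  rw [integral_add i1.ofReal (i2.ofReal.mul_const _), integral_mul_const, integral_complex_ofReal,
    integral_complex_ofReal, integral_sub ((hi _ _).const_mul _) ((hi _ _).const_mul _),
    integral_add ((hi _ _).const_mul _) ((hi _ _).const_mul _), integral_const_mul,
    integral_const_mul, integral_const_mul, integral_const_mul]
  simp only [p, q, hβ.integral_component_mul, Prod.mk.injEq]
  have hb : (if decide (0 ≤ s) = decide (0 ≤ t) then ((min (nnabs s) (nnabs t) : ℝ≥0) : ℝ)
      else 0) = bcov s t := by
    simp only [NNReal.coe_min, Real.coe_nnabs, bcov, decide_eq_decide]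
    rcases abs_cases s with h | h <;> rcases abs_cases t with h' | h' <;>
      rcases abs_cases (s - t) with h'' | h'' <;> rw [h.1, h'.1, h''.1] <;> grind
  by_cases hnm : n = m
  · simp only [hnm, true_and, if_true, Bool.false_eq_true, Bool.true_eq_false, false_and, if_false,
      hb]
    push_cast; ring
  · simp [hnm]

lemma integral_mul_eq_zero [IsProbabilityMeasure P] (n m : ℤ²) (s t : ℝ) : ∫ ω, β n s ω * β m t ω ∂P
    = 0 := by have := hβ.integral_mul_aux n m s t 1; simpa [re_add_im] using this

lemma integral_mul_conj [IsProbabilityMeasure P] (n m : ℤ²) (s t : ℝ) : ∫ ω, β n s ω * conj (β m t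
    ω) ∂P = if n = m then (bcov s t : ℂ) else 0 := by
  have e : ∀ z : ℂ, conj z = z.re + ((-1 : ℝ) : ℂ) * z.im * I := fun z => by
    apply Complex.ext <;> simp
  simp only [e]; rw [hβ.integral_mul_aux n m s t (-1)]; split_ifs <;> norm_num

lemma continuous_paths : ∀ᵐ ω ∂P, ∀ n, Continuous fun t => β n t ω := by
  have h : ∀ᵐ ω ∂P, ∀ i, Continuous fun t => component β i t ω :=
    ae_all_iff.2 fun i => (hβ.brownian i).cont
  filter_upwards [h] with ω h n; have h2 : √2 ≠ 0 := by simp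
  have key : ∀ d : Bool, Continuous fun r : ℝ≥0 => β n (if d then (r : ℝ) else -(r : ℝ)) ω := by
    intro d; have e : ∀ r : ℝ≥0, β n (if d then (r : ℝ) else -(r : ℝ)) ω =
        (((√2)⁻¹ * component β (n, true, d) r ω : ℝ) : ℂ) +
        (((√2)⁻¹ * component β (n, false, d) r ω : ℝ) : ℂ) * I := by
      intro r; simp only [component, if_true, Bool.false_eq_true, if_false, inv_mul_cancel_left₀ h2,
        re_add_im]
    simp only [e]; have h1 := h (n, true, d); have h3 := h (n, false, d); fun_prop
  have h1 := (key true).comp (continuous_real_toNNReal)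
  have h3 := (key false).comp (continuous_real_toNNReal.comp continuous_neg)
  have := Continuous.if_le h1 h3 continuous_const continuous_id (f := fun _ => (0 : ℝ))
    (fun x hx => by simp [← show (0 : ℝ) = x from hx])
  refine this.congr fun t => ?_; by_cases ht : 0 ≤ t
  · simp [ht]
  · have : t ≤ 0 := (not_le.1 ht).le; simp [ht, this]

end IsCylindricalWiener

lemma integral_norm_sq_le {f : Ω → ℂ} (hf : Measurable f) {c : ℝ} (hc : 0 ≤ c) (h : ∫⁻ ω, ‖f ω‖ₑ ^ 2
    ∂P ≤ ofReal c) : ∫ ω, ‖f ω‖ ^ 2 ∂P ≤ c := by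
  rw [integral_eq_lintegral_of_nonneg_ae (ae_of_all _ fun ω => by positivity)
    (hf.norm.pow_const 2).aestronglyMeasurable]
  refine ENNReal.toReal_le_of_le_ofReal hc (le_trans (le_of_eq (lintegral_congr fun ω => ?_)) h)
  rw [ofReal_pow (norm_nonneg _), ofReal_norm]

lemma InC.integral_mul_orthogonal {𝒢 : Submodule ℝ (Lp ℝ 2 P)} {Z : Ω → ℂ} (hZ : InC 𝒢 Z) {g : Lp ℝ
    2 P} (hg : g ∈ 𝒢ᗮ) : ∫ ω, (g ω : ℂ) * Z ω ∂P = 0 := by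
  obtain ⟨f, hf, f', hf', e⟩ := hZ; have h0 : ∀ f ∈ 𝒢, ∫ ω, ((f ω * g ω : ℝ) : ℂ) ∂P = 0 := by
    intro f hf
    have := hg f hf; rw [L2.inner_def] at this; rw [integral_complex_ofReal, ← ofReal_zero, ← this]
    congr 1; exact integral_congr_ae (ae_of_all _ fun ω => by simp [mul_comm])
  have hi : ∀ f : Lp ℝ 2 P, Integrable (fun ω => ((f ω * g ω : ℝ) : ℂ)) P := fun f =>
    ((Lp.memLp f).integrable_mul (Lp.memLp g)).ofReal
  rw [integral_congr_ae (g := fun ω => ((f ω * g ω : ℝ) : ℂ) + ((f' ω * g ω : ℝ) : ℂ) * I),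
    integral_add (hi f) ((hi f').mul_const _), integral_mul_const, h0 f hf, h0 f' hf']
  · simp
  · filter_upwards [e] with ω hω; rw [hω]; push_cast; ring

/-- A stationary-like Gaussian field of stochastic convolutions, Fourier mode by Fourier mode. -/
structure IsField (P : Measure Ω) (𝒢 : Submodule ℝ (Lp ℝ 2 P)) (X : ℤ² → ℝ → Ω → ℂ)
    (C : ℝ) : Prop where
  gauss : IsGaussSpace P 𝒢
  meas : ∀ n t, Measurable (X n t)
  cont : ∀ n ω, Continuous fun t => X n t ω
  inC : ∀ n t, InC 𝒢 (X n t)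
  orth : ∀ n m t s, ∫ ω, X n t ω * X m s ω ∂P = 0
  orth_conj : ∀ n m t s, n ≠ m → ∫ ω, X n t ω * conj (X m s ω) ∂P = 0
  sq_le : ∀ n t, ∫ ω, ‖X n t ω‖ ^ 2 ∂P ≤ C * jb n ^ (-2 : ℝ)
  sub_le : ∀ n t s, ∫ ω, ‖X n t ω - X n s ω‖ ^ 2 ∂P ≤ C * |t - s|
  pos : ∀ n t, 0 < ∫ ω, ‖X n t ω‖ ^ 2 ∂P

theorem exists_isField [IsProbabilityMeasure P] (ha : 0 < a.re) {β : ℤ² → ℝ → Ω → ℂ} (hβ :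
    IsCylindricalWiener β P) : ∃ 𝒢 X C, 0 ≤ C ∧ IsField P 𝒢 X C ∧ ∀ᵐ ω ∂P, ∀ n t, stochConv a β n t
    ω = X n t ω := by
  have hν : ∀ n, 0 < (symb a n).re := fun n => by rw [symb, Complex.re_mul_ofReal]; positivity
  have hL : ∀ G : Set Ω, (∀ᵐ ω ∂P, ω ∈ G) → ∀ n t, G.indicator (β n t) =ᵐ[P] β n t :=
    fun G hG n t => hG.mono fun ω hω => indicator_of_mem hω _
  have hW : ∀ G : Set Ω, (∀ᵐ ω ∂P, ω ∈ G) → (∀ n t, Measurable (G.indicator (β n t))) →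
      (∀ n ω, Continuous fun t => G.indicator (β n t) ω) →
      ∀ n, IsWienerLike P fun t => G.indicator (β n t) := by
    intro G hG h1 h2 n
    refine ⟨h1 n, h2 n, fun t => (memLp_congr_ae (hL G hG n t)).2 (hβ.memLp n t), fun s t => ?_⟩
    rw [integral_congr_ae (g := fun ω => β n s ω * conj (β n t ω)),
      hβ.integral_mul_conj, if_pos rfl]
    filter_upwards [hL G hG n s, hL G hG n t] with ω h1 h2; rw [h1, h2]
  obtain ⟨G₁, hG₁, -, hm₁, hc₁⟩ := exists_modification (p := fun _ => True)
    (fun n t => (hβ.memLp n t).1.aemeasurable) hβ.continuous_paths (ae_of_all _ fun _ => trivial)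
  have hint : ∀ᵐ ω ∂P, ∀ n,
      IntegrableOn (fun s => Real.exp ((symb a n).re * s) * ‖β n s ω‖) (Iic 0) := by
    refine ae_all_iff.2 fun n => ?_
    have h1 := (hW G₁ hG₁ hm₁ hc₁ n).integrable_prod_kernel (μ := ((symb a n).re : ℂ))
      (ofReal_re _) (hν n) (memLp_const (1 : ℂ)) 0
    filter_upwards [h1.prod_right_ae, hG₁] with ω h2 h3; rw [integrableOn_Iic_iff_Ioi]
    refine h2.norm.congr (ae_of_all _ fun r => ?_)
    simp only [one_mul, norm_mul, indicator_of_mem h3, zero_sub, mul_neg]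
    rw [← Complex.ofReal_mul, ← Complex.ofReal_neg, ← Complex.ofReal_exp, norm_real,
      norm_of_nonneg (exp_pos _).le, mul_comm r]
  obtain ⟨G, hG, hp, hm, hc⟩ := exists_modification
    (fun n t => (hβ.memLp n t).1.aemeasurable) hβ.continuous_paths hint
  set B : ℤ² → ℝ → Ω → ℂ := fun n t => G.indicator (β n t)
  have hB : ∀ n, IsTwoSided P (symb a n).re (B n) := fun n => ⟨hW G hG hm hc n, fun ω => by
    by_cases hω : ω ∈ G
    · simpa only [B, indicator_of_mem hω] using hp ω hω n
    · simp [B, Set.indicator_of_notMem hω]⟩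
  have h0 : ∀ n m s t, ∫ ω, B n s ω * B m t ω ∂P = 0 := fun n m s t => by
    rw [← hβ.integral_mul_eq_zero n m s t]; refine integral_congr_ae ?_
    filter_upwards [hL G hG n s, hL G hG m t] with ω h1 h2
    rw [show B n s ω = _ from h1, show B m t ω = _ from h2]
  have h0c : ∀ n m s t, n ≠ m → ∫ ω, conj (B m t ω) * B n s ω ∂P = 0 := by
    intro n m s t hnm; rw [← (hβ.integral_mul_conj n m s t).trans (if_neg hnm)]
    refine integral_congr_ae ?_; filter_upwards [hL G hG n s, hL G hG m t] with ω h1 h2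
    rw [show B n s ω = _ from h1, show B m t ω = _ from h2, mul_comm]
  set X : ℤ² → ℝ → Ω → ℂ := fun n => sconv (symb a n) (B n)
  have hXL : ∀ n t, MemLp (X n t) 2 P := fun n t => (hB n).memLp_sconv rfl (hν n) t
  set 𝒢 := (Submodule.span ℝ (Set.range fun j : (ℤ² × Bool × Bool) × ℝ≥0 =>
    (hβ.memLp_component j.1 j.2).toLp (component β j.1 j.2))).topologicalClosure
  have hBC : ∀ n t, InC 𝒢 (B n t) := by
    intro n t; have hmem : ∀ i s, (hβ.memLp_component i s).toLp (component β i s) ∈ 𝒢 := fun i s =>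
      Submodule.le_topologicalClosure _ (Submodule.subset_span ⟨(i, s), rfl⟩)
    have h1 : InC 𝒢 (fun ω => (component β (n, true, decide (0 ≤ t)) (nnabs t) ω : ℂ) +
        component β (n, false, decide (0 ≤ t)) (nnabs t) ω * I) := by
      refine ⟨_, hmem (n, true, decide (0 ≤ t)) (nnabs t), _,
        hmem (n, false, decide (0 ≤ t)) (nnabs t), ?_⟩
      filter_upwards [(hβ.memLp_component (n, true, decide (0 ≤ t)) (nnabs t)).coeFn_toLp,
        (hβ.memLp_component (n, false, decide (0 ≤ t)) (nnabs t)).coeFn_toLp] with ω h1 h2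
      rw [h1, h2]
    refine (h1.const_mul (((√2)⁻¹ : ℝ) : ℂ)).congr ((hL G hG n t).trans (ae_of_all _ fun ω => ?_))
    exact eq_component β n t ω
  have hn : ∀ n, ‖symb a n‖ = ‖a‖ * (‖freq n‖ ^ 2 + 1) ∧
      (symb a n).re = a.re * (‖freq n‖ ^ 2 + 1) := by
    intro n; rw [symb, Complex.re_mul_ofReal, norm_mul, norm_real, norm_freq_sq, norm_of_nonneg
      (by positivity)]
    exact ⟨rfl, rfl⟩
  set C : ℝ := max (2 * (‖a‖ ^ 2 / a.re ^ 3)) (4 * (‖a‖ / a.re) ^ 2)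
  refine ⟨𝒢, X, C, le_max_of_le_right (by positivity), ⟨?_, fun n t => (hB n).measurable_sconv t,
    fun n ω => (hB n).continuous_sconv rfl ω, fun n t => ?_, fun n m t s => ?_,
    fun n m t s hnm => ?_, fun n t => ?_, fun n t s => ?_, fun n t =>
    (hB n).integral_norm_sconv_sq_pos rfl (hν n) t⟩, ?_⟩
  · exact (isGaussSpace_span (fun i => IsPreBrownianReal.isGaussianProcess (hβ.brownian i).1)
      (fun i => (hβ.brownian i).integral_eval) hβ.indep hβ.memLp_component).topologicalClosure
  · refine inC_of_orthogonal (Submodule.isClosed_topologicalClosure _) (hXL n t) fun g hg => ?_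
    exact (hB n).integral_mul_sconv_eq_zero rfl (hν n) (Lp.memLp g).ofReal
      (fun s => (hBC n s).integral_mul_orthogonal hg) t
  · refine (hB m).integral_mul_sconv_eq_zero rfl (hν m) (hXL n t) (fun u => ?_) s
    simp only [mul_comm (X n t _)]
    exact (hB n).integral_mul_sconv_eq_zero rfl (hν n) ((hB m).memLp u) (fun v => h0 m n u v) t
  · simp only [mul_comm (X n t _)]
    refine (hB n).integral_mul_sconv_eq_zero rfl (hν n) (hXL m s).star (fun u => ?_) t
    have h1 := (hB m).integral_mul_sconv_eq_zero rfl (hν m) ((hB n).memLp u).star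
      (fun v => h0c m n v u hnm.symm) s
    have h2 := congrArg conj h1; rw [← integral_conj, map_zero] at h2; rw [← h2]; congr 1; ext ω
    simp [X, mul_comm]
  · refine integral_norm_sq_le ((hB n).measurable_sconv t) (by have := jb_pos n; positivity)
      (((hB n).lintegral_sconv_sq_le rfl (hν n) t).trans (ofReal_le_ofReal ?_))
    rw [(hn n).1, (hn n).2, rpow_neg (jb_pos n).le, Real.rpow_two]
    have h1 : jb n ^ 2 ≤ 2 * (‖freq n‖ ^ 2 + 1) := by rw [jb]; nlinarith [sq_nonneg (‖freq n‖ - 1)]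
    have h2 : (‖a‖ * (‖freq n‖ ^ 2 + 1)) ^ 2 / (a.re * (‖freq n‖ ^ 2 + 1)) ^ 3 =
        ‖a‖ ^ 2 / a.re ^ 3 * (‖freq n‖ ^ 2 + 1)⁻¹ := by field_simp
    have h3 : (‖freq n‖ ^ 2 + 1)⁻¹ ≤ 2 * (jb n ^ 2)⁻¹ := by
      have := jb_pos n
      rw [← div_eq_mul_inv, le_div_iff₀ (by positivity), inv_mul_le_iff₀ (by positivity)]; linarith
    have h4 : 0 ≤ (jb n ^ 2)⁻¹ := by positivity
    calc _ ≤ ‖a‖ ^ 2 / a.re ^ 3 * (2 * (jb n ^ 2)⁻¹) := by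
          rw [h2]; exact mul_le_mul_of_nonneg_left h3 (by positivity)
      _ = 2 * (‖a‖ ^ 2 / a.re ^ 3) * (jb n ^ 2)⁻¹ := by ring
      _ ≤ _ := mul_le_mul_of_nonneg_right (le_max_left _ _) h4
  · refine integral_norm_sq_le (((hB n).measurable_sconv t).sub ((hB n).measurable_sconv s))
      (by positivity) (((hB n).lintegral_sconv_sub_sq_le rfl (hν n) s t).trans
      (ofReal_le_ofReal ?_))
    have h2 : ‖a‖ * (‖freq n‖ ^ 2 + 1) / (a.re * (‖freq n‖ ^ 2 + 1)) = ‖a‖ / a.re := by field_simp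
    rw [(hn n).1, (hn n).2, h2]; exact mul_le_mul_of_nonneg_right (le_max_right _ _) (abs_nonneg _)
  · filter_upwards [hG] with ω hω n t; simp only [stochConv, X, sconv, B, indicator_of_mem hω]

end Field

/-! ### Wick powers of the truncated field -/

section Modes

variable {Ω : Type*} {χ : E2 → ℝ} {γ : ℝ} {X : ℤ² → ℝ → Ω → ℂ}

/-- The Fourier coefficients of the truncated field. -/
def modes (χ : E2 → ℝ) (γ : ℝ) (X : ℤ² → ℝ → Ω → ℂ) (N : ℕ) (t : ℝ) (ω : Ω) : Dist :=
  fun n => ((√(2 * γ) * χ ((N : ℝ)⁻¹ • freq n) : ℝ) : ℂ) * X n t ω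

lemma freq_zero : freq 0 = 0 := by ext i; fin_cases i <;> simp [freq]

lemma IsFreqCutoff.suppIn_modes (hχ : IsFreqCutoff χ) {N : ℕ} (hN : N ≠ 0) (t : ℝ) (ω : Ω) : SuppIn
    N (modes χ γ X N t ω) := by
  intro n hn; have hN' : (0 : ℝ) < N := by positivity
  have : 1 ≤ ‖(N : ℝ)⁻¹ • freq n‖ := by
    rw [norm_smul, norm_inv, norm_of_nonneg hN'.le, ← div_eq_inv_mul, le_div_iff₀ hN']; linarith
  simp [modes, hχ.eq_zero _ this]

lemma IsFreqCutoff.exists_abs_le (hχ : IsFreqCutoff χ) : ∃ M : ℝ, 0 ≤ M ∧ ∀ ξ, |χ ξ| ≤ M := by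
  have hc : HasCompactSupport χ := HasCompactSupport.intro (isCompact_closedBall 0 1)
    fun ξ hξ => hχ.eq_zero ξ (by simpa using (not_le.1 (by simpa using hξ)).le)
  obtain ⟨M, hM⟩ := hc.exists_bound_of_continuous hχ.smooth.continuous
  exact ⟨M, (norm_nonneg _).trans (hM 0), hM⟩

variable [MeasurableSpace Ω] {P : Measure Ω} {𝒢 : Submodule ℝ (Lp ℝ 2 P)} {C : ℝ}

def modesVar (P : Measure Ω) (χ : E2 → ℝ) (γ : ℝ) (X : ℤ² → ℝ → Ω → ℂ) (N : ℕ) (t : ℝ) : ℝ :=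
  ∫ ω, ‖ev (modes χ γ X N t ω) 0‖ ^ 2 ∂P

def modesWick (P : Measure Ω) (χ : E2 → ℝ) (γ : ℝ) (X : ℤ² → ℝ → Ω → ℂ) (k l N : ℕ) (t : ℝ)
    (ω : Ω) : Dist :=
  wickD (modesVar P χ γ X N t : ℂ) (modes χ γ X N t ω) k l

namespace IsField

variable (hX : IsField P 𝒢 X C)
include hX

lemma gaussPair_modes (hχ : IsFreqCutoff χ) (γ : ℝ) {N : Bool → ℕ} (hN : ∀ b, N b ≠ 0)
    (t : Bool → ℝ) (hR : ∀ b, N b ≤ R) :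
    GaussPair 𝒢 R fun b => modes χ γ X (N b) (t b) where
  supp b ω := (hχ.suppIn_modes (hN b) _ _).mono (hR b)
  inC b n := (hX.inC n (t b)).const_mul _
  orth b b' n m := by
    simp only [modes]
    refine (integral_congr_ae (ae_of_all _ fun ω => mul_mul_mul_comm _ _ _ _)).trans ?_
    rw [integral_const_mul, hX.orth, mul_zero]
  orth_conj b b' n m hnm := by
    simp only [modes, map_mul]
    refine (integral_congr_ae (ae_of_all _ fun ω => mul_mul_mul_comm _ _ _ _)).trans ?_
    rw [integral_const_mul, hX.orth_conj _ _ _ _ hnm, mul_zero]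

omit hX in
lemma integral_norm_modes_sq (hγ : 0 < γ) (N : ℕ) (t : ℝ) (n : ℤ²) : ∫ ω, ‖modes χ γ X N t ω n‖ ^ 2
    ∂P = 2 * γ * χ ((N : ℝ)⁻¹ • freq n) ^ 2 * ∫ ω, ‖X n t ω‖ ^ 2 ∂P := by
  rw [← integral_const_mul]; congr 1; ext ω
  rw [modes, norm_mul, norm_real, mul_pow, norm_eq_abs, sq_abs, mul_pow, sq_sqrt (by positivity)]

lemma integral_ev_modes (hχ : IsFreqCutoff χ) (γ : ℝ) {N : ℕ} (hN : N ≠ 0) (t : ℝ) (x : ℝ × ℝ) : ∫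
    ω, ‖ev (modes χ γ X N t ω) x‖ ^ 2 ∂P = ∑ n ∈ fball N, ∫ ω, ‖modes χ γ X N t ω n‖ ^ 2 ∂P := by
  have hp := hX.gaussPair_modes hχ γ (N := fun _ => N) (fun _ => hN) (fun _ => t) (R := N)
    (fun _ => le_rfl)
  have h1 := hp.integral_ev_mul_conj true true x x
  rw [sub_self, ev_eq_sum _ (hp.suppIn_cov2 true true).subset] at h1
  simp only [mul_conj', cov2, show ∀ n, char2 n 0 = 1 by simp [char2], mul_one] at h1
  have e : ∀ f : Ω → ℂ, ∫ ω, (‖f ω‖ : ℂ) ^ 2 ∂P = ((∫ ω, ‖f ω‖ ^ 2 ∂P : ℝ) : ℂ) := fun f => by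
    rw [← integral_complex_ofReal]; push_cast; rfl
  simp only [e] at h1; exact_mod_cast h1

lemma modesVar_pos (hχ : IsFreqCutoff χ) (hγ : 0 < γ) {N : ℕ} (hN : N ≠ 0) (t : ℝ) : 0 < modesVar P
    χ γ X N t := by
  rw [modesVar, hX.integral_ev_modes hχ γ hN]
  refine Finset.sum_pos' (fun n _ => integral_nonneg fun ω => by positivity)
    ⟨0, mem_fball.2 (by simp [freq_zero]), ?_⟩
  have := hX.pos 0 t; rw [integral_norm_modes_sq hγ, freq_zero, smul_zero, hχ.eq_one 0 (by simp)]
  positivity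

lemma bdPair_modes {p : Bool → ℕ × ℝ} (hχ : IsFreqCutoff χ) (hp : ∀ b, (p b).1 ≠ 0) {A δ θ : ℝ} (hθ
    : 0 < θ) (hδ : 0 < δ) (hA : 0 ≤ A) (h1 : ∀ b n, ∫ ω, ‖modes χ γ X (p b).1 (p b).2 ω n‖ ^ 2 ∂P ≤
    A * jb n ^ (-2 : ℝ)) (h2 : ∀ n, ∫ ω, ‖modes χ γ X (p true).1 (p true).2 ω n - modes χ γ X (p
    false).1 (p false).2 ω n‖ ^ 2 ∂P ≤ A * δ ^ 2 * jb n ^ (-2 + 2 * θ)) (b : Bool) : BdPair θ A δ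
    (cov2 P (modes χ γ X (p b).1 (p b).2) (modes χ γ X (p b).1 (p b).2)) (cov2 P (modes χ γ X (p
    b).1 (p b).2) (modes χ γ X (p !b).1 (p !b).2)) := by
  set ξ : Bool → Ω → Dist := fun b => modes χ γ X (p b).1 (p b).2
  have hL : ∀ b n, MemLp (fun ω => ξ b ω n) 2 P := fun b n => ((hX.inC n _).const_mul _).memLp
  have h2' : ∀ n, ∫ ω, ‖ξ b ω n - ξ (!b) ω n‖ ^ 2 ∂P ≤ A * δ ^ 2 * jb n ^ (-2 + 2 * θ) := by
    intro n
    cases b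
    · simp only [Bool.not_false, norm_sub_rev (ξ false _ n)]; exact h2 n
    · exact h2 n
  have cs : ∀ {f g : Ω → ℂ} (hf : MemLp f 2 P) (hg : MemLp g 2 P) {c : ℝ} (hc : 0 < c),
      ‖∫ ω, f ω * conj (g ω) ∂P‖ ≤ (c * ∫ ω, ‖f ω‖ ^ 2 ∂P + c⁻¹ * ∫ ω, ‖g ω‖ ^ 2 ∂P) / 2 := by
    intro f g hf hg c hc; have i1 := (hf.integrable_norm_pow two_ne_zero).const_mul c
    have i2 := (hg.integrable_norm_pow two_ne_zero).const_mul c⁻¹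
    rw [← integral_const_mul, ← integral_const_mul, ← integral_add i1 i2, ← integral_div]
    refine norm_integral_le_of_norm_le ((i1.add i2).div_const 2) (ae_of_all _ fun ω => ?_)
    rw [norm_mul, RCLike.norm_conj, le_div_iff₀ two_pos]
    have h3 : c * ‖f ω‖ ^ 2 + c⁻¹ * ‖g ω‖ ^ 2 - ‖f ω‖ * ‖g ω‖ * 2 =
        c⁻¹ * (c * ‖f ω‖ - ‖g ω‖) ^ 2 := by field_simp; ring
    have h4 : 0 ≤ c⁻¹ * (c * ‖f ω‖ - ‖g ω‖) ^ 2 := by positivity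
    linarith
  have hbd : ∀ b', Bd θ A (cov2 P (ξ b) (ξ b')) := by
    intro b' n; refine (cs (hL b n) (hL b' n) one_pos).trans ?_
    have h3 : jb n ^ (-2 : ℝ) ≤ jb n ^ (-2 + θ) :=
      rpow_le_rpow_of_exponent_le (one_le_jb n) (by linarith)
    have := mul_le_mul_of_nonneg_left h3 hA; linarith [h1 b n, h1 b' n]
  have hfin : ∀ b', (support (cov2 P (ξ b) (ξ b'))).Finite := fun b' =>
    (hX.gaussPair_modes hχ γ hp (fun b => (p b).2) (R := max (p true).1 (p false).1)
      (fun b => by cases b <;> simp)).suppIn_cov2 b b' |>.finite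
  refine ⟨hfin _, hfin _, hbd _, hbd _, fun n => ?_⟩
  have e : (cov2 P (ξ b) (ξ b) - cov2 P (ξ b) (ξ !b)) n =
      ∫ ω, ξ b ω n * conj (ξ b ω n - ξ (!b) ω n) ∂P := by
    simp only [map_sub, mul_sub]; exact (integral_sub ((hL b n).integrable_mul (hL b n).star)
      ((hL b n).integrable_mul (hL _ n).star)).symm
  have hj := jb_pos n; have hj' : 0 < jb n ^ θ := rpow_pos_of_pos hj θ; rw [e]
  refine (cs (hL b n) ((hL b n).sub (hL _ n)) (mul_pos hδ hj')).trans ?_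
  have h3 := mul_le_mul_of_nonneg_left (h1 b n) (mul_pos hδ hj').le
  have h4 := mul_le_mul_of_nonneg_left (h2' n) (inv_pos.2 (mul_pos hδ hj')).le
  rw [show -2 + 2 * θ = -2 + θ + θ by ring, rpow_add hj, rpow_add hj] at h4; rw [rpow_add hj]
  have e3 : δ * jb n ^ θ * (A * jb n ^ (-2 : ℝ)) = A * δ * (jb n ^ (-2 : ℝ) * jb n ^ θ) := by ring
  have e4 : (δ * jb n ^ θ)⁻¹ * (A * δ ^ 2 * (jb n ^ (-2 : ℝ) * jb n ^ θ * jb n ^ θ)) =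
      A * δ * (jb n ^ (-2 : ℝ) * jb n ^ θ) := by field_simp
  have h5 : ∀ x y z : ℝ, x ≤ z → y ≤ z → (x + y) / 2 ≤ z := fun x y z _ _ => by linarith
  exact h5 _ _ _ (h3.trans e3.le) (h4.trans e4.le)

end IsField

end Modes

section FieldMoments

variable {Ω : Type*} [MeasurableSpace Ω] {P : Measure Ω} {𝒢 : Submodule ℝ (Lp ℝ 2 P)} {C : ℝ}
  {χ : E2 → ℝ} {γ : ℝ} {X : ℤ² → ℝ → Ω → ℂ}

lemma enn_add_pow_le (a b : 𝐄) (n : ℕ) : (a + b) ^ n ≤ 2 ^ n * (a ^ n + b ^ n) := by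
  have h : (a + b) ^ n ≤ (2 * max a b) ^ n := by
    rw [two_mul]; exact pow_le_pow_left' (add_le_add (le_max_left _ _) (le_max_right _ _)) n
  refine h.trans ?_; rw [mul_pow]; refine mul_le_mul_right ?_ _
  rcases max_cases a b with h | h <;> rw [h.1]
  · exact le_self_add
  · exact le_add_self

lemma integral_norm_sub_sq_le {f g : Ω → ℂ} (hf : MemLp f 2 P) (hg : MemLp g 2 P) : ∫ ω, ‖f ω - g ω‖
    ^ 2 ∂P ≤ 2 * ∫ ω, ‖f ω‖ ^ 2 ∂P + 2 * ∫ ω, ‖g ω‖ ^ 2 ∂P := by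
  have i1 := (hf.integrable_norm_pow two_ne_zero).const_mul 2
  have i2 := (hg.integrable_norm_pow two_ne_zero).const_mul 2
  rw [← integral_const_mul, ← integral_const_mul, ← integral_add i1 i2]
  refine integral_mono ((hf.sub hg).integrable_norm_pow two_ne_zero) (i1.add i2) fun ω => ?_
  have := norm_sub_le (f ω) (g ω); change ‖f ω - g ω‖ ^ 2 ≤ 2 * ‖f ω‖ ^ 2 + 2 * ‖g ω‖ ^ 2
  nlinarith [sq_nonneg (‖f ω‖ - ‖g ω‖), norm_nonneg (f ω - g ω), norm_nonneg (f ω),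
    norm_nonneg (g ω)]

namespace IsField

variable (hX : IsField P 𝒢 X C) (hχ : IsFreqCutoff χ) (hγ : 0 < γ)
include hX hχ

lemma measurable_modesWick {N : ℕ} (hN : N ≠ 0) (k l : ℕ) (t : ℝ) (n : ℤ²) : Measurable fun ω =>
    modesWick P χ γ X k l N t ω n :=
  measurable_wickD (cast_nonneg N) (fun n => (hX.meas n t).const_mul _)
    (hχ.suppIn_modes hN t) _ k l n

include hγ

lemma exists_modes_le : ∃ A : ℝ, 0 ≤ A ∧ (∀ N t n, ∫ ω, ‖modes χ γ X N t ω n‖ ^ 2 ∂P ≤ A * jb n ^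
    (-2 : ℝ)) ∧ ∀ θ : ℝ, 0 < θ → θ ≤ 1 → (∀ N t s n, ∫ ω, ‖modes χ γ X N t ω n - modes χ γ X N s ω
    n‖ ^ 2 ∂P ≤ A * (|t - s| ^ (θ / 2)) ^ 2 * jb n ^ (-2 + 2 * θ)) ∧ ∀ (Λ N M : ℕ) t n, Λ ≠ 0 → Λ ≤
    N → Λ ≤ M → ∫ ω, ‖modes χ γ X N t ω n - modes χ γ X M t ω n‖ ^ 2 ∂P ≤ A * ((Λ : ℝ) ^ (-θ)) ^ 2 *
    jb n ^ (-2 + 2 * θ) := by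
  obtain ⟨M₀, hM₀, hM⟩ := hχ.exists_abs_le
  have hL : ∀ N t n, MemLp (fun ω => modes χ γ X N t ω n) 2 P := fun N t n =>
    ((hX.inC n t).const_mul _).memLp
  have hC : 0 ≤ C := by
    have := (integral_nonneg fun ω => by positivity).trans (hX.sub_le 0 1 0); simpa using this
  set B : ℝ := 2 * γ * M₀ ^ 2 * C with hB; have hB0 : 0 ≤ B := by positivity
  have hχ2 : ∀ ξ, 2 * γ * χ ξ ^ 2 ≤ 2 * γ * M₀ ^ 2 := fun ξ =>
    mul_le_mul_of_nonneg_left (sq_le_sq' (by linarith [abs_le.1 (hM ξ)]) (abs_le.1 (hM ξ)).2)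
      (by positivity)
  have h1 : ∀ N t n, ∫ ω, ‖modes χ γ X N t ω n‖ ^ 2 ∂P ≤ B * jb n ^ (-2 : ℝ) := by
    intro N t n; rw [integral_norm_modes_sq hγ, hB, mul_assoc (2 * γ * M₀ ^ 2)]
    exact mul_le_mul (hχ2 _) (hX.sq_le n t) (integral_nonneg fun ω => by positivity)
      (by positivity)
  have hj2 : ∀ n, 0 ≤ jb n ^ (-2 : ℝ) := fun n => rpow_nonneg (jb_pos n).le _
  have h4 : ∀ N M t s n, ∫ ω, ‖modes χ γ X N t ω n - modes χ γ X M s ω n‖ ^ 2 ∂P ≤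
      4 * B * jb n ^ (-2 : ℝ) := fun N M t s n => by
    have := integral_norm_sub_sq_le (hL N t n) (hL M s n); linarith [h1 N t n, h1 M s n]
  refine ⟨16 * B, by positivity, fun N t n => (h1 N t n).trans (mul_le_mul_of_nonneg_right
    (by linarith) (hj2 n)), fun θ hθ hθ1 => ⟨fun N t s n => ?_, fun Λ N M t n hΛ hN hM' => ?_⟩⟩
  · have hj := jb_pos n; have e1 : (|t - s| ^ (θ / 2)) ^ 2 = |t - s| ^ θ := by
      rw [← rpow_natCast, ← rpow_mul (abs_nonneg _)]; congr 1; push_cast; ring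
    have e2 : jb n ^ (-2 + 2 * θ) = (jb n ^ (-2 : ℝ)) ^ (1 - θ) := by
      rw [← rpow_mul hj.le]; congr 1; ring
    have ht : ∫ ω, ‖modes χ γ X N t ω n - modes χ γ X N s ω n‖ ^ 2 ∂P ≤ B * |t - s| := by
      have e : ∀ ω, ‖modes χ γ X N t ω n - modes χ γ X N s ω n‖ ^ 2 =
          2 * γ * χ ((N : ℝ)⁻¹ • freq n) ^ 2 * ‖X n t ω - X n s ω‖ ^ 2 := fun ω => by
        rw [modes, modes, ← mul_sub, norm_mul, norm_real, mul_pow, norm_eq_abs,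
          sq_abs, mul_pow, sq_sqrt (by positivity)]
      simp only [e]; rw [integral_const_mul, hB, mul_assoc (2 * γ * M₀ ^ 2)]
      exact mul_le_mul (hχ2 _) (hX.sub_le n t s) (integral_nonneg fun ω => by positivity)
        (by positivity)
    have key : min |t - s| (jb n ^ (-2 : ℝ)) ≤ |t - s| ^ θ * (jb n ^ (-2 : ℝ)) ^ (1 - θ) := by
      have hm : 0 ≤ min |t - s| (jb n ^ (-2 : ℝ)) := le_min (abs_nonneg _) (hj2 n)
      calc _ = min |t - s| (jb n ^ (-2 : ℝ)) ^ θ * min |t - s| (jb n ^ (-2 : ℝ)) ^ (1 - θ) := by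
            rw [← Real.rpow_add_of_nonneg hm hθ.le (by linarith), add_sub_cancel, rpow_one]
        _ ≤ _ := mul_le_mul (rpow_le_rpow hm (min_le_left _ _) hθ.le)
            (rpow_le_rpow hm (min_le_right _ _) (by linarith)) (rpow_nonneg hm _)
            (rpow_nonneg (abs_nonneg _) _)
    rw [e1, e2, mul_assoc]; refine le_trans ?_ (mul_le_mul_of_nonneg_left key (by positivity))
    rcases min_cases |t - s| (jb n ^ (-2 : ℝ)) with h | h <;> rw [h.1]
    · exact ht.trans (mul_le_mul_of_nonneg_right (by linarith) (abs_nonneg _))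
    · exact (h4 N N t s n).trans (mul_le_mul_of_nonneg_right (by linarith) (hj2 n))
  · have hj := jb_pos n; have hΛ0 : (0 : ℝ) < Λ := by positivity
    by_cases hn : ‖freq n‖ ≤ Λ / 2
    · have hone : ∀ K : ℕ, Λ ≤ K → χ ((K : ℝ)⁻¹ • freq n) = 1 := fun K hK => by
        have hK' : (Λ : ℝ) ≤ K := by exact_mod_cast hK
        refine hχ.eq_one _ ?_
        rw [norm_smul, norm_inv, norm_of_nonneg (by positivity), inv_mul_le_iff₀ (by linarith)]
        linarith
      simp only [modes, hone N hN, hone M hM', sub_self]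
      simp only [norm_zero, ne_eq, OfNat.ofNat_ne_zero, not_false_eq_true, zero_pow, integral_zero]
      positivity
    · refine (h4 N M t t n).trans ?_; have e1 : ((Λ : ℝ) ^ (-θ)) ^ 2 * jb n ^ (-2 + 2 * θ) =
          jb n ^ (-2 : ℝ) * ((jb n / Λ) ^ θ) ^ 2 := by
        rw [rpow_add hj, div_rpow hj.le hΛ0.le, rpow_neg hΛ0.le, mul_comm 2 θ,
          rpow_mul hj.le, Real.rpow_two]
        field_simp
      have h2 : 1 / 2 ≤ (jb n / Λ) ^ θ := by
        have h3 : (1 / 2 : ℝ) ≤ jb n / Λ := by rw [le_div_iff₀ hΛ0, jb]; linarith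
        calc (1 / 2 : ℝ) = (1 / 2) ^ (1 : ℝ) := (rpow_one _).symm
          _ ≤ (1 / 2) ^ θ := Real.rpow_le_rpow_of_exponent_ge (by norm_num) (by norm_num) hθ1
          _ ≤ _ := rpow_le_rpow (by norm_num) h3 hθ.le
      rw [mul_assoc (16 * B), e1]; have h3 : 1 / 4 ≤ ((jb n / Λ) ^ θ) ^ 2 := by nlinarith
      nlinarith [mul_le_mul_of_nonneg_left h3 (mul_nonneg hB0 (hj2 n))]

theorem exists_modesWick_moment_le [IsProbabilityMeasure P] (h : IsDyadicCutoff ϕ) (k l : ℕ) {ε : ℝ}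
    (hε : 0 < ε) (p₀ : ℕ) : ∃ r : ℕ, p₀ ≤ r ∧ r ≠ 0 ∧ ∃ A : ℝ≥0, ∀ Λ N M : ℕ, Λ ≠ 0 → Λ ≤ N → Λ ≤ M
    → ∀ s t : ℝ, (|t - s| ≤ 1 → ∫⁻ ω, besovNorm ϕ (-ε) ((modesWick P χ γ X k l N t ω - modesWick P χ
    γ X k l M t ω) - (modesWick P χ γ X k l N s ω - modesWick P χ γ X k l M s ω)) ^ r ∂P ≤ A *
    ofReal (Λ : ℝ)⁻¹ * ofReal (|t - s| ^ 2)) ∧ ∫⁻ ω, besovNorm ϕ (-ε) (modesWick P χ γ X k l N t ω -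
    modesWick P χ γ X k l M t ω) ^ r ∂P ≤ A * ofReal (Λ : ℝ)⁻¹ := by
  obtain ⟨A, hA, hA1, hA2⟩ := hX.exists_modes_le hχ hγ; set w := modesWick P χ γ X k l with hw
  set θ : ℝ := min 2 (ε / 2) / 3 ^ (k + l + 1) with hθ; have hθ0 : 0 < θ := by positivity
  have h3 : 3 ^ (k + l + 1) * θ = min 2 (ε / 2) := by rw [hθ]; field_simp
  have hθ1 : θ ≤ 1 := by
    have h4 : (3 : ℝ) ≤ 3 ^ (k + l + 1) := by
      rw [pow_succ]; linarith [one_le_pow₀ (show (1 : ℝ) ≤ 3 by norm_num) (n := k + l)]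
    have := min_le_left 2 (ε / 2); nlinarith
  obtain ⟨p, hp⟩ := exists_nat_ge (max (p₀ : ℝ) (max (4 / ε) (8 / θ)))
  have hp0 : p₀ ≤ p := by exact_mod_cast (le_max_left _ _).trans hp
  have hpε : 4 ≤ (p + 1) * ε := by
    have := ((le_max_left _ _).trans (le_max_right _ _)).trans hp; rw [div_le_iff₀ hε] at this
    linarith
  have hpθ : 8 ≤ θ * (p + 1) := by
    have := ((le_max_right _ _).trans (le_max_right _ _)).trans hp; rw [div_le_iff₀ hθ0] at this
    linarith
  obtain ⟨D, hD⟩ := h.exists_besov_moment_le hX.gauss k l hθ0 (h3.trans_le (min_le_left _ _))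
    (h3.trans_le (min_le_right _ _)) hA hpε
  set r := 2 * (p + 1) with hr; have key : ∀ (N M : ℕ) (t s δ : ℝ), N ≠ 0 → M ≠ 0 → 0 < δ →
      (∀ n, ∫ ω, ‖modes χ γ X N t ω n - modes χ γ X M s ω n‖ ^ 2 ∂P ≤
        A * δ ^ 2 * jb n ^ (-2 + 2 * θ)) →
      ∫⁻ ω, besovNorm ϕ (-ε) (w N t ω - w M s ω) ^ r ∂P ≤ D * ofReal δ ^ (p + 1) := by
    intro N M t s δ hN hM hδ hd; let q : Bool → ℕ × ℝ := fun b => if b then (N, t) else (M, s)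
    have hq : ∀ b, (q b).1 ≠ 0 := fun b => by cases b <;> simpa [q]
    have hb := hX.bdPair_modes (p := q) hχ hq hθ0 hδ hA (fun b n => hA1 _ _ n) hd
    refine hD (max N M) δ (fun b => modes χ γ X (q b).1 (q b).2)
      (fun b => modesVar P χ γ X (q b).1 (q b).2) (by positivity) hδ.le
      (hX.gaussPair_modes hχ γ hq _ fun b => by cases b <;> simp [q])
      (fun b n => (hX.meas n _).const_mul _) (fun b x => ?_) (hb true) (hb false)
    rw [modesVar, hX.integral_ev_modes hχ γ (hq b), hX.integral_ev_modes hχ γ (hq b)]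
  have hm : ∀ N M t s, N ≠ 0 → M ≠ 0 →
      AEMeasurable (fun ω => besovNorm ϕ (-ε) (w N t ω - w M s ω) ^ r) P := fun N M t s hN hM =>
    (aemeasurable_besov h (-ε) fun n => ((hX.measurable_modesWick hχ hN k l t n).sub
      (hX.measurable_modesWick hχ hM k l s n)).aemeasurable).pow_const r
  have hfreq : ∀ Λ N M : ℕ, Λ ≠ 0 → Λ ≤ N → Λ ≤ M → ∀ t,
      ∫⁻ ω, besovNorm ϕ (-ε) (w N t ω - w M t ω) ^ r ∂P ≤ D * ofReal ((Λ : ℝ)⁻¹ ^ 2) := by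
    intro Λ N M hΛ hN hM t; have hΛ1 : (1 : ℝ) ≤ Λ := by exact_mod_cast Nat.one_le_iff_ne_zero.2 hΛ
    refine (key N M t t _ (by omega) (by omega) (rpow_pos_of_pos (by linarith) _)
      fun n => (hA2 θ hθ0 hθ1).2 Λ N M t n hΛ hN hM).trans (mul_le_mul_right ?_ _)
    rw [← ofReal_pow (by positivity)]; refine ofReal_le_ofReal ?_
    rw [← rpow_natCast, ← rpow_mul (by linarith), ← Real.rpow_neg_one,
      ← rpow_natCast, ← rpow_mul (by linarith)]
    refine rpow_le_rpow_of_exponent_le hΛ1 ?_; push_cast; linarith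
  have htime : ∀ N t s, N ≠ 0 → |t - s| ≤ 1 → ∫⁻ ω, besovNorm ϕ (-ε) (w N t ω - w N s ω) ^ r ∂P ≤
        D * ofReal ((|t - s| ^ 2) ^ 2) := by
    intro N t s hN hts; rcases eq_or_ne t s with rfl | hne
    · simp [besov_zero, hr]
    have h0 : 0 < |t - s| := abs_pos.2 (sub_ne_zero.2 hne)
    refine (key N N t s _ hN hN (rpow_pos_of_pos h0 _)
      fun n => (hA2 θ hθ0 hθ1).1 N t s n).trans (mul_le_mul_right ?_ _)
    rw [← ofReal_pow (by positivity)]; refine ofReal_le_ofReal ?_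
    rw [← rpow_natCast, ← rpow_mul h0.le, ← pow_mul, ← rpow_natCast]
    refine Real.rpow_le_rpow_of_exponent_ge h0 hts ?_; push_cast; linarith
  refine ⟨r, by omega, by omega, 2 ^ (r + 1) * D, fun Λ N M hΛ hN hM s t => ⟨fun hts => ?_, ?_⟩⟩
  · have hsum : ∀ {F G H : Ω → Dist} {B : 𝐄}, (∀ ω, H ω = F ω - G ω) →
        AEMeasurable (fun ω => besovNorm ϕ (-ε) (F ω) ^ r) P →
        ∫⁻ ω, besovNorm ϕ (-ε) (F ω) ^ r ∂P ≤ D * B →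
        ∫⁻ ω, besovNorm ϕ (-ε) (G ω) ^ r ∂P ≤ D * B →
        ∫⁻ ω, besovNorm ϕ (-ε) (H ω) ^ r ∂P ≤ ((2 ^ (r + 1) * D : ℝ≥0) : 𝐄) * B := by
      intro F G H B e hF h1 h2
      calc _ ≤ ∫⁻ ω, 2 ^ r * (besovNorm ϕ (-ε) (F ω) ^ r + besovNorm ϕ (-ε) (G ω) ^ r) ∂P :=
            lintegral_mono fun ω => by
              rw [e]; exact (pow_le_pow_left' (h.besov_sub_le _ _ _) r).trans (enn_add_pow_le _ _ r)
        _ ≤ 2 ^ r * (D * B + D * B) := by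
            rw [lintegral_const_mul' _ _ (by finiteness), lintegral_add_left' hF]
            exact mul_le_mul_right (add_le_add h1 h2) _
        _ = _ := by push_cast; ring
    rw [mul_assoc, ← ofReal_mul (by positivity)]; have hN0 : N ≠ 0 := by omega
    have hM0 : M ≠ 0 := by omega
    have b1 := hsum (fun ω => by abel) (hm N N t s hN0 hN0) (htime N t s hN0 hts)
      (htime M t s hM0 hts) (H := fun ω => (w N t ω - w M t ω) - (w N s ω - w M s ω))
    have b2 := hsum (fun ω => rfl) (hm N M t t hN0 hM0) (hfreq Λ N M hΛ hN hM t)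
      (hfreq Λ N M hΛ hN hM s) (H := fun ω => (w N t ω - w M t ω) - (w N s ω - w M s ω))
    have hu : 0 ≤ |t - s| ^ 2 := by positivity
    have hv : 0 ≤ (Λ : ℝ)⁻¹ := by positivity
    rcases le_total (|t - s| ^ 2) (Λ : ℝ)⁻¹ with hle | hle
    · exact b1.trans (mul_le_mul_right (ofReal_le_ofReal (by nlinarith)) _)
    · exact b2.trans (mul_le_mul_right (ofReal_le_ofReal (by nlinarith)) _)
  · have hΛ1 : (Λ : ℝ)⁻¹ ≤ 1 := inv_le_one_of_one_le₀ (by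
      exact_mod_cast Nat.one_le_iff_ne_zero.2 hΛ)
    refine (hfreq Λ N M hΛ hN hM t).trans (mul_le_mul' ?_ (ofReal_le_ofReal ?_))
    · exact coe_le_coe.2 (le_mul_of_one_le_left' (one_le_pow₀ one_le_two))
    · exact pow_le_of_le_one (by positivity) hΛ1 two_ne_zero

end IsField

end FieldMoments

/-! ### Chaining -/

section Chaining

variable {Ω : Type*} [MeasurableSpace Ω] {P : Measure Ω}

lemma exists_lintegral_tsum_pow_le (r : ℕ) (hr : r ≠ 0) : ∃ c : ℝ≥0, ∀ (f : ℕ → Ω → 𝐄) (A : 𝐄), (∀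
    i, AEMeasurable (f i) P) → (∀ i, ∫⁻ ω, f i ω ^ r ∂P ≤ A * 2⁻¹ ^ i) → ∫⁻ ω, (∑' i, f i ω) ^ r ∂P
    ≤ c * A := by
  let u : ℕ → ℝ≥0 := fun i => (i + 1 : ℝ≥0) ^ 2; have h1 : ∑' i, ((u i)⁻¹ : 𝐄) ≠ ∞ := by
    have e : ∀ i, ((u i)⁻¹ : 𝐄) = ((((i + 1 : ℕ) : ℝ≥0) ^ 2)⁻¹ : ℝ≥0) := fun i => by
      rw [ENNReal.coe_inv (by positivity)]; simp [u]
    simp only [e]; rw [ENNReal.tsum_coe_ne_top_iff_summable, ← NNReal.summable_coe]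
    have := (summable_nat_add_iff 1).2 (Real.summable_nat_pow_inv.2 one_lt_two); simpa using this
  have h2 : ∑' i, (u i : 𝐄) ^ r * 2⁻¹ ^ i ≠ ∞ := by
    have e : ∀ i, (u i : 𝐄) ^ r * 2⁻¹ ^ i =
        ((2 * (((i + 1 : ℕ) : ℝ≥0) ^ (2 * r) * 2⁻¹ ^ (i + 1)) : ℝ≥0) : 𝐄) := fun i => by
      push_cast [u]; rw [pow_mul, pow_succ (2⁻¹ : 𝐄) i]
      have : (2 : 𝐄) * 2⁻¹ = 1 := ENNReal.mul_inv_cancel two_ne_zero ENNReal.ofNat_ne_top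
      calc _ = ((i + 1 : 𝐄) ^ 2) ^ r * 2⁻¹ ^ i * (2 * 2⁻¹) := by rw [this, mul_one]
        _ = _ := by ring
    simp only [e]; rw [ENNReal.tsum_coe_ne_top_iff_summable, ← NNReal.summable_coe]
    have := ((summable_nat_add_iff 1).2 (summable_pow_mul_geometric_of_norm_lt_one (2 * r)
      (r := (2⁻¹ : ℝ)) (by norm_num))).mul_left 2
    simpa using this
  refine ⟨((∑' i, ((u i)⁻¹ : 𝐄)) ^ r * ∑' i, (u i : 𝐄) ^ r * 2⁻¹ ^ i).toNNReal,
    fun f A hf hA => ?_⟩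
  rw [coe_toNNReal (mul_ne_top (pow_ne_top h1) h2)]
  have hu : ∀ i, (u i : 𝐄)⁻¹ * u i = 1 := fun i =>
    ENNReal.inv_mul_cancel (by simp [u]) coe_ne_top
  have hpt : ∀ ω, (∑' i, f i ω) ^ r ≤
      (∑' i, ((u i)⁻¹ : 𝐄)) ^ r * ∑' i, (u i : 𝐄) ^ r * f i ω ^ r := by
    intro ω; have h3 : ∑' i, f i ω ≤ (∑' i, ((u i)⁻¹ : 𝐄)) * ⨆ i, u i * f i ω := by
      rw [← ENNReal.tsum_mul_right]; refine tsum_le_tsum fun i => ?_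
      calc f i ω = (u i : 𝐄)⁻¹ * (u i * f i ω) := by rw [← mul_assoc, hu, one_mul]
        _ ≤ _ := mul_le_mul_right (le_iSup (fun i => u i * f i ω) i) _
    refine (pow_le_pow_left' h3 r).trans ?_; rw [mul_pow]
    refine mul_le_mul_right (iSup_pow_le hr fun i => ?_) _; rw [mul_pow]
    exact ENNReal.le_tsum (f := fun i => (u i : 𝐄) ^ r * f i ω ^ r) i
  refine (lintegral_mono hpt).trans ?_; rw [lintegral_const_mul' _ _ (pow_ne_top h1), lintegral_tsum
    fun i => ((hf i).pow_const r).const_mul _, mul_assoc]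
  refine mul_le_mul_right ?_ _; rw [← ENNReal.tsum_mul_right]; refine tsum_le_tsum fun i => ?_
  rw [lintegral_const_mul' _ _ (by finiteness), mul_assoc, mul_comm _ A]
  exact mul_le_mul_right (hA i) _

def dyadInc (ϕ : E2 → ℝ) (s : ℝ) (T : ℕ) (G : ℝ → Dist) : ℕ → 𝐄
  | 0 => ⨆ k : Fin (T + 1), besovNorm ϕ s (G k)
  | m + 1 => ⨆ k : Fin (T * 2 ^ (m + 1)),
      besovNorm ϕ s (G ((k + 1 : ℕ) / 2 ^ (m + 1)) - G ((k : ℕ) / 2 ^ (m + 1)))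

/-- A chaining bound for the supremum of a path over `[0, T]`. -/
def chain (ϕ : E2 → ℝ) (s : ℝ) (T : ℕ) (G : ℝ → Dist) : 𝐄 := ∑' m, dyadInc ϕ s T G m

lemma besov_dyadic_le (h : Cutoff) (s : ℝ) (T : ℕ) (G : ℝ → Dist) (m k : ℕ) (hk : k ≤ T * 2 ^ m) : 𝐁
    s (G (k / 2 ^ m)) ≤ ∑ i ∈ range (m + 1), dyadInc ϕ s T G i := by
  induction m generalizing k with
  | zero =>
    have : k < T + 1 := by simpa [Nat.lt_succ_iff] using hk
    simpa [dyadInc] using le_iSup (fun k : Fin (T + 1) => 𝐁 s (G k)) ⟨k, this⟩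
  | succ m ih =>
    rw [sum_range_succ]
    have hj : ∀ j : ℕ, ((2 * j : ℕ) : ℝ) / 2 ^ (m + 1) = j / 2 ^ m := fun j => by
      push_cast; field_simp; ring
    rcases Nat.even_or_odd' k with ⟨j, rfl | rfl⟩
    · rw [hj]; refine (ih j ?_).trans le_self_add; rw [pow_succ] at hk; linarith
    · have hlt : 2 * j < T * 2 ^ (m + 1) := hk
      have h1 := le_iSup (fun k : Fin (T * 2 ^ (m + 1)) => 𝐁 s
        (G ((k + 1 : ℕ) / 2 ^ (m + 1)) - G ((k : ℕ) / 2 ^ (m + 1)))) ⟨2 * j, hlt⟩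
      simp only [hj] at h1; have h2 := ih j (by rw [pow_succ] at hlt; linarith)
      calc 𝐁 s (G ((2 * j + 1 : ℕ) / 2 ^ (m + 1)))
          = 𝐁 s (G (j / 2 ^ m) +
            (G ((2 * j + 1 : ℕ) / 2 ^ (m + 1)) - G (j / 2 ^ m))) := by rw [add_sub_cancel]
        _ ≤ _ := (h.besov_add_le _ _ _).trans (add_le_add h2 h1)

lemma besov_le_chain (h : Cutoff) (s : ℝ) {T : ℕ} {G : ℝ → Dist} (hG : ∀ n, Continuous fun t => G t
    n) (ht : t ∈ Icc (0 : ℝ) T) : 𝐁 s (G t) ≤ chain ϕ s T G := by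
  have hlim : Tendsto (fun m : ℕ => (⌊t * 2 ^ m⌋₊ : ℝ) / 2 ^ m) atTop (𝓝 t) := by
    have := (tendsto_nat_floor_mul_div_atTop ht.1).comp (tendsto_pow_atTop_atTop_of_one_lt
      (one_lt_two : (1 : ℝ) < 2))
    exact this
  refine h.besov_le_of_tendsto (fun n => ((hG n).tendsto t).comp hlim)
    tendsto_const_nhds (.of_forall fun m => ?_)
  refine (besov_dyadic_le h s T G m _ ?_).trans (sum_le_tsum _)
  have h1 := Nat.floor_le (a := t * 2 ^ m) (mul_nonneg ht.1 (by positivity))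
  have h2 : t * 2 ^ m ≤ T * 2 ^ m := mul_le_mul_of_nonneg_right ht.2 (by positivity)
  exact_mod_cast h1.trans h2

lemma aemeasurable_dyadInc (h : IsDyadicCutoff ϕ) (s : ℝ) (T : ℕ) {G : ℝ → Ω → Dist} (hG : ∀ t n,
    AEMeasurable (fun ω => G t ω n) P) (m : ℕ) : AEMeasurable (fun ω => dyadInc ϕ s T (fun t => G t
    ω) m) P := by
  cases m with
  | zero => exact AEMeasurable.iSup fun k => aemeasurable_besov h s (hG _)
  | succ m =>
    exact AEMeasurable.iSup fun k => aemeasurable_besov h s fun n => (hG _ n).sub (hG _ n)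

lemma aemeasurable_chain (h : IsDyadicCutoff ϕ) (s : ℝ) (T : ℕ) {G : ℝ → Ω → Dist} (hG : ∀ t n,
    AEMeasurable (fun ω => G t ω n) P) : AEMeasurable (fun ω => chain ϕ s T (fun t => G t ω)) P :=
  AEMeasurable.tsum (aemeasurable_dyadInc h s T hG)

lemma lintegral_iSup_pow_le {n r : ℕ} (hr : r ≠ 0) {f : Fin n → Ω → 𝐄} (hf : ∀ k, AEMeasurable (f k)
    P) {B : 𝐄} (hB : ∀ k, ∫⁻ ω, f k ω ^ r ∂P ≤ B) : ∫⁻ ω, (⨆ k, f k ω) ^ r ∂P ≤ n * B := by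
  calc _ ≤ ∫⁻ ω, ∑ k, f k ω ^ r ∂P := lintegral_mono fun ω => iSup_pow_le hr fun k =>
        Finset.single_le_sum (f := fun k => f k ω ^ r) (fun _ _ => zero_le) (mem_univ k)
    _ = ∑ k, ∫⁻ ω, f k ω ^ r ∂P := lintegral_finsetSum' _ fun k _ => (hf k).pow_const r
    _ ≤ ∑ _k : Fin n, B := sum_le_sum fun k _ => hB k
    _ = _ := by simp

lemma exists_lintegral_chain_le (h : IsDyadicCutoff ϕ) (s : ℝ) (T r : ℕ) (hr : r ≠ 0) : ∃ c : ℝ≥0, ∀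
    (G : ℝ → Ω → Dist) (A : 𝐄), (∀ t n, AEMeasurable (fun ω => G t ω n) P) → (∀ s' t, |t - s'| ≤ 1 →
    ∫⁻ ω, besovNorm ϕ s (G t ω - G s' ω) ^ r ∂P ≤ A * ofReal (|t - s'| ^ 2)) → (∀ t, ∫⁻ ω, besovNorm
    ϕ s (G t ω) ^ r ∂P ≤ A) → ∫⁻ ω, chain ϕ s T (fun t => G t ω) ^ r ∂P ≤ c * A := by
  obtain ⟨c, hc⟩ := exists_lintegral_tsum_pow_le (P := P) r hr
  refine ⟨c * (T + 1), fun G A hm h1 h2 => ?_⟩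
  refine (hc (fun m ω => dyadInc ϕ s T (fun t => G t ω) m) ((T + 1) * A)
    (aemeasurable_dyadInc h s T hm) fun m => ?_).trans_eq (by push_cast; ring)
  cases m with
  | zero =>
    rw [pow_zero, mul_one]
    exact_mod_cast lintegral_iSup_pow_le hr (n := T + 1) (f := fun k ω => besovNorm ϕ s (G k ω))
      (fun k => aemeasurable_besov h s (hm _)) fun k => h2 _
  | succ m =>
    have hx : (0 : ℝ) < 2 ^ (m + 1) := by positivity
    refine (lintegral_iSup_pow_le hr (B := A * ofReal ((2 ^ (m + 1))⁻¹ ^ 2))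
      (fun k => aemeasurable_besov h s fun n => (hm _ n).sub (hm _ n)) fun k => ?_).trans ?_
    · have e : |((k + 1 : ℕ) : ℝ) / 2 ^ (m + 1) - (k : ℕ) / 2 ^ (m + 1)| = (2 ^ (m + 1))⁻¹ := by
        rw [← sub_div, Nat.cast_succ, add_sub_cancel_left, one_div, abs_of_pos (by positivity)]
      have := h1 ((k : ℕ) / 2 ^ (m + 1)) ((k + 1 : ℕ) / 2 ^ (m + 1)) (by
        rw [e]; exact inv_le_one_of_one_le₀ (one_le_pow₀ one_le_two))
      rwa [e] at this
    · have e : ofReal ((2 ^ (m + 1))⁻¹ ^ 2) = 2⁻¹ ^ (m + 1) * 2⁻¹ ^ (m + 1) := by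
        rw [ofReal_pow (by positivity), ofReal_inv_of_pos hx,
          ofReal_pow zero_le_two, ENNReal.ofReal_ofNat, ENNReal.inv_pow, sq]
      have e2 : (2 : 𝐄) ^ (m + 1) * 2⁻¹ ^ (m + 1) = 1 := by
        rw [← mul_pow, ENNReal.mul_inv_cancel two_ne_zero ENNReal.ofNat_ne_top, one_pow]
      rw [e]; push_cast
      calc (T * 2 ^ (m + 1) : 𝐄) * (A * (2⁻¹ ^ (m + 1) * 2⁻¹ ^ (m + 1)))
          = T * A * (2 ^ (m + 1) * 2⁻¹ ^ (m + 1)) * 2⁻¹ ^ (m + 1) := by ring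
        _ ≤ _ := by rw [e2, mul_one]; exact mul_le_mul_left (mul_le_mul_left le_self_add _) _

end Chaining

/-! ### The limit of the Wick powers -/

section Limit

variable {Ω : Type*} [MeasurableSpace Ω] {P : Measure Ω}

lemma contC_Ici_of_Icc (H : ∀ T : ℕ, ContC ϕ s (Icc 0 T) v) : ContC ϕ s (Ici 0) v := by
  intro t ht; obtain ⟨T, hT⟩ := exists_nat_gt t; obtain ⟨h1, h2⟩ := H T t ⟨ht, hT.le⟩
  refine ⟨h1, h2.mono_left ?_⟩; rw [← nhdsWithin_inter_of_mem (t := Ici (0 : ℝ))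
    (mem_nhdsWithin_of_mem_nhds (Iic_mem_nhds hT))]
  exact nhdsWithin_mono _ fun x hx => ⟨hx.2, hx.1⟩

/-- A family of random paths of trigonometric polynomials with the moment bounds that make it
converge. -/
structure IsCauchyFamily (P : Measure Ω) (ϕ : E2 → ℝ) (w : ℕ → ℝ → Ω → Dist) : Prop where
  meas : ∀ N, N ≠ 0 → ∀ t n, Measurable fun ω => w N t ω n
  cont : ∀ N, N ≠ 0 → ∀ ω n, Continuous fun t => w N t ω n
  supp : ∀ N, N ≠ 0 → ∃ S : Finset ℤ², ∀ t ω, support (w N t ω) ⊆ S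
  moment : ∀ ε : ℝ, 0 < ε → ∀ p₀ : ℕ, ∃ r : ℕ, p₀ ≤ r ∧ r ≠ 0 ∧ ∃ A : ℝ≥0, ∀ Λ N M : ℕ, Λ ≠ 0 →
    Λ ≤ N → Λ ≤ M → ∀ s t : ℝ,
    (|t - s| ≤ 1 → ∫⁻ ω, besovNorm ϕ (-ε)
      ((w N t ω - w M t ω) - (w N s ω - w M s ω)) ^ r ∂P ≤
      A * ofReal (Λ : ℝ)⁻¹ * ofReal (|t - s| ^ 2)) ∧
    ∫⁻ ω, besovNorm ϕ (-ε) (w N t ω - w M t ω) ^ r ∂P ≤ A * ofReal (Λ : ℝ)⁻¹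

def limD (w : ℕ → ℝ → Ω → Dist) (t : ℝ) (ω : Ω) : Dist :=
  fun n => limUnder atTop fun i : ℕ => w (2 ^ i) t ω n

def tailD (ϕ : E2 → ℝ) (s : ℝ) (T : ℕ) (w : ℕ → ℝ → Ω → Dist) (i : ℕ) (ω : Ω) : 𝐄 :=
  ∑' j : ℕ, chain ϕ s T fun t => w (2 ^ (j + i)) t ω - w (2 ^ (j + i + 1)) t ω

namespace IsCauchyFamily

variable {w : ℕ → ℝ → Ω → Dist} (hw : IsCauchyFamily P ϕ w) (h : IsDyadicCutoff ϕ)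
include hw h

lemma besov_sub_le_chain (s : ℝ) {T N M : ℕ} (hN : N ≠ 0) (hM : M ≠ 0) (ω : Ω) (ht : t ∈ Icc (0 : ℝ)
    T) : 𝐁 s (w N t ω - w M t ω) ≤ chain ϕ s T fun t => w N t ω - w M t ω :=
  besov_le_chain h s (G := fun t => w N t ω - w M t ω)
    (fun n => (hw.cont N hN ω n).sub (hw.cont M hM ω n)) ht

lemma aemeasurable_chain_sub (s : ℝ) (T : ℕ) {N M : ℕ} (hN : N ≠ 0) (hM : M ≠ 0) : AEMeasurable (fun
    ω => chain ϕ s T fun t => w N t ω - w M t ω) P :=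
  aemeasurable_chain h s T (G := fun t ω => w N t ω - w M t ω)
    fun t n => ((hw.meas N hN t n).sub (hw.meas M hM t n)).aemeasurable

lemma limD_spec {T : ℕ} {ω : Ω} (hω : tailD ϕ s T w 0 ω ≠ ∞) (ht : t ∈ Icc (0 : ℝ) T) : (∀ n,
    Tendsto (fun i : ℕ => w (2 ^ i) t ω n) atTop (𝓝 (limD w t ω n))) ∧ ∀ i, besovNorm ϕ s (w (2 ^ i)
    t ω - limD w t ω) ≤ tailD ϕ s T w i ω := by
  have h2 : ∀ i, 2 ^ i ≠ 0 := fun i => by positivity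
  have hV : ∀ i, besovNorm ϕ s (w (2 ^ i) t ω - w (2 ^ (i + 1)) t ω) ≤
      chain ϕ s T fun t => w (2 ^ i) t ω - w (2 ^ (i + 1)) t ω := fun i =>
    hw.besov_sub_le_chain h s (h2 _) (h2 _) ω ht
  have hlim : ∀ n, Tendsto (fun i : ℕ => w (2 ^ i) t ω n) atTop (𝓝 (limD w t ω n)) := by
    intro n; obtain ⟨C, hC⟩ := h.exists_coeff_le s n
    refine CauchySeq.tendsto_limUnder (cauchySeq_of_edist_le_of_tsum_ne_top
      (fun i => C * chain ϕ s T fun t => w (2 ^ i) t ω - w (2 ^ (i + 1)) t ω) (fun i => ?_) ?_)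
    · rw [edist_eq_enorm_sub]; exact (hC _).trans (mul_le_mul_right (hV i) _)
    · rw [ENNReal.tsum_mul_left]; exact mul_ne_top coe_ne_top (by simpa [tailD] using hω)
  refine ⟨hlim, fun i => ?_⟩; have hJ : ∀ J, besovNorm ϕ s (w (2 ^ i) t ω - w (2 ^ (J + i)) t ω) ≤
      ∑ j ∈ range J, chain ϕ s T fun t => w (2 ^ (j + i)) t ω - w (2 ^ (j + i + 1)) t ω := by
    intro J; induction J with
    | zero => simp [besov_zero]
    | succ J ih =>
      rw [sum_range_succ, Nat.succ_add]
      exact (h.besov_triangle s _ (w (2 ^ (J + i)) t ω) _).trans (add_le_add ih (hV _))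
  refine h.besov_le_of_tendsto (F := fun J => w (2 ^ i) t ω - w (2 ^ (J + i)) t ω)
    (fun n => tendsto_const_nhds.sub ((hlim n).comp (tendsto_add_atTop_nat i)))
    tendsto_const_nhds (.of_forall fun J => (hJ J).trans (sum_le_tsum _))

lemma exists_lintegral_le {ε : ℝ} (hε : 0 < ε) (T p₀ : ℕ) : ∃ r : ℕ, p₀ ≤ r ∧ r ≠ 0 ∧ ∃ D : ℝ≥0, (∀
    Λ N M : ℕ, Λ ≠ 0 → Λ ≤ N → Λ ≤ M → ∫⁻ ω, (chain ϕ (-ε) T fun t => w N t ω - w M t ω) ^ r ∂P ≤ D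
    * ofReal (Λ : ℝ)⁻¹) ∧ ∀ i, ∫⁻ ω, tailD ϕ (-ε) T w i ω ^ r ∂P ≤ D * 2⁻¹ ^ i := by
  obtain ⟨r, hr1, hr0, A, hA⟩ := hw.moment ε hε p₀
  obtain ⟨c, hc⟩ := exists_lintegral_chain_le (P := P) h (-ε) T r hr0
  obtain ⟨c', hc'⟩ := exists_lintegral_tsum_pow_le (P := P) r hr0
  have h1 : ∀ Λ N M : ℕ, Λ ≠ 0 → Λ ≤ N → Λ ≤ M →
      ∫⁻ ω, (chain ϕ (-ε) T fun t => w N t ω - w M t ω) ^ r ∂P ≤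
        (c * A : ℝ≥0) * ofReal (Λ : ℝ)⁻¹ := by
    intro Λ N M hΛ hN hM
    have := hc (fun t ω => w N t ω - w M t ω) (A * ofReal (Λ : ℝ)⁻¹)
      (fun t n => ((hw.meas N (by omega) t n).sub (hw.meas M (by omega) t n)).aemeasurable)
      (fun s t => (hA Λ N M hΛ hN hM s t).1) (fun t => (hA Λ N M hΛ hN hM 0 t).2)
    rwa [← mul_assoc, ← coe_mul] at this
  refine ⟨r, hr1, hr0, max 1 c' * (c * A), fun Λ N M hΛ hN hM => (h1 Λ N M hΛ hN hM).trans
    (mul_le_mul_left (coe_le_coe.2 (le_mul_of_one_le_left' (le_max_left _ _))) _),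
    fun i => ?_⟩
  have h2 : ∀ i, 2 ^ i ≠ 0 := fun i => by positivity
  refine (hc' (fun j ω => chain ϕ (-ε) T fun t => w (2 ^ (j + i)) t ω - w (2 ^ (j + i + 1)) t ω)
    ((c * A : ℝ≥0) * 2⁻¹ ^ i) (fun j => hw.aemeasurable_chain_sub h _ _ (h2 _) (h2 _))
    fun j => ?_).trans ?_
  · refine (h1 (2 ^ (j + i)) _ _ (h2 _) le_rfl
      (Nat.pow_le_pow_right two_pos (Nat.le_succ _))).trans_eq ?_
    rw [mul_assoc, ← pow_add, add_comm i j, Nat.cast_pow, Nat.cast_ofNat,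
      ofReal_inv_of_pos (by positivity), ofReal_pow zero_le_two,
      ENNReal.ofReal_ofNat, ENNReal.inv_pow]
  · rw [← mul_assoc, coe_mul (max 1 c')]
    exact mul_le_mul_left (mul_le_mul_left (coe_le_coe.2 (le_max_right _ _)) _) _

lemma aemeasurable_tailD (s : ℝ) (T i : ℕ) : AEMeasurable (tailD ϕ s T w i) P :=
  AEMeasurable.tsum fun j => hw.aemeasurable_chain_sub h s T (by positivity) (by positivity)

lemma tailD_ne_top {ε : ℝ} (hε : 0 < ε) : ∀ᵐ ω ∂P, ∀ T, tailD ϕ (-ε) T w 0 ω ≠ ∞ := by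
  refine ae_all_iff.2 fun T => ?_; obtain ⟨r, -, hr0, D, -, hD⟩ := hw.exists_lintegral_le h hε T 0
  have := ae_lt_top' ((hw.aemeasurable_tailD h (-ε) T 0).pow_const r)
    ((hD 0).trans_lt (by finiteness)).ne
  filter_upwards [this] with ω hω; exact fun hc => by simp [hc, hr0] at hω

lemma aemeasurable_limD (ht : 0 ≤ t) (n : ℤ²) : AEMeasurable (fun ω => limD w t ω n) P := by
  obtain ⟨T, hT⟩ := exists_nat_ge t
  refine aemeasurable_of_tendsto_metrizable_ae atTop (f := fun (i : ℕ) ω => w (2 ^ i) t ω n)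
    (fun i => (hw.meas _ (by positivity) t n).aemeasurable) ?_
  filter_upwards [hw.tailD_ne_top h one_pos] with ω hω; exact (hw.limD_spec h (hω T) ⟨ht, hT⟩).1 n

lemma contC_limD {ε : ℝ} (hε : 0 < ε) : ∀ᵐ ω ∂P, ContC ϕ (-ε) (Ici 0) fun t => limD w t ω := by
  filter_upwards [hw.tailD_ne_top h hε] with ω hω
  refine contC_Ici_of_Icc fun T => contC_of_unif h fun δ hδ => ?_
  have hlim := ENNReal.tendsto_sum_nat_add (fun j => chain ϕ (-ε) T fun t =>
    w (2 ^ j) t ω - w (2 ^ (j + 1)) t ω) (by simpa [tailD] using hω T)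
  obtain ⟨i, hi⟩ := ((tendsto_order.1 hlim).2 δ (by exact_mod_cast hδ)).exists
  obtain ⟨S, hS⟩ := hw.supp (2 ^ i) (by positivity)
  refine ⟨fun t => w (2 ^ i) t ω, fun t _ => ⟨MemC.of_finite _ _ (S.finite_toSet.subset (hS t ω)),
    h.tendsto_besov_of_finite _ S (fun τ n hn => ?_) fun n _ => ?_⟩, fun t ht => ?_⟩
  · by_contra hc
    have h0 : ∀ t, w (2 ^ i) t ω n = 0 := fun t => by
      by_contra hne
      exact hc (hS t ω hne)
    exact hn (by simp [h0])
  · have := ((hw.cont (2 ^ i) (by positivity) ω n).tendsto t).mono_left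
      (nhdsWithin_le_nhds (s := Icc 0 (T : ℝ)))
    simpa using this.sub_const (w (2 ^ i) t ω n)
  · rw [besov_sub_comm]; exact ((hw.limD_spec h (hω T) ht).2 i).trans hi.le

lemma tendsto_limD [IsProbabilityMeasure P] {ε T p : ℝ} (hε : 0 < ε) (hp : 1 ≤ p) : Tendsto (fun N :
    ℕ => ∫⁻ ω, (⨆ t ∈ Icc (0 : ℝ) T, besovNorm ϕ (-ε) (w N t ω - limD w t ω)) ^ p ∂P) atTop (𝓝 0) :=
    by
  obtain ⟨T', hT'⟩ := exists_nat_ge T; obtain ⟨p₀, hp₀⟩ := exists_nat_ge p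
  obtain ⟨r, hpr, hr0, D, hD1, hD2⟩ := hw.exists_lintegral_le h hε T' p₀
  have hpr' : p ≤ r := hp₀.trans (by exact_mod_cast hpr); have hr : (0 : ℝ) < r := by linarith
  set F : ℕ → Ω → 𝐄 := fun N ω => (chain ϕ (-ε) T' fun t => w N t ω - w (2 ^ N) t ω) +
    tailD ϕ (-ε) T' w N ω
  have hFm : ∀ N, N ≠ 0 → AEMeasurable (F N) P := fun N hN =>
    (hw.aemeasurable_chain_sub h _ _ hN (by positivity)).add (hw.aemeasurable_tailD h _ _ _)
  have hF : ∀ N, N ≠ 0 → ∫⁻ ω, F N ω ^ (r : ℝ) ∂P ≤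
      2 ^ r * (D * ofReal (N : ℝ)⁻¹ + D * 2⁻¹ ^ N) := by
    intro N hN; simp only [ENNReal.rpow_natCast]
    refine (lintegral_mono fun ω => enn_add_pow_le _ _ r).trans ?_
    rw [lintegral_const_mul' _ _ (by finiteness), lintegral_add_left'
      ((hw.aemeasurable_chain_sub h _ _ hN (by positivity)).pow_const r)]
    exact mul_le_mul_right (add_le_add (hD1 N N (2 ^ N) hN le_rfl Nat.lt_two_pow_self.le)
      (hD2 N)) _
  have hlim : Tendsto (fun N : ℕ => (2 ^ r * (D * ofReal (N : ℝ)⁻¹ + D * 2⁻¹ ^ N)) ^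
      (p / r)) atTop (𝓝 0) := by
    have h1 : Tendsto (fun N : ℕ => ofReal (N : ℝ)⁻¹) atTop (𝓝 0) := by
      simpa using ENNReal.tendsto_ofReal tendsto_inv_atTop_nhds_zero_nat
    have h2 : Tendsto (fun N : ℕ => (2⁻¹ : 𝐄) ^ N) atTop (𝓝 0) :=
      ENNReal.tendsto_pow_atTop_nhds_zero_of_lt_one (by simp)
    have h3 := (ENNReal.Tendsto.const_mul (a := (D : 𝐄)) h1 (Or.inr (by simp))).add
      (ENNReal.Tendsto.const_mul (a := (D : 𝐄)) h2 (Or.inr (by simp)))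
    have h4 := (ENNReal.Tendsto.const_mul (a := (2 ^ r : 𝐄)) h3
      (Or.inr (by finiteness))).ennrpow_const (p / r)
    simpa [ENNReal.zero_rpow_of_pos (show 0 < p / r by positivity)] using h4
  refine tendsto_of_tendsto_of_tendsto_of_le_of_le' tendsto_const_nhds hlim
    (.of_forall fun _ => zero_le) ?_
  filter_upwards [eventually_ne_atTop 0] with N hN
  have hle : ∫⁻ ω, (⨆ t ∈ Icc (0 : ℝ) T, besovNorm ϕ (-ε) (w N t ω - limD w t ω)) ^ p ∂P ≤
      ∫⁻ ω, F N ω ^ p ∂P := by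
    refine lintegral_mono_ae ?_; filter_upwards [hw.tailD_ne_top h hε] with ω hω
    refine ENNReal.rpow_le_rpow (iSup₂_le fun t ht => ?_) (by linarith)
    have ht' : t ∈ Icc (0 : ℝ) T' := ⟨ht.1, ht.2.trans hT'⟩
    exact (h.besov_triangle _ _ (w (2 ^ N) t ω) _).trans (add_le_add
      (hw.besov_sub_le_chain h _ hN (by positivity) ω ht') ((hw.limD_spec h (hω T') ht').2 N))
  have hlp := eLpNorm'_le_eLpNorm'_of_exponent_le (by linarith : 0 < p) hpr' P
    (hFm N hN).aestronglyMeasurable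
  simp only [eLpNorm', enorm_eq_self] at hlp
  calc _ ≤ _ := hle
    _ = ((∫⁻ ω, F N ω ^ p ∂P) ^ (1 / p)) ^ p := by
      rw [← ENNReal.rpow_mul, one_div_mul_cancel (by linarith), ENNReal.rpow_one]
    _ ≤ ((∫⁻ ω, F N ω ^ (r : ℝ) ∂P) ^ (1 / (r : ℝ))) ^ p :=
      ENNReal.rpow_le_rpow hlp (by linarith)
    _ = (∫⁻ ω, F N ω ^ (r : ℝ) ∂P) ^ (p / r) := by rw [← ENNReal.rpow_mul, one_div_mul_eq_div]
    _ ≤ _ := ENNReal.rpow_le_rpow (hF N hN) (by positivity)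

end IsCauchyFamily

end Limit

section WickLimit

lemma continuous_prod {F G : ℝ → Dist} (hF : ∀ n, Continuous fun t => F t n) (hG : ∀ n, Continuous
    fun t => G t n) (hs : ∀ t, SuppIn R (G t)) (n : ℤ²) : Continuous fun t => prod (F t) (G t) n :=
    by
  simp only [fun t => prod_eq_sum (F t) (hs t) n]
  exact continuous_finsetSum _ fun k _ => (hF _).mul (hG _)

lemma continuous_powD (hF : ∀ n, Continuous fun t => F t n) (hs : ∀ t, SuppIn R (F t)) (k : ℕ) (n :
    ℤ²) : Continuous fun t => powD (F t) k n := by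
  induction k generalizing n with
  | zero => exact continuous_const
  | succ k ih => exact continuous_prod hF ih (fun t => (hs t).powD k) n

lemma continuous_wickD (hR : 0 ≤ R) (hF : ∀ n, Continuous fun t => F t n) (hs : ∀ t, SuppIn R (F t))
    {σ : ℝ → ℂ} (hσ : Continuous σ) (k l : ℕ) (n : ℤ²) : Continuous fun t => wickD (σ t) (F t) k l n
    := by
  induction k generalizing l n with
  | zero =>
    exact continuous_powD (fun n => Complex.continuous_conj.comp (hF (-n)))
      (fun t => (hs t).conjD) l n
  | succ k ih =>
    exact (continuous_prod hF (ih l) (fun t => (hs t).wickD hR _ k l) n).sub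
      ((continuous_const.mul hσ).mul (ih (l - 1) n))

variable {Ω : Type*} [MeasurableSpace Ω] {P : Measure Ω} {𝒢 : Submodule ℝ (Lp ℝ 2 P)} {C : ℝ}
  {χ : E2 → ℝ} {γ : ℝ} {X : ℤ² → ℝ → Ω → ℂ}

namespace IsField

variable (hX : IsField P 𝒢 X C)
include hX

lemma continuous_integral_norm_sq (n : ℤ²) : Continuous fun t => ∫ ω, ‖X n t ω‖ ^ 2 ∂P := by
  have hC : 0 ≤ C := by
    have := (integral_nonneg fun ω => by positivity).trans (hX.sub_le 0 1 0); simpa using this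
  have hV : ∀ t, ∫ ω, ‖X n t ω‖ ^ 2 ∂P ≤ C := fun t => (hX.sq_le n t).trans
    (mul_le_of_le_one_right hC (Real.rpow_le_one_of_one_le_of_nonpos (one_le_jb n) (by norm_num)))
  have key : ∀ t s, ∫ ω, ‖X n t ω‖ ^ 2 ∂P - ∫ ω, ‖X n s ω‖ ^ 2 ∂P ≤
      C * (2 * √|t - s| + |t - s|) := by
    intro t s; rcases eq_or_ne t s with rfl | hne
    · simp
    have hτ : 0 < |t - s| := abs_pos.2 (sub_ne_zero.2 hne); set c := √|t - s|
    have hc : 0 < c := Real.sqrt_pos.2 hτ; have hcc : c ^ 2 = |t - s| := sq_sqrt hτ.le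
    have hpt : ∀ ω, ‖X n t ω‖ ^ 2 ≤ (1 + c) * ‖X n s ω‖ ^ 2 +
        (1 + c⁻¹) * ‖X n t ω - X n s ω‖ ^ 2 := by
      intro ω; have h1 : ‖X n t ω‖ ≤ ‖X n s ω‖ + ‖X n t ω - X n s ω‖ := by
        simpa using norm_add_le (X n s ω) (X n t ω - X n s ω)
      have h2 := pow_le_pow_left₀ (norm_nonneg _) h1 2
      have h3 : 0 ≤ c⁻¹ * (c * ‖X n s ω‖ - ‖X n t ω - X n s ω‖) ^ 2 := by positivity
      have h4 : c⁻¹ * (c * ‖X n s ω‖ - ‖X n t ω - X n s ω‖) ^ 2 = c * ‖X n s ω‖ ^ 2 +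
          c⁻¹ * ‖X n t ω - X n s ω‖ ^ 2 - 2 * (‖X n s ω‖ * ‖X n t ω - X n s ω‖) := by
        field_simp; ring
      linarith [add_sq ‖X n s ω‖ ‖X n t ω - X n s ω‖]
    have i0 := ((hX.inC n t).memLp.integrable_norm_pow two_ne_zero)
    have i1 := ((hX.inC n s).memLp.integrable_norm_pow two_ne_zero).const_mul (1 + c)
    have i2 : Integrable (fun ω => (1 + c⁻¹) * ‖X n t ω - X n s ω‖ ^ 2) P :=
      (((hX.inC n t).memLp.sub (hX.inC n s).memLp).integrable_norm_pow two_ne_zero).const_mul _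
    have h1 := integral_mono i0 (i1.add i2) hpt
    have h2 : ∫ ω, ‖X n t ω‖ ^ 2 ∂P ≤ (1 + c) * ∫ ω, ‖X n s ω‖ ^ 2 ∂P +
        (1 + c⁻¹) * ∫ ω, ‖X n t ω - X n s ω‖ ^ 2 ∂P := by
      rw [← integral_const_mul, ← integral_const_mul, ← integral_add i1 i2]; exact h1
    have h3 := mul_le_mul_of_nonneg_left (hV s) hc.le
    have h4 := mul_le_mul_of_nonneg_left (hX.sub_le n t s) (by positivity : 0 ≤ 1 + c⁻¹)
    have h5 : (1 + c⁻¹) * (C * |t - s|) = C * (c + |t - s|) := by rw [← hcc]; field_simp; ring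
    linarith
  refine continuous_iff_continuousAt.2 fun s => ?_; rw [ContinuousAt, tendsto_iff_dist_tendsto_zero]
  refine squeeze_zero (fun t => dist_nonneg) (g := fun t => C * (2 * √|t - s| + |t - s|))
    (fun t => ?_) ?_
  · rw [Real.dist_eq]; exact abs_sub_le_iff.2 ⟨key t s, by rw [abs_sub_comm]; exact key s t⟩
  · have : Continuous fun t : ℝ => C * (2 * √|t - s| + |t - s|) := by fun_prop
    simpa using this.tendsto s

lemma isCauchyFamily [IsProbabilityMeasure P] (hχ : IsFreqCutoff χ) (hγ : 0 < γ)
    (h : Cutoff) (k l : ℕ) : IsCauchyFamily P ϕ (modesWick P χ γ X k l) where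
  meas N hN t n := hX.measurable_modesWick hχ hN k l t n
  cont N hN ω n := by
    have hσ : Continuous fun t => modesVar P χ γ X N t := by
      simp only [modesVar, hX.integral_ev_modes hχ γ hN, integral_norm_modes_sq hγ]
      exact continuous_finsetSum _ fun n _ => (hX.continuous_integral_norm_sq n).const_mul _
    exact continuous_wickD (cast_nonneg N) (fun n => continuous_const.mul (hX.cont n ω))
      (fun t => hχ.suppIn_modes hN t ω) (continuous_ofReal.comp hσ) k l n
  supp N hN := ⟨fball ((k + l : ℕ) * N), fun t ω =>
    ((hχ.suppIn_modes hN t ω).wickD (cast_nonneg N) _ k l).subset⟩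
  moment ε hε p₀ := hX.exists_modesWick_moment_le hχ hγ h k l hε p₀

end IsField

omit [MeasurableSpace Ω] in
lemma psiN_eq_ev (χ : E2 → ℝ) (a : ℂ) {γ : ℝ} (β : ℤ² → ℝ → Ω → ℂ) (N : ℕ) {ω : Ω} (hω : ∀ n t,
    stochConv a β n t ω = X n t ω) (t : ℝ) (x : ℝ × ℝ) : psiN χ a γ β N t x ω = ev (modes χ γ X N t
    ω) x := by
  rw [psiN, ev, ← tsum_mul_left]; refine tsum_congr fun n => ?_; rw [hω, modes]; push_cast; ring

lemma wickN_eq [IsProbabilityMeasure P] (hX : IsField P 𝒢 X C) (hχ : IsFreqCutoff χ) (hγ : 0 < γ) {β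
    : ℤ² → ℝ → Ω → ℂ} (hβ : ∀ᵐ ω ∂P, ∀ n t, stochConv a β n t ω = X n t ω) {N : ℕ} (hN : N ≠ 0) (k l
    : ℕ) : ∀ᵐ ω ∂P, ∀ t, wickN P χ a γ β N k l t ω = modesWick P χ γ X k l N t ω := by
  have hσ : ∀ t x, sigmaN P χ a γ β N t x = modesVar P χ γ X N t := by
    intro t x
    rw [modesVar, hX.integral_ev_modes hχ γ hN, ← hX.integral_ev_modes hχ γ hN t x, sigmaN]
    refine integral_congr_ae ?_; filter_upwards [hβ] with ω hω; rw [psiN_eq_ev χ a β N hω]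
  filter_upwards [hβ] with ω hω t; have hs := hχ.suppIn_modes (γ := γ) (X := X) hN t ω
  have hσ0 : modesVar P χ γ X N t ≠ 0 := (hX.modesVar_pos hχ hγ hN t).ne'
  rw [modesWick, ← coeffs_ev (hs.wickD (cast_nonneg N) _ k l).finite, wickN]; congr 1; ext x
  rw [hσ, psiN_eq_ev χ a β N hω, wickMonomial_eq hσ0, ev_wickD (cast_nonneg N) hs]

theorem exists_isWickLimit [IsProbabilityMeasure P] (h : Cutoff) (hχ : IsFreqCutoff χ) (hγ : 0 < γ)
    (ha : 0 < a.re) {β : ℤ² → ℝ → Ω → ℂ} (hβ : IsCylindricalWiener β P) : ∃ Z : ℕ → ℕ → ℝ → Ω →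
    Dist, IsWickLimit P ϕ χ a γ β Z := by
  obtain ⟨𝒢, X, C, -, hX, hXβ⟩ := exists_isField ha hβ; have hw := hX.isCauchyFamily hχ hγ h
  refine ⟨fun k l => limD (modesWick P χ γ X k l), ⟨fun k l t n ht =>
    (hw k l).aemeasurable_limD h ht n, fun k l ε hε => (hw k l).contC_limD h hε,
    fun k l ε T p hε _ hp => ((hw k l).tendsto_limD h hε hp (T := T)).congr' ?_⟩⟩
  filter_upwards [eventually_ne_atTop 0] with N hN; refine lintegral_congr_ae ?_
  filter_upwards [wickN_eq hX hχ hγ hXβ hN k l] with ω hω; simp only [hω]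

end WickLimit

end SCGL

end

theorem theorem1p2 (m : ℕ) (hm : 2 ≤ m) (s₀ : ℝ) (hs₀ : -2 / (2 * (m : ℝ) - 1) < s₀)
    (hs₀_neg : s₀ < 0) :
    ∃ ε₀ : ℝ, 0 < ε₀ ∧ ∀ ε : ℝ, 0 < ε → ε < ε₀ → ∃ θ : ℝ, 0 < θ ∧
      ∀ (a₁ a₂ c₁ c₂ γ : ℝ), 0 < a₁ → 0 < γ →
      ∀ (φ₀ χ : EuclideanSpace ℝ (Fin 2) → ℝ), SCGL.IsDyadicCutoff φ₀ → SCGL.IsFreqCutoff χ →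
      ∀ (Ω : Type*) [MeasurableSpace Ω] (P : Measure Ω) [IsProbabilityMeasure P]
        (β : ℤ × ℤ → ℝ → Ω → ℂ), SCGL.IsCylindricalWiener β P →
      (∃ Z : ℕ → ℕ → ℝ → Ω → SCGL.Dist, SCGL.IsWickLimit P φ₀ χ ⟨a₁, a₂⟩ γ β Z) ∧
      ∀ Z : ℕ → ℕ → ℝ → Ω → SCGL.Dist, SCGL.IsWickLimit P φ₀ χ ⟨a₁, a₂⟩ γ β Z →
        ∃ K : Ω → ℝ, Measurable K ∧ ∀ᵐ ω ∂P, 0 < K ω ∧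
          -- existence and uniqueness on `[0, T]` with `T = K(ω) max(1, ‖u₀‖)^{-θ}`
          (∀ u₀ : SCGL.Dist, SCGL.MemC φ₀ s₀ u₀ →
            (∃ v : ℝ → SCGL.Dist,
              SCGL.IsMildSolution φ₀ ⟨a₁, a₂⟩ ⟨c₁, c₂⟩ m s₀ ε (fun k l t => Z k l t ω) u₀
                (SCGL.lifetime φ₀ s₀ θ (K ω) u₀) v) ∧
            ∀ v v' : ℝ → SCGL.Dist,
              SCGL.IsMildSolution φ₀ ⟨a₁, a₂⟩ ⟨c₁, c₂⟩ m s₀ ε (fun k l t => Z k l t ω) u₀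
                (SCGL.lifetime φ₀ s₀ θ (K ω) u₀) v →
              SCGL.IsMildSolution φ₀ ⟨a₁, a₂⟩ ⟨c₁, c₂⟩ m s₀ ε (fun k l t => Z k l t ω) u₀
                (SCGL.lifetime φ₀ s₀ θ (K ω) u₀) v' →
              Set.EqOn v v' (Set.Icc 0 (SCGL.lifetime φ₀ s₀ θ (K ω) u₀))) ∧
          -- continuous (Lipschitz) dependence on the initial data
          ∃ L : ℝ≥0, ∀ u₀ u₀' : SCGL.Dist, SCGL.MemC φ₀ s₀ u₀ → SCGL.MemC φ₀ s₀ u₀' →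
            ∀ v v' : ℝ → SCGL.Dist,
              SCGL.IsMildSolution φ₀ ⟨a₁, a₂⟩ ⟨c₁, c₂⟩ m s₀ ε (fun k l t => Z k l t ω) u₀
                (SCGL.lifetime φ₀ s₀ θ (K ω) u₀) v →
              SCGL.IsMildSolution φ₀ ⟨a₁, a₂⟩ ⟨c₁, c₂⟩ m s₀ ε (fun k l t => Z k l t ω) u₀'
                (SCGL.lifetime φ₀ s₀ θ (K ω) u₀') v' →
              ∀ t : ℝ, 0 < t → t ≤ SCGL.lifetime φ₀ s₀ θ (K ω) u₀ →
                t ≤ SCGL.lifetime φ₀ s₀ θ (K ω) u₀' →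
                SCGL.besovNorm φ₀ s₀ (v t - v' t) ≤ L * SCGL.besovNorm φ₀ s₀ (u₀ - u₀') ∧
                ENNReal.ofReal (t ^ ((2 * ε - s₀) / 2)) * SCGL.besovNorm φ₀ (2 * ε) (v t - v' t)
                  ≤ L * SCGL.besovNorm φ₀ s₀ (u₀ - u₀') := by

  obtain ⟨ε₀, hε₀, H⟩ := SCGL.exists_random_lifetime hm hs₀ hs₀_neg
  refine ⟨ε₀, hε₀, fun ε hε hεε => ?_⟩
  obtain ⟨θ, hθ, H⟩ := H ε hε hεε
  refine ⟨θ, hθ, fun a₁ a₂ c₁ c₂ γ ha hγ φ₀ χ h hχ Ω _ P _ β hβ =>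
    ⟨SCGL.exists_isWickLimit h hχ hγ ha hβ, fun Z hZ => ?_⟩⟩
  exact H ⟨a₁, a₂⟩ ⟨c₁, c₂⟩ ha φ₀ h Ω P Z hZ.aemeasurable fun k l => hZ.cont k l ε hε
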